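/- Fix a dimension $d\ge 2$. For a finite point set $P\subset\mathbb R^d$, a $k$-clustering of $P$ is a partition of $P$ into at most $k$ non-empty clusters. Let $S\subset\mathbb R^d$ be a set of $n\ge 2$ points and let $\Phi\ge 0$ be a cost function on the partitions of subsets of $S$; write $\mathrm{Opt}_k(P)$ for the minimum of $\Phi$ over the $k$-clusterings of $P$. For $r>0$, a subset $R\subseteq P$ is a weak $r$-packing for $P$ if every $p\in P$ has a $q\in R$ with $|pq|\le r$. Suppose that $\Phi$ is $(c,f(k))$-regular, where $c>0$ and $f:\mathbb N_{\ge2}\to\mathbb R_{\ge0}$; that is, * (diameter-sensitivity) $\Phi(\mathcal C)\ge c\cdot\max_{C\in\mathcal C}\mathrm{diam}(C)$ for every partition $\mathcal C$ of a subset of $S$; * (expansion) for every $S'\subseteq S$, every weak $r$-packing $R$ for $S'$ and every $k\ge 2$ we have $\mathrm{Opt}_k(R)\le \mathrm{Opt}_k(S')\le \mathrm{Opt}_k(R)+r\cdot f(k)$; moreover, if $S'$ is the set of points of $S$ in a given axis-aligned box, then from $R$, $r$ and a $k$-clustering $\mathcal C$ of $R$ one can compute, in time $T_{\mathrm{expand}}(n,k)$,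 a $k$-clustering $\mathcal C^*$ of $S'$ with $\Phi(\mathcal C^*)\le\Phi(\mathcal C)+r\cdot f(k)$. Suppose also that we have an algorithm that computes, for every $k\ge2$ and every subset of $S$ of at most $m$ points, an optimal $k$-clustering of it in time $T_{\mathrm{ss}}(m,k)$, where $T_{\mathrm{ss}}(m,k)\ge m$. (Clusterings are stored in any representation on which the two given algorithms agree.) Then there is a data structure that uses $O(n\log^{d-1}n)$ storage such that for every axis-aligned query box $Q$ and all query values $k\ge2$ and $\varepsilon>0$ one can compute a $k$-clustering $\mathcal C$ of $S\cap Q$ with $\Phi(\mathcal C)\le(1+\varepsilon)\,\mathrm{Opt}_k(S\cap Q)$ in time $$O\Bigl(k\,(x\log n)^{d-1}+T_{\mathrm{ss}}\bigl(\lceil K k x^d\rceil,k\bigr)+T_{\mathrm{expand}}(n,k)\Bigr),\qquad x:=\max\Bigl\{1,\frac{f(k)}{c\,\varepsilon}\Bigr\}.$$ Here $K$ and the constants hidden in the $O$-notation depend only on $d$. The model is a real RAM: unit-cost arithmetic $+,-,\times,/$ and comparisons on real numbers, without rounding; addition, truncated subtraction, halving, comparison and indirect addressing on natural numbers; the natural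 numbers stored in the data structure have $O(\log n)$ bits. The query program depends only on $d$; it uses the two given algorithms as subroutines, a call costing one step plus the time of the called algorithm. -/

import Mathlib

noncomputable section

namespace RangeClustering

/-! ## Clustering problems with a regular cost function -/

/-- Points of `ℝ^d` with the Euclidean metric. -/
abbrev Pt (d : ℕ) : Type := EuclideanSpace ℝ (Fin d)

instance ptDecidableEq (d : ℕ) : DecidableEq (Pt d) := Classical.decEq _

/-- A cost function. It is only ever applied to the set of clusters of a partition of a finite
point set (which determines the point set). -/
abbrev Cost (d : ℕ) : Type := Finset (Finset (Pt d)) → ℝ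

/-- `Opt_k(P)`: the minimum of the cost over the (finitely many) partitions of `P` into at most
`k` clusters. -/
def opt {d : ℕ} (cost : Cost d) (k : ℕ) (P : Finset (Pt d)) : ℝ :=
  ⨅ C : {C : Finpartition P // C.parts.card ≤ k}, cost C.1.parts

/-- `R` is a weak `r`-packing for `P`. -/
def IsWeakPacking {d : ℕ} (r : ℝ) (R P : Finset (Pt d)) : Prop :=
  0 < r ∧ R ⊆ P ∧ ∀ p ∈ P, ∃ q ∈ R, dist p q ≤ r

/-- The non-algorithmic part of `(c, f(k))`-regularity, for clusterings of subsets of `S`. -/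
structure RegularCost {d : ℕ} (S : Finset (Pt d)) (cost : Cost d) (c : ℝ) (f : ℕ → ℝ) : Prop where
  c_pos : 0 < c
  f_nonneg : ∀ k, 2 ≤ k → 0 ≤ f k
  cost_nonneg : ∀ P ⊆ S, ∀ C : Finpartition P, 0 ≤ cost C.parts
  diameter_sensitive : ∀ P ⊆ S, ∀ C : Finpartition P, ∀ B ∈ C.parts,
    c * Metric.diam (B : Set (Pt d)) ≤ cost C.parts
  opt_packing_le : ∀ P ⊆ S, ∀ (r : ℝ) (R : Finset (Pt d)), IsWeakPacking r R P →
    ∀ k, 2 ≤ k → opt cost k R ≤ opt cost k P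
  opt_le_packing : ∀ P ⊆ S, ∀ (r : ℝ) (R : Finset (Pt d)), IsWeakPacking r R P →
    ∀ k, 2 ≤ k → opt cost k P ≤ opt cost k R + r * f k

/-- The points of `S` in the closed axis-aligned box with corners `lo` and `hi`. -/
def inBox {d : ℕ} (S : Finset (Pt d)) (lo hi : Pt d) : Finset (Pt d) :=
  open Classical in S.filter fun p => ∀ i, lo i ≤ p i ∧ p i ≤ hi i

/-! ## The two given procedures -/

/-- The contents of a piece of memory that describes a clustering. -/
structure Desc where
  nats : List ℕ
  reals : List ℝ

/-- The single-shot clustering algorithm and the expansion algorithm, seen as procedures that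
return the description of a clustering together with the time spent.
`solve L k` gets a list of points and the number of clusters;
`expand lo hi L D r k` gets a box, a packing `L` of the points in the box, the description `D`
of a clustering of `L`, the packing radius and the number of clusters. -/
structure Procedures (d : ℕ) where
  solve : List (Pt d) → ℕ → Desc × ℕ
  expand : Pt d → Pt d → List (Pt d) → Desc → ℝ → ℕ → Desc × ℕ

/-- `A.solve` computes an optimal `k`-clustering of any at most `m` points of `S` in time
`T m k`. Here `rep D 𝒞` says that `D` is a description of the clustering `𝒞`. -/
def Solves {d : ℕ} (A : Procedures d) (rep : Desc → Finset (Finset (Pt d)) → Prop)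
    (S : Finset (Pt d)) (cost : Cost d) (T : ℕ → ℕ → ℕ) : Prop :=
  ∀ (L : List (Pt d)), L.Nodup → L.toFinset ⊆ S → ∀ k, 2 ≤ k →
    (∃ C : Finpartition L.toFinset, C.parts.card ≤ k ∧ rep (A.solve L k).1 C.parts ∧
      cost C.parts = opt cost k L.toFinset) ∧
    ∀ m, L.length ≤ m → (A.solve L k).2 ≤ T m k

/-- The algorithmic part of the expansion property: from a `k`-clustering `C` of a weak
`r`-packing of the points of `S` in a box, `A.expand` computes a `k`-clustering of all points of
`S` in the box of cost at most `cost C + r * f k`, in time `T n k` with `n = |S|`. -/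
def Expands {d : ℕ} (A : Procedures d) (rep : Desc → Finset (Finset (Pt d)) → Prop)
    (S : Finset (Pt d)) (cost : Cost d) (f : ℕ → ℝ) (T : ℕ → ℕ → ℕ) : Prop :=
  ∀ (lo hi : Pt d) (L : List (Pt d)) (r : ℝ), L.Nodup →
    IsWeakPacking r L.toFinset (inBox S lo hi) → ∀ k, 2 ≤ k →
    ∀ (C : Finpartition L.toFinset) (D : Desc), C.parts.card ≤ k → rep D C.parts →
      (∃ C' : Finpartition (inBox S lo hi), C'.parts.card ≤ k ∧
        rep (A.expand lo hi L D r k).1 C'.parts ∧ cost C'.parts ≤ cost C.parts + r * f k) ∧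
      (A.expand lo hi L D r k).2 ≤ T S.card k

/-! ## The machine model: a real RAM without rounding -/

/-- A machine state: registers and memory for natural numbers, and registers and memory for
real numbers. -/
structure State where
  nreg : ℕ → ℕ
  rreg : ℕ → ℝ
  nmem : ℕ → ℕ
  rmem : ℕ → ℝ

/-- Four natural-number registers that hold the position of a clustering description: address and
length of its part in the memory for naturals, address and length of its part in the memory for
reals. -/
structure DescRef where
  natAddr : ℕ
  natLen : ℕ
  realAddr : ℕ
  realLen : ℕ

/-- Unit-cost instructions. The arguments are register numbers, except for the constants. -/
inductive Instr where
  | nconst (i v : ℕ)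
  | nadd (i j l : ℕ)
  | nsub (i j l : ℕ)
  | nhalf (i j : ℕ)
  | nload (i j : ℕ)
  | nstore (i j : ℕ)
  | rconst (i : ℕ) (q : ℚ)
  | radd (i j l : ℕ)
  | rsub (i j l : ℕ)
  | rmul (i j l : ℕ)
  | rdiv (i j l : ℕ)
  | rload (i j : ℕ)
  | rstore (i j : ℕ)

/-- Comparisons of two registers. -/
inductive Test where
  | neq (i j : ℕ)
  | nlt (i j : ℕ)
  | rlt (i j : ℕ)
  | rle (i j : ℕ)

/-- Programs. In `solve` and `expand`, `pts` is a register with the address, in the memory for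
reals, of a list of points, `cnt` a register with the length of the list, `k` a register with the
number of clusters; the description of the resulting clustering is written at the addresses in
`out.natAddr` and `out.realAddr`, and its lengths into the registers `out.natLen` and
`out.realLen`. In `expand` the box is in the `2 * d` real registers from number `box` on, the
given clustering is described at `src`, and the packing radius is in the real register `r`. -/
inductive Cmd where
  | instr (a : Instr)
  | seq (p q : Cmd)
  | ite (b : Test) (p q : Cmd)
  | while (b : Test) (p : Cmd)
  | solve (pts cnt k : ℕ) (out : DescRef)
  | expand (box pts cnt : ℕ) (src : DescRef) (r k : ℕ) (out : DescRef)

namespace State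

def setN (s : State) (i v : ℕ) : State := { s with nreg := Function.update s.nreg i v }

def setR (s : State) (i : ℕ) (x : ℝ) : State := { s with rreg := Function.update s.rreg i x }

/-- The effect of an instruction. -/
def step (s : State) : Instr → State
  | .nconst i v => s.setN i v
  | .nadd i j l => s.setN i (s.nreg j + s.nreg l)
  | .nsub i j l => s.setN i (s.nreg j - s.nreg l)
  | .nhalf i j => s.setN i (s.nreg j / 2)
  | .nload i j => s.setN i (s.nmem (s.nreg j))
  | .nstore i j => { s with nmem := Function.update s.nmem (s.nreg i) (s.nreg j) }
  | .rconst i q => s.setR i q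
  | .radd i j l => s.setR i (s.rreg j + s.rreg l)
  | .rsub i j l => s.setR i (s.rreg j - s.rreg l)
  | .rmul i j l => s.setR i (s.rreg j * s.rreg l)
  | .rdiv i j l => s.setR i (s.rreg j / s.rreg l)
  | .rload i j => s.setR i (s.rmem (s.nreg j))
  | .rstore i j => { s with rmem := Function.update s.rmem (s.nreg i) (s.rreg j) }

/-- The truth of a comparison. -/
def holds (s : State) : Test → Prop
  | .neq i j => s.nreg i = s.nreg j
  | .nlt i j => s.nreg i < s.nreg j
  | .rlt i j => s.rreg i < s.rreg j
  | .rle i j => s.rreg i ≤ s.rreg j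

/-- The point of `ℝ^d` stored in `d` consecutive cells. -/
def point (d : ℕ) (h : ℕ → ℝ) (a : ℕ) : Pt d := WithLp.toLp 2 fun i => h (a + i)

/-- The list of `m` points stored consecutively from address `a` on. -/
def points (d : ℕ) (h : ℕ → ℝ) (a m : ℕ) : List (Pt d) :=
  (List.range m).map fun j => point d h (a + j * d)

/-- The contents of `m` consecutive cells. -/
def block {α : Type} (h : ℕ → α) (a m : ℕ) : List α := (List.range m).map fun j => h (a + j)

/-- Overwrite consecutive cells from address `a` on by a list. -/
def write {α : Type} (h : ℕ → α) (a : ℕ) (l : List α) : ℕ → α :=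
  fun j => if j < a then h j else l.getD (j - a) (h j)

/-- The description stored at the position given by `q`. -/
def readDesc (s : State) (q : DescRef) : Desc where
  nats := block s.nmem (s.nreg q.natAddr) (s.nreg q.natLen)
  reals := block s.rmem (s.nreg q.realAddr) (s.nreg q.realLen)

/-- Store a description at the addresses given by `q`, and its lengths in the registers of `q`. -/
def writeDesc (s : State) (q : DescRef) (D : Desc) : State where
  nreg := Function.update (Function.update s.nreg q.natLen D.nats.length) q.realLen D.reals.length
  rreg := s.rreg
  nmem := write s.nmem (s.nreg q.natAddr) D.nats
  rmem := write s.rmem (s.nreg q.realAddr) D.reals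

/-- The result and the time of a call of the single-shot algorithm. -/
def callSolve {d : ℕ} (A : Procedures d) (s : State) (pts cnt k : ℕ) : Desc × ℕ :=
  A.solve (points d s.rmem (s.nreg pts) (s.nreg cnt)) (s.nreg k)

/-- The result and the time of a call of the expansion algorithm. -/
def callExpand {d : ℕ} (A : Procedures d) (s : State) (box pts cnt : ℕ) (src : DescRef)
    (r k : ℕ) : Desc × ℕ :=
  A.expand (point d s.rreg box) (point d s.rreg (box + d))
    (points d s.rmem (s.nreg pts) (s.nreg cnt)) (s.readDesc src) (s.rreg r) (s.nreg k)

end State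

/-- `Exec A p s t s'`: started in state `s`, the program `p` stops after exactly `t` steps in state
`s'`. Instructions and tests take one step; a call takes one step plus the time of the called
procedure. -/
inductive Exec {d : ℕ} (A : Procedures d) : Cmd → State → ℕ → State → Prop where
  | instr (a : Instr) (s : State) : Exec A (.instr a) s 1 (s.step a)
  | seq {p q : Cmd} {s s' s'' : State} {t u : ℕ} :
      Exec A p s t s' → Exec A q s' u s'' → Exec A (.seq p q) s (t + u) s''
  | ite_true {b : Test} {p q : Cmd} {s s' : State} {t : ℕ} :
      s.holds b → Exec A p s t s' → Exec A (.ite b p q) s (t + 1) s'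
  | ite_false {b : Test} {p q : Cmd} {s s' : State} {t : ℕ} :
      ¬ s.holds b → Exec A q s t s' → Exec A (.ite b p q) s (t + 1) s'
  | while_true {b : Test} {p : Cmd} {s s' s'' : State} {t u : ℕ} :
      s.holds b → Exec A p s t s' → Exec A (.while b p) s' u s'' →
        Exec A (.while b p) s (t + u + 1) s''
  | while_false {b : Test} {p : Cmd} {s : State} :
      ¬ s.holds b → Exec A (.while b p) s 1 s
  | solve (pts cnt k : ℕ) (out : DescRef) (s : State) :
      Exec A (.solve pts cnt k out) s ((s.callSolve A pts cnt k).2 + 1)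
        (s.writeDesc out (s.callSolve A pts cnt k).1)
  | expand (box pts cnt : ℕ) (src : DescRef) (r k : ℕ) (out : DescRef) (s : State) :
      Exec A (.expand box pts cnt src r k out) s ((s.callExpand A box pts cnt src r k).2 + 1)
        (s.writeDesc out (s.callExpand A box pts cnt src r k).1)

/-- A data structure: the initial contents of the two memories. -/
structure DataStructure where
  nats : List ℕ
  reals : List ℝ

/-- The number of memory cells used. -/
def DataStructure.storage (D : DataStructure) : ℕ := D.nats.length + D.reals.length

/-- The state at the start of a query: the data structure is in memory, `k` is in the natural
register `0`, the corners `lo`, `hi` of the query box are in the real registers `0, …, d - 1` and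
`d, …, 2 * d - 1`, and `ε` is in the real register `2 * d`. -/
def DataStructure.queryState {d : ℕ} (D : DataStructure) (lo hi : Pt d) (k : ℕ) (ε : ℝ) :
    State where
  nreg := fun i => if i = 0 then k else 0
  rreg := fun i =>
    if h : i < d then lo ⟨i, h⟩
    else if h : i - d < d then hi ⟨i - d, h⟩
    else if i = 2 * d then ε
    else 0
  nmem := fun a => D.nats.getD a 0
  rmem := fun a => D.reals.getD a 0

/-- Where a query program leaves its answer. -/
def answerRef : DescRef := ⟨0, 1, 2, 3⟩

end RangeClustering

end

open RangeClustering

/-! Scale the points into the unit cube and interleave the binary digits of their coordinates to a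
key. The prefixes of the keys form a compressed binary tree whose cells are boxes and, at prefix
lengths divisible by `d`, cubes of a dyadic grid. In key order, each inner node belongs to a gap
between two consecutive points. Inner nodes are numbered by growing prefix length and leaves come
last, so a smaller number means a cell at least as large, and the lowest common ancestor of two
leaves is the minimum of the in-order sequence of node numbers between them (`Layout.OfKey.toTree`).

To examine a node, find an extreme point of node ∩ query box in each of the `2 * d` axis directions.
The lowest common ancestor of the first and the last of these in key order contains all points of
the intersection, because a cell is cut out by its bounding box, and it is tight: both children meet
the query box (`examine_found`). A plain range tree would need `log ^ d` steps for an extreme point.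
One factor is saved twice over: the axis to be maximised is innermost and searched in a heap of
maxima, and another axis becomes one-sided at the node where its two search paths part, hence a mere
threshold on weights. What is left is `log` for the innermost search and a factor `log` for each of
`d - 2` axes (`boxQuery_runs`). A node whose box lies inside the query box needs no such search.

The coarse phase keeps a front of disjoint tight nodes that cover the query and replaces the largest
one by the tight nodes below its children, until there are `2 ^ d * k + 1` nodes or only leaves. In
the second case all points are clustered exactly. Otherwise let `σ` be the size of the last refined
node. Representatives of the front lie in distinct grid cubes of side `σ / (2 * d)`. Any
`k`-clustering puts more than `2 ^ d` of them into one cluster; two of these have grid indices of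
equal parity on all axes, so they are at distance at least `σ / (2 * d)`. By diameter-sensitivity
`Opt ≥ c * σ / (2 * d)` (`Layout.Geometric.size_le_opt`).

The fine phase refines down to size `r = σ / (2 * d * x)` and selects one point per node, which
gives a weak `r`-packing `R`. The choice of `r` yields `r * f k ≤ ε * Opt`, so expanding an optimal
clustering of `R` costs at most `Opt(R) + r * f k ≤ (1 + ε) * Opt` (`query_correct`). Below each
front node, `O(x ^ d)` nodes are larger than `r`, since such a node is determined by few key bits. A
node that crosses a side of the query box has its bits on one axis prescribed, so only `O(x ^ (d -
1))` nodes cross and pay for range searches (`Layout.Geometric.card_pending_le`). This separates the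
two terms of the time bound.

Programs are verified by a Hoare-style logic with step budgets (`Runs`). The data structure comes
from `exists_geometric`, which builds the tree, and `exists_memory`, which lays it out in memory. -/

noncomputable section

namespace RangeClustering

/-! ## A program logic with time bounds -/

section ProgramLogic

variable {d : ℕ} {A : Procedures d}

/-- Started in `s`, the program `p` stops within `T` steps in a state that satisfies `Q`. -/
def Runs (A : Procedures d) (p : Cmd) (s : State) (T : ℕ) (Q : State → Prop) : Prop :=
  ∃ t s', t ≤ T ∧ Exec A p s t s' ∧ Q s'

theorem Runs.mono {p : Cmd} {s : State} {T T' : ℕ} {Q Q' : State → Prop} (h : Runs A p s T Q)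
    (hT : T ≤ T') (hQ : ∀ s', Q s' → Q' s') : Runs A p s T' Q' := by
  obtain ⟨t, s', ht, he, hq⟩ := h
  exact ⟨t, s', ht.trans hT, he, hQ _ hq⟩

theorem Runs.le {p : Cmd} {s : State} {T T' : ℕ} {Q : State → Prop} (h : Runs A p s T Q)
    (hT : T ≤ T') : Runs A p s T' Q := h.mono hT fun _ => id

theorem Runs.instr {a : Instr} {s : State} {T : ℕ} {Q : State → Prop} (hT : 1 ≤ T)
    (h : Q (s.step a)) : Runs A (.instr a) s T Q := ⟨1, _, hT, .instr a s, h⟩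

theorem Runs.seq {p q : Cmd} {s : State} {T : ℕ} {Q : State → Prop} (T₁ T₂ : ℕ)
    (hT : T₁ + T₂ ≤ T) (h : Runs A p s T₁ fun s' => Runs A q s' T₂ Q) :
    Runs A (.seq p q) s T Q := by
  obtain ⟨t, s', ht, he, t', s'', ht', he', hq⟩ := h
  exact ⟨t + t', s'', by omega, .seq he he', hq⟩

theorem Runs.ite {b : Test} {p q : Cmd} {s : State} {T : ℕ} {Q : State → Prop} (T₁ : ℕ)
    (hT : T₁ + 1 ≤ T) (h₁ : s.holds b → Runs A p s T₁ Q) (h₂ : ¬ s.holds b → Runs A q s T₁ Q) :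
    Runs A (.ite b p q) s T Q := by
  by_cases hb : s.holds b
  · obtain ⟨t, s', ht, he, hq⟩ := h₁ hb
    exact ⟨t + 1, s', by omega, .ite_true hb he, hq⟩
  · obtain ⟨t, s', ht, he, hq⟩ := h₂ hb
    exact ⟨t + 1, s', by omega, .ite_false hb he, hq⟩

/-- Loops: `Inv T s` says that `s` is a state before a test with at most `T` steps to go. -/
theorem Runs.while {b : Test} {p : Cmd} {Q : State → Prop} (Inv : ℕ → State → Prop)
    (hb : ∀ T s, Inv T s → s.holds b →
      ∃ T₁ T₂, T₁ + T₂ + 1 ≤ T ∧ Runs A p s T₁ (Inv T₂))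
    (hn : ∀ T s, Inv T s → ¬ s.holds b → 1 ≤ T ∧ Q s) :
    ∀ T s, Inv T s → Runs A (.while b p) s T Q := by
  intro T
  -- Strong induction on the budget: every round spends at least the step of its test.
  induction T using Nat.strong_induction_on with
  | _ T ih =>
    intro s hs
    by_cases h : s.holds b
    · obtain ⟨T₁, T₂, hT, t, s', ht, he, hi⟩ := hb T s hs h
      obtain ⟨t', s'', ht', he', hq⟩ := ih T₂ (by omega) s' hi
      exact ⟨t + t' + 1, s'', by omega, .while_true h he he', hq⟩
    · exact ⟨1, s, (hn T s hs h).1, .while_false h, (hn T s hs h).2⟩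

/-- The program that does nothing. -/
def nop : Cmd := .while (.nlt 0 0) (.instr (.nconst 0 0))

theorem Runs.nop {s : State} {T : ℕ} {Q : State → Prop} (hT : 1 ≤ T) (h : Q s) :
    Runs A nop s T Q := ⟨1, s, hT, .while_false (by simp [State.holds]), h⟩

/-- Straight-line programs. -/
def code : List Instr → Cmd
  | [] => nop
  | a :: l => .seq (.instr a) (code l)

theorem Runs.code {s : State} {T : ℕ} {Q : State → Prop} (l : List Instr) (hT : l.length + 1 ≤ T)
    (h : Q (l.foldl State.step s)) : Runs A (code l) s T Q := by
  induction l generalizing s T with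
  | nil => exact Runs.nop (by simpa using hT) h
  | cons a l ih =>
    simp only [List.length_cons] at hT
    exact Runs.seq 1 (l.length + 1) (by omega) (Runs.instr le_rfl (ih le_rfl h))

/-- The programs `p 0, …, p (n - 1)` one after the other. -/
def unroll (p : ℕ → Cmd) : ℕ → Cmd
  | 0 => nop
  | n + 1 => .seq (unroll p n) (p n)

theorem Runs.unroll {p : ℕ → Cmd} {n T : ℕ} (Inv : ℕ → State → Prop)
    (h : ∀ i < n, ∀ s, Inv i s → Runs A (p i) s T (Inv (i + 1))) {s : State} (h0 : Inv 0 s) :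
    Runs A (unroll p n) s (n * T + 1) (Inv n) := by
  induction n with
  | zero => exact Runs.nop (by simp) h0
  | succ n ih =>
    refine Runs.seq (n * T + 1) T (by rw [Nat.succ_mul]; omega) ?_
    exact (ih fun i hi => h i (by omega)).mono le_rfl fun s' hs' => h n (by omega) s' hs'

end ProgramLogic

/-! ### Simplification rules for machine states. -/

namespace State

@[simp] theorem nreg_setN_self (s : State) (i v : ℕ) : (s.setN i v).nreg i = v := by
  simp [setN]

@[simp] theorem nreg_setN_ne (s : State) {i j : ℕ} (v : ℕ) (h : j ≠ i) :
    (s.setN i v).nreg j = s.nreg j := by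
  simp [setN, h]

@[simp] theorem rreg_setN (s : State) (i v : ℕ) : (s.setN i v).rreg = s.rreg := rfl
@[simp] theorem nmem_setN (s : State) (i v : ℕ) : (s.setN i v).nmem = s.nmem := rfl
@[simp] theorem rmem_setN (s : State) (i v : ℕ) : (s.setN i v).rmem = s.rmem := rfl

@[simp] theorem rreg_setR_self (s : State) (i : ℕ) (v : ℝ) : (s.setR i v).rreg i = v := by
  simp [setR]

@[simp] theorem rreg_setR_ne (s : State) {i j : ℕ} (v : ℝ) (h : j ≠ i) :
    (s.setR i v).rreg j = s.rreg j := by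
  simp [setR, h]

@[simp] theorem nreg_setR (s : State) (i : ℕ) (v : ℝ) : (s.setR i v).nreg = s.nreg := rfl
@[simp] theorem nmem_setR (s : State) (i : ℕ) (v : ℝ) : (s.setR i v).nmem = s.nmem := rfl
@[simp] theorem rmem_setR (s : State) (i : ℕ) (v : ℝ) : (s.setR i v).rmem = s.rmem := rfl

/-- Overwrite a cell of the memory for naturals. -/
def putN (s : State) (a v : ℕ) : State := { s with nmem := Function.update s.nmem a v }

/-- Overwrite a cell of the memory for reals. -/
def putR (s : State) (a : ℕ) (x : ℝ) : State := { s with rmem := Function.update s.rmem a x }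

@[simp] theorem nreg_putN (s : State) (i v : ℕ) : (s.putN i v).nreg = s.nreg := rfl
@[simp] theorem rreg_putN (s : State) (i v : ℕ) : (s.putN i v).rreg = s.rreg := rfl
@[simp] theorem rmem_putN (s : State) (i v : ℕ) : (s.putN i v).rmem = s.rmem := rfl
@[simp] theorem nreg_putR (s : State) (i : ℕ) (v : ℝ) : (s.putR i v).nreg = s.nreg := rfl
@[simp] theorem rreg_putR (s : State) (i : ℕ) (v : ℝ) : (s.putR i v).rreg = s.rreg := rfl
@[simp] theorem nmem_putR (s : State) (i : ℕ) (v : ℝ) : (s.putR i v).nmem = s.nmem := rfl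

@[simp] theorem nmem_putN_self (s : State) (i v : ℕ) : (s.putN i v).nmem i = v := by
  simp [putN]
@[simp] theorem nmem_putN_ne (s : State) {i j : ℕ} (v : ℕ) (h : j ≠ i) :
    (s.putN i v).nmem j = s.nmem j := by
  simp [putN, h]
@[simp] theorem rmem_putR_self (s : State) (i : ℕ) (v : ℝ) : (s.putR i v).rmem i = v := by
  simp [putR]
@[simp] theorem rmem_putR_ne (s : State) {i j : ℕ} (v : ℝ) (h : j ≠ i) :
    (s.putR i v).rmem j = s.rmem j := by
  simp [putR, h]

variable (s : State)

@[simp] theorem step_nconst (i v : ℕ) : s.step (.nconst i v) = s.setN i v := rfl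
@[simp] theorem step_nadd (i j l : ℕ) :
    s.step (.nadd i j l) = s.setN i (s.nreg j + s.nreg l) := rfl
@[simp] theorem step_nsub (i j l : ℕ) :
    s.step (.nsub i j l) = s.setN i (s.nreg j - s.nreg l) := rfl
@[simp] theorem step_nhalf (i j : ℕ) : s.step (.nhalf i j) = s.setN i (s.nreg j / 2) := rfl
@[simp] theorem step_nload (i j : ℕ) : s.step (.nload i j) = s.setN i (s.nmem (s.nreg j)) := rfl
@[simp] theorem step_nstore (i j : ℕ) :
    s.step (.nstore i j) = s.putN (s.nreg i) (s.nreg j) := rfl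
@[simp] theorem step_rconst (i : ℕ) (q : ℚ) : s.step (.rconst i q) = s.setR i q := rfl
@[simp] theorem step_radd (i j l : ℕ) :
    s.step (.radd i j l) = s.setR i (s.rreg j + s.rreg l) := rfl
@[simp] theorem step_rsub (i j l : ℕ) :
    s.step (.rsub i j l) = s.setR i (s.rreg j - s.rreg l) := rfl
@[simp] theorem step_rmul (i j l : ℕ) :
    s.step (.rmul i j l) = s.setR i (s.rreg j * s.rreg l) := rfl
@[simp] theorem step_rdiv (i j l : ℕ) :
    s.step (.rdiv i j l) = s.setR i (s.rreg j / s.rreg l) := rfl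
@[simp] theorem step_rload (i j : ℕ) : s.step (.rload i j) = s.setR i (s.rmem (s.nreg j)) := rfl
@[simp] theorem step_rstore (i j : ℕ) :
    s.step (.rstore i j) = s.putR (s.nreg i) (s.rreg j) := rfl

@[simp] theorem holds_neq (i j : ℕ) : s.holds (.neq i j) ↔ s.nreg i = s.nreg j := Iff.rfl
@[simp] theorem holds_nlt (i j : ℕ) : s.holds (.nlt i j) ↔ s.nreg i < s.nreg j := Iff.rfl
@[simp] theorem holds_rlt (i j : ℕ) : s.holds (.rlt i j) ↔ s.rreg i < s.rreg j := Iff.rfl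
@[simp] theorem holds_rle (i j : ℕ) : s.holds (.rle i j) ↔ s.rreg i ≤ s.rreg j := Iff.rfl

end State

/-! ## Binary search -/

section BinarySearch

variable {d : ℕ} {A : Procedures d}

/-- Natural registers that hold constants: `7` holds one and `8` holds zero. -/
def Consts (s : State) : Prop := s.nreg 7 = 1 ∧ s.nreg 8 = 0

/-- `s'` differs from `s` at most in the natural registers from `c` on and in the real register
`t`. -/
def ScratchOnly (c t : ℕ) (s s' : State) : Prop :=
  s'.nmem = s.nmem ∧ s'.rmem = s.rmem ∧ (∀ i < c, s'.nreg i = s.nreg i) ∧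
    ∀ i, i ≠ t → s'.rreg i = s.rreg i

/-- Count the entries of a sorted array that are less than (at most) a given number. The array is
at the address in `b` and has the length in `n`; the result is left in `c`. -/
def bsearch (cmp : ℕ → ℕ → Test) (t b n x c : ℕ) : Cmd :=
  .seq (code [.nadd c 8 8, .nadd (c + 1) n 8])
    (.while (.nlt c (c + 1))
      (.seq (code [.nadd (c + 2) c (c + 1), .nhalf (c + 2) (c + 2), .nadd (c + 3) b (c + 2),
          .rload t (c + 3)])
        (.ite (cmp t x) (code [.nadd c (c + 2) 7]) (code [.nadd (c + 1) (c + 2) 8]))))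

/-- Time of `bsearch` on an array of fewer than `2 ^ l` entries. -/
def bsearchTime (l : ℕ) : ℕ := 9 * l + 4

/-- By `hrel` the entries in relation to `q` form an initial segment. The loop keeps `lo` at most
and `hi` at least the length of this segment, with `hi - lo < 2 ^ j` when `j` rounds remain. An
abstract relation serves both strict and weak comparisons, which are needed for the two ends of a
range. -/
theorem bsearch_runs {cmp : ℕ → ℕ → Test} {t b n x c l N : ℕ} {a : ℕ → ℝ} {q : ℝ} {s : State}
    (rel : ℝ → ℝ → Prop) (hcmp : ∀ (s : State) i j, s.holds (cmp i j) ↔ rel (s.rreg i) (s.rreg j))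
    (hrel : ∀ i j, i ≤ j → j < N → rel (a j) q → rel (a i) q)
    (hc : 9 ≤ c) (hbc : b < c) (hnc : n < c) (hx : x ≠ t) (hs : Consts s)
    (hn : s.nreg n = N) (hN : N < 2 ^ l) (ha : ∀ i < N, s.rmem (s.nreg b + i) = a i)
    (hq : s.rreg x = q) :
    Runs A (bsearch cmp t b n x c) s (bsearchTime l) fun s' =>
      ScratchOnly c t s s' ∧ s'.nreg c ≤ N ∧ (∀ i < s'.nreg c, rel (a i) q) ∧
        ∀ i < N, s'.nreg c ≤ i → ¬ rel (a i) q := by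
  obtain ⟨h7, h8⟩ := hs
  refine Runs.seq 3 (9 * l + 1) (by simp [bsearchTime]; omega) (Runs.code _ (by simp) ?_)
  refine Runs.while (fun T s' => ScratchOnly c t s s' ∧
    ∃ lo hi j, T = 9 * j + 1 ∧ s'.nreg c = lo ∧ s'.nreg (c + 1) = hi ∧ lo ≤ hi ∧ hi ≤ N ∧
      hi - lo < 2 ^ j ∧ (∀ i < lo, rel (a i) q) ∧ ∀ i < N, hi ≤ i → ¬ rel (a i) q) ?_ ?_ _ _ ?_
  · rintro T s' ⟨⟨hm, hr, hf, hg⟩, lo, hi, j, rfl, h1, h2, h3, h4, h5, h6, h9⟩ hb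
    simp only [State.holds_nlt, h1, h2] at hb
    obtain ⟨j, rfl⟩ : ∃ k, j = k + 1 := ⟨j - 1, by
      rcases j with _ | j
      · simp at h5; omega
      · simp⟩
    rw [pow_succ] at h5
    refine ⟨8, 9 * j + 1, by omega, ?_⟩
    refine Runs.seq 5 3 le_rfl (Runs.code _ (by simp) ?_)
    have e7 := hf 7 (by omega)
    have e8 := hf 8 (by omega)
    have ex := hg x hx
    have eb := hf b hbc
    have hv := ha ((lo + hi) / 2) (by omega)
    refine Runs.ite 2 le_rfl (fun hh => Runs.code _ (by simp) ?_)
      (fun hh => Runs.code _ (by simp) ?_)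
    · rw [hcmp] at hh
      simp (disch := omega) [h1, h2, eb, hr, hv, ex, hq] at hh
      refine ⟨⟨hm, hr, fun i hi => ?_, fun i hi => ?_⟩, (lo + hi) / 2 + 1, hi, j, rfl, ?_, ?_,
        by omega, h4, by omega,
        fun i hi => hrel i _ (Nat.lt_succ_iff.1 hi) (by omega) hh, h9⟩
      · simp (disch := omega) [hf i hi]
      · simp (disch := omega) [hg i hi]
      · simp (disch := omega) [h1, h2, e7, h7]
      · simp (disch := omega) [h2]
    · rw [hcmp] at hh
      simp (disch := omega) [h1, h2, eb, hr, hv, ex, hq] at hh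
      refine ⟨⟨hm, hr, fun i hi => ?_, fun i hi => ?_⟩, lo, (lo + hi) / 2, j, rfl, ?_, ?_,
        by omega, by omega, by omega, h6, fun i hi hi' hr => hh (hrel _ i (by omega) hi hr)⟩
      · simp (disch := omega) [hf i hi]
      · simp (disch := omega) [hg i hi]
      · simp (disch := omega) [h1]
      · simp (disch := omega) [h1, h2, e8, h8]
  · rintro T s' ⟨hsc, lo, hi, j, rfl, h1, h2, h3, h4, h5, h6, h9⟩ hb
    simp only [State.holds_nlt, h1, h2] at hb
    obtain rfl : lo = hi := by omega
    exact ⟨by omega, hsc, h1 ▸ h4, h1 ▸ h6, h1 ▸ h9⟩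
  · refine ⟨⟨rfl, rfl, fun i hi => ?_, fun i hi => ?_⟩, 0, N, l, rfl, ?_, ?_, by omega, le_rfl,
      by simpa using hN, by simp, fun i hi hi' => by omega⟩
    · simp (disch := omega)
    · simp (disch := omega)
    · simp (disch := omega) [h8]
    · simp (disch := omega) [h8, hn]

end BinarySearch

/-! ## Loops over the canonical nodes of a complete binary tree

The nodes of a complete binary tree with leaves `0, …, 2 ^ L - 1` are numbered from `1` on such that
the leaf `x` has number `2 ^ L + x` and the parent of `v` is `v / 2`. -/

section Heap

/-- The leaves below the node `v`. -/
def blk (L v : ℕ) : Finset ℕ :=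
  (Finset.range (2 ^ L)).filter fun x => (2 ^ L + x) / 2 ^ (L - Nat.log 2 v) = v

/-- The ancestor of leaf `x` at height `h` is `(2 ^ L + x) / 2 ^ h`, and the nodes of one height
occupy the numbers between two consecutive powers of two. -/
theorem heap_div_bounds {L h x : ℕ} (hh : h ≤ L) (hx : x < 2 ^ L) :
    2 ^ (L - h) ≤ (2 ^ L + x) / 2 ^ h ∧ (2 ^ L + x) / 2 ^ h < 2 ^ (L - h + 1) := by
  have e : 2 ^ L = 2 ^ (L - h) * 2 ^ h := by rw [← pow_add]; congr 1; omega
  constructor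
  · rw [Nat.le_div_iff_mul_le (by positivity)]; omega
  · rw [Nat.div_lt_iff_lt_mul (by positivity), pow_succ]
    have : 2 ^ (L - h) * 2 * 2 ^ h = 2 * (2 ^ (L - h) * 2 ^ h) := by ring
    omega

/-- With the height explicit instead of hidden in `Nat.log`, statements about leaves below a node
become linear arithmetic on quotients by `2 ^ h`. -/
theorem mem_blk {L h v x : ℕ} (hh : h ≤ L) (h1 : 2 ^ (L - h) ≤ v) (h2 : v < 2 ^ (L - h + 1)) :
    x ∈ blk L v ↔ x < 2 ^ L ∧ (2 ^ L + x) / 2 ^ h = v := by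
  have hl : Nat.log 2 v = L - h := by
    apply Nat.log_eq_of_pow_le_of_lt_pow h1 h2
  rw [blk, Finset.mem_filter, Finset.mem_range, hl]
  congr! 4
  omega

theorem heap_half (L h x : ℕ) : (2 ^ L + x) / 2 ^ h / 2 = (2 ^ L + x) / 2 ^ (h + 1) := by
  rw [Nat.div_div_eq_div_mul, pow_succ]

/-- Each leaf lies below at most `L + 1` nodes. -/
theorem sum_card_inter_blk_le (L : ℕ) (X : Finset ℕ) :
    ∑ v ∈ Finset.Ico 1 (2 ^ (L + 1)), (blk L v ∩ X).card ≤ X.card * (L + 1) := by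
  have h := Finset.sum_card_bipartiteAbove_eq_sum_card_bipartiteBelow
    (s := Finset.Ico 1 (2 ^ (L + 1))) (t := X) (fun v x => x ∈ blk L v)
  have e : ∀ v, blk L v ∩ X = X.bipartiteAbove (fun v x => x ∈ blk L v) v := by
    intro v; ext x; simp [Finset.mem_bipartiteAbove, and_comm]
  simp_rw [e]
  rw [h, ← smul_eq_mul, ← Finset.sum_const]
  refine Finset.sum_le_sum fun x _ => ?_
  -- The nodes above `x` are its ancestors, one for each of the `L + 1` depths.
  have hsub : (Finset.Ico 1 (2 ^ (L + 1))).bipartiteBelow (fun v x => x ∈ blk L v) x ⊆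
      (Finset.range (L + 1)).image fun j => (2 ^ L + x) / 2 ^ (L - j) := by
    intro v hv
    simp only [Finset.mem_bipartiteBelow, Finset.mem_Ico, blk, Finset.mem_filter] at hv
    rw [Finset.mem_image]
    exact ⟨Nat.log 2 v, by simpa using Nat.log_lt_of_lt_pow (by omega) hv.1.2, hv.2.2⟩
  exact (Finset.card_le_card hsub).trans (Finset.card_image_le.trans (by simp))

variable {d : ℕ} {A : Procedures d}

/-- Visit nodes whose leaf sets cover the leaves from `l` to `r - 1`, where the registers `c` and
`c + 1` hold the numbers of `l` and `r`. The program `take` finds the node in register `c + 2`. -/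
def canonicalLoop (take : Cmd) (c : ℕ) : Cmd :=
  .while (.nlt c (c + 1))
    (.seq (code [.nhalf (c + 3) c, .nadd (c + 5) (c + 3) (c + 3)])
    (.seq (.ite (.nlt (c + 5) c)
      (.seq (code [.nadd (c + 2) c 8]) (.seq take (code [.nadd (c + 3) (c + 3) 7]))) nop)
    (.seq (code [.nhalf (c + 4) (c + 1), .nadd (c + 2) (c + 4) (c + 4)])
    (.seq (.ite (.nlt (c + 2) (c + 1)) take nop)
      (code [.nadd c (c + 3) 8, .nadd (c + 1) (c + 4) 8])))))

/-- Time of `canonicalLoop` if `take` needs time `T`. -/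
def canonicalTime (L T : ℕ) : ℕ := L * (2 * T + 20) + 1

/-- Bottom-up decomposition of an interval. At height `h` the nodes still to be covered are those
from `l` to `r - 1`. If `l` is a right child it is taken alone, if `r - 1` is a left child it is
taken alone, and the rest consists of full pairs of siblings, so one may pass to the parents.
Oddness is tested by comparing twice the half with the number. The invariant records the leaves of
the interval whose ancestor at height `h` is outside the current node range as visited, and says
that all leaves below the current range belong to the interval. -/
theorem canonicalLoop_runs {take : Cmd} {c L T : ℕ} (Inv : Finset ℕ → State → Prop)
    (hcon : ∀ Y s, Inv Y s → Consts s) (hc : 9 ≤ c)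
    (hst : ∀ Y s i v, c ≤ i → i < c + 6 → Inv Y s → Inv Y (s.setN i v))
    (htake : ∀ Y s v, 2 ≤ v → v < 2 ^ (L + 1) → s.nreg (c + 2) = v → Inv Y s →
      Runs A take s T fun s' => Inv (Y ∪ blk L v) s' ∧
        ∀ i, c ≤ i → i < c + 6 → s'.nreg i = s.nreg i)
    {a b : ℕ} {s : State} (hb : b < 2 ^ L) (hl : s.nreg c = 2 ^ L + a)
    (hr : s.nreg (c + 1) = 2 ^ L + b) (hs : Inv ∅ s) :
    Runs A (canonicalLoop take c) s (canonicalTime L T) (Inv (Finset.Ico a b)) := by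
  -- At the root the range would satisfy `1 ≤ l < r < 2`. So the loop ends before, and node `1` is
  -- never taken.
  have key : ∀ h ≤ L, ∀ l r : ℕ, 2 ^ (L - h) ≤ l → r < 2 ^ (L - h + 1) → l < r →
      ∃ k, h + 1 ≤ L ∧ k = L - (h + 1) ∧ L - h = k + 1 := by
    intro h hh l r h1 h2 h3
    rcases Nat.lt_or_ge h L with h4 | h4
    · exact ⟨L - (h + 1), by omega, rfl, by omega⟩
    · obtain rfl : h = L := by omega
      simp at h1 h2; omega
  refine Runs.while (fun T' s' => ∃ h l r, h ≤ L ∧ T' = (L - h) * (2 * T + 20) + 1 ∧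
    s'.nreg c = l ∧ s'.nreg (c + 1) = r ∧ 2 ^ (L - h) ≤ l ∧ r < 2 ^ (L - h + 1) ∧
    Inv ((Finset.Ico a b).filter fun x =>
      ¬ (l ≤ (2 ^ L + x) / 2 ^ h ∧ (2 ^ L + x) / 2 ^ h < r)) s' ∧
    ∀ x < 2 ^ L, l ≤ (2 ^ L + x) / 2 ^ h → (2 ^ L + x) / 2 ^ h < r → a ≤ x ∧ x < b)
    ?_ ?_ _ _ ?_
  · rintro T' s' ⟨h, l, r, hh, rfl, h1, h2, h3, h4, h5, h6⟩ hb'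
    simp only [State.holds_nlt, h1, h2] at hb'
    obtain ⟨k, hk1, hk2, hk3⟩ := key h hh l r h3 h4 hb'
    have hkp : L - (h + 1) = k := hk2.symm
    have p1 : 2 ^ (L - h) = 2 * 2 ^ k := by rw [hk3, pow_succ]; ring
    have p2 : 2 ^ (L - h + 1) = 4 * 2 ^ k := by rw [hk3, pow_succ, pow_succ]; ring
    have p3 : 2 ^ (L - (h + 1) + 1) = 2 * 2 ^ k := by rw [hkp, pow_succ]; ring
    have p4 : 4 * 2 ^ k ≤ 2 ^ (L + 1) := by
      rw [← p2]; exact Nat.pow_le_pow_right (by omega) (by omega)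
    have p0 : 0 < 2 ^ k := by positivity
    refine ⟨2 * T + 19, (L - (h + 1)) * (2 * T + 20) + 1, ?_, ?_⟩
    · rw [hk3, hkp, Nat.add_mul k 1, Nat.one_mul]; omega
    refine Runs.seq 3 (2 * T + 16) (by omega) (Runs.code _ (by simp) ?_)
    set s1 := List.foldl State.step s'
      [.nhalf (c + 3) c, .nadd (c + 5) (c + 3) (c + 3)] with hs1
    have i1 : Inv ((Finset.Ico a b).filter fun x =>
      ¬ (l ≤ (2 ^ L + x) / 2 ^ h ∧ (2 ^ L + x) / 2 ^ h < r)) s1 := by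
      rw [hs1]; simp only [List.foldl, State.step_nhalf, State.step_nadd]
      exact hst _ _ _ _ (by omega) (by omega) (hst _ _ _ _ (by omega) (by omega) h5)
    have r0 : s1.nreg c = l := by simp (disch := omega) [hs1, h1]
    have r1 : s1.nreg (c + 1) = r := by simp (disch := omega) [hs1, h2]
    have r3 : s1.nreg (c + 3) = l / 2 := by simp (disch := omega) [hs1, h1]
    have r5 : s1.nreg (c + 5) = l / 2 + l / 2 := by simp (disch := omega) [hs1, h1]
    clear_value s1
    refine Runs.seq (T + 6) (T + 10) (by omega) ?_
    have hmid : Runs A (.ite (.nlt (c + 5) c)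
        (.seq (code [.nadd (c + 2) c 8]) (.seq take (code [.nadd (c + 3) (c + 3) 7]))) nop)
        s1 (T + 6) fun s2 => s2.nreg (c + 1) = r ∧ s2.nreg (c + 3) = (l + 1) / 2 ∧
          Inv ((Finset.Ico a b).filter fun x =>
            ¬ ((l + 1) / 2 * 2 ≤ (2 ^ L + x) / 2 ^ h ∧ (2 ^ L + x) / 2 ^ h < r)) s2 := by
      refine Runs.ite (T + 5) le_rfl (fun hc => ?_) (fun hc => Runs.nop (by omega) ?_)
      · simp only [State.holds_nlt, r0, r5] at hc
        refine Runs.seq 2 (T + 3) (by omega) (Runs.code _ (by simp) ?_)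
        refine Runs.seq T 2 (by omega) ?_
        have z : s1.nreg 8 = 0 := (hcon _ _ i1).2
        refine (htake _ _ l (by omega) (by omega) (by simp (disch := omega) [r0, z])
          (hst _ _ _ _ (by omega) (by omega) i1)).mono le_rfl ?_
        rintro s2 ⟨i2, f2⟩
        refine Runs.code _ (by simp) ⟨?_, ?_, ?_⟩
        · simp (disch := omega) [f2, r1]
        · have z7 := (hcon _ _ i2).1
          simp (disch := omega) [f2, r3, z7]; omega
        · have e : (l + 1) / 2 * 2 = l + 1 := by omega
          simp only [List.foldl, State.step_nadd]
          refine hst _ _ _ _ (by omega) (by omega) ?_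
          convert i2 using 1
          ext x
          rw [Finset.mem_union, mem_blk hh h3 (by omega), Finset.mem_filter, Finset.mem_filter,
            Finset.mem_Ico, e]
          have := h6 x
          constructor
          · rintro ⟨hx, hn⟩
            by_cases hxl : (2 ^ L + x) / 2 ^ h = l
            · exact Or.inr ⟨by omega, hxl⟩
            · exact Or.inl ⟨hx, by omega⟩
          · rintro (⟨hx, hn⟩ | ⟨hx, hn⟩)
            · exact ⟨hx, by omega⟩
            · exact ⟨this hx (by omega) (by omega), by omega⟩
      · simp only [State.holds_nlt, r0, r5] at hc
        have e : (l + 1) / 2 * 2 = l := by omega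
        exact ⟨r1, by rw [r3]; omega, by simpa only [e] using i1⟩
    refine hmid.mono le_rfl ?_
    rintro s2 ⟨q1, q3, i2⟩
    refine Runs.seq 3 (T + 7) (by omega) (Runs.code _ (by simp) ?_)
    set s3 := List.foldl State.step s2
      [.nhalf (c + 4) (c + 1), .nadd (c + 2) (c + 4) (c + 4)] with hs3
    have i3 : Inv ((Finset.Ico a b).filter fun x =>
      ¬ ((l + 1) / 2 * 2 ≤ (2 ^ L + x) / 2 ^ h ∧ (2 ^ L + x) / 2 ^ h < r)) s3 := by
      rw [hs3]; simp only [List.foldl, State.step_nhalf, State.step_nadd]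
      exact hst _ _ _ _ (by omega) (by omega) (hst _ _ _ _ (by omega) (by omega) i2)
    have t1 : s3.nreg (c + 1) = r := by simp (disch := omega) [hs3, q1]
    have t2 : s3.nreg (c + 2) = r / 2 + r / 2 := by simp (disch := omega) [hs3, q1]
    have t3 : s3.nreg (c + 3) = (l + 1) / 2 := by simp (disch := omega) [hs3, q3]
    have t4 : s3.nreg (c + 4) = r / 2 := by simp (disch := omega) [hs3, q1]
    clear_value s3
    refine Runs.seq (T + 2) 4 (by omega) ?_
    have hmid' : Runs A (.ite (.nlt (c + 2) (c + 1)) take nop) s3 (T + 2) fun s4 =>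
        s4.nreg (c + 3) = (l + 1) / 2 ∧ s4.nreg (c + 4) = r / 2 ∧
          Inv ((Finset.Ico a b).filter fun x =>
            ¬ ((l + 1) / 2 * 2 ≤ (2 ^ L + x) / 2 ^ h ∧ (2 ^ L + x) / 2 ^ h < r / 2 * 2)) s4 := by
      refine Runs.ite (T + 1) le_rfl (fun hc => ?_) (fun hc => Runs.nop (by omega) ?_)
      · simp only [State.holds_nlt, t1, t2] at hc
        refine (htake _ _ (r - 1) (by omega) (by omega) (by omega) i3).mono (by omega) ?_
        rintro s4 ⟨i4, f4⟩
        refine ⟨by rw [f4 _ (by omega) (by omega), t3], by rw [f4 _ (by omega) (by omega), t4], ?_⟩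
        have e : r / 2 * 2 = r - 1 := by omega
        convert i4 using 1
        ext x
        rw [Finset.mem_union, mem_blk hh (by omega) (by omega), Finset.mem_filter,
          Finset.mem_filter, Finset.mem_Ico, e]
        have := h6 x
        constructor
        · rintro ⟨hx, hn⟩
          by_cases hxl : (2 ^ L + x) / 2 ^ h = r - 1
          · exact Or.inr ⟨by omega, hxl⟩
          · exact Or.inl ⟨hx, by omega⟩
        · rintro (⟨hx, hn⟩ | ⟨hx, hn⟩)
          · exact ⟨hx, by omega⟩
          · exact ⟨this hx (by omega) (by omega), by omega⟩
      · simp only [State.holds_nlt, t1, t2] at hc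
        have e : r / 2 * 2 = r := by omega
        exact ⟨t3, t4, by simpa only [e] using i3⟩
    refine hmid'.mono le_rfl ?_
    rintro s4 ⟨w3, w4, i4⟩
    refine Runs.code _ (by simp) ?_
    have z := (hcon _ _ i4).2
    refine ⟨h + 1, (l + 1) / 2, r / 2, hk1, rfl, ?_, ?_, by rw [hkp]; omega, by omega, ?_, ?_⟩
    · simp (disch := omega) [w3, z]
    · simp (disch := omega) [w4, z]
    · simp only [List.foldl, State.step_nadd]
      refine hst _ _ _ _ (by omega) (by omega) (hst _ _ _ _ (by omega) (by omega) ?_)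
      convert i4 using 1
      refine Finset.filter_congr fun x _ => ?_
      rw [← heap_half]; omega
    · intro x hx hx1 hx2
      rw [← heap_half] at hx1 hx2
      exact h6 x hx (by omega) (by omega)
  · rintro T' s' ⟨h, l, r, hh, rfl, h1, h2, h3, h4, h5, h6⟩ hb'
    simp only [State.holds_nlt, h1, h2] at hb'
    refine ⟨by omega, ?_⟩
    convert h5 using 1
    rw [eq_comm, Finset.filter_eq_self]
    intro x _; omega
  · refine ⟨0, 2 ^ L + a, 2 ^ L + b, by omega, rfl, hl, hr, by simp, ?_, ?_, ?_⟩
    · rw [Nat.sub_zero, pow_succ]; omega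
    · convert hs using 1
      rw [Finset.filter_eq_empty_iff]
      intro x hx; rw [Finset.mem_Ico] at hx; simp; omega
    · intro x hx h1 h2; simp at h1 h2; omega

end Heap

/-! ## Searching a heap of maxima -/

section HeapSearch

variable {d : ℕ} {A : Procedures d}

theorem ScratchOnly.trans {c t : ℕ} {s s' s'' : State} (h : ScratchOnly c t s s')
    (h' : ScratchOnly c t s' s'') : ScratchOnly c t s s'' :=
  ⟨h'.1.trans h.1, h'.2.1.trans h.2.1, fun i hi => (h'.2.2.1 i hi).trans (h.2.2.1 i hi),
    fun i hi => (h'.2.2.2 i hi).trans (h.2.2.2 i hi)⟩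

theorem ScratchOnly.weaken {c c' t : ℕ} {s s' : State} (h : ScratchOnly c t s s') (hc : c' ≤ c) :
    ScratchOnly c' t s s' :=
  ⟨h.1, h.2.1, fun i hi => h.2.2.1 i (by omega), h.2.2.2⟩

theorem ScratchOnly.refl {c t : ℕ} {s : State} : ScratchOnly c t s s :=
  ⟨rfl, rfl, fun _ _ => rfl, fun _ _ => rfl⟩

/-- From the leaf in register `c + 3`, climb to the first left sibling of the path whose value
exceeds the threshold in register `27`. Its number is left in `c + 4` (zero if there is none). -/
def climb (c : ℕ) : Cmd :=
  .while (.nlt 7 (c + 3))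
    (.seq (code [.nhalf (c + 5) (c + 3), .nadd (c + 6) (c + 5) (c + 5), .nadd (c + 7) c (c + 6),
        .nload (c + 7) (c + 7)])
      (.ite (.nlt (c + 6) (c + 3))
        (.ite (.nlt 27 (c + 7)) (code [.nadd (c + 4) (c + 6) 8, .nadd (c + 3) 8 8])
          (code [.nadd (c + 3) (c + 5) 8]))
        (code [.nadd (c + 3) (c + 5) 8])))

/-- Descend from the node in register `c + 4` to the last leaf below it whose value exceeds the
threshold in register `27`. -/
def descend (c : ℕ) : Cmd :=
  .while (.nlt (c + 4) (c + 2))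
    (.seq (code [.nadd (c + 4) (c + 4) (c + 4), .nadd (c + 5) (c + 4) 7, .nadd (c + 6) c (c + 5),
        .nload (c + 6) (c + 6)])
      (.ite (.nlt 27 (c + 6)) (code [.nadd (c + 4) (c + 5) 8]) nop))

/-- The leaves to the left of `b` are exactly those below the left siblings met on the path from `b`
to the root, and siblings met earlier lie further right. Hence the first sibling that contains a
leaf with property `q` contains the last such leaf before `b`. The invariant says that all
candidates have their ancestor at the current height strictly to the left of the path. Setting the
path register to zero leaves the loop. -/
theorem climb_runs {c l b Ad thr t : ℕ} {s : State} (q : ℕ → Prop) (hc : 30 ≤ c) (hs : Consts s)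
    (hA : s.nreg c = Ad) (h27 : s.nreg 27 = thr) (hb : b < 2 ^ l)
    (hW : ∀ v, 2 ≤ v → v < 2 ^ (l + 1) → (thr < s.nmem (Ad + v) ↔ ∃ x ∈ blk l v, q x))
    (hw : s.nreg (c + 3) = 2 ^ l + b) (hv : s.nreg (c + 4) = 0) :
    Runs A (climb c) s (l * 12 + 2) fun s' => ScratchOnly (c + 3) t s s' ∧
      ((s'.nreg (c + 4) = 0 ∧ ∀ x < b, ¬ q x) ∨
        ∃ h ≤ l, 2 ≤ s'.nreg (c + 4) ∧ 2 ^ (l - h) ≤ s'.nreg (c + 4) ∧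
          s'.nreg (c + 4) < 2 ^ (l - h + 1) ∧ (∃ x ∈ blk l (s'.nreg (c + 4)), q x) ∧
          (∀ x ∈ blk l (s'.nreg (c + 4)), x < b) ∧
          ∀ x < b, q x → (2 ^ l + x) / 2 ^ h ≤ s'.nreg (c + 4)) := by
  obtain ⟨h7, h8⟩ := hs
  refine Runs.while (fun T s' => ScratchOnly (c + 3) t s s' ∧ ∃ h ≤ l,
    ((T = (l - h) * 12 + 2 ∧ s'.nreg (c + 4) = 0 ∧
      s'.nreg (c + 3) = (2 ^ l + b) / 2 ^ h ∧
      ∀ x < b, q x → (2 ^ l + x) / 2 ^ h < (2 ^ l + b) / 2 ^ h) ∨ (1 ≤ T ∧ s'.nreg (c + 3) = 0 ∧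
        2 ≤ s'.nreg (c + 4) ∧ 2 ^ (l - h) ≤ s'.nreg (c + 4) ∧
          s'.nreg (c + 4) < 2 ^ (l - h + 1) ∧ (∃ x ∈ blk l (s'.nreg (c + 4)), q x) ∧
          (∀ x ∈ blk l (s'.nreg (c + 4)), x < b) ∧
          ∀ x < b, q x → (2 ^ l + x) / 2 ^ h ≤ s'.nreg (c + 4)))) ?_ ?_ _ _ ?_
  · rintro T s' ⟨⟨hm, hr, hf, hg⟩, h, hh, h1 | h1⟩ hb'
    swap
    · simp [h1.2.1] at hb'
    obtain ⟨rfl, h1, h2, h3⟩ := h1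
    have e7 := (hf 7 (by omega)).trans h7
    have e8 := (hf 8 (by omega)).trans h8
    have e27 := (hf 27 (by omega)).trans h27
    have ec := (hf c (by omega)).trans hA
    simp only [State.holds_nlt, e7, h2] at hb'
    have hbd := heap_div_bounds hh hb
    have hhl : h < l := by
      rcases Nat.lt_or_ge h l with h4 | h4
      · exact h4
      · obtain rfl : h = l := by omega
        simp only [Nat.sub_self] at hbd; omega
    set w := (2 ^ l + b) / 2 ^ h with hwd
    obtain ⟨k, hk⟩ : ∃ k, l - h = k + 1 := ⟨l - h - 1, by omega⟩
    have hk' : l - (h + 1) = k := by omega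
    have p1 : 2 ^ (l - h) = 2 * 2 ^ k := by rw [hk, pow_succ]; ring
    have p2 : 2 ^ (l - h + 1) = 4 * 2 ^ k := by rw [hk, pow_succ, pow_succ]; ring
    have p4 : 4 * 2 ^ k ≤ 2 ^ (l + 1) := by
      rw [← p2]; exact Nat.pow_le_pow_right (by omega) (by omega)
    have hup : (∀ x < b, q x → (2 ^ l + x) / 2 ^ h / 2 < w / 2) →
        ∀ x < b, q x → (2 ^ l + x) / 2 ^ (h + 1) < (2 ^ l + b) / 2 ^ (h + 1) := by
      intro hx x hxb hq
      rw [← heap_half, ← heap_half, ← hwd]; exact hx x hxb hq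
    -- Common to the two cases in which the climb goes on: the current node is a left child, or its
    -- left sibling holds no candidate.
    have hskip : ∀ s'' : State, ScratchOnly (c + 3) t s s'' → s''.nreg (c + 4) = 0 →
        s''.nreg (c + 5) = w / 2 → (∀ x < b, q x → (2 ^ l + x) / 2 ^ h / 2 < w / 2) →
        Runs A (code [.nadd (c + 3) (c + 5) 8]) s'' 3 fun s' => ScratchOnly (c + 3) t s s' ∧
          ∃ h' ≤ l, (((l - (h + 1)) * 12 + 2 = (l - h') * 12 + 2 ∧ s'.nreg (c + 4) = 0 ∧
      s'.nreg (c + 3) = (2 ^ l + b) / 2 ^ h' ∧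
      ∀ x < b, q x → (2 ^ l + x) / 2 ^ h' < (2 ^ l + b) / 2 ^ h') ∨ (1 ≤ (l - (h + 1)) * 12 + 2 ∧ s'.nreg (c + 3) = 0 ∧
        2 ≤ s'.nreg (c + 4) ∧ 2 ^ (l - h') ≤ s'.nreg (c + 4) ∧
          s'.nreg (c + 4) < 2 ^ (l - h' + 1) ∧ (∃ x ∈ blk l (s'.nreg (c + 4)), q x) ∧
          (∀ x ∈ blk l (s'.nreg (c + 4)), x < b) ∧
          ∀ x < b, q x → (2 ^ l + x) / 2 ^ h' ≤ s'.nreg (c + 4))) := by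
      rintro s'' ⟨hm', hr', hf', hg'⟩ g4 g5 hx
      have e8' := (hf' 8 (by omega)).trans h8
      refine Runs.code _ (by simp) ⟨⟨hm', hr', fun i hi => ?_, hg'⟩, h + 1, hhl,
        Or.inl ⟨rfl, ?_, ?_, hup hx⟩⟩
      · simp (disch := omega) [hf' i hi]
      · simp (disch := omega) [g4]
      · simp (disch := omega) [g5, e8']
        rw [← heap_half]
    refine ⟨10, (l - (h + 1)) * 12 + 2, by omega, ?_⟩
    refine Runs.seq 5 5 le_rfl (Runs.code _ (by simp) ?_)
    set s1 := List.foldl State.step s' [.nhalf (c + 5) (c + 3), .nadd (c + 6) (c + 5) (c + 5),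
      .nadd (c + 7) c (c + 6), .nload (c + 7) (c + 7)] with hs1
    have hsc : ScratchOnly (c + 3) t s s1 := by
      refine ⟨hm, hr, fun i hi => ?_, hg⟩
      simp (disch := omega) [hs1, hf i hi]
    have g4 : s1.nreg (c + 4) = 0 := by simp (disch := omega) [hs1, h1]
    have g3 : s1.nreg (c + 3) = w := by simp (disch := omega) [hs1, h2]
    have g5 : s1.nreg (c + 5) = w / 2 := by simp (disch := omega) [hs1, h2]
    have g6 : s1.nreg (c + 6) = w / 2 + w / 2 := by simp (disch := omega) [hs1, h2]
    have g7 : s1.nreg (c + 7) = s.nmem (Ad + (w / 2 + w / 2)) := by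
      simp (disch := omega) [hs1, h2, ec, hm]
    clear_value s1
    refine Runs.ite 4 (by omega) (fun hodd => ?_) (fun hodd => (hskip s1 hsc g4 g5 ?_).le (by omega))
    all_goals rw [State.holds_nlt, g6, g3] at hodd
    · have e6 : w / 2 + w / 2 = w - 1 := by omega
      have hWw := hW (w - 1) (by omega) (by omega)
      have hmb : ∀ x, x ∈ blk l (w - 1) ↔ x < 2 ^ l ∧ (2 ^ l + x) / 2 ^ h = w - 1 := fun x =>
        mem_blk hh (by omega) (by omega)
      refine Runs.ite 3 le_rfl (fun hth => ?_) (fun hth => hskip s1 hsc g4 g5 ?_)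
      · rw [State.holds_nlt, hsc.2.2.1 27 (by omega), h27, g7, e6, hWw] at hth
        have z8 := (hsc.2.2.1 8 (by omega)).trans h8
        obtain ⟨hm', hr', hf', hg'⟩ := hsc
        have ev : (List.foldl State.step s1 [.nadd (c + 4) (c + 6) 8, .nadd (c + 3) 8 8]).nreg
            (c + 4) = w - 1 := by
          simp (disch := omega) [g6, z8]; omega
        refine Runs.code _ (by simp) ⟨⟨hm', hr', fun i hi => ?_, hg'⟩, h, by omega,
          Or.inr ?_⟩
        · simp (disch := omega) [hf' i hi]
        rw [ev]
        refine ⟨by omega, by simp (disch := omega) [z8], by omega, by omega, by omega, hth,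
          fun x hx => ?_, fun x hx hq => by have := h3 x hx hq; omega⟩
        by_contra hxb
        have : (2 ^ l + b) / 2 ^ h ≤ (2 ^ l + x) / 2 ^ h := Nat.div_le_div_right (by omega)
        have := ((hmb x).1 hx).2
        omega
      · rw [State.holds_nlt, hsc.2.2.1 27 (by omega), h27, g7, e6, hWw] at hth
        intro x hx hq
        have := h3 x hx hq
        have : (2 ^ l + x) / 2 ^ h ≠ w - 1 := fun h' =>
          hth ⟨x, (hmb x).2 ⟨by omega, h'⟩, hq⟩
        omega
    · intro x hx hq
      have := h3 x hx hq
      omega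
  · rintro T s' ⟨hsc, h, hh, h1 | h1⟩ hb'
    · obtain ⟨rfl, h1, h2, h3⟩ := h1
      refine ⟨by omega, hsc, Or.inl ⟨h1, fun x hx hq => ?_⟩⟩
      have := h3 x hx hq
      have hx' := (heap_div_bounds (x := x) hh (by omega)).1
      have e7 := (hsc.2.2.1 7 (by omega)).trans h7
      simp only [State.holds_nlt, e7, h2] at hb'
      have : 0 < 2 ^ (l - h) := by positivity
      omega
    · exact ⟨h1.1, hsc, Or.inr ⟨h, hh, h1.2.2⟩⟩
  · refine ⟨ScratchOnly.refl, 0, by omega, Or.inl ⟨by simp, hv, by simpa using hw,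
      fun x hx _ => by simpa using hx⟩⟩

/-- Going to the right child whenever its maximum exceeds the threshold, and to the left child
otherwise, keeps the last candidate below the current node. By `h4` all leaves below the start node
precede `b`, so the bound `b` needs no test on the way. -/
theorem descend_runs {c l b Ad thr t h : ℕ} {s : State} (q : ℕ → Prop) (hc : 30 ≤ c)
    (hs : Consts s) (hA : s.nreg c = Ad) (h27 : s.nreg 27 = thr) (hb : b < 2 ^ l)
    (hW : ∀ v, 2 ≤ v → v < 2 ^ (l + 1) → (thr < s.nmem (Ad + v) ↔ ∃ x ∈ blk l v, q x))
    (hM : s.nreg (c + 2) = 2 ^ l) (hh : h ≤ l) (h1 : 2 ^ (l - h) ≤ s.nreg (c + 4))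
    (h2 : s.nreg (c + 4) < 2 ^ (l - h + 1)) (h3 : ∃ x ∈ blk l (s.nreg (c + 4)), q x)
    (h4 : ∀ x ∈ blk l (s.nreg (c + 4)), x < b)
    (h5 : ∀ x < b, q x → (2 ^ l + x) / 2 ^ h ≤ s.nreg (c + 4)) :
    Runs A (descend c) s (l * 12 + 1) fun s' => ScratchOnly (c + 3) t s s' ∧
      ∃ x < b, s'.nreg (c + 4) = 2 ^ l + x ∧ q x ∧ ∀ y < b, q y → y ≤ x := by
  obtain ⟨h7, h8⟩ := hs
  refine Runs.le ?_ (show h * 12 + 1 ≤ l * 12 + 1 by omega)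
  refine Runs.while (fun T s' => ScratchOnly (c + 3) t s s' ∧ ∃ h ≤ l, T = h * 12 + 1 ∧
    2 ^ (l - h) ≤ s'.nreg (c + 4) ∧ s'.nreg (c + 4) < 2 ^ (l - h + 1) ∧
    (∃ x ∈ blk l (s'.nreg (c + 4)), q x) ∧ (∀ x ∈ blk l (s'.nreg (c + 4)), x < b) ∧
    ∀ x < b, q x → (2 ^ l + x) / 2 ^ h ≤ s'.nreg (c + 4)) ?_ ?_ _ _
    ⟨ScratchOnly.refl, h, hh, rfl, h1, h2, h3, h4, h5⟩
  · clear h1 h2 h3 h4 h5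
    rintro T s' ⟨⟨hm, hr, hf, hg⟩, h, hh, rfl, h1, h2, h3, h4, h5⟩ hb'
    have e7 := (hf 7 (by omega)).trans h7
    have e8 := (hf 8 (by omega)).trans h8
    have e27 := (hf 27 (by omega)).trans h27
    have ec := (hf c (by omega)).trans hA
    have e2 := (hf (c + 2) (by omega)).trans hM
    rw [State.holds_nlt, e2] at hb'
    obtain ⟨k, rfl⟩ : ∃ k, h = k + 1 := ⟨h - 1, by
      rcases h with _ | h
      · simp only [Nat.sub_zero] at h1; omega
      · simp⟩
    set v := s'.nreg (c + 4) with hv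
    have hlk : l - k = l - (k + 1) + 1 := by omega
    have p0 : 0 < 2 ^ (l - (k + 1)) := by positivity
    have p1 : 2 ^ (l - k) = 2 * 2 ^ (l - (k + 1)) := by rw [hlk, pow_succ]; ring
    have p2 : 2 ^ (l - k + 1) = 4 * 2 ^ (l - (k + 1)) := by rw [hlk, pow_succ, pow_succ]; ring
    have p4 : 2 ^ (l - k + 1) ≤ 2 ^ (l + 1) := Nat.pow_le_pow_right (by omega) (by omega)
    have p5 : 2 ^ (l - (k + 1) + 1) = 2 * 2 ^ (l - (k + 1)) := by rw [pow_succ]; ring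
    refine ⟨9, k * 12 + 1, by omega, ?_⟩
    refine Runs.seq 5 4 le_rfl (Runs.code _ (by simp) ?_)
    set s1 := List.foldl State.step s' [.nadd (c + 4) (c + 4) (c + 4), .nadd (c + 5) (c + 4) 7,
      .nadd (c + 6) c (c + 5), .nload (c + 6) (c + 6)] with hs1
    have hsc : ScratchOnly (c + 3) t s s1 := by
      refine ⟨hm, hr, fun i hi => ?_, hg⟩
      simp (disch := omega) [hs1, hf i hi]
    have g4 : s1.nreg (c + 4) = v + v := by simp (disch := omega) [hs1, hv]
    have g5 : s1.nreg (c + 5) = v + v + 1 := by simp (disch := omega) [hs1, hv, e7]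
    have g6 : s1.nreg (c + 6) = s.nmem (Ad + (v + v + 1)) := by
      simp (disch := omega) [hs1, hv, ec, hm, e7]
    clear_value s1
    have hWv := hW (v + v + 1) (by omega) (by omega)
    have mv : ∀ x, x ∈ blk l v ↔ x < 2 ^ l ∧ (2 ^ l + x) / 2 ^ (k + 1) = v := fun x =>
      mem_blk hh h1 h2
    have m0 : ∀ x, x ∈ blk l (v + v) ↔ x < 2 ^ l ∧ (2 ^ l + x) / 2 ^ k = v + v := fun x =>
      mem_blk (by omega) (by omega) (by omega)
    have m1 : ∀ x, x ∈ blk l (v + v + 1) ↔ x < 2 ^ l ∧ (2 ^ l + x) / 2 ^ k = v + v + 1 := fun x =>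
      mem_blk (by omega) (by omega) (by omega)
    refine Runs.ite 2 (by omega) (fun hth => ?_) (fun hth => ?_)
    all_goals rw [State.holds_nlt, hsc.2.2.1 27 (by omega), h27, g6, hWv] at hth
    · have z8 := (hsc.2.2.1 8 (by omega)).trans h8
      obtain ⟨hm', hr', hf', hg'⟩ := hsc
      have ev : (List.foldl State.step s1 [.nadd (c + 4) (c + 5) 8]).nreg (c + 4) = v + v + 1 := by
        simp (disch := omega) [g5, z8]
      refine Runs.code _ (by simp) ⟨⟨hm', hr', fun i hi => ?_, hg'⟩, k, by omega, rfl, ?_⟩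
      · simp (disch := omega) [hf' i hi]
      rw [ev]
      refine ⟨by omega, by omega, hth, fun x hx => h4 x ?_, fun x hx hq => ?_⟩
      · rw [mv, ← heap_half]; rw [m1] at hx; omega
      · have := h5 x hx hq
        rw [← heap_half] at this; omega
    · refine Runs.nop (by omega) ⟨hsc, k, by omega, rfl, ?_⟩
      rw [g4]
      obtain ⟨x, hx, hq⟩ := h3
      refine ⟨by omega, by omega, ⟨x, ?_, hq⟩, fun x hx => h4 x ?_, fun x hx hq => ?_⟩
      · rw [mv, ← heap_half] at hx
        have : x ∉ blk l (v + v + 1) := fun h => hth ⟨x, h, hq⟩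
        rw [m1] at this; rw [m0]; omega
      · rw [mv, ← heap_half]; rw [m0] at hx; omega
      · have := h5 x hx hq
        have h' : x ∉ blk l (v + v + 1) := fun h => hth ⟨x, h, hq⟩
        rw [m1] at h'
        rw [← heap_half] at this; omega
  · clear h1 h2 h3 h4 h5
    rintro T s' ⟨hsc, h, hh, rfl, h1, h2, h3, h4, h5⟩ hb'
    refine ⟨by omega, hsc, ?_⟩
    have e2 := (hsc.2.2.1 (c + 2) (by omega)).trans hM
    rw [State.holds_nlt, e2] at hb'
    obtain rfl : h = 0 := by
      by_contra hne
      have : 2 ^ (l - h + 1) ≤ 2 ^ l := Nat.pow_le_pow_right (by omega) (by omega)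
      omega
    obtain ⟨x, hx, hq⟩ := h3
    have hxb := h4 x hx
    rw [mem_blk hh h1 h2] at hx
    simp only [pow_zero, Nat.div_one] at hx h5
    exact ⟨x, hxb, hx.2.symm, hq, fun y hy hq' => by have := h5 y hy hq'; omega⟩

end HeapSearch

/-! ## Range trees -/

section RangeTree

/-- The points of `X`, enumerated by `e` in the order of `key`, are stored at the address `a`: their
number, the number `2 ^ l` of leaves of a complete binary tree on top, and their keys. -/
structure SortedAt (key : ℕ → ℝ) (nm : ℕ → ℕ) (rm : ℕ → ℝ) (X : Finset ℕ) (a l : ℕ)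
    (e : ℕ → ℕ) : Prop where
  card_lt : X.card < 2 ^ l
  length_eq : nm a = X.card
  width_eq : nm (a + 1) = 2 ^ l
  image_eq : (Finset.range X.card).image e = X
  key_eq : ∀ i < X.card, rm (a + i) = key (e i)
  mono : ∀ i j, i ≤ j → j < X.card → key (e i) ≤ key (e j)

/-- The points of `X` below the node `v`. -/
def part (X : Finset ℕ) (e : ℕ → ℕ) (l v : ℕ) : Finset ℕ :=
  (blk l v ∩ Finset.range X.card).image e

/-- A range tree on the coordinates `1, …, m + 1` of the points of `X`, at address `a`. The nodes of
the innermost trees (on coordinate `1`) store the maximum of the weights `wt`. -/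
def RangeTree (co : ℕ → ℕ → ℝ) (wt : ℕ → ℕ) (Λ : ℕ) (nm : ℕ → ℕ) (rm : ℕ → ℝ) :
    ℕ → Finset ℕ → ℕ → Prop
  | 0, X, a => ∃ l ≤ Λ, ∃ e, SortedAt (co 1) nm rm X a l e ∧
      (∀ v, 2 ≤ v → v < 2 ^ (l + 1) → nm (a + v) = (part X e l v).sup wt) ∧
      ∀ i < X.card, nm (a + 2 ^ l + 2 ^ l + i) = e i
  | m + 1, X, a => ∃ l ≤ Λ, ∃ e, SortedAt (co (m + 2)) nm rm X a l e ∧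
      ∀ v, 2 ≤ v → v < 2 ^ (l + 1) → RangeTree co wt Λ nm rm m (part X e l v) (nm (a + v))

/-- The points of `X` with a weight over `thr` whose coordinates `1, …, m + 1` are in the range. -/
def sel (co : ℕ → ℕ → ℝ) (wt : ℕ → ℕ) (thr : ℕ) (lo hi : ℕ → ℝ) (m : ℕ) (X : Finset ℕ) :
    Finset ℕ :=
  open Classical in X.filter fun p =>
    thr < wt p ∧ ∀ a, 1 ≤ a → a ≤ m + 1 → lo a ≤ co a p ∧ co a p ≤ hi a

theorem mem_sel {co : ℕ → ℕ → ℝ} {wt : ℕ → ℕ} {thr : ℕ} {lo hi : ℕ → ℝ} {m p : ℕ}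
    {X : Finset ℕ} : p ∈ sel co wt thr lo hi m X ↔
      p ∈ X ∧ thr < wt p ∧ ∀ a, 1 ≤ a → a ≤ m + 1 → lo a ≤ co a p ∧ co a p ≤ hi a := by
  simp only [sel, Finset.mem_filter]

/-- `b` is a point of `Y` with maximal first coordinate `v`, or `b = 0` if `Y` is empty. -/
def Best (co : ℕ → ℕ → ℝ) (Y : Finset ℕ) (b : ℕ) (v : ℝ) : Prop :=
  (b = 0 ∧ Y = ∅) ∨ (b ≠ 0 ∧ b ∈ Y ∧ v = co 1 b ∧ ∀ y ∈ Y, co 1 y ≤ v)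

/-- What a query in a range tree may change. -/
def QueryScratch (d c : ℕ) (s s' : State) : Prop :=
  s'.nmem = s.nmem ∧ s'.rmem = s.rmem ∧ (∀ i < c, i ≠ 26 → s'.nreg i = s.nreg i) ∧
    ∀ i, i ≠ 2 * d + 4 → i ≠ 2 * d + 6 → s'.rreg i = s.rreg i

theorem QueryScratch.trans {d c : ℕ} {s s' s'' : State} (h : QueryScratch d c s s')
    (h' : QueryScratch d c s' s'') : QueryScratch d c s s'' :=
  ⟨h'.1.trans h.1, h'.2.1.trans h.2.1,
    fun i hi hn => (h'.2.2.1 i hi hn).trans (h.2.2.1 i hi hn),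
    fun i hi hn => (h'.2.2.2 i hi hn).trans (h.2.2.2 i hi hn)⟩

theorem QueryScratch.weaken {d c c' : ℕ} {s s' : State} (h : QueryScratch d c s s')
    (hc : c' ≤ c) : QueryScratch d c' s s' :=
  ⟨h.1, h.2.1, fun i hi => h.2.2.1 i (by omega), h.2.2.2⟩

theorem ScratchOnly.query {d c : ℕ} {s s' : State} (h : ScratchOnly c (2 * d + 4) s s') :
    QueryScratch d c s s' :=
  ⟨h.1, h.2.1, fun i hi _ => h.2.2.1 i hi, fun i hi _ => h.2.2.2 i hi⟩

theorem QueryScratch.refl {d c : ℕ} {s : State} : QueryScratch d c s s :=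
  ⟨rfl, rfl, fun _ _ _ => rfl, fun _ _ _ => rfl⟩

variable {d : ℕ} {A : Procedures d}

/-- Replace the best point so far by the one at index `c + 5` of the array at `c` if it is
better. -/
def updateBest (d c : ℕ) : Cmd :=
  let upd := code [.nadd (c + 6) c (c + 2), .nadd (c + 6) (c + 6) (c + 2),
    .nadd (c + 6) (c + 6) (c + 5), .nload 26 (c + 6), .rconst (2 * d + 6) 0,
    .radd (2 * d + 6) (2 * d + 6) (2 * d + 4)]
  .ite (.neq 26 8) upd (.ite (.rlt (2 * d + 6) (2 * d + 4)) upd nop)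

/-- Query in an innermost tree at the address in `c`: find the point with maximal first coordinate
in the range among the points with weight over the threshold in register `27`. -/
def innerQuery (d c : ℕ) : Cmd :=
  .seq (code [.nload (c + 1) c, .nadd (c + 3) c 7, .nload (c + 2) (c + 3)])
  (.seq (bsearch .rle (2 * d + 4) c (c + 1) (3 * d + 10 + 1) (c + 10))
  (.seq (code [.nadd (c + 3) (c + 2) (c + 10), .nadd (c + 4) 8 8])
  (.seq (climb c)
  (.ite (.nlt 8 (c + 4))
    (.seq (descend c)
    (.seq (code [.nsub (c + 5) (c + 4) (c + 2), .nadd (c + 6) c (c + 5),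
        .rload (2 * d + 4) (c + 6)])
      (.ite (.rle (2 * d + 10 + 1) (2 * d + 4)) (updateBest d c) nop)))
    nop))))

/-- Query in a range tree on `m + 1` coordinates. -/
def rangeQuery (d : ℕ) : ℕ → ℕ → Cmd
  | 0, c => innerQuery d c
  | m + 1, c =>
    .seq (code [.nload (c + 1) c, .nadd (c + 3) c 7, .nload (c + 2) (c + 3)])
    (.seq (bsearch .rlt (2 * d + 4) c (c + 1) (2 * d + 10 + (m + 2)) (c + 10))
    (.seq (code [.nadd (c + 3) (c + 2) (c + 10)])
    (.seq (bsearch .rle (2 * d + 4) c (c + 1) (3 * d + 10 + (m + 2)) (c + 10))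
    (.seq (code [.nadd (c + 4) (c + 2) (c + 10)])
      (canonicalLoop (.seq (code [.nadd (c + 10) c (c + 5), .nload (c + 10) (c + 10)])
        (rangeQuery d m (c + 10))) (c + 3))))))

/-- Time of `rangeQuery`. -/
def rangeTime (Λ : ℕ) : ℕ → ℕ
  | 0 => 40 * Λ + 60
  | m + 1 => canonicalTime Λ (rangeTime Λ m + 3) + 2 * bsearchTime Λ + 20

/-- The value zero in register `26` means that nothing was found yet; this is unambiguous because
points have nonzero numbers. Since `p` dominates all of `Z`, comparing it with the best point of `Y`
is enough. -/
theorem updateBest_runs {co : ℕ → ℕ → ℝ} {c p : ℕ} {Y Z : Finset ℕ} {s : State}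
    (hs : Consts s) (hY : Best co Y (s.nreg 26) (s.rreg (2 * d + 6)))
    (hp : s.nmem (s.nreg c + s.nreg (c + 2) + s.nreg (c + 2) + s.nreg (c + 5)) = p) (hp0 : p ≠ 0)
    (hpZ : p ∈ Z) (hv : s.rreg (2 * d + 4) = co 1 p) (hZ : ∀ z ∈ Z, co 1 z ≤ co 1 p) :
    Runs A (updateBest d c) s 9 fun s' => QueryScratch d (c + 3) s s' ∧
      Best co (Y ∪ Z) (s'.nreg 26) (s'.rreg (2 * d + 6)) := by
  obtain ⟨h7, h8⟩ := hs
  have hupd : (∀ y ∈ Y, co 1 y ≤ co 1 p) →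
      Runs A (code [.nadd (c + 6) c (c + 2), .nadd (c + 6) (c + 6) (c + 2),
        .nadd (c + 6) (c + 6) (c + 5), .nload 26 (c + 6), .rconst (2 * d + 6) 0,
        .radd (2 * d + 6) (2 * d + 6) (2 * d + 4)]) s 7 fun s' => QueryScratch d (c + 3) s s' ∧
      Best co (Y ∪ Z) (s'.nreg 26) (s'.rreg (2 * d + 6)) := by
    intro hYp
    refine Runs.code _ (by simp) ⟨⟨rfl, rfl, fun i hi hn => ?_, fun i h1 h2 => ?_⟩, Or.inr ?_⟩
    · simp (disch := omega)
    · simp (disch := omega)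
    · simp (disch := omega) [hp, hv, hp0, hpZ]
      rintro y (hy | hy)
      · exact hYp y hy
      · exact hZ y hy
  refine Runs.ite 8 le_rfl (fun h => ?_) (fun h => ?_)
  all_goals rw [State.holds_neq, h8] at h
  · obtain ⟨-, rfl⟩ : s.nreg 26 = 0 ∧ Y = ∅ := by
      rcases hY with hY | hY
      · exact hY
      · exact absurd h hY.1
    exact (hupd (by simp)).le (by omega)
  · obtain ⟨-, hb, hv', hYv⟩ := hY.resolve_left fun h' => h h'.1
    refine Runs.ite 7 le_rfl (fun h => hupd fun y hy => ?_) (fun h => Runs.nop (by omega) ?_)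
    all_goals rw [State.holds_rlt, hv] at h
    · exact (hYv y hy).trans h.le
    · refine ⟨QueryScratch.refl, Or.inr ⟨by assumption, Finset.mem_union_left _ hb, hv', ?_⟩⟩
      intro y hy
      rcases Finset.mem_union.1 hy with hy | hy
      · exact hYv y hy
      · exact (hZ y hy).trans (not_lt.1 h)

/-- The points are sorted by the coordinate that is to be maximised. So the best point with
coordinate at most `hi 1` and weight over the threshold is the last one with large weight among the
first `b` points, where `b` comes from one binary search. The lower end of the range needs no
search: if the best candidate falls below `lo 1`, so do all others. -/
theorem innerQuery_runs {co : ℕ → ℕ → ℝ} {wt : ℕ → ℕ} {Λ : ℕ} {lo hi : ℕ → ℝ}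
    {c thr : ℕ} {X Y : Finset ℕ} {s : State} (hd : 2 ≤ d) (hc : 30 ≤ c)
    (hs : Consts s) (hX : ∀ p ∈ X, p ≠ 0)
    (hR : RangeTree co wt Λ s.nmem s.rmem 0 X (s.nreg c)) (hthr : s.nreg 27 = thr)
    (hlo : ∀ a, a < d → s.rreg (2 * d + 10 + a) = lo a)
    (hhi : ∀ a, a < d → s.rreg (3 * d + 10 + a) = hi a)
    (hY : Best co Y (s.nreg 26) (s.rreg (2 * d + 6))) :
    Runs A (innerQuery d c) s (rangeTime Λ 0) fun s' => QueryScratch d (c + 1) s s' ∧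
      Best co (Y ∪ sel co wt thr lo hi 0 X) (s'.nreg 26) (s'.rreg (2 * d + 6)) := by
  obtain ⟨h7, h8⟩ := hs
  obtain ⟨l, hl, e, hS, hW, hid⟩ := hR
  have hmem : ∀ p, p ∈ X → ∃ i < X.card, e i = p := fun p hp => by
    have := hS.image_eq.symm ▸ hp
    simpa using this
  have hmem' : ∀ i < X.card, e i ∈ X := fun i hi => by
    have := Finset.mem_image_of_mem e (Finset.mem_range.2 hi)
    rwa [hS.image_eq] at this
  have hsel : ∀ p, p ∈ sel co wt thr lo hi 0 X ↔ p ∈ X ∧ thr < wt p ∧ lo 1 ≤ co 1 p ∧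
      co 1 p ≤ hi 1 := fun p => by
    rw [mem_sel]
    constructor
    · rintro ⟨h1, h2, h3⟩; exact ⟨h1, h2, h3 1 le_rfl le_rfl⟩
    · rintro ⟨h1, h2, h3⟩
      refine ⟨h1, h2, fun a ha ha' => ?_⟩
      obtain rfl : a = 1 := by omega
      exact h3
  refine Runs.seq 4 (bsearchTime l + 31 * l + 40) (by simp [rangeTime, bsearchTime]; omega)
    (Runs.code _ (by simp) ?_)
  set s1 := List.foldl State.step s [.nload (c + 1) c, .nadd (c + 3) c 7, .nload (c + 2) (c + 3)]
    with hs1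
  have f1 : ScratchOnly (c + 1) (2 * d + 4) s s1 := by
    refine ⟨rfl, rfl, fun i hi => ?_, fun i hi => rfl⟩
    simp (disch := omega) [hs1]
  have g1 : s1.nreg (c + 1) = X.card := by simp (disch := omega) [hs1, hS.length_eq]
  have g2 : s1.nreg (c + 2) = 2 ^ l := by simp (disch := omega) [hs1, hS.width_eq, h7]
  clear_value s1
  refine Runs.seq (bsearchTime l) (31 * l + 40) (by omega) ?_
  refine (bsearch_runs (N := X.card) (l := l) (a := fun i => co 1 (e i)) (q := hi 1)
    (fun x y => x ≤ y) (fun s i j => Iff.rfl) (fun i j hij hj h => (hS.mono i j hij hj).trans h)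
    (by omega) (by omega) (by omega) (by omega)
    ⟨(f1.2.2.1 7 (by omega)).trans h7, (f1.2.2.1 8 (by omega)).trans h8⟩ g1 hS.card_lt ?_ ?_).mono
    le_rfl ?_
  · intro i hi
    rw [f1.2.1, f1.2.2.1 c (by omega)]; exact hS.key_eq i hi
  · rw [f1.2.2.2 _ (by omega), hhi 1 (by omega)]
  rintro s2 ⟨f2, hbN, hb1, hb2⟩
  have g1' := (f2.2.2.1 (c + 1) (by omega)).trans g1
  have g2' := (f2.2.2.1 (c + 2) (by omega)).trans g2
  have f12 := f1.trans (f2.weaken (c' := c + 1) (by omega))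
  set b := s2.nreg (c + 10) with hb
  clear_value b
  refine Runs.seq 3 (31 * l + 37) (by omega) (Runs.code _ (by simp) ?_)
  set s3 := List.foldl State.step s2 [.nadd (c + 3) (c + 2) (c + 10), .nadd (c + 4) 8 8] with hs3
  have f13 : ScratchOnly (c + 1) (2 * d + 4) s s3 := by
    refine f12.trans ⟨rfl, rfl, fun i hi => ?_, fun i hi => rfl⟩
    simp (disch := omega) [hs3]
  have k2 : s3.nreg (c + 2) = 2 ^ l := by simp (disch := omega) [hs3, g2']
  have k3 : s3.nreg (c + 3) = 2 ^ l + b := by simp (disch := omega) [hs3, g2', hb]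
  have k4 : s3.nreg (c + 4) = 0 := by
    simp (disch := omega) [hs3, (f12.2.2.1 8 (by omega)).trans h8]
  clear_value s3
  -- The strict bound `X.card < 2 ^ l` provides a leaf `b` one past the admissible points even if
  -- all are admissible; the climb starts there.
  have hbl : b < 2 ^ l := lt_of_le_of_lt hbN hS.card_lt
  have hWq : ∀ v, 2 ≤ v → v < 2 ^ (l + 1) → (thr < s3.nmem (s.nreg c + v) ↔
      ∃ x ∈ blk l v, x < X.card ∧ thr < wt (e x)) := by
    intro v hv hv'
    rw [f13.1, hW v hv hv', Finset.lt_sup_iff]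
    constructor
    · rintro ⟨p, hp, hpt⟩
      obtain ⟨x, hx, rfl⟩ := Finset.mem_image.1 hp
      rw [Finset.mem_inter, Finset.mem_range] at hx
      exact ⟨x, hx.1, hx.2, hpt⟩
    · rintro ⟨x, hx, hx', hpt⟩
      exact ⟨e x, Finset.mem_image.2 ⟨x, by simp [hx, hx'], rfl⟩, hpt⟩
  refine Runs.seq (l * 12 + 2) (19 * l + 35) (by omega) ?_
  refine (climb_runs (t := 2 * d + 4) (fun x => x < X.card ∧ thr < wt (e x)) hc
    ⟨(f13.2.2.1 7 (by omega)).trans h7, (f13.2.2.1 8 (by omega)).trans h8⟩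
    (f13.2.2.1 c (by omega)) ((f13.2.2.1 27 (by omega)).trans hthr) hbl hWq k3 k4).mono le_rfl ?_
  rintro s4 ⟨f4, h4⟩
  have f14 := f13.trans (f4.weaken (c' := c + 1) (by omega))
  have e8 := (f14.2.2.1 8 (by omega)).trans h8
  have e7 := (f14.2.2.1 7 (by omega)).trans h7
  have k2' := (f4.2.2.1 (c + 2) (by omega)).trans k2
  have hempty : ∀ s' : State, ScratchOnly (c + 1) (2 * d + 4) s s' →
      sel co wt thr lo hi 0 X = ∅ → QueryScratch d (c + 1) s s' ∧
      Best co (Y ∪ sel co wt thr lo hi 0 X) (s'.nreg 26) (s'.rreg (2 * d + 6)) := by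
    intro s' hs' he
    rw [he, Finset.union_empty, hs'.2.2.1 26 (by omega), hs'.2.2.2 _ (by omega)]
    exact ⟨hs'.query, hY⟩
  have hind : ∀ p ∈ sel co wt thr lo hi 0 X, ∃ i < b, e i = p ∧ i < X.card ∧ thr < wt (e i) := by
    intro p hp
    rw [hsel] at hp
    obtain ⟨i, hi, rfl⟩ := hmem p hp.1
    refine ⟨i, ?_, rfl, hi, hp.2.1⟩
    by_contra hib
    exact hb2 i hi (by omega) hp.2.2.2
  refine Runs.ite (19 * l + 34) le_rfl (fun hf => ?_) (fun hf => Runs.nop (by omega) ?_)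
  all_goals rw [State.holds_nlt, e8] at hf
  swap
  · rcases h4 with h4 | ⟨h, hh, h4⟩
    · refine hempty s4 f14 (Finset.eq_empty_of_forall_notMem fun p hp => ?_)
      obtain ⟨i, hi, -, h⟩ := hind p hp
      exact h4.2 i hi h
    · omega
  rcases h4 with h4 | ⟨h, hh, -, h41, h42, h43, h44, h45⟩
  · omega
  refine Runs.seq (l * 12 + 1) 20 (by omega) ?_
  refine (descend_runs (t := 2 * d + 4) (fun x => x < X.card ∧ thr < wt (e x)) hc ⟨e7, e8⟩
    (f14.2.2.1 c (by omega)) ((f14.2.2.1 27 (by omega)).trans hthr) hbl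
    (by rw [f14.1]; rw [f13.1] at hWq; exact hWq) k2' hh h41 h42 h43 h44 h45).mono le_rfl ?_
  rintro s5 ⟨f5, x, hxb, hx, ⟨hxX, hxt⟩, hxm⟩
  have f15 := f14.trans (f5.weaken (c' := c + 1) (by omega))
  have k2'' := (f5.2.2.1 (c + 2) (by omega)).trans k2'
  have hcc := f15.2.2.1 c (by omega)
  refine Runs.seq 4 15 (by omega) (Runs.code _ (by simp) ?_)
  set s6 := List.foldl State.step s5 [.nsub (c + 5) (c + 4) (c + 2), .nadd (c + 6) c (c + 5),
        .rload (2 * d + 4) (c + 6)] with hs6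
  have f16 : ScratchOnly (c + 1) (2 * d + 4) s s6 := by
    refine f15.trans ⟨rfl, rfl, fun i hi => ?_, fun i hi => ?_⟩
    · simp (disch := omega) [hs6]
    · simp (disch := omega) [hs6]
  have j2 : s6.nreg (c + 2) = 2 ^ l := by simp (disch := omega) [hs6, k2'']
  have j5 : s6.nreg (c + 5) = x := by simp (disch := omega) [hs6, hx, k2'']
  have jr : s6.rreg (2 * d + 4) = co 1 (e x) := by
    simp (disch := omega) [hs6, hx, k2'', hcc, f15.2.1, hS.key_eq x hxX]
  clear_value s6
  refine Runs.ite 9 (by omega) (fun hin => ?_) (fun hin => Runs.nop (by omega) ?_)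
  all_goals rw [State.holds_rle, jr, f16.2.2.2 _ (by omega), hlo 1 (by omega)] at hin
  · refine (updateBest_runs (co := co) (p := e x) (Y := Y) (Z := sel co wt thr lo hi 0 X)
      ⟨(f16.2.2.1 7 (by omega)).trans h7, (f16.2.2.1 8 (by omega)).trans h8⟩ ?_ ?_
      (hX _ (hmem' x hxX)) ?_ jr ?_).mono le_rfl ?_
    · rw [f16.2.2.1 26 (by omega), f16.2.2.2 _ (by omega)]; exact hY
    · rw [f16.1, f16.2.2.1 c (by omega), j2, j5]; exact hid x hxX
    · rw [hsel]; exact ⟨hmem' x hxX, hxt, hin, hb1 x hxb⟩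
    · intro z hz
      obtain ⟨i, hi, rfl, hi'⟩ := hind z hz
      exact hS.mono i x (hxm i hi hi') hxX
    · rintro s7 ⟨f7, hB⟩
      exact ⟨f16.query.trans (f7.weaken (by omega)), hB⟩
  -- The candidate with the largest coordinate is below the range, hence nothing is selected.
  · refine hempty s6 f16 (Finset.eq_empty_of_forall_notMem fun p hp => ?_)
    obtain ⟨i, hi, rfl, hi'⟩ := hind p hp
    have := hS.mono i x (hxm i hi hi') hxX
    rw [hsel] at hp
    exact hin (hp.2.2.1.trans this)

theorem sel_union {co : ℕ → ℕ → ℝ} {wt : ℕ → ℕ} {thr : ℕ} {lo hi : ℕ → ℝ} {m : ℕ}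
    {X X' : Finset ℕ} : sel co wt thr lo hi m (X ∪ X') =
      sel co wt thr lo hi m X ∪ sel co wt thr lo hi m X' := by
  ext p; simp only [mem_sel, Finset.mem_union]; tauto

/-- Induction on the number of coordinates. Two binary searches turn the range of the outermost
coordinate into an interval of leaves, `canonicalLoop_runs` covers it by subtrees, and each of these
is queried recursively. The best point so far is carried along, so the invariant speaks of the union
of the selections. Each recursion level works in registers ten higher, which protects the loop
registers of its caller. -/
theorem rangeQuery_runs {co : ℕ → ℕ → ℝ} {wt : ℕ → ℕ} {Λ : ℕ} {lo hi : ℕ → ℝ} {thr : ℕ}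
    (hd : 2 ≤ d) (m : ℕ) : ∀ {c : ℕ} {X Y : Finset ℕ} {s : State}, m + 2 ≤ d → 30 ≤ c →
    Consts s → (∀ p ∈ X, p ≠ 0) → RangeTree co wt Λ s.nmem s.rmem m X (s.nreg c) →
    s.nreg 27 = thr → (∀ a, a < d → s.rreg (2 * d + 10 + a) = lo a) →
    (∀ a, a < d → s.rreg (3 * d + 10 + a) = hi a) →
    Best co Y (s.nreg 26) (s.rreg (2 * d + 6)) →
    Runs A (rangeQuery d m c) s (rangeTime Λ m) fun s' => QueryScratch d (c + 1) s s' ∧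
      Best co (Y ∪ sel co wt thr lo hi m X) (s'.nreg 26) (s'.rreg (2 * d + 6)) := by
  induction m with
  | zero =>
    intro c X Y s hm hc hs hX hR hthr hlo hhi hY
    exact innerQuery_runs hd hc hs hX hR hthr hlo hhi hY
  | succ m ih =>
    intro c X Y s hm hc hs hX hR hthr hlo hhi hY
    obtain ⟨h7, h8⟩ := hs
    obtain ⟨l, hl, e, hS, hW⟩ := hR
    have hbt : bsearchTime l ≤ bsearchTime Λ := by simp only [bsearchTime]; omega
    have hct : canonicalTime l (rangeTime Λ m + 3) ≤ canonicalTime Λ (rangeTime Λ m + 3) := by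
      simp only [canonicalTime]; gcongr
    refine Runs.seq 4 (canonicalTime Λ (rangeTime Λ m + 3) + 2 * bsearchTime Λ + 16)
      (by simp only [rangeTime]; omega) (Runs.code _ (by simp) ?_)
    set s1 := List.foldl State.step s [.nload (c + 1) c, .nadd (c + 3) c 7, .nload (c + 2) (c + 3)]
      with hs1
    have f1 : ScratchOnly (c + 1) (2 * d + 4) s s1 := by
      refine ⟨rfl, rfl, fun i hi => ?_, fun i hi => rfl⟩
      simp (disch := omega) [hs1]
    have g1 : s1.nreg (c + 1) = X.card := by simp (disch := omega) [hs1, hS.length_eq]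
    have g2 : s1.nreg (c + 2) = 2 ^ l := by simp (disch := omega) [hs1, hS.width_eq, h7]
    clear_value s1
    refine Runs.seq (bsearchTime Λ) (canonicalTime Λ (rangeTime Λ m + 3) + bsearchTime Λ + 16)
      (by omega) ?_
    refine (bsearch_runs (N := X.card) (l := l) (a := fun i => co (m + 2) (e i)) (q := lo (m + 2))
      (fun x y => x < y) (fun s i j => Iff.rfl)
      (fun i j hij hj h => lt_of_le_of_lt (hS.mono i j hij hj) h)
      (by omega) (by omega) (by omega) (by omega)
      ⟨(f1.2.2.1 7 (by omega)).trans h7, (f1.2.2.1 8 (by omega)).trans h8⟩ g1 hS.card_lt ?_ ?_).mono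
      hbt ?_
    · intro i hi
      rw [f1.2.1, f1.2.2.1 c (by omega)]; exact hS.key_eq i hi
    · rw [f1.2.2.2 _ (by omega), hlo (m + 2) (by omega)]
    rintro s2 ⟨f2, haN, ha1, ha2⟩
    have g1' := (f2.2.2.1 (c + 1) (by omega)).trans g1
    have g2' := (f2.2.2.1 (c + 2) (by omega)).trans g2
    have f12 := f1.trans (f2.weaken (c' := c + 1) (by omega))
    set a := s2.nreg (c + 10) with ha
    clear_value a
    refine Runs.seq 2 (canonicalTime Λ (rangeTime Λ m + 3) + bsearchTime Λ + 14) (by omega)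
      (Runs.code _ (by simp) ?_)
    set s3 := List.foldl State.step s2 [.nadd (c + 3) (c + 2) (c + 10)] with hs3
    have f13 : ScratchOnly (c + 1) (2 * d + 4) s s3 := by
      refine f12.trans ⟨rfl, rfl, fun i hi => ?_, fun i hi => rfl⟩
      simp (disch := omega) [hs3]
    have k1 : s3.nreg (c + 1) = X.card := by simp (disch := omega) [hs3, g1']
    have k2 : s3.nreg (c + 2) = 2 ^ l := by simp (disch := omega) [hs3, g2']
    have k3 : s3.nreg (c + 3) = 2 ^ l + a := by simp (disch := omega) [hs3, g2', ha]
    clear_value s3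
    refine Runs.seq (bsearchTime Λ) (canonicalTime Λ (rangeTime Λ m + 3) + 14) (by omega) ?_
    refine (bsearch_runs (N := X.card) (l := l) (a := fun i => co (m + 2) (e i)) (q := hi (m + 2))
      (fun x y => x ≤ y) (fun s i j => Iff.rfl)
      (fun i j hij hj h => (hS.mono i j hij hj).trans h)
      (by omega) (by omega) (by omega) (by omega)
      ⟨(f13.2.2.1 7 (by omega)).trans h7, (f13.2.2.1 8 (by omega)).trans h8⟩ k1 hS.card_lt ?_ ?_).mono
      hbt ?_
    · intro i hi
      rw [f13.2.1, f13.2.2.1 c (by omega)]; exact hS.key_eq i hi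
    · rw [f13.2.2.2 _ (by omega), hhi (m + 2) (by omega)]
    rintro s4 ⟨f4, hbN, hb1, hb2⟩
    have k2' := (f4.2.2.1 (c + 2) (by omega)).trans k2
    have k3' := (f4.2.2.1 (c + 3) (by omega)).trans k3
    have f14 := f13.trans (f4.weaken (c' := c + 1) (by omega))
    set b := s4.nreg (c + 10) with hb
    clear_value b
    refine Runs.seq 2 (canonicalTime Λ (rangeTime Λ m + 3)) (by omega) (Runs.code _ (by simp) ?_)
    set s5 := List.foldl State.step s4 [.nadd (c + 4) (c + 2) (c + 10)] with hs5
    have f15 : ScratchOnly (c + 1) (2 * d + 4) s s5 := by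
      refine f14.trans ⟨rfl, rfl, fun i hi => ?_, fun i hi => rfl⟩
      simp (disch := omega) [hs5]
    have j3 : s5.nreg (c + 3) = 2 ^ l + a := by simp (disch := omega) [hs5, k3']
    have j4 : s5.nreg (c + 4) = 2 ^ l + b := by simp (disch := omega) [hs5, k2', hb]
    clear_value s5
    -- The counts `a` (strictly below the range) and `b` (not above it) cut out exactly the points
    -- in the range of the outermost coordinate.
    have hfin : (((Finset.Ico a b) ∩ Finset.range X.card).image e) =
        X.filter fun p => lo (m + 2) ≤ co (m + 2) p ∧ co (m + 2) p ≤ hi (m + 2) := by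
      ext p
      simp only [Finset.mem_image, Finset.mem_inter, Finset.mem_Ico, Finset.mem_range,
        Finset.mem_filter]
      constructor
      · rintro ⟨i, ⟨⟨h1, h2⟩, h3⟩, rfl⟩
        refine ⟨?_, not_lt.1 (ha2 i h3 h1), hb1 i h2⟩
        have := Finset.mem_image_of_mem e (Finset.mem_range.2 h3)
        rwa [hS.image_eq] at this
      · rintro ⟨hp, h1, h2⟩
        rw [← hS.image_eq] at hp
        obtain ⟨i, hi, rfl⟩ := Finset.mem_image.1 hp
        rw [Finset.mem_range] at hi
        refine ⟨i, ⟨⟨?_, ?_⟩, hi⟩, rfl⟩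
        · by_contra hia
          exact absurd (ha1 i (by omega)) (not_lt.2 h1)
        · by_contra hib
          exact hb2 i hi (by omega) h2
    have hselfin : sel co wt thr lo hi m (((Finset.Ico a b) ∩ Finset.range X.card).image e) =
        sel co wt thr lo hi (m + 1) X := by
      rw [hfin]
      ext p
      simp only [mem_sel, Finset.mem_filter]
      constructor
      · rintro ⟨⟨h1, h2⟩, h3, h4⟩
        refine ⟨h1, h3, fun i hi hi' => ?_⟩
        rcases Nat.lt_or_ge i (m + 2) with h | h
        · exact h4 i hi (by omega)
        · obtain rfl : i = m + 2 := by omega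
          exact h2
      · rintro ⟨h1, h2, h3⟩
        exact ⟨⟨h1, h3 (m + 2) (by omega) (by omega)⟩, h2, fun i hi hi' => h3 i hi (by omega)⟩
    refine (canonicalLoop_runs (L := l) (T := rangeTime Λ m + 3) (a := a) (b := b)
      (fun Z s' => QueryScratch d (c + 1) s s' ∧ Best co
        (Y ∪ sel co wt thr lo hi m ((Z ∩ Finset.range X.card).image e)) (s'.nreg 26)
        (s'.rreg (2 * d + 6))) ?_ (by omega) ?_ ?_ (lt_of_le_of_lt hbN hS.card_lt) j3 j4 ?_).mono
      hct ?_
    · rintro Z s' ⟨h, -⟩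
      exact ⟨(h.2.2.1 7 (by omega) (by omega)).trans h7, (h.2.2.1 8 (by omega) (by omega)).trans h8⟩
    · rintro Z s' i v hi hi' ⟨h, hB⟩
      refine ⟨h.trans ⟨rfl, rfl, fun j hj _ => ?_, fun _ _ _ => rfl⟩, ?_⟩
      · simp (disch := omega)
      · simpa (disch := omega) using hB
    · rintro Z s' v hv hv' hv'' ⟨h, hB⟩
      refine Runs.seq 3 (rangeTime Λ m) (by omega) (Runs.code _ (by simp) ?_)
      have hcc := h.2.2.1 c (by omega) (by omega)
      set s6 := List.foldl State.step s' [.nadd (c + 10) c (c + 5), .nload (c + 10) (c + 10)]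
        with hs6
      have f6 : QueryScratch d (c + 10) s' s6 := by
        refine ⟨rfl, rfl, fun i hi _ => ?_, fun _ _ _ => rfl⟩
        simp (disch := omega) [hs6]
      have q10 : s6.nreg (c + 10) = s.nmem (s.nreg c + v) := by
        simp (disch := omega) [hs6, hcc, h.1]
        rw [← hv'']
      have q26 : s6.nreg 26 = s'.nreg 26 := by simp (disch := omega) [hs6]
      have qr : s6.rreg = s'.rreg := rfl
      clear_value s6
      have f06 := h.trans (f6.weaken (c' := c + 1) (by omega))
      refine (ih (c := c + 10) (X := part X e l v) (by omega) (by omega)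
        ⟨(f06.2.2.1 7 (by omega) (by omega)).trans h7,
          (f06.2.2.1 8 (by omega) (by omega)).trans h8⟩
        ?_ ?_ ((f06.2.2.1 27 (by omega) (by omega)).trans hthr) ?_ ?_ (q26 ▸ qr ▸ hB)).mono le_rfl ?_
      · intro p hp
        refine hX p ?_
        rw [← hS.image_eq]
        exact Finset.image_subset_image Finset.inter_subset_right hp
      · rw [f06.1, f06.2.1, q10]; exact hW v hv hv'
      · intro i hi; rw [f06.2.2.2 _ (by omega) (by omega)]; exact hlo i hi
      · intro i hi; rw [f06.2.2.2 _ (by omega) (by omega)]; exact hhi i hi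
      · rintro s7 ⟨f7, hB7⟩
        refine ⟨⟨f06.trans (f7.weaken (by omega)), ?_⟩, fun i hi hi' => ?_⟩
        · rw [Finset.union_inter_distrib_right, Finset.image_union, sel_union,
            ← Finset.union_assoc]
          exact hB7
        · rw [f7.2.2.1 i (by omega) (by omega), f6.2.2.1 i (by omega) (by omega)]
    · refine ⟨f15.query, ?_⟩
      rw [f15.2.2.1 26 (by omega), f15.2.2.2 _ (by omega)]
      simpa [sel] using hY
    · rintro s' ⟨h, hB⟩
      rw [hselfin] at hB
      exact ⟨h, hB⟩

end RangeTree

/-! ## Extreme points in a box -/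

section BoxQuery

variable {d : ℕ} {A : Procedures d}

/-- The points of `{1, …, n}`, with coordinates `co`, are stored for box queries: `e` enumerates
them in the order of coordinate `0`, their coordinates `0` are at the address `ab`, and at the address
`pb` there are pointers to range trees for the nodes of a complete binary tree with `2 ^ L` leaves, in
which the `i`-th point is at leaf `i + 1`. The weights at left children are the ranks of the points,
those at right children are complementary. -/
structure BoxStructure (d : ℕ) (co : ℕ → ℕ → ℝ) (n L Λ : ℕ) (nm : ℕ → ℕ) (rm : ℕ → ℝ)
    (ab pb : ℕ) (e rk : ℕ → ℕ) : Prop where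
  image_eq : (Finset.range n).image e = Finset.Icc 1 n
  rank_eq : ∀ i < n, rk (e i) = i + 1
  key_eq : ∀ i < n, rm (ab + i) = co 0 (e i)
  mono : ∀ i j, i ≤ j → j < n → co 0 (e i) ≤ co 0 (e j)
  tree : ∀ v, 2 ≤ v → v < 2 ^ (L + 1) →
    RangeTree co (fun p => if v % 2 = 0 then rk p else 2 ^ L - rk p) Λ nm rm (d - 2)
      (((Finset.range n).filter fun i => i + 1 ∈ blk L v).image e) (nm (pb + v))

/-- The points of `X` in a box. -/
def boxSel (co : ℕ → ℕ → ℝ) (lo hi : ℕ → ℝ) (d : ℕ) (X : Finset ℕ) : Finset ℕ :=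
  open Classical in X.filter fun p => ∀ a < d, lo a ≤ co a p ∧ co a p ≤ hi a

theorem mem_boxSel {co : ℕ → ℕ → ℝ} {lo hi : ℕ → ℝ} {d p : ℕ} {X : Finset ℕ} :
    p ∈ boxSel co lo hi d X ↔ p ∈ X ∧ ∀ a < d, lo a ≤ co a p ∧ co a p ≤ hi a := by
  simp only [boxSel, Finset.mem_filter]

/-- Find the point with maximal coordinate `1` in the box given by the real registers from
`2 * d + 10` and from `3 * d + 10` on. The registers `rab` and `rpb` hold the addresses of a
`BoxStructure`, the register `5` holds `2 ^ L` and the register `32` the address of `n`. -/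
def boxQuery (d rab rpb c : ℕ) : Cmd :=
  .seq (code [.nload (c + 2) 32])
  (.seq (bsearch .rlt (2 * d + 4) rab (c + 2) (2 * d + 10) (c + 10))
  (.seq (code [.nadd c (c + 10) 8])
  (.seq (bsearch .rle (2 * d + 4) rab (c + 2) (3 * d + 10) (c + 10))
  (.seq (code [.nadd (c + 1) (c + 10) 7, .nadd (c + 3) 5 c, .nadd (c + 4) 5 (c + 1),
    .nhalf (c + 5) (c + 3), .nhalf (c + 6) (c + 4), .nconst 26 0])
  (.ite (.nlt c (c + 1))
    (.seq (.while (.nlt (c + 5) (c + 6)) (code [.nadd (c + 3) (c + 5) 8, .nadd (c + 4) (c + 6) 8,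
      .nhalf (c + 5) (c + 3), .nhalf (c + 6) (c + 4)]))
    (.seq (code [.nadd 27 c 8, .nadd (c + 10) rpb (c + 3), .nload (c + 10) (c + 10)])
    (.seq (rangeQuery d (d - 2) (c + 10))
    (.seq (code [.nsub 27 5 (c + 1), .nadd (c + 10) rpb (c + 4), .nload (c + 10) (c + 10)])
      (rangeQuery d (d - 2) (c + 10))))))
    nop)))))

/-- Time of `boxQuery`. -/
def boxTime (d L Λ : ℕ) : ℕ := 2 * bsearchTime L + 6 * L + 2 * rangeTime Λ (d - 2) + 40

/-- What a box query may change. -/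
def BoxScratch (d c : ℕ) (s s' : State) : Prop :=
  s'.nmem = s.nmem ∧ s'.rmem = s.rmem ∧
    (∀ i < c, i ≠ 26 → i ≠ 27 → s'.nreg i = s.nreg i) ∧
    ∀ i, i ≠ 2 * d + 4 → i ≠ 2 * d + 6 → s'.rreg i = s.rreg i

theorem BoxScratch.trans {c : ℕ} {s s' s'' : State} (h : BoxScratch d c s s')
    (h' : BoxScratch d c s' s'') : BoxScratch d c s s'' :=
  ⟨h'.1.trans h.1, h'.2.1.trans h.2.1,
    fun i hi hn hn' => (h'.2.2.1 i hi hn hn').trans (h.2.2.1 i hi hn hn'),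
    fun i hi hn => (h'.2.2.2 i hi hn).trans (h.2.2.2 i hi hn)⟩

theorem QueryScratch.box {c : ℕ} {s s' : State} (h : QueryScratch d c s s') :
    BoxScratch d c s s' :=
  ⟨h.1, h.2.1, fun i hi hn _ => h.2.2.1 i hi hn, h.2.2.2⟩

/-- The points in a box come from the two children of the node where the paths to the ends of the
range of ranks part. -/
theorem boxSel_eq_union {co : ℕ → ℕ → ℝ} {n L Λ : ℕ} {lo hi : ℕ → ℝ} {e rk : ℕ → ℕ}
    {nm : ℕ → ℕ} {rm : ℕ → ℝ} {ab pb a b h u : ℕ} (hd : 2 ≤ d)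
    (hB : BoxStructure d co n L Λ nm rm ab pb e rk) (hn : n + 1 < 2 ^ L) (hbN : b ≤ n)
    (hax : ∀ i < n, (lo 0 ≤ co 0 (e i) ∧ co 0 (e i) ≤ hi 0) ↔ a ≤ i ∧ i < b) (hh : h < L)
    (hu : u % 2 = 0) (hua : (2 ^ L + a) / 2 ^ h = u) (hub : (2 ^ L + (b + 1)) / 2 ^ h = u + 1) :
    boxSel co lo hi d (Finset.Icc 1 n) =
      sel co rk a lo hi (d - 2) (((Finset.range n).filter fun i => i + 1 ∈ blk L u).image e) ∪
      sel co (fun p => 2 ^ L - rk p) (2 ^ L - (b + 1)) lo hi (d - 2)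
        (((Finset.range n).filter fun i => i + 1 ∈ blk L (u + 1)).image e) := by
  have hdm : ∀ x y, x ≤ y → (2 ^ L + x) / 2 ^ h ≤ (2 ^ L + y) / 2 ^ h := fun x y hxy =>
    Nat.div_le_div_right (by omega)
  have hab : a < b + 1 := by
    by_contra hab
    have := hdm (b + 1) a (by omega)
    omega
  have hua' := heap_div_bounds (x := a) hh.le (by omega)
  have hub' := heap_div_bounds (x := b + 1) hh.le (by omega)
  rw [hua] at hua'
  rw [hub] at hub'
  have mu : ∀ x, x ∈ blk L u ↔ x < 2 ^ L ∧ (2 ^ L + x) / 2 ^ h = u := fun x =>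
    mem_blk hh.le hua'.1 hua'.2
  have mw : ∀ x, x ∈ blk L (u + 1) ↔ x < 2 ^ L ∧ (2 ^ L + x) / 2 ^ h = u + 1 := fun x =>
    mem_blk hh.le hub'.1 hub'.2
  have hmem : ∀ p ∈ Finset.Icc 1 n, ∃ i < n, e i = p := fun p hp => by
    rw [← hB.image_eq] at hp; simpa using hp
  have hmem' : ∀ i < n, e i ∈ Finset.Icc 1 n := fun i hi => by
    rw [← hB.image_eq]; exact Finset.mem_image_of_mem e (Finset.mem_range.2 hi)
  ext p
  simp only [mem_boxSel, Finset.mem_union, mem_sel, Finset.mem_image, Finset.mem_filter,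
    Finset.mem_range]
  constructor
  · rintro ⟨hp, hbox⟩
    obtain ⟨i, hi, rfl⟩ := hmem p hp
    have hi0 := (hax i hi).1 (hbox 0 (by omega))
    have hm1 := hdm a (i + 1) (by omega)
    have hm2 := hdm (i + 1) (b + 1) (by omega)
    -- Leaf `i + 1` lies between the leaves `a` and `b + 1`, so its ancestor at height `h` lies
    -- between `u` and `u + 1`.
    rcases (show (2 ^ L + (i + 1)) / 2 ^ h = u ∨ (2 ^ L + (i + 1)) / 2 ^ h = u + 1 by omega)
      with hiu | hiu
    · refine Or.inl ⟨⟨i, ⟨hi, (mu _).2 ⟨by omega, hiu⟩⟩, rfl⟩, ?_, fun a ha ha' =>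
        hbox a (by omega)⟩
      rw [hB.rank_eq i hi]; omega
    · refine Or.inr ⟨⟨i, ⟨hi, (mw _).2 ⟨by omega, hiu⟩⟩, rfl⟩, ?_, fun a ha ha' =>
        hbox a (by omega)⟩
      rw [hB.rank_eq i hi]; omega
  · rintro (⟨⟨i, ⟨hi, hiu⟩, rfl⟩, hw, hbox⟩ | ⟨⟨i, ⟨hi, hiu⟩, rfl⟩, hw, hbox⟩)
    all_goals
      rw [hB.rank_eq i hi] at hw
      refine ⟨hmem' i hi, fun x hx => ?_⟩
      rcases Nat.eq_zero_or_pos x with rfl | hx0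
      swap
      · exact hbox x hx0 (by omega)
      refine (hax i hi).2 ?_
    -- Below the left child only `a ≤ i` has to be tested, which is the threshold on the rank; `i <
    -- b` is automatic because leaf `b + 1` is below the right child. The right child is symmetric,
    -- with complementary weights.
    · rw [mu] at hiu
      refine ⟨by omega, ?_⟩
      by_contra hib
      have := hdm (b + 1) (i + 1) (by omega)
      omega
    · rw [mw] at hiu
      refine ⟨?_, by omega⟩
      by_contra hia
      have := hdm (i + 1) a (by omega)
      omega

-- The points with coordinate `0` in the range are at the leaves strictly between `a` and `b + 1`;
-- the shift by one of the leaf numbers makes these two exclusive ends leaves of the tree. At the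
-- node where their paths to the root part, the condition on coordinate `0` splits into a one-sided
-- rank condition for each child. Each is a weight threshold for the range tree of that child, so
-- only `d - 1` coordinates remain for range searching.
set_option maxHeartbeats 400000 in
theorem boxQuery_runs {co : ℕ → ℕ → ℝ} {n L Λ : ℕ} {lo hi : ℕ → ℝ} {e rk : ℕ → ℕ}
    {rab rpb c : ℕ} {s : State} (hd : 2 ≤ d) (hc : 40 ≤ c) (hs : Consts s) (hn : n + 1 < 2 ^ L)
    (hB : BoxStructure d co n L Λ s.nmem s.rmem (s.nreg rab) (s.nreg rpb) e rk)
    (hab : rab < c) (hpb : 30 ≤ rpb) (hpb' : rpb < c)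
    (h5 : s.nreg 5 = 2 ^ L) (h32 : s.nmem (s.nreg 32) = n)
    (hlo : ∀ a, a < d → s.rreg (2 * d + 10 + a) = lo a)
    (hhi : ∀ a, a < d → s.rreg (3 * d + 10 + a) = hi a) :
    Runs A (boxQuery d rab rpb c) s (boxTime d L Λ) fun s' => BoxScratch d c s s' ∧
      Best co (boxSel co lo hi d (Finset.Icc 1 n)) (s'.nreg 26) (s'.rreg (2 * d + 6)) := by
  obtain ⟨h7, h8⟩ := hs
  refine Runs.seq 2 (2 * bsearchTime L + 6 * L + 2 * rangeTime Λ (d - 2) + 38)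
    (by simp only [boxTime]; omega) (Runs.code _ (by simp) ?_)
  set s1 := List.foldl State.step s [.nload (c + 2) 32] with hs1
  have f1 : ScratchOnly c (2 * d + 4) s s1 := by
    refine ⟨rfl, rfl, fun i hi => ?_, fun i hi => rfl⟩
    simp (disch := omega) [hs1]
  have g2 : s1.nreg (c + 2) = n := by simp (disch := omega) [hs1, h32]
  clear_value s1
  refine Runs.seq (bsearchTime L) (bsearchTime L + 6 * L + 2 * rangeTime Λ (d - 2) + 38)
    (by omega) ?_
  refine (bsearch_runs (N := n) (l := L) (a := fun i => co 0 (e i)) (q := lo 0)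
    (fun x y => x < y) (fun s i j => Iff.rfl)
    (fun i j hij hj h => lt_of_le_of_lt (hB.mono i j hij hj) h)
    (by omega) (by omega) (by omega) (by omega)
    ⟨(f1.2.2.1 7 (by omega)).trans h7, (f1.2.2.1 8 (by omega)).trans h8⟩ g2 (by omega) ?_ ?_).mono
    le_rfl ?_
  · intro i hi
    rw [f1.2.1, f1.2.2.1 rab (by omega)]; exact hB.key_eq i hi
  · rw [f1.2.2.2 _ (by omega), ← hlo 0 (by omega), Nat.add_zero]
  rintro s2 ⟨f2, haN, ha1, ha2⟩
  have g2' := (f2.2.2.1 (c + 2) (by omega)).trans g2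
  have f12 := f1.trans (f2.weaken (c' := c) (by omega))
  set a := s2.nreg (c + 10) with ha
  clear_value a
  have z8 := (f12.2.2.1 8 (by omega)).trans h8
  refine Runs.seq 2 (bsearchTime L + 6 * L + 2 * rangeTime Λ (d - 2) + 36) (by omega)
    (Runs.code _ (by simp) ?_)
  set s3 := List.foldl State.step s2 [.nadd c (c + 10) 8] with hs3
  have f13 : ScratchOnly c (2 * d + 4) s s3 := by
    refine f12.trans ⟨rfl, rfl, fun i hi => ?_, fun i hi => rfl⟩
    simp (disch := omega) [hs3]
  have k0 : s3.nreg c = a := by simp (disch := omega) [hs3, z8, ha]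
  have k2 : s3.nreg (c + 2) = n := by simp (disch := omega) [hs3, g2']
  clear_value s3
  refine Runs.seq (bsearchTime L) (6 * L + 2 * rangeTime Λ (d - 2) + 36) (by omega) ?_
  refine (bsearch_runs (N := n) (l := L) (a := fun i => co 0 (e i)) (q := hi 0)
    (fun x y => x ≤ y) (fun s i j => Iff.rfl)
    (fun i j hij hj h => (hB.mono i j hij hj).trans h)
    (by omega) (by omega) (by omega) (by omega)
    ⟨(f13.2.2.1 7 (by omega)).trans h7, (f13.2.2.1 8 (by omega)).trans h8⟩ k2 (by omega) ?_ ?_).mono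
    le_rfl ?_
  · intro i hi
    rw [f13.2.1, f13.2.2.1 rab (by omega)]; exact hB.key_eq i hi
  · rw [f13.2.2.2 _ (by omega), ← hhi 0 (by omega), Nat.add_zero]
  rintro s4 ⟨f4, hbN, hb1, hb2⟩
  have k0' := (f4.2.2.1 c (by omega)).trans k0
  have f14 := f13.trans (f4.weaken (c' := c) (by omega))
  set b := s4.nreg (c + 10) with hb
  clear_value b
  have z7 := (f14.2.2.1 7 (by omega)).trans h7
  have z5 := (f14.2.2.1 5 (by omega)).trans h5
  refine Runs.seq 7 (6 * L + 2 * rangeTime Λ (d - 2) + 29) (by omega) (Runs.code _ (by simp) ?_)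
  set s5 := List.foldl State.step s4 [.nadd (c + 1) (c + 10) 7, .nadd (c + 3) 5 c,
    .nadd (c + 4) 5 (c + 1), .nhalf (c + 5) (c + 3), .nhalf (c + 6) (c + 4), .nconst 26 0] with hs5
  have f15 : BoxScratch d c s s5 := by
    refine (f14.query.box).trans ⟨rfl, rfl, fun i hi _ _ => ?_, fun i hi _ => rfl⟩
    simp (disch := omega) [hs5]
  have j0 : s5.nreg c = a := by simp (disch := omega) [hs5, k0']
  have j1 : s5.nreg (c + 1) = b + 1 := by simp (disch := omega) [hs5, ← hb, z7]
  have j3 : s5.nreg (c + 3) = 2 ^ L + a := by simp (disch := omega) [hs5, k0', z5]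
  have j4 : s5.nreg (c + 4) = 2 ^ L + (b + 1) := by simp (disch := omega) [hs5, ← hb, z7, z5]
  have j5 : s5.nreg (c + 5) = (2 ^ L + a) / 2 := by simp (disch := omega) [hs5, k0', z5]
  have j6 : s5.nreg (c + 6) = (2 ^ L + (b + 1)) / 2 := by
    simp (disch := omega) [hs5, ← hb, z7, z5]
  have j26 : s5.nreg 26 = 0 := by simp (disch := omega) [hs5]
  clear_value s5
  have hmem : ∀ p ∈ Finset.Icc 1 n, ∃ i < n, e i = p := fun p hp => by
    rw [← hB.image_eq] at hp; simpa using hp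
  have hmem' : ∀ i < n, e i ∈ Finset.Icc 1 n := fun i hi => by
    rw [← hB.image_eq]; exact Finset.mem_image_of_mem e (Finset.mem_range.2 hi)
  have hax : ∀ i < n, (lo 0 ≤ co 0 (e i) ∧ co 0 (e i) ≤ hi 0) ↔ a ≤ i ∧ i < b := by
    intro i hi
    constructor
    · rintro ⟨h1, h2⟩
      constructor
      · by_contra hia
        exact absurd (ha1 i (by omega)) (not_lt.2 h1)
      · by_contra hib
        exact hb2 i hi (by omega) h2
    · rintro ⟨h1, h2⟩
      exact ⟨not_lt.1 (ha2 i hi h1), hb1 i h2⟩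
  refine Runs.ite (6 * L + 2 * rangeTime Λ (d - 2) + 28) le_rfl (fun hab => ?_)
    (fun hab => Runs.nop (by omega) ?_)
  all_goals rw [State.holds_nlt, j0, j1] at hab
  swap
  · refine ⟨f15, Or.inl ⟨j26, Finset.eq_empty_of_forall_notMem fun p hp => ?_⟩⟩
    rw [mem_boxSel] at hp
    obtain ⟨i, hi, rfl⟩ := hmem p hp.1
    have := (hax i hi).1 (hp.2 0 (by omega))
    omega
  refine Runs.seq (6 * L + 1) (2 * rangeTime Λ (d - 2) + 20) (by omega) ?_
  -- Climb from both leaves as long as the parents differ. The two nodes stay distinct and in order,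
  -- so when their parents coincide they are siblings `u` and `u + 1` with `u` even.
  have hloop : Runs A (.while (.nlt (c + 5) (c + 6)) (code [.nadd (c + 3) (c + 5) 8,
      .nadd (c + 4) (c + 6) 8, .nhalf (c + 5) (c + 3), .nhalf (c + 6) (c + 4)])) s5 (6 * L + 1)
      fun s' => BoxScratch d c s s' ∧ s'.nreg c = a ∧ s'.nreg (c + 1) = b + 1 ∧
        s'.nreg 26 = 0 ∧ ∃ h < L, ∃ u,
        s'.nreg (c + 3) = u ∧ s'.nreg (c + 4) = u + 1 ∧ u % 2 = 0 ∧
        (2 ^ L + a) / 2 ^ h = u ∧ (2 ^ L + (b + 1)) / 2 ^ h = u + 1 := by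
    refine Runs.while (fun T s' => BoxScratch d c s s' ∧ s'.nreg c = a ∧ s'.nreg (c + 1) = b + 1 ∧
        s'.nreg 26 = 0 ∧ ∃ h ≤ L, T = 6 * (L - h) + 1 ∧
        s'.nreg (c + 3) = (2 ^ L + a) / 2 ^ h ∧ s'.nreg (c + 4) = (2 ^ L + (b + 1)) / 2 ^ h ∧
        s'.nreg (c + 5) = (2 ^ L + a) / 2 ^ (h + 1) ∧
        s'.nreg (c + 6) = (2 ^ L + (b + 1)) / 2 ^ (h + 1) ∧
        (2 ^ L + a) / 2 ^ h < (2 ^ L + (b + 1)) / 2 ^ h) ?_ ?_ _ _ ?_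
    · rintro T s' ⟨f, q0, q1, q26, h, hh, rfl, q3, q4, q5, q6, hlt⟩ hb'
      rw [State.holds_nlt, q5, q6] at hb'
      have hhl : h < L := by
        rcases Nat.lt_or_ge h L with h' | h'
        · exact h'
        · obtain rfl : h = L := by omega
          have := (heap_div_bounds (x := b + 1) hh (by omega)).2
          have := (heap_div_bounds (x := a) hh (by omega)).1
          simp only [Nat.sub_self] at *
          omega
      have w8 := (f.2.2.1 8 (by omega) (by omega) (by omega)).trans h8
      refine ⟨5, 6 * (L - (h + 1)) + 1, by omega, Runs.code _ (by simp) ⟨f.trans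
        ⟨rfl, rfl, fun i hi _ _ => ?_, fun _ _ _ => rfl⟩, ?_, ?_, ?_, h + 1, hhl, rfl, ?_, ?_, ?_,
        ?_, hb'⟩⟩
      · simp (disch := omega)
      · simp (disch := omega) [q0]
      · simp (disch := omega) [q1]
      · simp (disch := omega) [q26]
      · simp (disch := omega) [q5, w8]
      · simp (disch := omega) [q6, w8]
      · simp (disch := omega) [q5, w8]; rw [heap_half]
      · simp (disch := omega) [q6, w8]; rw [heap_half]
    · rintro T s' ⟨f, q0, q1, q26, h, hh, rfl, q3, q4, q5, q6, hlt⟩ hb'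
      rw [State.holds_nlt, q5, q6, ← heap_half, ← heap_half] at hb'
      refine ⟨by omega, f, q0, q1, q26, h, ?_, _, q3, ?_, ?_, rfl, ?_⟩
      · rcases Nat.lt_or_ge h L with h' | h'
        · exact h'
        · obtain rfl : h = L := by omega
          have := (heap_div_bounds (x := b + 1) hh (by omega)).2
          have := (heap_div_bounds (x := a) hh (by omega)).1
          simp only [Nat.sub_self] at *
          omega
      · rw [q4]; omega
      · omega
      · omega
    · refine ⟨f15, j0, j1, j26, 0, by omega, by omega, by simpa using j3, by simpa using j4,
        by simpa using j5, by simpa using j6, ?_⟩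
      simp only [pow_zero, Nat.div_one]; omega
  refine hloop.mono le_rfl ?_
  clear hloop
  rintro s6 ⟨f6, q0, q1, q26, h, hh, u, q3, q4, hu, hua, hub⟩
  have hua' := heap_div_bounds (x := a) hh.le (by omega)
  have hub' := heap_div_bounds (x := b + 1) hh.le (by omega)
  rw [hua] at hua'
  rw [hub] at hub'
  have hu2 : 2 ≤ u := by
    have : 2 ^ 1 ≤ 2 ^ (L - h) := Nat.pow_le_pow_right (by omega) (by omega)
    omega
  have hub2 : u + 1 < 2 ^ (L + 1) := lt_of_lt_of_le hub'.2
    (Nat.pow_le_pow_right (by omega) (by omega))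
  have w8 := (f6.2.2.1 8 (by omega) (by omega) (by omega)).trans h8
  have wpb := f6.2.2.1 rpb hpb' (by omega) (by omega)
  refine Runs.seq 4 (2 * rangeTime Λ (d - 2) + 16) (by omega) (Runs.code _ (by simp) ?_)
  set s7 := List.foldl State.step s6 [.nadd 27 c 8, .nadd (c + 10) rpb (c + 3),
    .nload (c + 10) (c + 10)] with hs7
  have f7 : BoxScratch d c s s7 := by
    refine f6.trans ⟨rfl, rfl, fun i hi _ _ => ?_, fun i hi _ => rfl⟩
    simp (disch := omega) [hs7]
  have t0 : s7.nreg (c + 10) = s.nmem (s.nreg rpb + u) := by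
    simp (disch := omega) [hs7, q3, wpb, f6.1]
  have t27 : s7.nreg 27 = a := by simp (disch := omega) [hs7, q0, w8]
  have t26 : s7.nreg 26 = 0 := by simp (disch := omega) [hs7, q26]
  have t1 : s7.nreg (c + 1) = b + 1 := by simp (disch := omega) [hs7, q1]
  have t4 : s7.nreg (c + 4) = u + 1 := by simp (disch := omega) [hs7, q4]
  clear_value s7
  refine Runs.seq (rangeTime Λ (d - 2)) (rangeTime Λ (d - 2) + 16) (by omega) ?_
  refine (rangeQuery_runs (lo := lo) (hi := hi) hd (d - 2) (c := c + 10) (Y := ∅) (by omega)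
    (by omega) ⟨(f7.2.2.1 7 (by omega) (by omega) (by omega)).trans h7,
      (f7.2.2.1 8 (by omega) (by omega) (by omega)).trans h8⟩ ?_
    (by rw [f7.1, f7.2.1, t0]; exact hB.tree u hu2 (by omega)) t27 ?_ ?_
    (Or.inl ⟨t26, rfl⟩)).mono le_rfl ?_
  · intro p hp
    obtain ⟨i, hi, rfl⟩ := Finset.mem_image.1 hp
    have := hmem' i (by simpa using (Finset.mem_filter.1 hi).1)
    rw [Finset.mem_Icc] at this; omega
  · intro i hi; rw [f7.2.2.2 _ (by omega) (by omega)]; exact hlo i hi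
  · intro i hi; rw [f7.2.2.2 _ (by omega) (by omega)]; exact hhi i hi
  rintro s8 ⟨f8, hB8⟩
  have f08 := f7.trans ((f8.weaken (c' := c) (by omega)).box)
  have t1' := (f8.2.2.1 (c + 1) (by omega) (by omega)).trans t1
  have t4' := (f8.2.2.1 (c + 4) (by omega) (by omega)).trans t4
  have x5 := (f08.2.2.1 5 (by omega) (by omega) (by omega)).trans h5
  have xpb := f08.2.2.1 rpb hpb' (by omega) (by omega)
  refine Runs.seq 4 (rangeTime Λ (d - 2) + 12) (by omega) (Runs.code _ (by simp) ?_)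
  set s9 := List.foldl State.step s8 [.nsub 27 5 (c + 1), .nadd (c + 10) rpb (c + 4),
    .nload (c + 10) (c + 10)] with hs9
  have f9 : BoxScratch d c s s9 := by
    refine f08.trans ⟨rfl, rfl, fun i hi _ _ => ?_, fun i hi _ => rfl⟩
    simp (disch := omega) [hs9]
  have y0 : s9.nreg (c + 10) = s.nmem (s.nreg rpb + (u + 1)) := by
    simp (disch := omega) [hs9, t4', xpb, f08.1]
  have y27 : s9.nreg 27 = 2 ^ L - (b + 1) := by simp (disch := omega) [hs9, t1', x5]
  have y26 : s9.nreg 26 = s8.nreg 26 := by simp (disch := omega) [hs9]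
  have yr : s9.rreg = s8.rreg := by simp (disch := omega) [hs9]
  clear_value s9
  rw [← y26, ← yr] at hB8
  refine (rangeQuery_runs (lo := lo) (hi := hi) hd (d - 2) (c := c + 10) (by omega)
    (by omega) ⟨(f9.2.2.1 7 (by omega) (by omega) (by omega)).trans h7,
      (f9.2.2.1 8 (by omega) (by omega) (by omega)).trans h8⟩ ?_
    (by rw [f9.1, f9.2.1, y0]; exact hB.tree (u + 1) (by omega) hub2) y27 ?_ ?_ hB8).mono
    (by omega) ?_
  · intro p hp
    obtain ⟨i, hi, rfl⟩ := Finset.mem_image.1 hp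
    have := hmem' i (by simpa using (Finset.mem_filter.1 hi).1)
    rw [Finset.mem_Icc] at this; omega
  · intro i hi; rw [f9.2.2.2 _ (by omega) (by omega)]; exact hlo i hi
  · intro i hi; rw [f9.2.2.2 _ (by omega) (by omega)]; exact hhi i hi
  rintro s10 ⟨f10, hB10⟩
  refine ⟨f9.trans ((f10.weaken (c' := c) (by omega)).box), ?_⟩
  rw [boxSel_eq_union hd hB hn hbN hax hh hu hua hub, ← Finset.empty_union (sel _ _ a lo hi _ _)]
  simp only [if_pos hu, if_neg (show (u + 1) % 2 ≠ 0 by omega)] at hB10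
  exact hB10

end BoxQuery

/-! ## The static part of the data structure -/

section Layout

/-- The contents of the data structure: a binary tree whose nodes are numbered from `1` to
`2 * n - 1`, with bounding boxes and sizes, and the coordinates of the points `1, …, n`. The numbers
`sq x` describe the in-order sequence of the nodes. -/
structure Layout (d : ℕ) where
  n : ℕ
  L : ℕ
  E : ℕ
  Λ : ℕ
  lc : ℕ → ℕ
  rc : ℕ → ℕ
  rp : ℕ → ℕ
  sq : ℕ → ℕ
  bl : ℕ → ℕ → ℝ
  bh : ℕ → ℕ → ℝ
  sz : ℕ → ℝ
  co : ℕ → ℕ → ℝ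
  fk : ℕ → ℝ
  cc : ℝ
  nm : ℕ → ℕ
  rm : ℕ → ℝ

variable {d : ℕ}

/-- The axes in the order in which the `j`-th box structure treats them. -/
def copyAxis (j a : ℕ) : ℕ := Equiv.swap 1 (j / 2) a

/-- The coordinates that the `j`-th box structure uses. -/
def copyCo (co : ℕ → ℕ → ℝ) (j a p : ℕ) : ℝ :=
  if j % 2 = 0 then co (copyAxis j a) p else -co (copyAxis j a) p

/-- The number of fields of the static part. -/
def numFields (d : ℕ) : ℕ := 5 * d + 9

/-- The layout in memory. Field `j` starts at the address `j * 2 ^ L`. -/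
structure Layout.Stored (l : Layout d) (nm : ℕ → ℕ) (rm : ℕ → ℝ) : Prop where
  width : nm 0 = 2 ^ l.L
  free : nm (1 * 2 ^ l.L) = l.E
  size : nm (2 * 2 ^ l.L) = l.n
  left : ∀ i, 1 ≤ i → i < l.n → nm (0 * 2 ^ l.L + i) = l.lc i
  right : ∀ i, 1 ≤ i → i < l.n → nm (1 * 2 ^ l.L + i) = l.rc i
  rep : ∀ i, 1 ≤ i → i < 2 * l.n → nm (2 * 2 ^ l.L + i) = l.rp i
  seq : ∀ v, 2 ≤ v → v < 2 ^ (l.L + 1 + 1) →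
    nm (3 * 2 ^ l.L + v) = (blk (l.L + 1) v).fold min (2 ^ l.L) l.sq
  boxLo : ∀ a < d, ∀ i, 1 ≤ i → i < 2 * l.n → rm (a * 2 ^ l.L + i) = l.bl a i
  boxHi : ∀ a < d, ∀ i, 1 ≤ i → i < 2 * l.n → rm ((d + a) * 2 ^ l.L + i) = l.bh a i
  nodeSize : ∀ i, 1 ≤ i → i < 2 * l.n → rm (2 * d * 2 ^ l.L + i) = l.sz i
  coord : ∀ a < d, ∀ p, 1 ≤ p → p ≤ l.n → rm ((2 * d + 1 + a) * 2 ^ l.L + p) = l.co a p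
  factor : ∀ k ≤ l.n, rm ((3 * d + 1) * 2 ^ l.L + k) = l.fk k
  const : rm 0 = l.cc
  copies : ∀ j < 2 * d, ∃ e rk, BoxStructure d (copyCo l.co j) l.n l.L l.Λ nm rm
    ((3 * d + 2 + j) * 2 ^ l.L) ((7 + 2 * j) * 2 ^ l.L) e rk

/-- The layout is determined by the memory below the address `E`. -/
structure Layout.Valid (l : Layout d) : Prop where
  two_le : 2 ≤ l.n
  lt_width : 2 * l.n < 2 ^ l.L
  stored : ∀ nm rm, (∀ a < l.E, nm a = l.nm a) → (∀ a < l.E, rm a = l.rm a) → l.Stored nm rm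

/-- A query: the box and the other real parameter. -/
structure Box where
  lo : ℕ → ℝ
  hi : ℕ → ℝ
  ε : ℝ

/-- The invariant of all states of a query. -/
structure Ok (l : Layout d) (Q : Box) (s : State) : Prop where
  width : s.nreg 5 = 2 ^ l.L
  free : s.nreg 6 = l.E
  one : s.nreg 7 = 1
  zero : s.nreg 8 = 0
  field : ∀ j < numFields d, s.nreg (30 + j) = j * 2 ^ l.L
  nmem : ∀ a < l.E, s.nmem a = l.nm a
  rmem : ∀ a < l.E, s.rmem a = l.rm a
  lo : ∀ a < d, s.rreg a = Q.lo a
  hi : ∀ a < d, s.rreg (d + a) = Q.hi a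
  eps : s.rreg (2 * d) = Q.ε
  rzero : s.rreg (2 * d + 3) = 0

theorem Ok.consts {l : Layout d} {Q : Box} {s : State} (h : Ok l Q s) : Consts s :=
  ⟨h.one, h.zero⟩

theorem Ok.stored {l : Layout d} {Q : Box} {s : State} (h : Ok l Q s) (hl : l.Valid) :
    l.Stored s.nmem s.rmem := hl.stored _ _ h.nmem h.rmem

/-- The first register that subroutines use as scratch space. -/
def scratch (d : ℕ) : ℕ := 5 * d + 50

/-- What the examination of a node may change. -/
structure Keep (d : ℕ) (s s' : State) : Prop where
  nmem : s'.nmem = s.nmem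
  rmem : s'.rmem = s.rmem
  low : ∀ i < 24, s'.nreg i = s.nreg i
  field : ∀ i, 30 ≤ i → i < scratch d → s'.nreg i = s.nreg i
  rreg : ∀ i < 2 * d + 4, s'.rreg i = s.rreg i

theorem Keep.trans {s s' s'' : State} (h : Keep d s s') (h' : Keep d s' s'') : Keep d s s'' :=
  ⟨h'.nmem.trans h.nmem, h'.rmem.trans h.rmem, fun i hi => (h'.low i hi).trans (h.low i hi),
    fun i hi hi' => (h'.field i hi hi').trans (h.field i hi hi'),
    fun i hi => (h'.rreg i hi).trans (h.rreg i hi)⟩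

theorem Keep.ok {l : Layout d} {Q : Box} {s s' : State} (h : Keep d s s') (hs : Ok l Q s) :
    Ok l Q s' where
  width := (h.low 5 (by omega)).trans hs.width
  free := (h.low 6 (by omega)).trans hs.free
  one := (h.low 7 (by omega)).trans hs.one
  zero := (h.low 8 (by omega)).trans hs.zero
  field j hj := (h.field _ (by omega) (by simp only [numFields, scratch] at *; omega)).trans
    (hs.field j hj)
  nmem a ha := by rw [h.nmem]; exact hs.nmem a ha
  rmem a ha := by rw [h.rmem]; exact hs.rmem a ha
  lo a ha := (h.rreg _ (by omega)).trans (hs.lo a ha)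
  hi a ha := (h.rreg _ (by omega)).trans (hs.hi a ha)
  eps := (h.rreg _ (by omega)).trans hs.eps
  rzero := (h.rreg _ (by omega)).trans hs.rzero

end Layout

/-! ## Lowest common ancestors -/

section Lca

variable {d : ℕ} {A : Procedures d}

/-- The minimum of the sequence from position `2 * p` to position `2 * q`. -/
def Layout.lcaId (l : Layout d) (p q : ℕ) : ℕ :=
  (Finset.Ico (2 * p) (2 * q + 1)).fold min (2 ^ l.L) l.sq

/-- Compute the lowest common ancestor of the leaves in the registers `28` and `29`. -/
def lcaQuery (d : ℕ) : Cmd :=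
  let w := scratch d
  .seq (code [.nadd w 5 5, .nadd (w + 1) w 29, .nadd (w + 1) (w + 1) 29, .nadd (w + 1) (w + 1) 7,
    .nadd w w 28, .nadd w w 28, .nadd 24 5 8])
  (canonicalLoop (.seq (code [.nadd (w + 6) 33 (w + 2), .nload (w + 6) (w + 6)])
    (.ite (.nlt (w + 6) 24) (code [.nadd 24 (w + 6) 8]) nop)) w)

theorem fold_min_union (b : ℕ) (f : ℕ → ℕ) (X Y : Finset ℕ) :
    (X ∪ Y).fold min b f = min (X.fold min b f) (Y.fold min b f) := by
  refine eq_of_forall_le_iff fun c => ?_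
  simp only [le_min_iff, Finset.le_fold_min, Finset.mem_union]
  constructor
  · rintro ⟨h1, h2⟩
    exact ⟨⟨h1, fun x hx => h2 x (Or.inl hx)⟩, h1, fun x hx => h2 x (Or.inr hx)⟩
  · rintro ⟨⟨h1, h2⟩, -, h3⟩
    exact ⟨h1, fun x hx => hx.elim (h2 x) (h3 x)⟩

/-- Time of `lcaQuery`. -/
def lcaTime (L : ℕ) : ℕ := canonicalTime (L + 1) 8 + 10

/-- The minimum over an interval of positions is the minimum over its canonical nodes, whose minima
are stored. Leaf `p` stands at position `2 * p` and gap `g` at position `2 * g + 1`, so the sequence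
needs a tree with `2 ^ (L + 1)` leaves. -/
theorem lcaQuery_runs {l : Layout d} {Q : Box} {s : State} {p q : ℕ} (hl : l.Valid)
    (hs : Ok l Q s) (hp : s.nreg 28 = p) (hq : s.nreg 29 = q) (hqn : q ≤ l.n) :
    Runs A (lcaQuery d) s (lcaTime l.L) fun s' => Keep d s s' ∧ s'.nreg 24 = l.lcaId p q ∧
      s'.nreg 28 = p := by
  have hn := hl.lt_width
  have h2 := hl.two_le
  have hw : 50 ≤ scratch d := by simp [scratch]
  have hw' : 5 * d + 50 = scratch d := rfl
  unfold lcaQuery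
  generalize scratch d = w at *
  have e5 := hs.width
  have e7 := hs.one
  have e8 := hs.zero
  refine Runs.seq 8 (canonicalTime (l.L + 1) 8) (by simp only [lcaTime]; omega)
    (Runs.code _ (by simp) ?_)
  refine (canonicalLoop_runs (L := l.L + 1) (T := 8) (a := 2 * p) (b := 2 * q + 1)
    (fun Y s' => Keep d s s' ∧ s'.nreg 24 = Y.fold min (2 ^ l.L) l.sq ∧ s'.nreg 28 = p)
    ?_ (by omega) ?_ ?_ ?_ ?_ ?_ ?_).mono le_rfl ?_
  · rintro Y s' ⟨h, -⟩
    exact (h.ok hs).consts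
  · rintro Y s' i v hi hi' ⟨h, h24, h28⟩
    refine ⟨h.trans ⟨rfl, rfl, fun j hj => ?_, fun j hj hj' => ?_, fun _ _ => rfl⟩, ?_, ?_⟩
    · simp (disch := omega)
    · rw [← hw'] at *
      simp only [scratch] at hj'
      simp (disch := omega)
    · simp (disch := omega) [h24]
    · simp (disch := omega) [h28]
  · rintro Y s' v hv hv' hv'' ⟨h, h24, h28⟩
    have hok := h.ok hs
    have e33 := hok.field 3 (by simp [numFields])
    have z8 := hok.zero
    refine Runs.seq 3 5 (by omega) (Runs.code _ (by simp) ?_)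
    set s1 := List.foldl State.step s' [.nadd (w + 6) 33 (w + 2), .nload (w + 6) (w + 6)] with hs1
    have k1 : Keep d s' s1 := by
      refine ⟨rfl, rfl, fun j hj => ?_, fun j hj hj' => ?_, fun _ _ => rfl⟩
      · simp (disch := omega) [hs1]
      · simp only [scratch] at hj'
        simp (disch := omega) [hs1]
    have g6 : s1.nreg (w + 6) = (blk (l.L + 1) v).fold min (2 ^ l.L) l.sq := by
      rw [← (hok.stored hl).seq v hv hv']
      simp (disch := omega) [hs1, e33, hv'']
    have g24 : s1.nreg 24 = Y.fold min (2 ^ l.L) l.sq := by simp (disch := omega) [hs1, h24]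
    have g28 : s1.nreg 28 = p := by simp (disch := omega) [hs1, h28]
    have gw : ∀ i, w ≤ i → i < w + 6 → s1.nreg i = s'.nreg i := by
      intro i h1 h2
      simp (disch := omega) [hs1]
    clear_value s1
    refine Runs.ite 2 (by omega) (fun hlt => Runs.code _ (by simp) ?_)
      (fun hlt => Runs.nop (by omega) ?_)
    all_goals rw [State.holds_nlt, g6, g24] at hlt
    · have z8' := (k1.low 8 (by omega)).trans z8
      refine ⟨⟨h.trans (k1.trans ⟨rfl, rfl, fun j hj => ?_, fun j hj hj' => ?_, fun _ _ => rfl⟩),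
        ?_, ?_⟩, fun i hi hi' => ?_⟩
      · simp (disch := omega)
      · simp (disch := omega)
      · simp (disch := omega) [g6, z8', fold_min_union]
      · simp (disch := omega) [g28]
      · simp (disch := omega) [gw i hi hi']
    · refine ⟨⟨h.trans k1, ?_, g28⟩, gw⟩
      rw [g24, fold_min_union, min_eq_left (not_lt.1 hlt)]
  · rw [pow_succ]; omega
  · simp (disch := omega) [e5, hp, pow_succ]; omega
  · simp (disch := omega) [e5, hq, e7, pow_succ]; omega
  · refine ⟨⟨rfl, rfl, fun j hj => ?_, fun j hj hj' => ?_, fun _ _ => rfl⟩, ?_, ?_⟩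
    · simp (disch := omega)
    · simp only [scratch] at hj'
      simp (disch := omega)
    · simp (disch := omega) [e5, e8]
    · simp (disch := omega) [hp]
  · rintro s' ⟨h, h24, h28⟩
    exact ⟨h, h24, h28⟩

end Lca

/-! ## Examining a node -/

section Examine

variable {d : ℕ} {A : Procedures d}

/-- Intersect the box of the node in register `23` with the query box; the result is in the real
registers from `4 * d + 10` and from `5 * d + 10` on. The first scratch register tells whether the
box of the node is not inside the query box. -/
def clipBox (d : ℕ) : Cmd :=
  let w := scratch d
  .seq (code [.nconst w 0])
  (unroll (fun i =>
    .seq (code [.nadd (w + 1) (30 + i) 23, .rload (2 * d + 4) (w + 1),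
      .nadd (w + 1) (30 + (d + i)) 23, .rload (2 * d + 5) (w + 1)])
    (.seq (.ite (.rlt (2 * d + 4) i)
        (code [.radd (4 * d + 10 + i) i (2 * d + 3), .nconst w 1])
        (code [.radd (4 * d + 10 + i) (2 * d + 4) (2 * d + 3)]))
      (.ite (.rlt (d + i) (2 * d + 5))
        (code [.radd (5 * d + 10 + i) (d + i) (2 * d + 3), .nconst w 1])
        (code [.radd (5 * d + 10 + i) (2 * d + 5) (2 * d + 3)])))) d)

/-- The lower ends of the clipped box of node `i`. -/
def clipLo (l : Layout d) (Q : Box) (i a : ℕ) : ℝ := max (Q.lo a) (l.bl a i)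

/-- The upper ends of the clipped box of node `i`. -/
def clipHi (l : Layout d) (Q : Box) (i a : ℕ) : ℝ := min (Q.hi a) (l.bh a i)

/-- The box of node `i` is inside the query box. -/
def Inside (l : Layout d) (Q : Box) (i : ℕ) : Prop :=
  ∀ a < d, Q.lo a ≤ l.bl a i ∧ l.bh a i ≤ Q.hi a

/-- Restricting the query box to the box of the node makes the later range searches see only points
of this node, although their structures store all points. The flag in the first scratch register
decides whether these searches can be avoided. -/
theorem clipBox_runs {l : Layout d} {Q : Box} {s : State} {i : ℕ} (hl : l.Valid)
    (hs : Ok l Q s) (h23 : s.nreg 23 = i) (hi1 : 1 ≤ i) (hi2 : i < 2 * l.n) :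
    Runs A (clipBox d) s (d * 20 + 5) fun s' => Keep d s s' ∧
      (∀ a < d, s'.rreg (4 * d + 10 + a) = clipLo l Q i a ∧
        s'.rreg (5 * d + 10 + a) = clipHi l Q i a) ∧
      (s'.nreg (scratch d) = 0 ↔ Inside l Q i) := by
  have hw : 50 ≤ scratch d := by simp [scratch]
  have hw' : 5 * d + 50 = scratch d := rfl
  refine Runs.seq 2 (d * 20 + 1) (by omega) (Runs.code _ (by simp) ?_)
  refine (Runs.unroll (T := 20) (fun m s' => Keep d s s' ∧
    (∀ a < m, s'.rreg (4 * d + 10 + a) = clipLo l Q i a ∧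
        s'.rreg (5 * d + 10 + a) = clipHi l Q i a) ∧
      (s'.nreg (scratch d) = 0 ↔ ∀ a < m, Q.lo a ≤ l.bl a i ∧ l.bh a i ≤ Q.hi a))
    ?_ ?_).mono le_rfl fun s' h => h
  · rintro m hm s' ⟨hk, hc, hf⟩
    have hok := hk.ok hs
    have hst := hok.stored hl
    generalize scratch d = w at *
    have e1 := hok.field m (by simp only [numFields]; omega)
    have e2 := hok.field (d + m) (by simp only [numFields]; omega)
    have e23 := (hk.low 23 (by omega)).trans h23
    have b1 := hst.boxLo m hm i hi1 hi2
    have b2 := hst.boxHi m hm i hi1 hi2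
    have e0 := hok.rzero
    refine Runs.seq 5 15 (by omega) (Runs.code _ (by simp) ?_)
    set s1 := List.foldl State.step s' [.nadd (w + 1) (30 + m) 23, .rload (2 * d + 4) (w + 1),
      .nadd (w + 1) (30 + (d + m)) 23, .rload (2 * d + 5) (w + 1)] with hs1
    have k1 : Keep d s' s1 := by
      refine ⟨rfl, rfl, fun j hj => ?_, fun j hj hj' => ?_, fun j hj => ?_⟩
      · simp (disch := omega) [hs1]
      · simp only [scratch] at hj'
        simp (disch := omega) [hs1]
      · simp (disch := omega) [hs1]
    have r4 : s1.rreg (2 * d + 4) = l.bl m i := by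
      simp (disch := omega) [hs1, e1, e23, b1]
    have r5 : s1.rreg (2 * d + 5) = l.bh m i := by
      simp (disch := omega) [hs1, e2, e23, b2]
    have rw1 : s1.nreg w = s'.nreg w := by simp (disch := omega) [hs1]
    have ra : ∀ j, 4 * d + 10 ≤ j → s1.rreg j = s'.rreg j := by
      intro j hj; simp (disch := omega) [hs1]
    clear_value s1
    have hok1 := k1.ok hok
    have f0 := hok1.rzero
    have flo := hok1.lo m hm
    have fhi := hok1.hi m hm
    refine Runs.seq 5 10 (by omega) ?_
    have hmid : Runs A (.ite (.rlt (2 * d + 4) m)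
        (code [.radd (4 * d + 10 + m) m (2 * d + 3), .nconst w 1])
        (code [.radd (4 * d + 10 + m) (2 * d + 4) (2 * d + 3)])) s1 5 fun s2 => Keep d s1 s2 ∧
          s2.rreg (4 * d + 10 + m) = clipLo l Q i m ∧ s2.rreg (2 * d + 5) = l.bh m i ∧
          (∀ j, 4 * d + 10 ≤ j → j ≠ 4 * d + 10 + m → s2.rreg j = s'.rreg j) ∧
          (s2.nreg w = 0 ↔ s'.nreg w = 0 ∧ Q.lo m ≤ l.bl m i) := by
      refine Runs.ite 3 (by omega) (fun h => Runs.code _ (by simp) ?_)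
        (fun h => Runs.code _ (by simp) ?_)
      all_goals rw [State.holds_rlt, r4, flo] at h
      · refine ⟨⟨rfl, rfl, fun j hj => ?_, fun j hj hj' => ?_, fun j hj => ?_⟩, ?_, ?_,
          fun j hj hj' => ?_, ?_⟩
        · simp (disch := omega)
        · simp only [scratch] at hj'
          simp (disch := omega)
        · simp (disch := omega)
        · simp (disch := omega) [flo, f0, clipLo, h.le]
        · simp (disch := omega) [r5]
        · simp (disch := omega) [ra]
        · simp (disch := omega) [h]
      · refine ⟨⟨rfl, rfl, fun j hj => ?_, fun j hj hj' => ?_, fun j hj => ?_⟩, ?_, ?_,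
          fun j hj hj' => ?_, ?_⟩
        · simp (disch := omega)
        · simp (disch := omega)
        · simp (disch := omega)
        · simp (disch := omega) [r4, f0, clipLo, not_lt.1 h]
        · simp (disch := omega) [r5]
        · simp (disch := omega) [ra]
        · simp (disch := omega) [rw1, not_lt.1 h]
    refine hmid.mono le_rfl ?_
    rintro s2 ⟨k2, hlo2, r5', ra', hw2⟩
    have hok2 := k2.ok hok1
    have f0' := hok2.rzero
    have fhi' := hok2.hi m hm
    have hcl : ∀ a < m, s2.rreg (4 * d + 10 + a) = clipLo l Q i a ∧
        s2.rreg (5 * d + 10 + a) = clipHi l Q i a := by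
      intro a ha
      rw [ra' _ (by omega) (by omega), ra' _ (by omega) (by omega)]
      exact hc a ha
    have hall : ∀ P : ℕ → Prop, (∀ a < m + 1, P a) ↔ (∀ a < m, P a) ∧ P m := by
      intro P
      constructor
      · exact fun h => ⟨fun a ha => h a (by omega), h m (by omega)⟩
      · rintro ⟨h1, h2⟩ a ha
        rcases Nat.lt_or_ge a m with h | h
        · exact h1 a h
        · obtain rfl : a = m := by omega
          exact h2
    refine Runs.ite 3 (by omega) (fun h => Runs.code _ (by simp) ?_)
      (fun h => Runs.code _ (by simp) ?_)
    all_goals rw [State.holds_rlt, r5', fhi'] at h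
    · refine ⟨(hk.trans k1).trans (k2.trans
        ⟨rfl, rfl, fun j hj => ?_, fun j hj hj' => ?_, fun j hj => ?_⟩), ?_, ?_⟩
      · simp (disch := omega)
      · simp only [scratch] at hj'
        simp (disch := omega)
      · simp (disch := omega)
      · rw [hall]
        refine ⟨fun a ha => ?_, ?_⟩
        · simpa (disch := omega) using hcl a ha
        · simp (disch := omega) [hlo2, fhi', f0', clipHi, h.le]
      · rw [hall]
        simp (disch := omega) [h]
    · refine ⟨(hk.trans k1).trans (k2.trans
        ⟨rfl, rfl, fun j hj => ?_, fun j hj hj' => ?_, fun j hj => ?_⟩), ?_, ?_⟩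
      · simp (disch := omega)
      · simp (disch := omega)
      · simp (disch := omega)
      · rw [hall]
        refine ⟨fun a ha => ?_, ?_⟩
        · simpa (disch := omega) using hcl a ha
        · simp (disch := omega) [hlo2, r5', f0', clipHi, not_lt.1 h]
      · rw [hall]
        simp (disch := omega) [hw2, hf, not_lt.1 h]
  · refine ⟨⟨rfl, rfl, fun j hj => ?_, fun j hj hj' => ?_, fun _ _ => rfl⟩, by simp, ?_⟩
    · simp (disch := omega)
    · simp (disch := omega)
    · simp

/-- Query the `j`-th box structure and update the range of the points found. -/
def copyStep (d j : ℕ) : Cmd :=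
  .seq (unroll (fun a => if j % 2 = 0 then
      code [.radd (2 * d + 10 + a) (4 * d + 10 + copyAxis j a) (2 * d + 3),
        .radd (3 * d + 10 + a) (5 * d + 10 + copyAxis j a) (2 * d + 3)]
    else
      code [.rsub (2 * d + 10 + a) (2 * d + 3) (5 * d + 10 + copyAxis j a),
        .rsub (3 * d + 10 + a) (2 * d + 3) (4 * d + 10 + copyAxis j a)]) d)
  (.seq (boxQuery d (30 + (3 * d + 2 + j)) (30 + (7 + 2 * j)) (scratch d))
  (.ite (.nlt 8 26)
    (.seq (.ite (.nlt 26 28) (code [.nadd 28 26 8]) nop)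
      (.ite (.nlt 29 26) (code [.nadd 29 26 8]) nop)) nop))

theorem copyAxis_lt {d j a : ℕ} (hd : 2 ≤ d) (hj : j < 2 * d) (ha : a < d) :
    copyAxis j a < d := by
  unfold copyAxis
  rcases eq_or_ne a 1 with rfl | h1
  · rw [Equiv.swap_apply_left]; omega
  rcases eq_or_ne a (j / 2) with rfl | h2
  · rw [Equiv.swap_apply_right]; omega
  · rwa [Equiv.swap_apply_of_ne_of_ne h1 h2]

theorem copyAxis_copyAxis (j a : ℕ) : copyAxis j (copyAxis j a) = a := by
  simp [copyAxis]

/-- The lower ends of a box in the coordinates of the `j`-th box structure. -/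
def copyLo (lo hi : ℕ → ℝ) (j a : ℕ) : ℝ :=
  if j % 2 = 0 then lo (copyAxis j a) else -hi (copyAxis j a)

/-- The upper ends of a box in the coordinates of the `j`-th box structure. -/
def copyHi (lo hi : ℕ → ℝ) (j a : ℕ) : ℝ :=
  if j % 2 = 0 then hi (copyAxis j a) else -lo (copyAxis j a)

/-- Swapping two axes permutes the conditions, and a sign change exchanges the two ends of each
range. So every box structure answers for the same set of points, only in another direction. -/
theorem boxSel_copy {co : ℕ → ℕ → ℝ} {lo hi : ℕ → ℝ} {d j : ℕ} {X : Finset ℕ} (hd : 2 ≤ d)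
    (hj : j < 2 * d) : boxSel (copyCo co j) (copyLo lo hi j) (copyHi lo hi j) d X =
      boxSel co lo hi d X := by
  ext p
  rw [mem_boxSel, mem_boxSel]
  refine and_congr_right fun _ => ?_
  have key : ∀ a, (copyLo lo hi j a ≤ copyCo co j a p ∧ copyCo co j a p ≤ copyHi lo hi j a) ↔
      (lo (copyAxis j a) ≤ co (copyAxis j a) p ∧ co (copyAxis j a) p ≤ hi (copyAxis j a)) := by
    intro a
    unfold copyLo copyHi copyCo
    split_ifs
    · rfl
    · rw [neg_le_neg_iff, neg_le_neg_iff, and_comm]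
  constructor
  · intro h a ha
    have := (key (copyAxis j a)).1 (h _ (copyAxis_lt hd hj ha))
    rwa [copyAxis_copyAxis] at this
  · intro h a ha
    exact (key a).2 (h _ (copyAxis_lt hd hj ha))

/-- The range of the points found by the first `j` box structures. -/
def Spread (l : Layout d) (X : Finset ℕ) (j u v : ℕ) : Prop :=
  (v = 0 ∧ u = 2 ^ l.L ∧ (j = 0 ∨ X = ∅)) ∨
    (u ∈ X ∧ v ∈ X ∧ u ≤ v ∧ ∀ j' < j, ∃ p ∈ X, u ≤ p ∧ p ≤ v ∧
      ∀ y ∈ X, copyCo l.co j' 1 y ≤ copyCo l.co j' 1 p)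

/-- Structure `j` maximises the axis `j / 2` for even `j` and minimises it for odd `j`. Only the
least and the largest number of the extreme points are kept, since an ancestor of these two leaves
contains all points numbered between them. -/
theorem copyStep_runs {l : Layout d} {Q : Box} {s : State} {lo hi : ℕ → ℝ} {j u v : ℕ}
    (hd : 2 ≤ d) (hl : l.Valid) (hs : Ok l Q s) (hj : j < 2 * d)
    (hlo : ∀ a < d, s.rreg (4 * d + 10 + a) = lo a ∧ s.rreg (5 * d + 10 + a) = hi a)
    (hu : s.nreg 28 = u) (hv : s.nreg 29 = v)
    (hX : Spread l (boxSel l.co lo hi d (Finset.Icc 1 l.n)) j u v) :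
    Runs A (copyStep d j) s (boxTime d l.L l.Λ + d * 3 + 10) fun s' => Keep d s s' ∧
      (∀ a < d, s'.rreg (4 * d + 10 + a) = lo a ∧ s'.rreg (5 * d + 10 + a) = hi a) ∧
      Spread l (boxSel l.co lo hi d (Finset.Icc 1 l.n)) (j + 1) (s'.nreg 28) (s'.nreg 29) := by
  have hn := hl.lt_width
  have h2 := hl.two_le
  refine Runs.seq (d * 3 + 1) (boxTime d l.L l.Λ + 9) (by omega) ?_
  refine (Runs.unroll (T := 3) (fun m s' => s'.nmem = s.nmem ∧ s'.rmem = s.rmem ∧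
    s'.nreg = s.nreg ∧ (∀ i, (i < 2 * d + 10 ∨ 4 * d + 10 ≤ i) → s'.rreg i = s.rreg i) ∧
    ∀ a < m, s'.rreg (2 * d + 10 + a) = copyLo lo hi j a ∧
      s'.rreg (3 * d + 10 + a) = copyHi lo hi j a) ?_ ?_).mono le_rfl ?_
  · rintro m hm s' ⟨i1, i2, i3, i4, i5⟩
    have hcm := copyAxis_lt hd hj hm
    have z := (i4 (2 * d + 3) (by omega)).trans hs.rzero
    have e1 := (i4 (4 * d + 10 + copyAxis j m) (by omega)).trans (hlo _ hcm).1
    have e2 := (i4 (5 * d + 10 + copyAxis j m) (by omega)).trans (hlo _ hcm).2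
    have hall : ∀ P : ℕ → Prop, (∀ a < m + 1, P a) ↔ (∀ a < m, P a) ∧ P m := by
      intro P
      constructor
      · exact fun h => ⟨fun a ha => h a (by omega), h m (by omega)⟩
      · rintro ⟨h1, h2⟩ a ha
        rcases Nat.lt_or_ge a m with h | h
        · exact h1 a h
        · obtain rfl : a = m := by omega
          exact h2
    split_ifs with hpar
    · refine Runs.code _ (by simp) ⟨i1, i2, i3, fun i hi => ?_, ?_⟩
      · simp (disch := omega) [i4 i hi]
      · rw [hall]
        refine ⟨fun a ha => ?_, ?_⟩
        · simpa (disch := omega) using i5 a ha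
        · simp (disch := omega) [e1, e2, z, copyLo, copyHi, hpar]
    · refine Runs.code _ (by simp) ⟨i1, i2, i3, fun i hi => ?_, ?_⟩
      · simp (disch := omega) [i4 i hi]
      · rw [hall]
        refine ⟨fun a ha => ?_, ?_⟩
        · simpa (disch := omega) using i5 a ha
        · simp (disch := omega) [e1, e2, z, copyLo, copyHi, hpar]
  · exact ⟨rfl, rfl, rfl, fun _ _ => rfl, by simp⟩
  rintro s1 ⟨i1, i2, i3, i4, i5⟩
  have k1 : Keep d s s1 := ⟨i1, i2, fun _ _ => by rw [i3], fun _ _ _ => by rw [i3],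
    fun i hi => i4 i (by omega)⟩
  have hok := k1.ok hs
  have hst := hok.stored hl
  obtain ⟨e, rk, hB⟩ := hst.copies j hj
  have hsc : 5 * d + 50 = scratch d := rfl
  refine Runs.seq (boxTime d l.L l.Λ) 8 (by omega) ?_
  refine (boxQuery_runs (lo := copyLo lo hi j) (hi := copyHi lo hi j) (e := e) (rk := rk)
    (Λ := l.Λ) (co := copyCo l.co j) hd (by simp [scratch])
    hok.consts (show l.n + 1 < 2 ^ l.L by omega) ?_ (by omega) (by omega) (by omega) hok.width ?_
    (fun a ha => (i5 a ha).1) (fun a ha => (i5 a ha).2)).mono le_rfl ?_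
  · rw [hok.field _ (by simp only [numFields]; omega), hok.field _ (by simp only [numFields]; omega)]
    exact hB
  · rw [hok.field 2 (by simp [numFields])]; exact hst.size
  rintro s2 ⟨f2, hb⟩
  rw [boxSel_copy hd hj] at hb
  have k2 : Keep d s s2 := k1.trans ⟨f2.1, f2.2.1,
    fun i hi => f2.2.2.1 i (by omega) (by omega) (by omega),
    fun i hi hi' => f2.2.2.1 i (by omega) (by omega) (by omega),
    fun i hi => f2.2.2.2 i (by omega) (by omega)⟩
  have z8 := (k2.ok hs).zero
  have e28 : s2.nreg 28 = u := by rw [f2.2.2.1 28 (by omega) (by omega) (by omega), i3, hu]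
  have e29 : s2.nreg 29 = v := by rw [f2.2.2.1 29 (by omega) (by omega) (by omega), i3, hv]
  have hbox : ∀ a < d, s2.rreg (4 * d + 10 + a) = lo a ∧ s2.rreg (5 * d + 10 + a) = hi a := by
    intro a ha
    rw [f2.2.2.2 _ (by omega) (by omega), f2.2.2.2 _ (by omega) (by omega), i4 _ (by omega),
      i4 _ (by omega)]
    exact hlo a ha
  set X := boxSel l.co lo hi d (Finset.Icc 1 l.n) with hXdef
  have hXn : ∀ p ∈ X, 1 ≤ p ∧ p ≤ l.n := fun p hp => by
    rw [hXdef, mem_boxSel, Finset.mem_Icc] at hp; exact hp.1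
  clear_value X
  set p := s2.nreg 26 with hp
  refine Runs.ite 7 le_rfl (fun h => ?_) (fun h => Runs.nop (by omega) ⟨k2, hbox, ?_⟩)
  all_goals rw [State.holds_nlt, z8, ← hp] at h
  swap
  · have hXe : X = ∅ := by
      rcases hb with hb | hb
      · exact hb.2
      · exact absurd hb.1 (by omega)
    rw [e28, e29]
    rcases hX with ⟨h1, h2, h3⟩ | h3
    · exact Or.inl ⟨h1, h2, Or.inr hXe⟩
    · rw [hXe] at h3
      exact absurd h3.1 (by simp)
  obtain ⟨-, hpX, hpv, hpm⟩ := hb.resolve_left (by omega)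
  rw [hpv] at hpm
  have hpn := hXn p hpX
  refine Runs.seq 3 3 (by omega) ?_
  have hmin : Runs A (.ite (.nlt 26 28) (code [.nadd 28 26 8]) nop) s2 3 fun s3 =>
      Keep d s s3 ∧ s3.nreg 28 = min u p ∧ s3.nreg 29 = v ∧ s3.nreg 26 = p ∧
      (∀ a < d, s3.rreg (4 * d + 10 + a) = lo a ∧ s3.rreg (5 * d + 10 + a) = hi a) := by
    refine Runs.ite 2 le_rfl (fun h => Runs.code _ (by simp) ?_) (fun h => Runs.nop (by omega) ?_)
    all_goals rw [State.holds_nlt, e28, ← hp] at h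
    · refine ⟨k2.trans ⟨rfl, rfl, fun i hi => ?_, fun i hi hi' => ?_, fun i hi => rfl⟩, ?_, ?_, ?_,
        hbox⟩
      · simp (disch := omega)
      · simp (disch := omega)
      · simp (disch := omega) [z8, ← hp]
      · simp (disch := omega) [e29]
      · simp (disch := omega) [hp]
    · exact ⟨k2, by omega, e29, rfl, hbox⟩
  refine hmin.mono le_rfl ?_
  rintro s3 ⟨k3, m28, m29, m26, hbox3⟩
  have z8' := (k3.ok hs).zero
  -- The start values `u = 2 ^ L` and `v = 0` lie beyond all point numbers, so minimum and maximum
  -- with the first point found both give this point.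
  have hfin : Spread l X (j + 1) (min u p) (max v p) := by
    refine Or.inr ?_
    rcases hX with ⟨rfl, rfl, h3⟩ | ⟨h3, h4, h5, h6⟩
    · rw [min_eq_right (by omega), max_eq_right (by omega)]
      refine ⟨hpX, hpX, le_rfl, fun j' hj' => ?_⟩
      rcases h3 with rfl | rfl
      · obtain rfl : j' = 0 := by omega
        exact ⟨p, hpX, le_rfl, le_rfl, hpm⟩
      · simp at hpX
    · refine ⟨?_, ?_, by omega, fun j' hj' => ?_⟩
      · rcases le_total u p with h | h
        · rwa [min_eq_left h]
        · rwa [min_eq_right h]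
      · rcases le_total v p with h | h
        · rwa [max_eq_right h]
        · rwa [max_eq_left h]
      · rcases Nat.lt_or_ge j' j with h | h
        · obtain ⟨x, hx, h1, h2, h3⟩ := h6 j' h
          exact ⟨x, hx, by omega, by omega, h3⟩
        · obtain rfl : j' = j := by omega
          exact ⟨p, hpX, by omega, by omega, hpm⟩
  refine Runs.ite 2 le_rfl (fun h => Runs.code _ (by simp) ?_) (fun h => Runs.nop (by omega) ?_)
  all_goals rw [State.holds_nlt, m29, m26] at h
  · refine ⟨k3.trans ⟨rfl, rfl, fun i hi => ?_, fun i hi hi' => ?_, fun i hi => rfl⟩, hbox3, ?_⟩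
    · simp (disch := omega)
    · simp (disch := omega)
    · rw [max_eq_right h.le] at hfin
      simpa (disch := omega) [m28, m26, z8'] using hfin
  · rw [max_eq_left (not_lt.1 h)] at hfin
    exact ⟨k3, hbox3, by rw [m28, m29]; exact hfin⟩

/-- Examine the node in register `23`: find a node (register `24`, zero if there is none) below it
that contains its points in the query box, and one of these points (register `25`). -/
def examine (d : ℕ) : Cmd :=
  let w := scratch d
  .seq (clipBox d)
  (.ite (.neq w 8)
    (code [.nadd 24 23 8, .nadd (w + 1) 32 23, .nload 25 (w + 1)])
    (.seq (code [.nadd 28 5 8, .nadd 29 8 8])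
    (.seq (unroll (copyStep d) (2 * d))
    (.ite (.nlt 8 29) (.seq (lcaQuery d) (code [.nadd 25 28 8])) (code [.nadd 24 8 8])))))

/-- Time of `examine` for a node inside the query box. -/
def insideTime (d : ℕ) : ℕ := d * 20 + 20

/-- Additional time of `examine` for a node that is not inside the query box. -/
def crossTime (d L Λ : ℕ) : ℕ := 2 * d * (boxTime d L Λ + d * 3 + 10) + lcaTime L + 20

-- Three outcomes: the box of the node is inside the query box and the node itself is returned in
-- constant time; no point is found; or the `2 * d` searches give a range `u, v` of extreme points
-- whose lowest common ancestor is returned. The expensive part of the budget is due only in the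
-- last two.
open Classical in
theorem examine_runs {l : Layout d} {Q : Box} {s : State} {i : ℕ} (hd : 2 ≤ d) (hl : l.Valid)
    (hs : Ok l Q s) (h23 : s.nreg 23 = i) (hi1 : 1 ≤ i) (hi2 : i < 2 * l.n) :
    Runs A (examine d) s (insideTime d + if Inside l Q i then 0 else crossTime d l.L l.Λ)
      fun s' => Keep d s s' ∧ ((Inside l Q i ∧ s'.nreg 24 = i ∧ s'.nreg 25 = l.rp i) ∨
        (boxSel l.co (clipLo l Q i) (clipHi l Q i) d (Finset.Icc 1 l.n) = ∅ ∧ s'.nreg 24 = 0) ∨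
        ∃ u v, Spread l (boxSel l.co (clipLo l Q i) (clipHi l Q i) d (Finset.Icc 1 l.n))
          (2 * d) u v ∧ v ≠ 0 ∧ s'.nreg 24 = l.lcaId u v ∧ s'.nreg 25 = u) := by
  have hsc : 5 * d + 50 = scratch d := rfl
  have hcr : crossTime d l.L l.Λ =
    2 * d * (boxTime d l.L l.Λ + d * 3 + 10) + lcaTime l.L + 20 := rfl
  set C := if Inside l Q i then 0 else crossTime d l.L l.Λ with hC
  refine Runs.seq (d * 20 + 5) (10 + C) (by simp only [insideTime]; omega) ?_
  refine (clipBox_runs hl hs h23 hi1 hi2).mono le_rfl ?_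
  rintro s1 ⟨k1, hc1, hin⟩
  have hok := k1.ok hs
  have z8 := hok.zero
  have e23 := (k1.low 23 (by omega)).trans h23
  refine Runs.ite (9 + C) (by omega) (fun h => Runs.code _ (by simp; omega) ?_) (fun h => ?_)
  all_goals rw [State.holds_neq, z8, hin] at h
  · have e32 := hok.field 2 (by simp [numFields])
    have hr := (hok.stored hl).rep i hi1 hi2
    refine ⟨k1.trans ⟨rfl, rfl, fun i hi => ?_, fun i hi hi' => ?_, fun i hi => rfl⟩,
      Or.inl ⟨h, ?_, ?_⟩⟩
    · simp (disch := omega)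
    · simp (disch := omega)
    · simp (disch := omega) [e23, z8]
    · simp (disch := omega) [e23, e32, hr]
  rw [if_neg h] at hC
  refine Runs.seq 3 (6 + C) (by omega) (Runs.code _ (by simp) ?_)
  refine Runs.seq (2 * d * (boxTime d l.L l.Λ + d * 3 + 10) + 1) (lcaTime l.L + 20)
    (by omega) ?_
  refine (Runs.unroll (T := boxTime d l.L l.Λ + d * 3 + 10) (fun j s' => Keep d s s' ∧
    (∀ a < d, s'.rreg (4 * d + 10 + a) = clipLo l Q i a ∧
      s'.rreg (5 * d + 10 + a) = clipHi l Q i a) ∧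
    Spread l (boxSel l.co (clipLo l Q i) (clipHi l Q i) d (Finset.Icc 1 l.n)) j
      (s'.nreg 28) (s'.nreg 29)) ?_ ?_).mono le_rfl ?_
  · rintro j hj s' ⟨hk, hc, hsp⟩
    refine (copyStep_runs hd hl (hk.ok hs) hj hc rfl rfl hsp).mono le_rfl ?_
    rintro s'' ⟨hk', hc', hsp'⟩
    exact ⟨hk.trans hk', hc', hsp'⟩
  · refine ⟨k1.trans ⟨rfl, rfl, fun i hi => ?_, fun i hi hi' => ?_, fun i hi => rfl⟩, hc1,
      Or.inl ⟨?_, ?_, Or.inl rfl⟩⟩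
    · simp (disch := omega)
    · simp (disch := omega)
    · simp (disch := omega) [z8]
    · simp (disch := omega) [z8, hok.width]
  rintro s2 ⟨k2, -, hsp⟩
  have hok2 := k2.ok hs
  refine Runs.ite (lcaTime l.L + 2) (by omega) (fun h => ?_)
    (fun h => Runs.code _ (by simp) ⟨k2.trans
      ⟨rfl, rfl, fun i hi => ?_, fun i hi hi' => ?_, fun i hi => rfl⟩, Or.inr (Or.inl ?_)⟩)
  all_goals rw [State.holds_nlt, hok2.zero] at h
  rotate_left
  · simp (disch := omega)
  · simp (disch := omega)
  · rcases hsp with ⟨-, -, h3⟩ | ⟨-, h3, -⟩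
    · refine ⟨h3.resolve_left (by omega), ?_⟩
      simp (disch := omega) [hok2.zero]
    · rw [mem_boxSel, Finset.mem_Icc] at h3; omega
  have hvn : s2.nreg 29 ≤ l.n := by
    rcases hsp with ⟨h1, -⟩ | ⟨-, h3, -⟩
    · omega
    · rw [mem_boxSel, Finset.mem_Icc] at h3; exact h3.1.2
  refine Runs.seq (lcaTime l.L) 2 le_rfl ((lcaQuery_runs hl hok2 rfl rfl hvn).mono le_rfl ?_)
  rintro s3 ⟨k3, e24, e28⟩
  have hok3 := k3.ok hok2
  refine Runs.code _ (by simp) ⟨(k2.trans k3).trans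
      ⟨rfl, rfl, fun i hi => ?_, fun i hi hi' => ?_, fun i hi => rfl⟩,
      Or.inr (Or.inr ⟨_, _, hsp, by omega, ?_, ?_⟩)⟩
  · simp (disch := omega)
  · simp (disch := omega)
  · simp (disch := omega) [e24]
  · simp (disch := omega) [hok3.zero, e28]

end Examine

/-! ## A priority queue of node numbers -/

section Queue

variable {d : ℕ} {A : Procedures d}

/-- The counters from address `E` on describe the set `B` of numbers below `2 ^ L`: the counter of
a node of the complete binary tree is the number of elements below it. -/
def Counts (L E : ℕ) (nm : ℕ → ℕ) (B : Finset ℕ) : Prop :=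
  ∀ v, 1 ≤ v → v < 2 ^ (L + 1) → nm (E + v) = (B ∩ blk L v).card

/-- `s'` differs from `s` at most in the natural registers `17` to `29` and in the counters. -/
structure KeepCounts (L E : ℕ) (s s' : State) : Prop where
  low : ∀ i < 17, s'.nreg i = s.nreg i
  high : ∀ i, 30 ≤ i → s'.nreg i = s.nreg i
  rreg : s'.rreg = s.rreg
  rmem : s'.rmem = s.rmem
  below : ∀ a < E, s'.nmem a = s.nmem a
  above : ∀ a, E + 2 ^ (L + 1) ≤ a → s'.nmem a = s.nmem a

theorem KeepCounts.trans {L E : ℕ} {s s' s'' : State} (h : KeepCounts L E s s')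
    (h' : KeepCounts L E s' s'') : KeepCounts L E s s'' :=
  ⟨fun i hi => (h'.low i hi).trans (h.low i hi), fun i hi => (h'.high i hi).trans (h.high i hi),
    h'.rreg.trans h.rreg, h'.rmem.trans h.rmem, fun i hi => (h'.below i hi).trans (h.below i hi),
    fun i hi => (h'.above i hi).trans (h.above i hi)⟩

theorem KeepCounts.ok {l : Layout d} {Q : Box} {s s' : State} (h : KeepCounts l.L l.E s s')
    (hs : Ok l Q s) : Ok l Q s' where
  width := (h.low 5 (by omega)).trans hs.width
  free := (h.low 6 (by omega)).trans hs.free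
  one := (h.low 7 (by omega)).trans hs.one
  zero := (h.low 8 (by omega)).trans hs.zero
  field j hj := (h.high _ (by omega)).trans (hs.field j hj)
  nmem a ha := (h.below a ha).trans (hs.nmem a ha)
  rmem a ha := by rw [h.rmem]; exact hs.rmem a ha
  lo a ha := by rw [h.rreg]; exact hs.lo a ha
  hi a ha := by rw [h.rreg]; exact hs.hi a ha
  eps := by rw [h.rreg]; exact hs.eps
  rzero := by rw [h.rreg]; exact hs.rzero

/-- Insert the number in register `18`. -/
def enqueue : Cmd :=
  .seq (code [.nadd 19 5 18])
  (.while (.nlt 8 19)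
    (code [.nadd 20 6 19, .nload 21 20, .nadd 21 21 7, .nstore 20 21, .nhalf 19 19]))

/-- Remove the least number and leave it in register `17`. -/
def dequeue : Cmd :=
  .seq (code [.nadd 19 7 8])
  (.seq (.while (.nlt 19 5)
    (.seq (code [.nadd 20 6 19, .nload 21 20, .nsub 21 21 7, .nstore 20 21, .nadd 19 19 19,
      .nadd 20 6 19, .nload 21 20])
      (.ite (.neq 21 8) (code [.nadd 19 19 7]) nop)))
  (code [.nadd 20 6 19, .nload 21 20, .nsub 21 21 7, .nstore 20 21, .nsub 17 19 5]))

/-- Exactly the counters on the path from the leaf of `i` to the root grow by one. After `h` rounds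
the heights below `h`, that is the nodes from `2 ^ (L + 1 - h)` on, already describe `insert i B`.
-/
theorem enqueue_runs {l : Layout d} {Q : Box} {s : State} {B : Finset ℕ} {i : ℕ}
    (hs : Ok l Q s) (hB : Counts l.L l.E s.nmem B) (hi : s.nreg 18 = i) (hiL : i < 2 ^ l.L)
    (hiB : i ∉ B) :
    Runs A enqueue s ((l.L + 1) * 7 + 3) fun s' => KeepCounts l.L l.E s s' ∧
      Counts l.L l.E s'.nmem (insert i B) ∧ s'.nreg 17 = s.nreg 17 ∧ s'.nreg 22 = s.nreg 22 := by
  generalize hL : l.L = L at *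
  generalize hE : l.E = E at *
  refine Runs.seq 2 ((L + 1) * 7 + 1) (by omega) (Runs.code _ (by simp) ?_)
  refine Runs.while (fun T s' => KeepCounts L E s s' ∧ s'.nreg 17 = s.nreg 17 ∧
    s'.nreg 22 = s.nreg 22 ∧ ∃ h ≤ L + 1,
    T = (L + 1 - h) * 7 + 1 ∧ s'.nreg 19 = (2 ^ L + i) / 2 ^ h ∧
    ∀ v, 1 ≤ v → v < 2 ^ (L + 1) → s'.nmem (E + v) =
      if 2 ^ (L + 1 - h) ≤ v then (insert i B ∩ blk L v).card else (B ∩ blk L v).card) ?_ ?_ _ _ ?_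
  · rintro T s' ⟨hk, h17, h22, h, hh, rfl, h19, hc⟩ hb
    have hok : Ok l Q s' := by subst hL hE; exact hk.ok hs
    have e7 := hok.one
    have e8 := hok.zero
    have e6 := hok.free
    rw [hE] at e6
    rw [State.holds_nlt, e8, h19] at hb
    have hhL : h ≤ L := by
      by_contra hc
      obtain rfl : h = L + 1 := by omega
      rw [Nat.div_eq_of_lt (by rw [pow_succ]; omega)] at hb
      omega
    have hbd := heap_div_bounds hhL hiL
    set v := (2 ^ L + i) / 2 ^ h with hv
    have hvl : v < 2 ^ (L + 1) := lt_of_lt_of_le hbd.2 (Nat.pow_le_pow_right (by omega) (by omega))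
    have p1 : L + 1 - h = L - h + 1 := by omega
    have p2 : L + 1 - (h + 1) = L - h := by omega
    have hcv := hc v (by omega) hvl
    rw [if_neg (by rw [p1]; omega)] at hcv
    have hmem : i ∈ blk L v := (mem_blk hhL hbd.1 hbd.2).2 ⟨hiL, rfl⟩
    refine ⟨6, (L + 1 - (h + 1)) * 7 + 1, by omega, Runs.code _ (by simp) ⟨hk.trans
      ⟨fun j hj => ?_, fun j hj => ?_, rfl, rfl, fun a ha => ?_, fun a ha => ?_⟩, ?_, ?_, h + 1,
      by omega, rfl, ?_, ?_⟩⟩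
    · simp (disch := omega)
    · simp (disch := omega)
    · simp (disch := omega) [e6, h19]
    · simp (disch := omega) [e6, h19]
    · simp (disch := omega) [h17]
    · simp (disch := omega) [h22]
    · simp (disch := omega) [h19]
      rw [← heap_half]
    · intro w hw hw'
      rcases eq_or_ne w v with rfl | hne
      · rw [if_pos (by rw [p2]; exact hbd.1), Finset.insert_inter_of_mem hmem,
          Finset.card_insert_of_notMem fun h => hiB (Finset.mem_inter.1 h).1]
        simp (disch := omega) [e6, h19, e7, hcv]
      · have : (List.foldl State.step s' [.nadd 20 6 19, .nload 21 20, .nadd 21 21 7,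
            .nstore 20 21, .nhalf 19 19]).nmem (E + w) = s'.nmem (E + w) := by
          simp (disch := omega) [e6, h19]
        rw [this, hc w hw hw', p1, p2]
        rcases Nat.lt_or_ge w (2 ^ (L - h)) with h1 | h1
        · rw [if_neg (by rw [pow_succ]; omega), if_neg (by omega)]
        · rw [if_pos h1]
          split_ifs with h2
          · rfl
          · rw [Finset.insert_inter_of_notMem]
            rw [mem_blk hhL h1 (by omega)]
            rintro ⟨-, h3⟩
            exact hne (h3.symm.trans hv.symm)
  · rintro T s' ⟨hk, h17, h22, h, hh, rfl, h19, hc⟩ hb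
    have hok : Ok l Q s' := by subst hL hE; exact hk.ok hs
    rw [State.holds_nlt, hok.zero, h19] at hb
    refine ⟨by omega, hk, fun v hv hv' => ?_, h17, h22⟩
    rw [hc v hv hv', if_pos]
    have : ¬ h ≤ L := by
      intro hhL
      have := (heap_div_bounds hhL hiL).1
      have : 0 < 2 ^ (L - h) := by positivity
      omega
    rw [show L + 1 - h = 0 by omega]; simpa using hv
  · refine ⟨⟨fun j hj => ?_, fun j hj => ?_, rfl, rfl, fun _ _ => rfl, fun _ _ => rfl⟩, ?_, ?_, 0,
      by omega, by omega, ?_, fun v hv hv' => ?_⟩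
    · simp (disch := omega)
    · simp (disch := omega)
    · simp (disch := omega)
    · simp (disch := omega)
    · have := hs.width
      rw [hL] at this
      simp (disch := omega) [this, hi]
    · rw [if_neg (by simpa using hv')]
      exact hB v hv hv'

/-- Descend from the root, to the left whenever the counter there is positive; this follows the path
to the least element, and the counters on it are lowered on the way. Here the upper part of the
tree, above the current height, is the part already updated. -/
theorem dequeue_runs {l : Layout d} {Q : Box} {s : State} {B : Finset ℕ} {m : ℕ}
    (hs : Ok l Q s) (hB : Counts l.L l.E s.nmem B) (hBL : ∀ x ∈ B, x < 2 ^ l.L)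
    (hm : m ∈ B) (hmin : ∀ x ∈ B, m ≤ x) :
    Runs A dequeue s (l.L * 12 + 10) fun s' => KeepCounts l.L l.E s s' ∧
      Counts l.L l.E s'.nmem (B.erase m) ∧ s'.nreg 17 = m := by
  generalize hL : l.L = L at *
  generalize hE : l.E = E at *
  have hmL := hBL m hm
  have e7 := hs.one
  have e8 := hs.zero
  have hdec : ∀ v, m ∈ blk L v → (B ∩ blk L v).card - 1 = (B.erase m ∩ blk L v).card := by
    intro v hv
    rw [Finset.erase_inter, Finset.card_erase_of_mem (Finset.mem_inter.2 ⟨hm, hv⟩)]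
  have hsame : ∀ v, m ∉ blk L v → (B ∩ blk L v).card = (B.erase m ∩ blk L v).card := by
    intro v hv
    rw [Finset.erase_inter, Finset.erase_eq_of_notMem fun h => hv (Finset.mem_inter.1 h).2]
  refine Runs.seq 2 (L * 12 + 8) (by omega) (Runs.code _ (by simp) ?_)
  refine Runs.seq (L * 12 + 1) 6 (by omega) ?_
  refine (Runs.while (Q := fun s' => KeepCounts L E s s' ∧ s'.nreg 19 = 2 ^ L + m ∧
      ∀ v, 1 ≤ v → v < 2 ^ (L + 1) → s'.nmem (E + v) =
      if v < 2 ^ L then (B.erase m ∩ blk L v).card else (B ∩ blk L v).card)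
    (fun T s' => KeepCounts L E s s' ∧ ∃ h ≤ L,
    T = h * 12 + 1 ∧ s'.nreg 19 = (2 ^ L + m) / 2 ^ h ∧
    ∀ v, 1 ≤ v → v < 2 ^ (L + 1) → s'.nmem (E + v) =
      if v < 2 ^ (L - h) then (B.erase m ∩ blk L v).card else (B ∩ blk L v).card)
    ?_ ?_ _ _ ?_).mono le_rfl ?_
  · rintro T s' ⟨hk, h, hh, rfl, h19, hc⟩ hb
    have hok : Ok l Q s' := by subst hL hE; exact hk.ok hs
    have e7 := hok.one
    have e8 := hok.zero
    have e6 := hok.free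
    have e5 := hok.width
    rw [hE] at e6
    rw [hL] at e5
    rw [State.holds_nlt, e5, h19] at hb
    obtain ⟨k, rfl⟩ : ∃ k, h = k + 1 := ⟨h - 1, by
      rcases h with _ | h
      · simp at hb
      · simp⟩
    have hbd := heap_div_bounds hh hmL
    have hbk := heap_div_bounds (show k ≤ L by omega) hmL
    have hhf := heap_half L k m
    set v := (2 ^ L + m) / 2 ^ (k + 1) with hv
    have p1 : 2 ^ (L - k) = 2 * 2 ^ (L - (k + 1)) := by
      rw [show L - k = L - (k + 1) + 1 by omega, pow_succ]; ring
    have p2 : 2 ^ (L - k + 1) = 4 * 2 ^ (L - (k + 1)) := by rw [pow_succ, p1]; ring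
    have p3 : 2 ^ (L - (k + 1) + 1) = 2 * 2 ^ (L - (k + 1)) := by rw [pow_succ]; ring
    have p4 : 2 ^ (L - k + 1) ≤ 2 ^ (L + 1) := Nat.pow_le_pow_right (by omega) (by omega)
    have p0 : 0 < 2 ^ (L - (k + 1)) := by positivity
    have hmv : m ∈ blk L v := (mem_blk hh hbd.1 hbd.2).2 ⟨hmL, rfl⟩
    have hcv := hc v (by omega) (by omega)
    rw [if_neg (by omega)] at hcv
    have hc2 := hc (v + v) (by omega) (by omega)
    rw [if_neg (by omega)] at hc2
    have m2 : ∀ x, x ∈ blk L (v + v) ↔ x < 2 ^ L ∧ (2 ^ L + x) / 2 ^ k = v + v := fun x =>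
      mem_blk (by omega) (by omega) (by omega)
    refine ⟨11, k * 12 + 1, by omega, ?_⟩
    refine Runs.seq 8 3 (by omega) (Runs.code _ (by simp) ?_)
    set s1 := List.foldl State.step s' [.nadd 20 6 19, .nload 21 20, .nsub 21 21 7, .nstore 20 21,
      .nadd 19 19 19, .nadd 20 6 19, .nload 21 20] with hs1
    have k1 : KeepCounts L E s' s1 := by
      refine ⟨fun j hj => ?_, fun j hj => ?_, rfl, rfl, fun a ha => ?_, fun a ha => ?_⟩
      · simp (disch := omega) [hs1]
      · simp (disch := omega) [hs1]
      · simp (disch := omega) [hs1, e6, h19]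
      · simp (disch := omega) [hs1, e6, h19]
    have g19 : s1.nreg 19 = v + v := by simp (disch := omega) [hs1, h19]
    have g21 : s1.nreg 21 = (B ∩ blk L (v + v)).card := by
      simp (disch := omega) [hs1, h19, e6, hc2]
    have gm : ∀ w, 1 ≤ w → w < 2 ^ (L + 1) → s1.nmem (E + w) =
      if w < 2 ^ (L - k) then (B.erase m ∩ blk L w).card else (B ∩ blk L w).card := by
      intro w hw hw'
      rcases eq_or_ne w v with rfl | hne
      · rw [if_pos (by omega), ← hdec _ hmv]
        simp (disch := omega) [hs1, h19, e6, e7, hcv]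
      · have : s1.nmem (E + w) = s'.nmem (E + w) := by
          simp (disch := omega) [hs1, e6, h19]
        rw [this, hc w hw hw']
        rcases Nat.lt_or_ge w (2 ^ (L - (k + 1))) with h1 | h1
        · rw [if_pos h1, if_pos (by omega)]
        · rw [if_neg (by omega)]
          split_ifs with h2
          · refine hsame w ?_
            rw [mem_blk hh h1 (by omega)]
            rintro ⟨-, h3⟩
            exact hne (h3.symm.trans hv.symm)
          · rfl
    clear_value s1
    have z8 := (k1.low 8 (by omega)).trans e8
    have z7 := (k1.low 7 (by omega)).trans e7
    refine Runs.ite 2 le_rfl (fun h0 => Runs.code _ (by simp) ?_) (fun h0 => Runs.nop (by omega) ?_)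
    all_goals rw [State.holds_neq, z8, g21, Finset.card_eq_zero] at h0
    · refine ⟨hk.trans (k1.trans
        ⟨fun j hj => ?_, fun j hj => ?_, rfl, rfl, fun a ha => rfl, fun a ha => rfl⟩), k, by omega,
        rfl, ?_, gm⟩
      · simp (disch := omega)
      · simp (disch := omega)
      · have : m ∉ blk L (v + v) := fun h => by
          have := Finset.mem_inter.2 ⟨hm, h⟩
          rw [h0] at this; simp at this
        rw [m2] at this
        simp (disch := omega) [g19, z7]
        omega
    · refine ⟨hk.trans k1, k, by omega, rfl, ?_, gm⟩
      rw [g19]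
      obtain ⟨x, hx⟩ := Finset.nonempty_iff_ne_empty.2 h0
      rw [Finset.mem_inter, m2] at hx
      -- Some element `x` lies below the left child. Since `m ≤ x`, the path to `m` cannot turn
      -- right.
      have : (2 ^ L + m) / 2 ^ k ≤ (2 ^ L + x) / 2 ^ k :=
        Nat.div_le_div_right (by have := hmin x hx.1; omega)
      omega
  · rintro T s' ⟨hk, h, hh, rfl, h19, hc⟩ hb
    have hok : Ok l Q s' := by subst hL hE; exact hk.ok hs
    have e5 := hok.width
    rw [hL] at e5
    rw [State.holds_nlt, e5, h19] at hb
    obtain rfl : h = 0 := by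
      by_contra hne
      have := (heap_div_bounds hh hmL).2
      have : 2 ^ (L - h + 1) ≤ 2 ^ L := Nat.pow_le_pow_right (by omega) (by omega)
      omega
    exact ⟨by omega, hk, by simpa using h19, by simpa using hc⟩
  · refine ⟨⟨fun j hj => ?_, fun j hj => ?_, rfl, rfl, fun _ _ => rfl, fun _ _ => rfl⟩, L, le_rfl,
      rfl, ?_, fun v hv hv' => ?_⟩
    · simp (disch := omega)
    · simp (disch := omega)
    · have := heap_div_bounds (le_refl L) hmL
      simp only [Nat.sub_self] at this
      simp (disch := omega) [e7, e8]
      omega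
    · rw [if_neg (by simp; omega)]
      exact hB v hv hv'
  · rintro s' ⟨hk, h19, hc⟩
    have hok : Ok l Q s' := by subst hL hE; exact hk.ok hs
    have e7 := hok.one
    have e6 := hok.free
    have e5 := hok.width
    rw [hE] at e6
    rw [hL] at e5
    have pL : 2 ^ (L + 1) = 2 * 2 ^ L := by rw [pow_succ]; ring
    have hmb : m ∈ blk L (2 ^ L + m) :=
      (mem_blk (h := 0) (by omega) (by simp) (by simp [pow_succ]; omega)).2 ⟨hmL, by simp⟩
    have hcm := hc (2 ^ L + m) (by omega) (by omega)
    rw [if_neg (by omega)] at hcm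
    refine Runs.code _ (by simp) ⟨hk.trans ⟨fun j hj => ?_, fun j hj => ?_, rfl, rfl,
      fun a ha => ?_, fun a ha => ?_⟩, fun v hv hv' => ?_, ?_⟩
    · simp (disch := omega)
    · simp (disch := omega)
    · simp (disch := omega) [e6, h19]
    · simp (disch := omega) [e6, h19]
    · rcases eq_or_ne v (2 ^ L + m) with rfl | hne
      · rw [← hdec _ hmb]
        simp (disch := omega) [h19, e6, e7, hcm]
      · have : (List.foldl State.step s' [.nadd 20 6 19, .nload 21 20, .nsub 21 21 7,
            .nstore 20 21, .nsub 17 19 5]).nmem (E + v) = s'.nmem (E + v) := by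
          simp (disch := omega) [e6, h19]
        rw [this, hc v hv hv']
        split_ifs with h1
        · rfl
        · refine hsame v ?_
          rw [mem_blk (h := 0) (by omega) (by simpa using not_lt.1 h1) (by simpa using hv')]
          rintro ⟨-, h3⟩
          simp at h3
          omega
    · simp (disch := omega) [h19, e5]

end Queue

/-! ## The tree -/

section Tree

variable {d : ℕ} {A : Procedures d}

/-- The nodes of a layout form a binary tree of point sets `nd i`, which are cut out by the boxes of
the nodes. The nodes `1, …, n - 1` are inner nodes, the nodes `n, …, 2 * n - 1` are leaves. -/
structure Tree (l : Layout d) (nd : ℕ → Finset ℕ) : Prop where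
  subset : ∀ i, 1 ≤ i → i < 2 * l.n → nd i ⊆ Finset.Icc 1 l.n
  mem_iff : ∀ i, 1 ≤ i → i < 2 * l.n → ∀ p ∈ Finset.Icc 1 l.n,
    (p ∈ nd i ↔ ∀ a < d, l.bl a i ≤ l.co a p ∧ l.co a p ≤ l.bh a i)
  lo_attained : ∀ i, 1 ≤ i → i < 2 * l.n → ∀ a < d, ∃ p ∈ nd i, l.co a p = l.bl a i
  hi_attained : ∀ i, 1 ≤ i → i < 2 * l.n → ∀ a < d, ∃ p ∈ nd i, l.co a p = l.bh a i
  rep_mem : ∀ i, 1 ≤ i → i < 2 * l.n → l.rp i ∈ nd i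
  root : nd 1 = Finset.Icc 1 l.n
  left_gt : ∀ i, 1 ≤ i → i < l.n → i < l.lc i ∧ l.lc i < 2 * l.n
  right_gt : ∀ i, 1 ≤ i → i < l.n → i < l.rc i ∧ l.rc i < 2 * l.n
  union : ∀ i, 1 ≤ i → i < l.n → nd i = nd (l.lc i) ∪ nd (l.rc i)
  disjoint : ∀ i, 1 ≤ i → i < l.n → Disjoint (nd (l.lc i)) (nd (l.rc i))
  lca_valid : ∀ u v, 1 ≤ u → u ≤ v → v ≤ l.n → 1 ≤ l.lcaId u v ∧ l.lcaId u v < 2 * l.n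
  lca_mem : ∀ u v, 1 ≤ u → u ≤ v → v ≤ l.n → ∀ p, u ≤ p → p ≤ v → p ∈ nd (l.lcaId u v)
  lca_subset : ∀ u v, 1 ≤ u → u ≤ v → v ≤ l.n → ∀ i, 1 ≤ i → i < 2 * l.n → u ∈ nd i → v ∈ nd i →
    i ≤ l.lcaId u v ∧ nd (l.lcaId u v) ⊆ nd i
  lca_split : ∀ u v, 1 ≤ u → u ≤ v → v ≤ l.n → l.lcaId u v < l.n →
    u ∈ nd (l.lc (l.lcaId u v)) ∧ v ∈ nd (l.rc (l.lcaId u v))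
  lca_le : ∀ i, 1 ≤ i → i < l.n → ∀ u ∈ nd (l.lc i), ∀ v ∈ nd (l.rc i), u < v ∧ l.lcaId u v ≤ i

/-- The points in the query box. -/
def inQuery (l : Layout d) (Q : Box) : Finset ℕ := boxSel l.co Q.lo Q.hi d (Finset.Icc 1 l.n)

/-- Both children of an inner node meet the query box. -/
def Tight (l : Layout d) (nd : ℕ → Finset ℕ) (Q : Box) (i : ℕ) : Prop :=
  i < l.n → (nd (l.lc i) ∩ inQuery l Q).Nonempty ∧ (nd (l.rc i) ∩ inQuery l Q).Nonempty

/-- The outcome of the examination of node `i`. -/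
def Found (l : Layout d) (nd : ℕ → Finset ℕ) (Q : Box) (i m r : ℕ) : Prop :=
  (m = 0 ∧ nd i ∩ inQuery l Q = ∅) ∨
    (i ≤ m ∧ m < 2 * l.n ∧ nd m ⊆ nd i ∧ nd i ∩ inQuery l Q ⊆ nd m ∧
      r ∈ nd m ∩ inQuery l Q ∧ Tight l nd Q m)

variable {l : Layout d} {nd : ℕ → Finset ℕ} {Q : Box}

/-- The boxes of the nodes are bounding boxes: every side is attained by a point of the node. Hence
containment of the box can be read off from the points. -/
theorem Tree.inside_iff (ht : Tree l nd) {i : ℕ} (hi1 : 1 ≤ i) (hi2 : i < 2 * l.n) :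
    Inside l Q i ↔ nd i ⊆ inQuery l Q := by
  constructor
  · intro h p hp
    have hpn := ht.subset i hi1 hi2 hp
    have := (ht.mem_iff i hi1 hi2 p hpn).1 hp
    rw [inQuery, mem_boxSel]
    exact ⟨hpn, fun a ha => ⟨(h a ha).1.trans (this a ha).1, (this a ha).2.trans (h a ha).2⟩⟩
  · intro h a ha
    obtain ⟨p, hp, hpa⟩ := ht.lo_attained i hi1 hi2 a ha
    obtain ⟨q, hq, hqa⟩ := ht.hi_attained i hi1 hi2 a ha
    have h1 := h hp
    have h2 := h hq
    rw [inQuery, mem_boxSel] at h1 h2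
    rw [← hpa, ← hqa]
    exact ⟨(h1.2 a ha).1, (h2.2 a ha).2⟩

/-- A node consists of all points in its box, so intersecting boxes intersects point sets. -/
theorem Tree.clip (ht : Tree l nd) {i : ℕ} (hi1 : 1 ≤ i) (hi2 : i < 2 * l.n) :
    boxSel l.co (clipLo l Q i) (clipHi l Q i) d (Finset.Icc 1 l.n) = nd i ∩ inQuery l Q := by
  ext p
  rw [Finset.mem_inter, inQuery, mem_boxSel, mem_boxSel]
  constructor
  · rintro ⟨hp, h⟩
    rw [ht.mem_iff i hi1 hi2 p hp]
    refine ⟨fun a ha => ?_, hp, fun a ha => ?_⟩ <;> have := h a ha <;>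
      simp only [clipLo, clipHi, max_le_iff, le_min_iff] at this
    · exact ⟨this.1.2, this.2.2⟩
    · exact ⟨this.1.1, this.2.1⟩
  · rintro ⟨h1, hp, h2⟩
    rw [ht.mem_iff i hi1 hi2 p hp] at h1
    refine ⟨hp, fun a ha => ?_⟩
    simp only [clipLo, clipHi, max_le_iff, le_min_iff]
    exact ⟨⟨(h2 a ha).1, (h1 a ha).1⟩, (h2 a ha).2, (h1 a ha).2⟩

/-- For every axis and direction, node `m` contains a point of `X` that is extreme there. So the box
of `m` contains the bounding box of `X`, and since the node consists of all points in its box, it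
contains `X`. -/
theorem Tree.subset_of_spread (ht : Tree l nd) {X : Finset ℕ} {u v m : ℕ}
    (hX : X ⊆ Finset.Icc 1 l.n) (hm1 : 1 ≤ m) (hm2 : m < 2 * l.n)
    (hs : ∀ j < 2 * d, ∃ p ∈ X, u ≤ p ∧ p ≤ v ∧ ∀ y ∈ X, copyCo l.co j 1 y ≤ copyCo l.co j 1 p)
    (hm : ∀ p, u ≤ p → p ≤ v → p ∈ nd m) : X ⊆ nd m := by
  intro y hy
  rw [ht.mem_iff m hm1 hm2 y (hX hy)]
  intro a ha
  have hax : ∀ j, j / 2 = a → copyAxis j 1 = a := by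
    rintro j rfl
    simp [copyAxis]
  constructor
  · obtain ⟨p, hpX, h1, h2, h3⟩ := hs (2 * a + 1) (by omega)
    have := h3 y hy
    rw [copyCo, copyCo, if_neg (by omega), if_neg (by omega), hax _ (by omega),
      neg_le_neg_iff] at this
    exact (((ht.mem_iff m hm1 hm2 p (hX hpX)).1 (hm p h1 h2)) a ha).1.trans this
  · obtain ⟨p, hpX, h1, h2, h3⟩ := hs (2 * a) (by omega)
    have := h3 y hy
    rw [copyCo, copyCo, if_pos (by omega), if_pos (by omega), hax _ (by omega)] at this
    exact this.trans (((ht.mem_iff m hm1 hm2 p (hX hpX)).1 (hm p h1 h2)) a ha).2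

-- Tightness of the result: for a node inside the query box each child contains points, all of them
-- in the query; for a lowest common ancestor, `u` is in the left and `v` in the right child, and
-- both are in the query. The point returned with the node becomes its stored representative.
open Classical in
theorem examine_found {s : State} {i : ℕ} (hd : 2 ≤ d) (hl : l.Valid) (ht : Tree l nd)
    (hs : Ok l Q s) (h23 : s.nreg 23 = i) (hi1 : 1 ≤ i) (hi2 : i < 2 * l.n) :
    Runs A (examine d) s (insideTime d + if Inside l Q i then 0 else crossTime d l.L l.Λ)
      fun s' => Keep d s s' ∧ Found l nd Q i (s'.nreg 24) (s'.nreg 25) := by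
  refine (examine_runs hd hl hs h23 hi1 hi2).mono le_rfl ?_
  rintro s' ⟨hk, h⟩
  refine ⟨hk, ?_⟩
  rw [ht.clip hi1 hi2] at h
  rcases h with ⟨h1, h2, h3⟩ | ⟨h1, h2⟩ | ⟨u, v, h1, h2, h3, h4⟩
  · rw [ht.inside_iff hi1 hi2] at h1
    have hr := ht.rep_mem i hi1 hi2
    refine Or.inr ⟨h2.ge, by omega, by rw [h2], by rw [h2]; exact Finset.inter_subset_left,
      by rw [h2, h3]; exact Finset.mem_inter.2 ⟨hr, h1 hr⟩, fun hn => ?_⟩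
    rw [h2] at hn ⊢
    have hl' := ht.left_gt i hi1 hn
    have hr' := ht.right_gt i hi1 hn
    have hu := ht.union i hi1 hn
    have a1 := ht.rep_mem (l.lc i) (by omega) hl'.2
    have a2 := ht.rep_mem (l.rc i) (by omega) hr'.2
    exact ⟨⟨_, Finset.mem_inter.2 ⟨a1, h1 (by rw [hu]; exact Finset.mem_union_left _ a1)⟩⟩,
      ⟨_, Finset.mem_inter.2 ⟨a2, h1 (by rw [hu]; exact Finset.mem_union_right _ a2)⟩⟩⟩
  · exact Or.inl ⟨h2, h1⟩
  · obtain ⟨b1, b2, b3, b4⟩ := h1.resolve_left fun h => h2 h.1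
    have hXn : nd i ∩ inQuery l Q ⊆ Finset.Icc 1 l.n :=
      Finset.inter_subset_left.trans (ht.subset i hi1 hi2)
    have c1 := Finset.mem_Icc.1 (hXn b1)
    have c2 := Finset.mem_Icc.1 (hXn b2)
    rw [Finset.mem_inter] at b1 b2
    have v1 := ht.lca_valid u v c1.1 b3 c2.2
    have v2 := ht.lca_subset u v c1.1 b3 c2.2 i hi1 hi2 b1.1 b2.1
    have v3 := ht.lca_mem u v c1.1 b3 c2.2
    have v4 := ht.lca_split u v c1.1 b3 c2.2
    rw [h3, h4]
    refine Or.inr ⟨v2.1, v1.2, v2.2, ht.subset_of_spread hXn v1.1 v1.2 b4 v3,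
      Finset.mem_inter.2 ⟨v3 u le_rfl b3, b1.2⟩, fun hn => ?_⟩
    exact ⟨⟨u, Finset.mem_inter.2 ⟨(v4 hn).1, b1.2⟩⟩, ⟨v, Finset.mem_inter.2 ⟨(v4 hn).2, b2.2⟩⟩⟩

end Tree

/-! ## Refining a node -/

section Refine

variable {d : ℕ} {A : Procedures d}

/-- The addresses of the table of representatives and of the stack are in the registers `16` and
`11`. -/
structure Ready (l : Layout d) (Q : Box) (s : State) : Prop extends Ok l Q s where
  reps : s.nreg 16 = l.E + 2 ^ (l.L + 1)
  base : s.nreg 11 = l.E + 2 ^ (l.L + 1) + 2 ^ l.L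

/-- The contents of the stack. -/
def Stack (l : Layout d) (s : State) (st : List ℕ) : Prop :=
  s.nreg 10 = l.E + 2 ^ (l.L + 1) + 2 ^ l.L + st.length ∧
    ∀ j (hj : j < st.length), s.nmem (l.E + 2 ^ (l.L + 1) + 2 ^ l.L + j) = st[j]

/-- A point of node `i` in the query box is stored in the table of representatives. -/
def HasRep (l : Layout d) (nd : ℕ → Finset ℕ) (Q : Box) (s : State) (i : ℕ) : Prop :=
  s.nmem (l.E + 2 ^ (l.L + 1) + i) ∈ nd i ∩ inQuery l Q

/-- What refining a node may change. -/
structure KeepRefine (l : Layout d) (nd : ℕ → Finset ℕ) (Q : Box) (s s' : State) : Prop where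
  low : ∀ i < 20, i ≠ 10 → s'.nreg i = s.nreg i
  field : ∀ i, 30 ≤ i → i < scratch d → s'.nreg i = s.nreg i
  rreg : ∀ i < 2 * d + 4, s'.rreg i = s.rreg i
  rmem : s'.rmem = s.rmem
  below : ∀ a < l.E + 2 ^ (l.L + 1), s'.nmem a = s.nmem a
  hasRep : ∀ i < 2 * l.n, HasRep l nd Q s i → HasRep l nd Q s' i

variable {l : Layout d} {nd : ℕ → Finset ℕ} {Q : Box}

theorem KeepRefine.trans {s s' s'' : State} (h : KeepRefine l nd Q s s')
    (h' : KeepRefine l nd Q s' s'') : KeepRefine l nd Q s s'' :=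
  ⟨fun i hi hn => (h'.low i hi hn).trans (h.low i hi hn),
    fun i hi hi' => (h'.field i hi hi').trans (h.field i hi hi'),
    fun i hi => (h'.rreg i hi).trans (h.rreg i hi), h'.rmem.trans h.rmem,
    fun a ha => (h'.below a ha).trans (h.below a ha),
    fun i hi hr => h'.hasRep i hi (h.hasRep i hi hr)⟩

theorem KeepRefine.ready {s s' : State} (h : KeepRefine l nd Q s s') (hs : Ready l Q s) :
    Ready l Q s' where
  width := (h.low 5 (by omega) (by omega)).trans hs.width
  free := (h.low 6 (by omega) (by omega)).trans hs.free
  one := (h.low 7 (by omega) (by omega)).trans hs.one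
  zero := (h.low 8 (by omega) (by omega)).trans hs.zero
  field j hj := (h.field _ (by omega) (by simp only [numFields, scratch] at *; omega)).trans
    (hs.field j hj)
  nmem a ha := (h.below a (lt_of_lt_of_le ha (Nat.le_add_right _ _))).trans (hs.nmem a ha)
  rmem a ha := by rw [h.rmem]; exact hs.rmem a ha
  lo a ha := (h.rreg _ (by omega)).trans (hs.lo a ha)
  hi a ha := (h.rreg _ (by omega)).trans (hs.hi a ha)
  eps := (h.rreg _ (by omega)).trans hs.eps
  rzero := (h.rreg _ (by omega)).trans hs.rzero
  reps := (h.low 16 (by omega) (by omega)).trans hs.reps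
  base := (h.low 11 (by omega) (by omega)).trans hs.base

theorem Keep.refine {s s' : State} (h : Keep d s s') : KeepRefine l nd Q s s' :=
  ⟨fun i hi _ => h.low i (by omega), h.field, h.rreg, h.rmem, fun a _ => by rw [h.nmem],
    fun i _ hr => by rw [HasRep, h.nmem]; exact hr⟩

/-- Examine the child of the node in register `17` that is given in field `j`, and push the result
onto the stack. -/
def visitChild (d j : ℕ) : Cmd :=
  .seq (code [.nadd 20 (30 + j) 17, .nload 23 20])
  (.seq (examine d)
  (.ite (.nlt 8 24) (code [.nadd 20 16 24, .nstore 20 25, .nstore 10 24, .nadd 10 10 7]) nop))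

/-- Push the nodes found below the children of the node in register `17` onto the stack. -/
def refineNode (d : ℕ) : Cmd := .seq (visitChild d 0) (visitChild d 1)

/-- The list of the nodes found. -/
def foundList (m : ℕ) : List ℕ := if m = 0 then [] else [m]

theorem Stack.snoc {s : State} {st : List ℕ} {x : ℕ}
    (h10 : s.nreg 10 = l.E + 2 ^ (l.L + 1) + 2 ^ l.L + (st.length + 1))
    (h : ∀ j (hj : j < st.length), s.nmem (l.E + 2 ^ (l.L + 1) + 2 ^ l.L + j) = st[j])
    (hx : s.nmem (l.E + 2 ^ (l.L + 1) + 2 ^ l.L + st.length) = x) :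
    Stack l s (st ++ [x]) := by
  refine ⟨by simpa using h10, fun j hj => ?_⟩
  rw [List.length_append, List.length_singleton] at hj
  rcases Nat.lt_or_ge j st.length with h1 | h1
  · rw [List.getElem_append_left h1]; exact h j h1
  · obtain rfl : j = st.length := by omega
    simpa using hx

open Classical in
theorem visitChild_runs {s : State} {st : List ℕ} {j i : ℕ} (hd : 2 ≤ d) (hl : l.Valid)
    (ht : Tree l nd) (hs : Ready l Q s) (hst : Stack l s st) (hj : j < 2)
    (hi : s.nmem (j * 2 ^ l.L + s.nreg 17) = i) (hi1 : 1 ≤ i) (hi2 : i < 2 * l.n) :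
    Runs A (visitChild d j) s
      (insideTime d + 9 + if Inside l Q i then 0 else crossTime d l.L l.Λ)
      fun s' => KeepRefine l nd Q s s' ∧ ∃ m r, Found l nd Q i m r ∧
        Stack l s' (st ++ foundList m) ∧ ∀ x ∈ foundList m, HasRep l nd Q s' x := by
  set C := if Inside l Q i then 0 else crossTime d l.L l.Λ with hC
  have hf := hs.field j (by simp only [numFields]; omega)
  refine Runs.seq 3 (insideTime d + 6 + C) (by omega) (Runs.code _ (by simp) ?_)
  set s1 := List.foldl State.step s [.nadd 20 (30 + j) 17, .nload 23 20] with hs1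
  have k1 : KeepRefine l nd Q s s1 := by
    refine ⟨fun i hi _ => ?_, fun i hi hi' => ?_, fun _ _ => rfl, rfl, fun _ _ => rfl,
      fun _ _ h => h⟩
    · simp (disch := omega) [hs1]
    · simp (disch := omega) [hs1]
  have g23 : s1.nreg 23 = i := by simp (disch := omega) [hs1, hf, hi]
  have st1 : Stack l s1 st := by
    refine ⟨?_, hst.2⟩
    rw [← hst.1]; simp (disch := omega) [hs1]
  clear_value s1
  have hr1 := k1.ready hs
  refine Runs.seq (insideTime d + C) 6 (by omega) ?_
  refine (examine_found hd hl ht hr1.toOk g23 hi1 hi2).mono le_rfl ?_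
  rintro s2 ⟨k2, hf2⟩
  have hr2 := (k2.refine (l := l) (nd := nd) (Q := Q)).ready hr1
  have st2 : Stack l s2 st := by
    refine ⟨(k2.low 10 (by omega)).trans st1.1, ?_⟩
    rw [k2.nmem]; exact st1.2
  have e8 := hr2.zero
  have e7 := hr2.one
  have e16 := hr2.reps
  have e10 := st2.1
  have hlw := hl.lt_width
  refine Runs.ite 5 le_rfl (fun h => Runs.code _ (by simp) ?_) (fun h => Runs.nop (by omega) ?_)
  all_goals rw [State.holds_nlt, e8] at h
  · rcases hf2 with h2 | h2
    · omega
    set m := s2.nreg 24 with hm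
    set r := s2.nreg 25 with hrr
    have hm2 := h2.2.1
    refine ⟨(k1.trans k2.refine).trans ⟨fun i hi _ => ?_, fun i hi hi' => ?_, fun _ _ => rfl, rfl,
      fun a ha => ?_, fun i hi hh => ?_⟩, m, r, Or.inr h2, ?_, ?_⟩
    · simp (disch := omega)
    · simp (disch := omega)
    · simp (disch := omega) [e16, e10]
    · rcases eq_or_ne i m with rfl | hne
      · simp (disch := omega) [HasRep, e16, e10, ← hm, ← hrr]
        simpa using h2.2.2.2.2.1
      · simp only [HasRep] at hh ⊢
        simpa (disch := omega) [e16, e10, ← hm] using hh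
    · rw [foundList, if_neg (by omega)]
      refine Stack.snoc ?_ (fun j hj => ?_) ?_
      · simp (disch := omega) [e10, e7]; omega
      · have := st2.2 j hj
        simpa (disch := omega) [e16, e10, ← hm] using this
      · simp (disch := omega) [e16, e10, ← hm]
    · rw [foundList, if_neg (by omega)]
      intro x hx
      rw [List.mem_singleton] at hx
      subst hx
      simp (disch := omega) [HasRep, e16, e10, ← hm, ← hrr]
      simpa using h2.2.2.2.2.1
  · refine ⟨k1.trans k2.refine, 0, s2.nreg 25, ?_, by simpa [foundList] using st2,
      by simp [foundList]⟩
    have : s2.nreg 24 = 0 := by omega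
    rwa [this] at hf2

/-- Time of `refineNode`. -/
def refineTime (d L Λ : ℕ) (inside : Bool) : ℕ :=
  2 * insideTime d + 18 + if inside then 0 else 2 * crossTime d L Λ

-- The children of a node inside the query box are inside too. So the cost of range searches can be
-- charged to the refined node: it is due only if this node itself is not inside.
open Classical in
theorem refineNode_runs {s : State} {st : List ℕ} {i : ℕ} (hd : 2 ≤ d) (hl : l.Valid)
    (ht : Tree l nd) (hs : Ready l Q s) (hst : Stack l s st)
    (hi : s.nreg 17 = i) (hi1 : 1 ≤ i) (hi2 : i < l.n) :
    Runs A (refineNode d) s (refineTime d l.L l.Λ (Inside l Q i))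
      fun s' => KeepRefine l nd Q s s' ∧ ∃ m₁ r₁ m₂ r₂, Found l nd Q (l.lc i) m₁ r₁ ∧
        Found l nd Q (l.rc i) m₂ r₂ ∧ Stack l s' (st ++ foundList m₁ ++ foundList m₂) ∧
        ∀ x ∈ foundList m₁ ++ foundList m₂, HasRep l nd Q s' x := by
  have hst0 := hs.toOk.stored hl
  have hlc := ht.left_gt i hi1 hi2
  have hrc := ht.right_gt i hi1 hi2
  have hu := ht.union i hi1 hi2
  have hin1 : Inside l Q i → Inside l Q (l.lc i) := by
    rw [ht.inside_iff hi1 (by omega), ht.inside_iff (by omega) hlc.2, hu]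
    exact fun h => Finset.subset_union_left.trans h
  have hin2 : Inside l Q i → Inside l Q (l.rc i) := by
    rw [ht.inside_iff hi1 (by omega), ht.inside_iff (by omega) hrc.2, hu]
    exact fun h => Finset.subset_union_right.trans h
  set C := if Inside l Q i then 0 else crossTime d l.L l.Λ with hC
  have hC1 : (if Inside l Q (l.lc i) then 0 else crossTime d l.L l.Λ) ≤ C := by
    split_ifs with h1
    · omega
    · rw [hC, if_neg fun h => h1 (hin1 h)]
  have hC2 : (if Inside l Q (l.rc i) then 0 else crossTime d l.L l.Λ) ≤ C := by
    split_ifs with h1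
    · omega
    · rw [hC, if_neg fun h => h1 (hin2 h)]
  have hT : refineTime d l.L l.Λ (Inside l Q i) = 2 * insideTime d + 18 + 2 * C := by
    rw [refineTime, hC]
    by_cases h : Inside l Q i <;> simp [h]
  refine Runs.seq (insideTime d + 9 + C) (insideTime d + 9 + C) (by omega) ?_
  refine (visitChild_runs hd hl ht hs hst (j := 0) (i := l.lc i) (by omega)
    (by rw [hi]; exact hst0.left i hi1 hi2) (by omega) hlc.2).mono (by omega) ?_
  rintro s1 ⟨k1, m1, r1, f1, st1, hr1⟩
  have hs1 := k1.ready hs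
  have h17 := (k1.low 17 (by omega) (by omega)).trans hi
  refine (visitChild_runs hd hl ht hs1 st1 (j := 1) (i := l.rc i) (by omega)
    (by rw [h17]; exact (hs1.toOk.stored hl).right i hi1 hi2) (by omega) hrc.2).mono (by omega) ?_
  rintro s2 ⟨k2, m2, r2, f2, st2, hr2⟩
  refine ⟨k1.trans k2, m1, r1, m2, r2, f1, f2, st2, fun x hx => ?_⟩
  rcases List.mem_append.1 hx with h | h
  · refine k2.hasRep x ?_ (hr1 x h)
    rw [foundList] at h
    split_ifs at h with h0
    · simp at h
    · rw [List.mem_singleton] at h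
      rcases f1 with f1 | f1
      · exact absurd f1.1 h0
      · omega
  · exact hr2 x h

end Refine

/-! ## Refining a front of nodes -/

section Front

variable {d : ℕ} {l : Layout d} {nd : ℕ → Finset ℕ} {Q : Box}

/-- A set of pairwise disjoint tight nodes that cover the points in the query box; their numbers
are larger than `e`, and the lowest common ancestors of points of different nodes are at most
`e`. -/
structure Front (l : Layout d) (nd : ℕ → Finset ℕ) (Q : Box) (B : Finset ℕ) (e : ℕ) : Prop where
  valid : ∀ i ∈ B, e < i ∧ i < 2 * l.n
  tight : ∀ i ∈ B, Tight l nd Q i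
  meets : ∀ i ∈ B, (nd i ∩ inQuery l Q).Nonempty
  disj : ∀ i ∈ B, ∀ j ∈ B, i ≠ j → Disjoint (nd i) (nd j)
  cover : ∀ p ∈ inQuery l Q, ∃ i ∈ B, p ∈ nd i
  sep : ∀ i ∈ B, ∀ j ∈ B, i ≠ j → ∀ u ∈ nd i, ∀ v ∈ nd j, u ≤ v → l.lcaId u v ≤ e

theorem Front.ne_of_subset {B : Finset ℕ} {e i j m : ℕ} (h : Front l nd Q B e) (hi : i ∈ B)
    (hj : j ∈ B) (hij : i ≠ j) (hm : nd m ⊆ nd i) (hmn : (nd m).Nonempty) : j ≠ m := by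
  rintro rfl
  obtain ⟨x, hx⟩ := hmn
  exact Finset.disjoint_left.1 (h.disj i hi j hj hij) (hm hx) hx

theorem Found.of_meets {i m r : ℕ} (h : Found l nd Q i m r)
    (hm : (nd i ∩ inQuery l Q).Nonempty) :
    i ≤ m ∧ m < 2 * l.n ∧ nd m ⊆ nd i ∧ nd i ∩ inQuery l Q ⊆ nd m ∧
      r ∈ nd m ∩ inQuery l Q ∧ Tight l nd Q m := by
  refine h.resolve_left fun h' => ?_
  rw [h'.2] at hm
  exact Finset.not_nonempty_empty hm

/-- Since `i` is tight, both children yield a node, and the front grows by exactly one. The new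
nodes have numbers above `i` because numbers grow downwards; the old ones do because `i` was least.
Lowest common ancestors of points from different nodes are at most `i`: across the two new nodes by
`lca_le`, and in all other cases by the old bound `e ≤ i`. -/
theorem Front.refine {B : Finset ℕ} {e i m₁ r₁ m₂ r₂ : ℕ} (ht : Tree l nd)
    (h : Front l nd Q B e) (hi : i ∈ B) (hmin : ∀ x ∈ B, i ≤ x) (hin : i < l.n)
    (h₁ : Found l nd Q (l.lc i) m₁ r₁) (h₂ : Found l nd Q (l.rc i) m₂ r₂) :
    m₁ ≠ 0 ∧ m₂ ≠ 0 ∧ m₁ ≠ m₂ ∧ m₁ ∉ B.erase i ∧ m₂ ∉ B.erase i ∧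
      Front l nd Q (insert m₁ (insert m₂ (B.erase i))) i ∧ m₁ < 2 * l.n ∧ m₂ < 2 * l.n := by
  have hi1 : 1 ≤ i := by have := (h.valid i hi).1; omega
  obtain ⟨t1, t2⟩ := h.tight i hi hin
  obtain ⟨a1, a2, a3, a4, a5, a6⟩ := h₁.of_meets t1
  obtain ⟨b1, b2, b3, b4, b5, b6⟩ := h₂.of_meets t2
  have hl1 := ht.left_gt i hi1 hin
  have hr1 := ht.right_gt i hi1 hin
  have hu := ht.union i hi1 hin
  have hdj := ht.disjoint i hi1 hin
  have n1 : (nd m₁).Nonempty := ⟨r₁, (Finset.mem_inter.1 a5).1⟩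
  have n2 : (nd m₂).Nonempty := ⟨r₂, (Finset.mem_inter.1 b5).1⟩
  have s1 : nd m₁ ⊆ nd i := a3.trans (by rw [hu]; exact Finset.subset_union_left)
  have s2 : nd m₂ ⊆ nd i := b3.trans (by rw [hu]; exact Finset.subset_union_right)
  have d12 : Disjoint (nd m₁) (nd m₂) := Finset.disjoint_of_subset_left a3
    (Finset.disjoint_of_subset_right b3 hdj)
  have hne : m₁ ≠ m₂ := by
    rintro rfl
    exact n1.ne_empty (Finset.disjoint_self_iff_empty _ |>.1 d12)
  have o1 : ∀ j ∈ B.erase i, Disjoint (nd m₁) (nd j) := fun j hj =>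
    Finset.disjoint_of_subset_left s1
      (h.disj i hi j (Finset.mem_of_mem_erase hj) (Finset.ne_of_mem_erase hj).symm)
  have o2 : ∀ j ∈ B.erase i, Disjoint (nd m₂) (nd j) := fun j hj =>
    Finset.disjoint_of_subset_left s2
      (h.disj i hi j (Finset.mem_of_mem_erase hj) (Finset.ne_of_mem_erase hj).symm)
  have e1 : e ≤ i := (h.valid i hi).1.le
  refine ⟨by omega, by omega, hne, fun hm => ?_, fun hm => ?_, ?_, a2, b2⟩
  · exact h.ne_of_subset hi (Finset.mem_of_mem_erase hm) (Finset.ne_of_mem_erase hm).symm s1 n1 rfl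
  · exact h.ne_of_subset hi (Finset.mem_of_mem_erase hm) (Finset.ne_of_mem_erase hm).symm s2 n2 rfl
  -- Points of `i` against points of another old node, in both orders; this covers the two new
  -- nodes, which are contained in `i`.
  have old : ∀ j ∈ B.erase i, ∀ u ∈ nd i, ∀ v ∈ nd j,
      (u ≤ v → l.lcaId u v ≤ i) ∧ (v ≤ u → l.lcaId v u ≤ i) := fun j hj u hu v hv =>
    ⟨fun huv => (h.sep i hi j (Finset.mem_of_mem_erase hj) (Finset.ne_of_mem_erase hj).symm
        u hu v hv huv).trans e1,
      fun huv => (h.sep j (Finset.mem_of_mem_erase hj) i hi (Finset.ne_of_mem_erase hj)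
        v hv u hu huv).trans e1⟩
  constructor
  · intro j hj
    rw [Finset.mem_insert, Finset.mem_insert] at hj
    rcases hj with rfl | rfl | hj
    · omega
    · omega
    · have := hmin j (Finset.mem_of_mem_erase hj)
      have h2 := Finset.ne_of_mem_erase hj
      exact ⟨by omega, (h.valid j (Finset.mem_of_mem_erase hj)).2⟩
  · intro j hj
    rw [Finset.mem_insert, Finset.mem_insert] at hj
    rcases hj with rfl | rfl | hj
    · exact a6
    · exact b6
    · exact h.tight j (Finset.mem_of_mem_erase hj)
  · intro j hj
    rw [Finset.mem_insert, Finset.mem_insert] at hj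
    rcases hj with rfl | rfl | hj
    · exact ⟨_, a5⟩
    · exact ⟨_, b5⟩
    · exact h.meets j (Finset.mem_of_mem_erase hj)
  · intro j hj j' hj' hjj
    rw [Finset.mem_insert, Finset.mem_insert] at hj hj'
    rcases hj with rfl | rfl | hj <;> rcases hj' with rfl | rfl | hj'
    · exact absurd rfl hjj
    · exact d12
    · exact o1 _ hj'
    · exact d12.symm
    · exact absurd rfl hjj
    · exact o2 _ hj'
    · exact (o1 _ hj).symm
    · exact (o2 _ hj).symm
    · exact h.disj j (Finset.mem_of_mem_erase hj) j' (Finset.mem_of_mem_erase hj') hjj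
  · intro p hp
    obtain ⟨j, hj, hpj⟩ := h.cover p hp
    rcases eq_or_ne j i with rfl | hji
    · rw [hu, Finset.mem_union] at hpj
      rcases hpj with hpj | hpj
      · exact ⟨m₁, by simp, a4 (Finset.mem_inter.2 ⟨hpj, hp⟩)⟩
      · exact ⟨m₂, by simp, b4 (Finset.mem_inter.2 ⟨hpj, hp⟩)⟩
    · exact ⟨j, by simp [hj, hji], hpj⟩
  · intro j hj j' hj' hjj u hu v hv huv
    rw [Finset.mem_insert, Finset.mem_insert] at hj hj'
    rcases hj with rfl | rfl | hj <;> rcases hj' with rfl | rfl | hj'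
    · exact absurd rfl hjj
    · exact (ht.lca_le i hi1 hin u (a3 hu) v (b3 hv)).2
    · exact (old _ hj' u (s1 hu) v hv).1 huv
    · have := (ht.lca_le i hi1 hin v (a3 hv) u (b3 hu)).1
      omega
    · exact absurd rfl hjj
    · exact (old _ hj' u (s2 hu) v hv).1 huv
    · exact (old _ hj v (s1 hv) u hu).2 huv
    · exact (old _ hj v (s2 hv) u hu).2 huv
    · exact (h.sep j (Finset.mem_of_mem_erase hj) j' (Finset.mem_of_mem_erase hj') hjj
        u hu v hv huv).trans e1

/-- A front with a single node has nothing to separate, so the bound `0` for the common ancestors is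
admissible. If no point is in the query, the front is empty. -/
theorem Front.root {m r : ℕ} (ht : Tree l nd) (h : Found l nd Q 1 m r) :
    Front l nd Q (foundList m).toFinset 0 := by
  have hin : nd 1 ∩ inQuery l Q = inQuery l Q := by
    rw [ht.root, Finset.inter_eq_right]
    exact Finset.filter_subset _ _
  rw [Found, hin] at h
  rcases h with ⟨rfl, h⟩ | ⟨h1, h2, h3, h4, h5, h6⟩
  · constructor <;> simp [foundList, h]
  · have : foundList m = [m] := by rw [foundList, if_neg (by omega)]
    rw [this]
    constructor <;> simp only [List.toFinset_cons, List.toFinset_nil, insert_empty_eq,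
      Finset.mem_singleton, forall_eq]
    · omega
    · exact h6
    · exact ⟨_, h5⟩
    · simp
    · intro p hp
      exact ⟨m, rfl, h4 hp⟩
    · simp

end Front

/-! ## The coarse phase of a query -/

section Coarse

variable {d : ℕ} {A : Procedures d} {l : Layout d} {nd : ℕ → Finset ℕ} {Q : Box}

/-- The states of the coarse phase: `B` is the contents of the priority queue and `st` that of the
stack; the phase goes on while the queue has fewer than `lim` elements, and `σ` is the size of the
last node that was refined. -/
structure Work (l : Layout d) (nd : ℕ → Finset ℕ) (Q : Box) (k lim : ℕ) (σ : ℝ) (B : Finset ℕ)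
    (st : List ℕ) (s : State) : Prop extends Ready l Q s where
  clusters : s.nreg 4 = k
  limit : s.nreg 9 = lim
  last : s.rreg (2 * d + 1) = σ
  outAddr : s.nreg 12 = l.E
  outCount : s.nreg 13 = 0
  counts : Counts l.L l.E s.nmem B
  total : s.nreg 14 = B.card
  stack : Stack l s st
  queue_lt : ∀ i ∈ B, i < 2 * l.n
  stack_lt : ∀ i ∈ st, i < 2 * l.n
  queue_rep : ∀ i ∈ B, HasRep l nd Q s i
  stack_rep : ∀ i ∈ st, HasRep l nd Q s i

theorem KeepCounts.ready {s s' : State} (h : KeepCounts l.L l.E s s') (hs : Ready l Q s) :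
    Ready l Q s' :=
  { h.ok hs.toOk with
    reps := (h.low 16 (by omega)).trans hs.reps
    base := (h.low 11 (by omega)).trans hs.base }

theorem KeepCounts.hasRep {s s' : State} (h : KeepCounts l.L l.E s s') {i : ℕ}
    (hi : HasRep l nd Q s i) : HasRep l nd Q s' i := by
  rw [HasRep, h.above _ (by omega)]
  exact hi

theorem KeepCounts.stack {s s' : State} (h : KeepCounts l.L l.E s s') {st : List ℕ}
    (hs : Stack l s st) : Stack l s' st :=
  ⟨(h.low 10 (by omega)).trans hs.1, fun j hj => by
    rw [h.above _ (by rw [add_assoc (l.E + _)]; exact Nat.le_add_right _ _)]; exact hs.2 j hj⟩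

theorem Counts.update_above {L E a v : ℕ} {nm : ℕ → ℕ} {B : Finset ℕ} (h : Counts L E nm B)
    (ha : E + 2 ^ (L + 1) ≤ a) : Counts L E (Function.update nm a v) B := fun w hw hw' => by
  rw [Function.update_of_ne (by omega)]
  exact h w hw hw'

theorem Ready.congr {s s' : State} (h : Ready l Q s)
    (hn : ∀ j, (5 ≤ j ∧ j ≤ 8 ∨ j = 11 ∨ j = 16 ∨ 30 ≤ j ∧ j < scratch d) → s'.nreg j = s.nreg j)
    (hr : ∀ j, j ≤ 2 * d ∨ j = 2 * d + 3 → s'.rreg j = s.rreg j)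
    (hm : ∀ a < l.E, s'.nmem a = s.nmem a) (hrm : ∀ a < l.E, s'.rmem a = s.rmem a) :
    Ready l Q s' where
  width := (hn 5 (by omega)).trans h.width
  free := (hn 6 (by omega)).trans h.free
  one := (hn 7 (by omega)).trans h.one
  zero := (hn 8 (by omega)).trans h.zero
  field j hj := (hn _ (by simp only [numFields, scratch] at *; omega)).trans (h.field j hj)
  nmem a ha := (hm a ha).trans (h.nmem a ha)
  rmem a ha := (hrm a ha).trans (h.rmem a ha)
  lo a ha := (hr _ (by omega)).trans (h.lo a ha)
  hi a ha := (hr _ (by omega)).trans (h.hi a ha)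
  eps := (hr _ (by omega)).trans h.eps
  rzero := (hr _ (by omega)).trans h.rzero
  reps := (hn 16 (by omega)).trans h.reps
  base := (hn 11 (by omega)).trans h.base

/-- Move the stack into the queue. -/
def drainStack : Cmd :=
  .while (.nlt 11 10)
    (.seq (code [.nsub 10 10 7, .nload 18 10]) (.seq enqueue (code [.nadd 14 14 7])))

theorem Stack.pop {s : State} {st : List ℕ} {i : ℕ} (h : Stack l s (st ++ [i])) :
    s.nreg 10 = l.E + 2 ^ (l.L + 1) + 2 ^ l.L + st.length + 1 ∧
    s.nmem (l.E + 2 ^ (l.L + 1) + 2 ^ l.L + st.length) = i ∧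
    ∀ j (hj : j < st.length), s.nmem (l.E + 2 ^ (l.L + 1) + 2 ^ l.L + j) = st[j] := by
  refine ⟨?_, ?_, fun j hj => ?_⟩
  · rw [h.1]; simp; omega
  · rw [h.2 st.length (by simp)]; simp
  · rw [h.2 j (by simp; omega)]; rw [List.getElem_append_left hj]

theorem drainStack_runs {k lim : ℕ} {σ : ℝ} (hl : l.Valid) : ∀ (st : List ℕ) (B : Finset ℕ)
    (s : State), Work l nd Q k lim σ B st s → st.Nodup → (∀ i ∈ st, i ∉ B) →
    Runs A drainStack s (st.length * ((l.L + 1) * 7 + 10) + 1)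
      (Work l nd Q k lim σ (B ∪ st.toFinset) []) := by
  intro st B s hs hnd hB
  refine Runs.while (fun T s' => ∃ st' B', T = st'.length * ((l.L + 1) * 7 + 10) + 1 ∧
    Work l nd Q k lim σ B' st' s' ∧ st'.Nodup ∧ (∀ i ∈ st', i ∉ B') ∧
    B' ∪ st'.toFinset = B ∪ st.toFinset) ?_ ?_ _ _ ⟨st, B, rfl, hs, hnd, hB, rfl⟩
  · rintro T s' ⟨st', B', rfl, hw, hnd', hB', hu⟩ hb
    rw [State.holds_nlt, hw.base, hw.stack.1] at hb
    obtain rfl | ⟨st', i, rfl⟩ := st'.eq_nil_or_concat'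
    · simp at hb
    obtain ⟨p1, p2, p3⟩ := hw.stack.pop
    have hlw := hl.lt_width
    have hi := hw.stack_lt i (by simp)
    refine ⟨3 + ((l.L + 1) * 7 + 3 + 2), st'.length * ((l.L + 1) * 7 + 10) + 1, ?_, ?_⟩
    · rw [List.length_append, List.length_singleton, Nat.add_mul st'.length 1]; omega
    refine Runs.seq 3 ((l.L + 1) * 7 + 3 + 2) le_rfl (Runs.code _ (by simp) ?_)
    have e7 := hw.one
    set s1 := List.foldl State.step s' [.nsub 10 10 7, .nload 18 10] with hs1
    have g10 : s1.nreg 10 = l.E + 2 ^ (l.L + 1) + 2 ^ l.L + st'.length := by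
      simp (disch := omega) [hs1, p1, e7]
    have g18 : s1.nreg 18 = i := by
      simp (disch := omega) [hs1, p1, e7, p2]
    have gn : ∀ j, j ≠ 10 → j ≠ 18 → s1.nreg j = s'.nreg j := by
      intro j h1 h2; simp (disch := omega) [hs1]
    have gm : s1.nmem = s'.nmem := rfl
    have gr : s1.rreg = s'.rreg := rfl
    have grm : s1.rmem = s'.rmem := rfl
    clear_value s1
    have w1 : Work l nd Q k lim σ B' st' s1 := by
      refine { hw.toReady.congr (fun j hj => gn j (by omega) (by omega)) (by simp [gr]) (by simp [gm])
        (by simp [grm]), hw with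
        clusters := (gn 4 (by omega) (by omega)).trans hw.clusters
        limit := (gn 9 (by omega) (by omega)).trans hw.limit
        last := by rw [gr]; exact hw.last
        outAddr := (gn 12 (by omega) (by omega)).trans hw.outAddr
        outCount := (gn 13 (by omega) (by omega)).trans hw.outCount
        counts := by rw [gm]; exact hw.counts
        total := (gn 14 (by omega) (by omega)).trans hw.total
        stack := ⟨g10, by rw [gm]; exact p3⟩
        stack_lt := fun j hj => hw.stack_lt j (by simp [hj])
        queue_rep := fun j hj => by rw [HasRep, gm]; exact hw.queue_rep j hj
        stack_rep := fun j hj => by rw [HasRep, gm]; exact hw.stack_rep j (by simp [hj]) }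
    have hrep : HasRep l nd Q s1 i := by rw [HasRep, gm]; exact hw.stack_rep i (by simp)
    have hiB : i ∉ B' := hB' i (by simp)
    refine Runs.seq ((l.L + 1) * 7 + 3) 2 le_rfl ?_
    refine (enqueue_runs w1.toOk w1.counts g18 (by omega) hiB).mono le_rfl ?_
    rintro s2 ⟨k2, c2, -, -⟩
    have r2 := k2.ready w1.toReady
    have t14 := (k2.low 14 (by omega)).trans w1.total
    have z7 := r2.one
    refine Runs.code _ (by simp) ⟨st', insert i B', rfl, ?_, (List.nodup_append.1 hnd').1, ?_, ?_⟩
    · set s3 := List.foldl State.step s2 [.nadd 14 14 7] with hs3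
      have f14 : s3.nreg 14 = B'.card + 1 := by simp (disch := omega) [hs3, t14, z7]
      have fn : ∀ j, j ≠ 14 → s3.nreg j = s2.nreg j := by
        intro j h1; simp (disch := omega) [hs3]
      have fm : s3.nmem = s2.nmem := rfl
      have fr : s3.rreg = s2.rreg := rfl
      have frm : s3.rmem = s2.rmem := rfl
      clear_value s3
      have q2 := k2.stack w1.stack
      refine { r2.congr (fun j hj => fn j (by omega)) (by simp [fr]) (by simp [fm]) (by simp [frm]) with
        clusters := ((fn 4 (by omega)).trans (k2.low 4 (by omega))).trans w1.clusters
        limit := ((fn 9 (by omega)).trans (k2.low 9 (by omega))).trans w1.limit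
        last := by rw [fr, k2.rreg]; exact w1.last
        outAddr := ((fn 12 (by omega)).trans (k2.low 12 (by omega))).trans w1.outAddr
        outCount := ((fn 13 (by omega)).trans (k2.low 13 (by omega))).trans w1.outCount
        counts := by rw [fm]; exact c2
        total := by rw [f14, Finset.card_insert_of_notMem hiB]
        stack := ⟨(fn 10 (by omega)).trans q2.1, by rw [fm]; exact q2.2⟩
        queue_lt := fun j hj => ?_
        stack_lt := w1.stack_lt
        queue_rep := fun j hj => ?_
        stack_rep := fun j hj => by
          rw [HasRep, fm]; exact k2.hasRep (w1.stack_rep j hj) }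
      · rw [Finset.mem_insert] at hj
        rcases hj with rfl | hj
        · exact hi
        · exact hw.queue_lt j hj
      · rw [HasRep, fm]
        rw [Finset.mem_insert] at hj
        rcases hj with rfl | hj
        · exact k2.hasRep hrep
        · exact k2.hasRep (w1.queue_rep j hj)
    · intro j hj hj'
      rw [Finset.mem_insert] at hj'
      rcases hj' with rfl | hj'
      · exact (List.nodup_append.1 hnd').2.2 j hj j (by simp) rfl
      · exact hB' j (by simp [hj]) hj'
    · rw [← hu]
      ext x
      simp only [Finset.mem_union, Finset.mem_insert, List.mem_toFinset, List.mem_append,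
        List.mem_singleton]
      tauto
  · rintro T s' ⟨st', B', rfl, hw, hnd', hB', hu⟩ hb
    rw [State.holds_nlt, hw.base, hw.stack.1] at hb
    obtain rfl : st' = [] := List.eq_nil_of_length_eq_zero (by omega)
    refine ⟨by omega, ?_⟩
    rw [← hu]
    simpa using hw

/-- Move the queue onto the stack. -/
def drainQueue : Cmd :=
  .while (.nlt 8 14) (.seq dequeue (code [.nsub 14 14 7, .nstore 10 17, .nadd 10 10 7]))

/-- The common part of emptying the queue and of stopping at a leaf: a dequeued node is put on the
stack. The size register and the limit are left free, since stopping at a leaf resets both to zero.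
-/
theorem Work.push {k lim lim' : ℕ} {σ σ' : ℝ} {st : List ℕ} {B : Finset ℕ} {s s1 s2 : State}
    {m : ℕ} (hl : l.Valid) (hs : Work l nd Q k lim σ B st s) (hm : m ∈ B)
    (k1 : KeepCounts l.L l.E s s1) (c1 : Counts l.L l.E s1.nmem (B.erase m)) (g17 : s1.nreg 17 = m)
    (a1 : ∀ j, j ≠ 14 → j ≠ 10 → j ≠ 9 → j ≠ 20 → s2.nreg j = s1.nreg j)
    (a2 : s2.nreg 14 = s1.nreg 14 - s1.nreg 7) (a3 : s2.nreg 10 = s1.nreg 10 + s1.nreg 7)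
    (a4 : s2.nreg 9 = lim') (a5 : ∀ j, j ≠ 2 * d + 1 → j ≠ 2 * d + 4 → s2.rreg j = s1.rreg j)
    (a6 : s2.rreg (2 * d + 1) = σ') (a7 : s2.rmem = s1.rmem)
    (a8 : s2.nmem = Function.update s1.nmem (s1.nreg 10) (s1.nreg 17)) :
    Work l nd Q k lim' σ' (B.erase m) (st ++ [m]) s2 := by
  have hlw := hl.lt_width
  have hpos := Nat.two_pow_pos l.L
  have r1 := k1.ready hs.toReady
  have q1 := k1.stack hs.stack
  have e7 := r1.one
  have e14 := (k1.low 14 (by omega)).trans hs.total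
  rw [q1.1, g17] at a8
  have hrep : ∀ i < 2 * l.n, HasRep l nd Q s i → HasRep l nd Q s2 i := by
    intro i hi h
    rw [HasRep, a8, Function.update_of_ne (by omega)]
    exact k1.hasRep h
  have hm2 := hs.queue_lt m hm
  refine { r1.congr (fun j hj => a1 j (by omega) (by omega) (by omega) (by omega))
      (fun j hj => a5 j (by omega) (by omega)) (fun a ha => ?_) (fun a ha => by rw [a7]) with
    clusters := ((a1 4 (by omega) (by omega) (by omega) (by omega)).trans
      (k1.low 4 (by omega))).trans hs.clusters
    limit := a4
    last := a6
    outAddr := ((a1 12 (by omega) (by omega) (by omega) (by omega)).trans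
      (k1.low 12 (by omega))).trans hs.outAddr
    outCount := ((a1 13 (by omega) (by omega) (by omega) (by omega)).trans
      (k1.low 13 (by omega))).trans hs.outCount
    counts := by
      rw [a8]
      refine c1.update_above ?_
      rw [add_assoc (l.E + _)]
      exact Nat.le_add_right _ _
    total := by rw [a2, e14, e7, Finset.card_erase_of_mem hm]
    stack := Stack.snoc (by rw [a3, q1.1, e7]; omega) (fun j hj => ?_) (by rw [a8]; simp)
    queue_lt := fun i hi => hs.queue_lt i (Finset.mem_of_mem_erase hi)
    stack_lt := fun i hi => ?_
    queue_rep := fun i hi => hrep i (hs.queue_lt i (Finset.mem_of_mem_erase hi))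
      (hs.queue_rep i (Finset.mem_of_mem_erase hi))
    stack_rep := fun i hi => ?_ }
  · rw [a8, Function.update_of_ne (by omega)]
  · rw [a8, Function.update_of_ne (by omega)]
    exact q1.2 j hj
  · rw [List.mem_append, List.mem_singleton] at hi
    rcases hi with hi | rfl
    · exact hs.stack_lt i hi
    · exact hm2
  · rw [List.mem_append, List.mem_singleton] at hi
    rcases hi with hi | rfl
    · exact hrep i (hs.stack_lt i hi) (hs.stack_rep i hi)
    · exact hrep i hm2 (hs.queue_rep i hm)

theorem drainQueue_runs {k lim : ℕ} {σ : ℝ} {st : List ℕ} {B : Finset ℕ} {s : State} (hl : l.Valid)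
    (hs : Work l nd Q k lim σ B st s) (hnd : st.Nodup) (hB : ∀ i ∈ st, i ∉ B) :
    Runs A drainQueue s (B.card * (l.L * 12 + 15) + 1) fun s' =>
      ∃ st', Work l nd Q k lim σ ∅ st' s' ∧ st'.Nodup ∧ st'.toFinset = B ∪ st.toFinset := by
  refine Runs.while (fun T s' => ∃ st' B', T = B'.card * (l.L * 12 + 15) + 1 ∧
    Work l nd Q k lim σ B' st' s' ∧ st'.Nodup ∧ (∀ i ∈ st', i ∉ B') ∧
    B' ∪ st'.toFinset = B ∪ st.toFinset) ?_ ?_ _ _ ?_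
  rotate_left 2
  · exact ⟨st, B, rfl, hs, hnd, hB, rfl⟩
  · rintro T s' ⟨st', B', rfl, hw, hnd', hB', hu⟩ hb
    rw [State.holds_nlt, hw.zero, hw.total] at hb
    have hne := Finset.card_pos.1 hb
    obtain ⟨m, hm, hmin⟩ := B'.exists_min_image id hne
    refine ⟨l.L * 12 + 10 + (3 + 1), (B'.erase m).card * (l.L * 12 + 15) + 1, ?_, ?_⟩
    · have := Finset.card_erase_add_one hm
      rw [← this, Nat.add_mul (B'.erase m).card 1]; omega
    have hlw := hl.lt_width
    refine Runs.seq (l.L * 12 + 10) 4 le_rfl ?_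
    refine (dequeue_runs hw.toOk hw.counts (fun x hx => by have := hw.queue_lt x hx; omega)
      hm hmin).mono le_rfl ?_
    rintro s1 ⟨k1, c1, g17⟩
    have e9 := (k1.low 9 (by omega)).trans hw.limit
    have el : s1.rreg (2 * d + 1) = σ := by rw [k1.rreg, hw.last]
    refine Runs.code _ (by simp) ?_
    set s2 := List.foldl State.step s1 [.nsub 14 14 7, .nstore 10 17, .nadd 10 10 7] with hs2
    have h2 : Work l nd Q k lim σ (B'.erase m) (st' ++ [m]) s2 := by
      refine hw.push hl hm k1 c1 g17 (fun j h1 h2 _ _ => ?_) ?_ ?_ ?_ (fun j _ _ => ?_) ?_ ?_ ?_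
      · simp (disch := omega) [hs2]
      · simp (disch := omega) [hs2]
      · simp (disch := omega) [hs2]
      · simp (disch := omega) [hs2, e9]
      · simp [hs2]
      · simp [hs2, el]
      · simp [hs2]
      · simp (disch := omega) [hs2, State.putN]
    · clear_value s2
      refine ⟨st' ++ [m], B'.erase m, rfl, h2, ?_, fun i hi hi' => ?_, ?_⟩
      · rw [List.nodup_append]
        exact ⟨hnd', by simp, fun a ha b hb => by
          rw [List.mem_singleton] at hb; subst hb; rintro rfl; exact hB' _ ha hm⟩
      · rw [List.mem_append, List.mem_singleton] at hi
        rcases hi with hi | rfl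
        · exact hB' i hi (Finset.mem_of_mem_erase hi')
        · exact Finset.ne_of_mem_erase hi' rfl
      · rw [← hu]
        ext x
        simp only [Finset.mem_union, Finset.mem_erase, List.mem_toFinset, List.mem_append,
          List.mem_singleton]
        by_cases hx : x = m
        · subst hx; simp [hm]
        · simp [hx]
  · rintro T s' ⟨st', B', rfl, hw, hnd', hB', hu⟩ hb
    rw [State.holds_nlt, hw.zero, hw.total] at hb
    obtain rfl : B' = ∅ := Finset.card_eq_zero.1 (by omega)
    exact ⟨by omega, st', hw, hnd', by simpa using hu⟩

/-- Refine the least node of the queue, or finish if it is a leaf. -/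
def coarseStep (d : ℕ) : Cmd :=
  .seq dequeue
  (.seq (code [.nadd 20 (30 + 2 * d) 17, .rload (2 * d + 4) 20])
  (.ite (.rle (2 * d + 4) (2 * d + 3))
    (code [.nsub 14 14 7, .nstore 10 17, .nadd 10 10 7, .nconst 9 0, .rconst (2 * d + 1) 0])
    (.seq (code [.nsub 14 14 7, .radd (2 * d + 1) (2 * d + 4) (2 * d + 3)])
      (.seq (refineNode d) drainStack))))

/-- Time of `coarseStep`. -/
def coarseTime (d L Λ : ℕ) : ℕ := refineTime d L Λ false + (L + 1) * 26 + 60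

-- The test whether the size is positive separates inner nodes from leaves. A leaf as least element
-- ends the phase: size and limit are set to zero. An inner node is refined, and the two nodes found
-- are new to the queue by `Front.refine`.
open Classical in
theorem coarseStep_runs {k lim m : ℕ} {σ : ℝ} {B : Finset ℕ} {s : State} {e : ℕ} (hd : 2 ≤ d)
    (hl : l.Valid) (ht : Tree l nd)
    (hz : ∀ i, 1 ≤ i → i < 2 * l.n → (l.sz i ≤ 0 ↔ l.n ≤ i))
    (hs : Work l nd Q k lim σ B [] s) (hf : Front l nd Q B e) (hm : m ∈ B)
    (hmin : ∀ x ∈ B, m ≤ x) :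
    Runs A (coarseStep d) s (coarseTime d l.L l.Λ) fun s' =>
      (l.n ≤ m ∧ Work l nd Q k 0 0 (B.erase m) [m] s') ∨
      (m < l.n ∧ ∃ B', B'.card = B.card + 1 ∧ Front l nd Q B' m ∧
        Work l nd Q k lim (l.sz m) B' [] s') := by
  have hlw := hl.lt_width
  have hm2 := hf.valid m hm
  have hrt : ∀ b, refineTime d l.L l.Λ b ≤ refineTime d l.L l.Λ false := by
    intro b; cases b <;> simp [refineTime]
  refine Runs.seq (l.L * 12 + 10) (refineTime d l.L l.Λ false + (l.L + 1) * 14 + 50)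
    (by simp only [coarseTime]; omega) ?_
  refine (dequeue_runs hs.toOk hs.counts (fun x hx => by have := hs.queue_lt x hx; omega)
    hm hmin).mono le_rfl ?_
  rintro s1 ⟨k1, c1, g17⟩
  have r1 := k1.ready hs.toReady
  have e30 := r1.field (2 * d) (by simp only [numFields]; omega)
  have esz := (r1.toOk.stored hl).nodeSize m (by omega) hm2.2
  refine Runs.seq 3 (refineTime d l.L l.Λ false + (l.L + 1) * 14 + 47) (by omega)
    (Runs.code _ (by simp) ?_)
  set s2 := List.foldl State.step s1 [.nadd 20 (30 + 2 * d) 17, .rload (2 * d + 4) 20] with hs2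
  have n2 : ∀ j, j ≠ 20 → s2.nreg j = s1.nreg j := by
    intro j hj; simp (disch := omega) [hs2]
  have q2 : ∀ j, j ≠ 2 * d + 4 → s2.rreg j = s1.rreg j := by
    intro j hj; simp (disch := omega) [hs2]
  have z2 : s2.rreg (2 * d + 4) = l.sz m := by simp (disch := omega) [hs2, e30, g17, esz]
  have m2 : s2.nmem = s1.nmem := rfl
  have p2 : s2.rmem = s1.rmem := rfl
  clear_value s2
  have z3 := (q2 (2 * d + 3) (by omega)).trans r1.rzero
  refine Runs.ite (refineTime d l.L l.Λ false + (l.L + 1) * 14 + 46) (by omega) (fun h => ?_)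
    (fun h => ?_)
  all_goals rw [State.holds_rle, z2, z3, hz m (by omega) hm2.2] at h
  · refine Runs.code _ (by simp) (Or.inl ⟨h, ?_⟩)
    set s3 := List.foldl State.step s2 [.nsub 14 14 7, .nstore 10 17, .nadd 10 10 7, .nconst 9 0,
      .rconst (2 * d + 1) 0] with hs3
    refine hs.push hl hm k1 c1 g17 (fun j h1 h2 h3 h4 => ?_) ?_ ?_ ?_ (fun j h1 h2 => ?_) ?_ ?_ ?_
    · rw [← n2 j h4]; simp (disch := omega) [hs3]
    · simp (disch := omega) [hs3, n2]
    · simp (disch := omega) [hs3, n2]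
    · simp (disch := omega) [hs3]
    · rw [← q2 j h2]; simp (disch := omega) [hs3]
    · simp (disch := omega) [hs3]
    · simp [hs3, p2]
    · simp (disch := omega) [hs3, State.putN, n2, m2]
  · have hmn : m < l.n := not_le.1 h
    refine Runs.seq 3 (refineTime d l.L l.Λ false + (l.L + 1) * 14 + 43) (by omega)
      (Runs.code _ (by simp) ?_)
    set s3 := List.foldl State.step s2 [.nsub 14 14 7, .radd (2 * d + 1) (2 * d + 4) (2 * d + 3)]
      with hs3
    have n3 : ∀ j, j ≠ 20 → j ≠ 14 → s3.nreg j = s1.nreg j := by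
      intro j h1 h2; rw [← n2 j h1]; simp (disch := omega) [hs3]
    have f14 : s3.nreg 14 = B.card - 1 := by
      have h1 := (k1.low 14 (by omega)).trans hs.total
      have h2 := r1.one
      simp (disch := omega) [hs3, n2, h1, h2]
    have q3 : ∀ j, j ≠ 2 * d + 4 → j ≠ 2 * d + 1 → s3.rreg j = s1.rreg j := by
      intro j h1 h2; rw [← q2 j h1]; simp (disch := omega) [hs3]
    have z3 : s3.rreg (2 * d + 1) = l.sz m := by simp (disch := omega) [hs3, z2, z3]
    have m3 : s3.nmem = s1.nmem := by simp [hs3, m2]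
    have p3 : s3.rmem = s1.rmem := by simp [hs3, p2]
    clear_value s3
    have r3 : Ready l Q s3 := r1.congr (fun j hj => n3 j (by omega) (by omega))
      (fun j hj => q3 j (by omega) (by omega)) (by simp [m3]) (by simp [p3])
    have st3 : Stack l s3 [] := by
      have := k1.stack hs.stack
      exact ⟨(n3 10 (by omega) (by omega)).trans this.1, by simp⟩
    refine Runs.seq (refineTime d l.L l.Λ false) ((l.L + 1) * 14 + 43) (by omega) ?_
    refine (refineNode_runs hd hl ht r3 st3 ((n3 17 (by omega) (by omega)).trans g17) (by omega)
      hmn).mono (hrt _) ?_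
    rintro s4 ⟨k4, m₁, r₁, m₂, r₂, F1, F2, st4, rep4⟩
    obtain ⟨y1, y2, y3, y4, y5, y6, y7, y8⟩ := hf.refine ht hm hmin hmn F1 F2
    have r4 := k4.ready r3
    have hl1 : foundList m₁ = [m₁] := if_neg y1
    have hl2 : foundList m₂ = [m₂] := if_neg y2
    rw [hl1, hl2] at st4 rep4
    have w4 : Work l nd Q k lim (l.sz m) (B.erase m) [m₁, m₂] s4 := by
      refine { r4 with
        clusters := ((k4.low 4 (by omega) (by omega)).trans (n3 4 (by omega) (by omega))).trans
          ((k1.low 4 (by omega)).trans hs.clusters)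
        limit := ((k4.low 9 (by omega) (by omega)).trans (n3 9 (by omega) (by omega))).trans
          ((k1.low 9 (by omega)).trans hs.limit)
        last := (k4.rreg _ (by omega)).trans z3
        outAddr := ((k4.low 12 (by omega) (by omega)).trans (n3 12 (by omega) (by omega))).trans
          ((k1.low 12 (by omega)).trans hs.outAddr)
        outCount := ((k4.low 13 (by omega) (by omega)).trans (n3 13 (by omega) (by omega))).trans
          ((k1.low 13 (by omega)).trans hs.outCount)
        counts := fun v hv hv' => ?_
        total := ?_
        stack := st4
        queue_lt := fun i hi => hs.queue_lt i (Finset.mem_of_mem_erase hi)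
        stack_lt := ?_
        queue_rep := fun i hi => k4.hasRep i (hs.queue_lt i (Finset.mem_of_mem_erase hi)) ?_
        stack_rep := rep4 }
      · rw [k4.below _ (by omega), m3]
        exact c1 v hv hv'
      · rw [k4.low 14 (by omega) (by omega), f14, Finset.card_erase_of_mem hm]
      · simp [y7, y8]
      · rw [HasRep, m3]
        exact k1.hasRep (hs.queue_rep i (Finset.mem_of_mem_erase hi))
    refine (drainStack_runs hl _ _ s4 w4 (by simpa using y3) ?_).mono (by simp; omega) ?_
    · simp only [List.mem_cons, List.not_mem_nil, or_false, forall_eq_or_imp, forall_eq]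
      exact ⟨y4, y5⟩
    · intro s5 w5
      have hB : B.erase m ∪ [m₁, m₂].toFinset = insert m₁ (insert m₂ (B.erase m)) := by
        ext x; simp
      rw [hB] at w5
      refine Or.inr ⟨hmn, _, ?_, y6, w5⟩
      rw [Finset.card_insert_of_notMem, Finset.card_insert_of_notMem y5,
        Finset.card_erase_add_one hm]
      rw [Finset.mem_insert, not_or]
      exact ⟨y3, y4⟩

/-- Refine nodes until the queue has `lim` elements or only leaves are left. -/
def coarseLoop (d : ℕ) : Cmd := .while (.nlt 14 9) (coarseStep d)

/-- The outcome of the coarse phase. -/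
def CoarseResult (l : Layout d) (nd : ℕ → Finset ℕ) (Q : Box) (lim : ℕ) (σ : ℝ) (B : Finset ℕ) :
    Prop :=
  ∃ e, Front l nd Q B e ∧ B.card ≤ lim ∧ ((σ = 0 ∧ ∀ i ∈ B, l.n ≤ i) ∨
    (B.card = lim ∧ 1 ≤ e ∧ e < l.n ∧ σ = l.sz e))

-- Every round but a final one adds a node to the front, so there are at most `lim` rounds. The loop
-- starts with a single node and `lim ≥ 2`; hence, if the limit is reached, some node was refined,
-- and its size is the recorded `σ`.
open Classical in
theorem coarseLoop_runs {k lim : ℕ} {σ : ℝ} {B : Finset ℕ} {s : State} {e : ℕ} (hd : 2 ≤ d)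
    (hl : l.Valid) (ht : Tree l nd)
    (hz : ∀ i, 1 ≤ i → i < 2 * l.n → (l.sz i ≤ 0 ↔ l.n ≤ i))
    (hs : Work l nd Q k lim σ B [] s) (hf : Front l nd Q B e) (hB : B.card = 1) (hlim : 2 ≤ lim) :
    Runs A (coarseLoop d) s (lim * (coarseTime d l.L l.Λ + 1) + 1) fun s' =>
      ∃ lim' σ' B' st, Work l nd Q k lim' σ' B' st s' ∧ st.Nodup ∧ (∀ i ∈ st, i ∉ B') ∧
        CoarseResult l nd Q lim σ' (B' ∪ st.toFinset) := by
  refine Runs.while (fun T s' =>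
    (∃ B' e' σ', T = (lim - B'.card + 1) * (coarseTime d l.L l.Λ + 1) + 1 ∧
      Work l nd Q k lim σ' B' [] s' ∧
      Front l nd Q B' e' ∧ B'.Nonempty ∧ B'.card ≤ lim ∧
      (1 < B'.card → 1 ≤ e' ∧ e' < l.n ∧ σ' = l.sz e')) ∨
    (∃ B' m e', 1 ≤ T ∧ Work l nd Q k 0 0 B' [m] s' ∧ m ∉ B' ∧ Front l nd Q (insert m B') e' ∧
      (∀ i ∈ insert m B', l.n ≤ i) ∧ (insert m B').card ≤ lim)) ?_ ?_ _ _ ?_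
  rotate_left 2
  · exact Or.inl ⟨B, e, σ, by rw [hB]; congr 2; omega, hs, hf, Finset.card_pos.1 (by omega),
      by omega, fun h => by omega⟩
  · rintro T s' (⟨B', e', σ', rfl, hw, hf', hne, hcard, hlast⟩ | ⟨B', m, e', hT, hw, -⟩) hb
    · rw [State.holds_nlt, hw.total, hw.limit] at hb
      obtain ⟨m, hm, hmin⟩ := B'.exists_min_image id hne
      refine ⟨coarseTime d l.L l.Λ, (lim - B'.card) * (coarseTime d l.L l.Λ + 1) + 1, ?_, ?_⟩
      · rw [Nat.add_mul _ 1]; omega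
      refine (coarseStep_runs hd hl ht hz hw hf' hm hmin).mono le_rfl ?_
      rintro s2 (⟨h1, h2⟩ | ⟨h1, B2, h3, h4, h5⟩)
      -- The least node is a leaf. Leaves have the largest numbers, so all nodes of the front are
      -- leaves; the limit `0` stops the loop.
      · refine Or.inr ⟨B'.erase m, m, e', by omega, h2, by simp, ?_, ?_, ?_⟩ <;>
          rw [Finset.insert_erase hm]
        · exact hf'
        · intro i hi
          exact h1.trans (hmin i hi)
        · exact hcard
      · refine Or.inl ⟨B2, m, l.sz m, ?_, h5, h4, Finset.card_pos.1 (by omega), by omega,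
          fun _ => ⟨?_, h1, rfl⟩⟩
        · rw [h3]; congr 2; omega
        · have := (hf'.valid m hm).1; omega
    · rw [State.holds_nlt, hw.limit] at hb
      omega
  · rintro T s' (⟨B', e', σ', rfl, hw, hf', hne, hcard, hlast⟩ | ⟨B', m, e', hT, hw, h1, h2, h3, h4⟩)
      hb
    · rw [State.holds_nlt, hw.total, hw.limit] at hb
      refine ⟨by omega, lim, σ', B', [], hw, by simp, by simp, e', ?_⟩
      simp only [List.toFinset_nil, Finset.union_empty]
      exact ⟨hf', hcard, Or.inr ⟨by omega, hlast (by omega)⟩⟩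
    · refine ⟨hT, 0, 0, B', [m], hw, by simp, by simpa using h1, e', ?_⟩
      have : B' ∪ [m].toFinset = insert m B' := by ext x; simp
      rw [this]
      exact ⟨h2, h4, Or.inl ⟨rfl, h3⟩⟩

end Coarse

/-! ## The fine phase of a query -/

section Fine

variable {d : ℕ} {A : Procedures d} {l : Layout d} {nd : ℕ → Finset ℕ} {Q : Box}

/-- The nodes on the stack `st` and the points `out` selected so far: every point in the query box
is in a node on the stack or shares a node of size at most `r` with a selected point. -/
structure Cover (l : Layout d) (nd : ℕ → Finset ℕ) (Q : Box) (r : ℝ) (st out : List ℕ) : Prop where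
  valid : ∀ i ∈ st, 1 ≤ i ∧ i < 2 * l.n
  disj : st.Pairwise fun i j => Disjoint (nd i) (nd j)
  nodup : out.Nodup
  mem : ∀ x ∈ out, x ∈ inQuery l Q
  sep : ∀ x ∈ out, ∀ i ∈ st, x ∉ nd i
  cover : ∀ p ∈ inQuery l Q, (∃ i ∈ st, p ∈ nd i) ∨
    ∃ i, 1 ≤ i ∧ i < 2 * l.n ∧ l.sz i ≤ r ∧ p ∈ nd i ∧ ∃ q ∈ out, q ∈ nd i

open Classical in
/-- The nodes of size larger than `r` that meet the query box and are below a node in `st`. -/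
def pending (l : Layout d) (nd : ℕ → Finset ℕ) (Q : Box) (r : ℝ) (st : List ℕ) : Finset ℕ :=
  (Finset.Ico 1 l.n).filter fun e => r < l.sz e ∧ (nd e ∩ inQuery l Q).Nonempty ∧
    ∃ D ∈ st, nd e ⊆ nd D

theorem Front.cover_list {B : Finset ℕ} {e : ℕ} {r : ℝ} {st : List ℕ} (h : Front l nd Q B e)
    (hst : st.toFinset = B) (hnd : st.Nodup) : Cover l nd Q r st [] where
  valid i hi := by
    have := h.valid i (by rw [← hst]; simpa using hi)
    omega
  disj := by
    refine hnd.imp_of_mem ?_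
    intro i j hi hj hij
    exact h.disj i (by rw [← hst]; simpa using hi) j (by rw [← hst]; simpa using hj) hij
  nodup := by simp
  mem := by simp
  sep := by simp
  cover p hp := by
    obtain ⟨i, hi, hpi⟩ := h.cover p hp
    exact Or.inl ⟨i, by rw [← hst] at hi; simpa using hi, hpi⟩

/-- The popped node has size at most `r`, so its representative is close to all its points.
Disjointness from the nodes left on the stack shows that no point is selected twice. -/
theorem Cover.output {r : ℝ} {st out : List ℕ} {i x : ℕ}
    (h : Cover l nd Q r (st ++ [i]) out) (hr : l.sz i ≤ r) (hx : x ∈ nd i ∩ inQuery l Q) :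
    Cover l nd Q r st (out ++ [x]) := by
  rw [Finset.mem_inter] at hx
  have hp := List.pairwise_append.1 h.disj
  have hi := h.valid i (by simp)
  constructor
  · exact fun j hj => h.valid j (by simp [hj])
  · exact hp.1
  · rw [List.nodup_append]
    refine ⟨h.nodup, by simp, fun a ha b hb => ?_⟩
    rw [List.mem_singleton] at hb
    subst hb
    rintro rfl
    exact h.sep a ha i (by simp) hx.1
  · intro y hy
    rw [List.mem_append, List.mem_singleton] at hy
    rcases hy with hy | rfl
    · exact h.mem y hy
    · exact hx.2
  · intro y hy j hj
    rw [List.mem_append, List.mem_singleton] at hy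
    rcases hy with hy | rfl
    · exact h.sep y hy j (by simp [hj])
    · exact fun hyj => Finset.disjoint_left.1 (hp.2.2 j hj i (by simp)) hyj hx.1
  · intro p hpq
    rcases h.cover p hpq with ⟨j, hj, hpj⟩ | ⟨j, h1, h2, h3, h4, q, hq, hqj⟩
    · rw [List.mem_append, List.mem_singleton] at hj
      rcases hj with hj | rfl
      · exact Or.inl ⟨j, hj, hpj⟩
      · exact Or.inr ⟨j, hi.1, hi.2, hr, hpj, x, by simp, hx.1⟩
    · exact Or.inr ⟨j, h1, h2, h3, h4, q, by simp [hq], hqj⟩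

theorem Found.mem_list {i m r : ℕ} (h : Found l nd Q i m r) {x : ℕ} (hx : x ∈ foundList m) :
    x = m ∧ i ≤ m ∧ m < 2 * l.n ∧ nd m ⊆ nd i := by
  rcases h with ⟨rfl, -⟩ | h
  · simp [foundList] at hx
  · refine ⟨?_, h.1, h.2.1, h.2.2.1⟩
    rw [foundList] at hx
    split_ifs at hx <;> simp at hx
    exact hx

theorem Found.cover_list {i m r : ℕ} (hi : 1 ≤ i) (h : Found l nd Q i m r) {p : ℕ} (hp : p ∈ nd i)
    (hq : p ∈ inQuery l Q) : ∃ j ∈ foundList m, p ∈ nd j := by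
  rcases h with ⟨-, h⟩ | h
  · have := Finset.mem_inter.2 ⟨hp, hq⟩
    rw [h] at this
    simp at this
  · refine ⟨m, ?_, h.2.2.2.1 (Finset.mem_inter.2 ⟨hp, hq⟩)⟩
    rw [foundList, if_neg (by omega)]
    simp

/-- Every query point of the popped node lies in one of its children, and there in the node found.
The nodes found in different children are disjoint because the children are. -/
theorem Cover.refine {r : ℝ} {st out : List ℕ} {i m₁ r₁ m₂ r₂ : ℕ} (ht : Tree l nd)
    (h : Cover l nd Q r (st ++ [i]) out) (hin : i < l.n)
    (h₁ : Found l nd Q (l.lc i) m₁ r₁) (h₂ : Found l nd Q (l.rc i) m₂ r₂) :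
    Cover l nd Q r (st ++ foundList m₁ ++ foundList m₂) out := by
  have hi := (h.valid i (by simp)).1
  have hl1 := ht.left_gt i hi hin
  have hr1 := ht.right_gt i hi hin
  have hu := ht.union i hi hin
  have hdj := ht.disjoint i hi hin
  have hp := List.pairwise_append.1 h.disj
  have s1 : ∀ x ∈ foundList m₁, nd x ⊆ nd i := by
    intro x hx
    obtain ⟨rfl, -, -, h4⟩ := h₁.mem_list hx
    exact h4.trans (by rw [hu]; exact Finset.subset_union_left)
  have s2 : ∀ x ∈ foundList m₂, nd x ⊆ nd i := by
    intro x hx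
    obtain ⟨rfl, -, -, h4⟩ := h₂.mem_list hx
    exact h4.trans (by rw [hu]; exact Finset.subset_union_right)
  have one : ∀ m, (foundList m).Pairwise fun i j => Disjoint (nd i) (nd j) := by
    intro m; rw [foundList]; split_ifs <;> simp
  constructor
  · intro j hj
    rw [List.mem_append, List.mem_append] at hj
    rcases hj with (hj | hj) | hj
    · exact h.valid j (by simp [hj])
    · obtain ⟨rfl, h2, h3, h4⟩ := h₁.mem_list hj
      omega
    · obtain ⟨rfl, h2, h3, h4⟩ := h₂.mem_list hj
      omega
  · rw [List.pairwise_append, List.pairwise_append]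
    refine ⟨⟨hp.1, one _, fun a ha b hb => ?_⟩, one _, fun a ha b hb => ?_⟩
    · exact Finset.disjoint_of_subset_right (s1 b hb) (hp.2.2 a ha i (by simp))
    · rw [List.mem_append] at ha
      rcases ha with ha | ha
      · exact Finset.disjoint_of_subset_right (s2 b hb) (hp.2.2 a ha i (by simp))
      · obtain ⟨rfl, -, -, h4⟩ := h₁.mem_list ha
        obtain ⟨rfl, -, -, h5⟩ := h₂.mem_list hb
        exact Finset.disjoint_of_subset_left h4 (Finset.disjoint_of_subset_right h5 hdj)
  · exact h.nodup
  · exact h.mem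
  · intro x hx j hj
    rw [List.mem_append, List.mem_append] at hj
    have hxi := h.sep x hx i (by simp)
    rcases hj with (hj | hj) | hj
    · exact h.sep x hx j (by simp [hj])
    · exact fun hh => hxi (s1 j hj hh)
    · exact fun hh => hxi (s2 j hj hh)
  · intro p hpq
    rcases h.cover p hpq with ⟨j, hj, hpj⟩ | hh
    · refine Or.inl ?_
      rw [List.mem_append, List.mem_singleton] at hj
      rcases hj with hj | rfl
      · exact ⟨j, by simp [hj], hpj⟩
      · rw [hu, Finset.mem_union] at hpj
        rcases hpj with hpj | hpj
        · obtain ⟨j', hj', hp'⟩ := h₁.cover_list (by omega) hpj hpq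
          exact ⟨j', by simp [hj'], hp'⟩
        · obtain ⟨j', hj', hp'⟩ := h₂.cover_list (by omega) hpj hpq
          exact ⟨j', by simp [hj'], hp'⟩
    · exact Or.inr hh

/-- A node found below one child misses the points of the other child, so `i` itself is no longer
below a node on the stack. Refining therefore uses up one pending node, which makes the set of
pending nodes a potential for time and output size. -/
theorem pending_refine {r : ℝ} {st out : List ℕ} {i m₁ r₁ m₂ r₂ : ℕ} (ht : Tree l nd)
    (h : Cover l nd Q r (st ++ [i]) out) (hin : i < l.n) (hr : r < l.sz i)
    (hm : (nd i ∩ inQuery l Q).Nonempty)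
    (h₁ : Found l nd Q (l.lc i) m₁ r₁) (h₂ : Found l nd Q (l.rc i) m₂ r₂) :
    i ∈ pending l nd Q r (st ++ [i]) ∧
      pending l nd Q r (st ++ foundList m₁ ++ foundList m₂) ⊆
        (pending l nd Q r (st ++ [i])).erase i := by
  have hi := (h.valid i (by simp)).1
  have hl1 := ht.left_gt i hi hin
  have hr1 := ht.right_gt i hi hin
  have hu := ht.union i hi hin
  have hdj := ht.disjoint i hi hin
  have hp := List.pairwise_append.1 h.disj
  have a1 := ht.rep_mem (l.lc i) (by omega) hl1.2
  have a2 := ht.rep_mem (l.rc i) (by omega) hr1.2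
  refine ⟨?_, fun e he => ?_⟩
  · simp only [pending, Finset.mem_filter, Finset.mem_Ico]
    exact ⟨⟨hi, hin⟩, hr, hm, i, by simp, subset_rfl⟩
  · simp only [pending, Finset.mem_filter, Finset.mem_Ico, Finset.mem_erase] at he ⊢
    obtain ⟨h1, h2, h3, D, hD, hDe⟩ := he
    rw [List.mem_append, List.mem_append] at hD
    obtain ⟨x, hx⟩ := h3
    rw [Finset.mem_inter] at hx
    rcases hD with (hD | hD) | hD
    · refine ⟨?_, h1, h2, ⟨x, Finset.mem_inter.2 hx⟩, D, by simp [hD], hDe⟩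
      rintro rfl
      exact Finset.disjoint_left.1 (hp.2.2 D hD e (by simp)) (hDe hx.1) hx.1
    · obtain ⟨rfl, -, -, h4⟩ := h₁.mem_list hD
      refine ⟨?_, h1, h2, ⟨x, Finset.mem_inter.2 hx⟩, i, by simp, ?_⟩
      · rintro rfl
        exact Finset.disjoint_left.1 hdj
          (h4 (hDe (by rw [hu]; exact Finset.mem_union_right _ a2))) a2
      · exact (hDe.trans h4).trans (by rw [hu]; exact Finset.subset_union_left)
    · obtain ⟨rfl, -, -, h4⟩ := h₂.mem_list hD
      refine ⟨?_, h1, h2, ⟨x, Finset.mem_inter.2 hx⟩, i, by simp, ?_⟩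
      · rintro rfl
        exact Finset.disjoint_left.1 hdj a1
          (h4 (hDe (by rw [hu]; exact Finset.mem_union_left _ a1)))
      · exact (hDe.trans h4).trans (by rw [hu]; exact Finset.subset_union_right)

theorem pending_pop {r : ℝ} {st : List ℕ} {i : ℕ} :
    pending l nd Q r st ⊆ pending l nd Q r (st ++ [i]) := by
  intro e he
  simp only [pending, Finset.mem_filter, Finset.mem_Ico] at he ⊢
  obtain ⟨h1, h2, h3, D, hD, hDe⟩ := he
  exact ⟨h1, h2, h3, D, by simp [hD], hDe⟩

/-- The states of the fine phase. -/
structure Fine (l : Layout d) (nd : ℕ → Finset ℕ) (Q : Box) (k : ℕ) (σ r : ℝ) (st out : List ℕ)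
    (s : State) : Prop extends Ready l Q s where
  clusters : s.nreg 4 = k
  last : s.rreg (2 * d + 1) = σ
  radius : s.rreg (2 * d + 2) = r
  outAddr : s.nreg 12 = l.E + out.length * d
  outCount : s.nreg 13 = out.length
  stack : Stack l s st
  points : ∀ j (hj : j < out.length), ∀ a < d, s.rmem (l.E + j * d + a) = l.co a out[j]
  stack_rep : ∀ i ∈ st, HasRep l nd Q s i

/-- Append the point chosen for the node in register `17` to the output. -/
def outputPoint (d : ℕ) : Cmd :=
  .seq (code [.nadd 20 16 17, .nload 20 20])
  (.seq (unroll (fun a => code [.nadd 21 (30 + (2 * d + 1 + a)) 20, .rload (2 * d + 4) 21,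
    .rstore 12 (2 * d + 4), .nadd 12 12 7]) d)
  (code [.nadd 13 13 7]))

theorem outputPoint_runs {k : ℕ} {σ r : ℝ} {st out : List ℕ} {s : State} {i x : ℕ} (hl : l.Valid)
    (ht : Tree l nd)
    (hs : Fine l nd Q k σ r st out s) (hi : s.nreg 17 = i) (hi1 : 1 ≤ i) (hi2 : i < 2 * l.n)
    (hx : s.nmem (l.E + 2 ^ (l.L + 1) + i) = x) (hxi : x ∈ nd i) :
    Runs A (outputPoint d) s (d * 5 + 6) (Fine l nd Q k σ r st (out ++ [x])) := by
  have hxn := Finset.mem_Icc.1 (ht.subset i hi1 hi2 hxi)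
  have e16 := hs.reps
  refine Runs.seq 3 (d * 5 + 3) (by omega) (Runs.code _ (by simp) ?_)
  refine Runs.seq (d * 5 + 1) 2 (by omega) ?_
  refine (Runs.unroll (T := 5) (fun m s' => Ready l Q s' ∧ s'.nreg 20 = x ∧
    s'.nreg 12 = l.E + out.length * d + m ∧
    (∀ j, j ≠ 12 → j ≠ 20 → j ≠ 21 → s'.nreg j = s.nreg j) ∧
    (∀ j, j ≠ 2 * d + 4 → s'.rreg j = s.rreg j) ∧
    s'.nmem = s.nmem ∧ (∀ a < l.E + out.length * d, s'.rmem a = s.rmem a) ∧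
    ∀ a < m, s'.rmem (l.E + out.length * d + a) = l.co a x) ?_ ?_).mono le_rfl ?_
  · rintro m hm s' ⟨r', g20, g12, gn, gr, gm, gp, gc⟩
    have ef := r'.field (2 * d + 1 + m) (by simp only [numFields]; omega)
    have ec := (r'.toOk.stored hl).coord m hm x hxn.1 hxn.2
    have e7 := r'.one
    refine Runs.code _ (by simp) ⟨?_, ?_, ?_, ?_, ?_, ?_, ?_, ?_⟩
    · refine r'.congr (fun j hj => ?_) (fun j hj => ?_) (fun a ha => ?_) (fun a ha => ?_)
      · simp (disch := omega)
      · simp (disch := omega)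
      · simp
      · simp (disch := omega) [g12]
    · simp (disch := omega) [g20]
    · simp (disch := omega) [g12, e7]; omega
    · intro j h1 h2 h3; simp (disch := omega) [gn j h1 h2 h3]
    · intro j h1; simp (disch := omega) [gr j h1]
    · simp [gm]
    · intro a ha
      rw [← gp a ha]
      simp (disch := omega) [g12]
    · intro a ha
      rcases Nat.lt_or_ge a m with h | h
      · rw [← gc a h]
        simp (disch := omega) [g12]
      · obtain rfl : a = m := by omega
        simp (disch := omega) [g12, ef, g20, ec]
  · have o12 := hs.outAddr
    refine ⟨?_, ?_, ?_, ?_, ?_, ?_, ?_, ?_⟩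
    · refine hs.toReady.congr (fun j hj => ?_) (fun j hj => ?_) (fun a ha => ?_) (fun a ha => ?_)
      · simp (disch := omega)
      · simp (disch := omega)
      · simp
      · simp
    · simp (disch := omega) [e16, hi, hx]
    · simp (disch := omega) [o12]
    · intro j h1 h2 h3; simp (disch := omega)
    · intro j h1; simp
    · simp
    · intro a ha; simp
    · intro a ha; omega
  · rintro s' ⟨r', g20, g12, gn, gr, gm, gp, gc⟩
    have e7 := r'.one
    have o13 := (gn 13 (by omega) (by omega) (by omega)).trans hs.outCount
    refine Runs.code _ (by simp) ?_
    refine { r'.congr (fun j hj => ?_) (fun j hj => ?_) (fun a ha => ?_) (fun a ha => ?_) with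
      clusters := ?_, last := ?_, radius := ?_, outAddr := ?_, outCount := ?_, stack := ?_,
      points := ?_, stack_rep := ?_ }
    · simp (disch := omega)
    · simp
    · simp
    · simp
    · simp (disch := omega) [gn, hs.clusters]
    · simp (disch := omega) [gr, hs.last]
    · simp (disch := omega) [gr, hs.radius]
    · simp (disch := omega) [g12]; ring
    · simp (disch := omega) [o13, e7]
    · refine ⟨?_, ?_⟩
      · rw [← hs.stack.1]; simp (disch := omega) [gn]
      · simpa [gm] using hs.stack.2
    · intro j hj a ha
      rw [List.length_append, List.length_singleton] at hj
      rcases Nat.lt_or_ge j out.length with h | h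
      · rw [List.getElem_append_left h, ← hs.points j h a ha]
        have : j * d + d ≤ out.length * d := by
          rw [← Nat.succ_mul]; exact Nat.mul_le_mul_right _ h
        simp [gp (l.E + j * d + a) (by omega)]
      · obtain rfl : j = out.length := by omega
        simp [gc a ha]
    · intro j hj
      have := hs.stack_rep j hj
      simpa [HasRep, gm] using this

/-- Refine the nodes on the stack until their size is at most the radius. -/
def fineLoop (d : ℕ) : Cmd :=
  .while (.nlt 11 10)
    (.seq (code [.nsub 10 10 7, .nload 17 10, .nadd 20 (30 + 2 * d) 17, .rload (2 * d + 4) 20])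
      (.ite (.rle (2 * d + 4) (2 * d + 2)) (outputPoint d) (refineNode d)))

/-- Time for popping a node and for the output of a point. -/
def outputTime (d : ℕ) : ℕ := d * 5 + 15

-- Amortisation: each node on the stack carries credit for being popped and possibly output, each
-- pending node carries the cost of its refinement and the credit for the two nodes it may push. The
-- number of selected points is bounded in the same way: outputs, stack and pending nodes together
-- never increase.
open Classical in
theorem fineLoop_runs {k : ℕ} {σ r : ℝ} {st : List ℕ} {s : State} (hd : 2 ≤ d)
    (hl : l.Valid) (ht : Tree l nd)
    (hz : ∀ i, 1 ≤ i → i < 2 * l.n → (l.sz i ≤ 0 ↔ l.n ≤ i)) (hr : 0 ≤ r)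
    (hs : Fine l nd Q k σ r st [] s) (hc : Cover l nd Q r st []) :
    Runs A (fineLoop d) s (∑ e ∈ pending l nd Q r st,
        (refineTime d l.L l.Λ (Inside l Q e) + 2 * outputTime d) + st.length * outputTime d + 1)
      fun s' => ∃ out, Fine l nd Q k σ r [] out s' ∧ Cover l nd Q r [] out ∧
        out.length ≤ (pending l nd Q r st).card + st.length := by
  refine Runs.while (fun T s' => ∃ st' out, ∑ e ∈ pending l nd Q r st',
      (refineTime d l.L l.Λ (Inside l Q e) + 2 * outputTime d) + st'.length * outputTime d + 1 ≤ T ∧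
    Fine l nd Q k σ r st' out s' ∧ Cover l nd Q r st' out ∧
    out.length + st'.length + (pending l nd Q r st').card ≤
      (pending l nd Q r st).card + st.length) ?_ ?_ _ _ ?_
  rotate_left 2
  · exact ⟨st, [], le_rfl, hs, hc, by simp; omega⟩
  · rintro T s' ⟨st', out, hT, hw, hc', hle⟩ hb
    rw [State.holds_nlt, hw.base, hw.stack.1] at hb
    obtain rfl | ⟨st', i, rfl⟩ := st'.eq_nil_or_concat'
    · simp at hb
    obtain ⟨p1, p2, p3⟩ := hw.stack.pop
    have hi := hc'.valid i (by simp)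
    have e7 := hw.one
    have ef := hw.field (2 * d) (by simp only [numFields]; omega)
    have esz := (hw.toOk.stored hl).nodeSize i hi.1 hi.2
    have hrep := hw.stack_rep i (by simp)
    set s1 := List.foldl State.step s' [.nsub 10 10 7, .nload 17 10, .nadd 20 (30 + 2 * d) 17,
      .rload (2 * d + 4) 20] with hs1
    have g10 : s1.nreg 10 = l.E + 2 ^ (l.L + 1) + 2 ^ l.L + st'.length := by
      simp (disch := omega) [hs1, p1, e7]
    have g17 : s1.nreg 17 = i := by simp (disch := omega) [hs1, p1, e7, p2]
    have gn : ∀ j, j ≠ 10 → j ≠ 17 → j ≠ 20 → s1.nreg j = s'.nreg j := by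
      intro j h1 h2 h3; simp (disch := omega) [hs1]
    have gz : s1.rreg (2 * d + 4) = l.sz i := by
      simp (disch := omega) [hs1, p1, e7, p2, ef, esz]
    have gr : ∀ j, j ≠ 2 * d + 4 → s1.rreg j = s'.rreg j := by
      intro j h1; simp (disch := omega) [hs1]
    have gm : s1.nmem = s'.nmem := by simp [hs1]
    have gp : s1.rmem = s'.rmem := by simp [hs1]
    have run1 : ∀ {p : Cmd} {T : ℕ} {R : State → Prop}, Runs A p s1 T R →
        Runs A (.seq (code [.nsub 10 10 7, .nload 17 10, .nadd 20 (30 + 2 * d) 17,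
          .rload (2 * d + 4) 20]) p) s' (5 + T) R := fun h =>
      Runs.seq 5 _ le_rfl (Runs.code _ (by simp) h)
    clear_value s1
    have w1 : Fine l nd Q k σ r st' out s1 := by
      refine { hw.toReady.congr (fun j hj => gn j (by omega) (by omega) (by omega))
          (fun j hj => gr j (by omega)) (by simp [gm]) (by simp [gp]) with
        clusters := (gn 4 (by omega) (by omega) (by omega)).trans hw.clusters
        last := (gr _ (by omega)).trans hw.last
        radius := (gr _ (by omega)).trans hw.radius
        outAddr := (gn 12 (by omega) (by omega) (by omega)).trans hw.outAddr
        outCount := (gn 13 (by omega) (by omega) (by omega)).trans hw.outCount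
        stack := ⟨g10, by rw [gm]; exact p3⟩
        points := by rw [gp]; exact hw.points
        stack_rep := fun j hj => by rw [HasRep, gm]; exact hw.stack_rep j (by simp [hj]) }
    have hrep1 : HasRep l nd Q s1 i := by rw [HasRep, gm]; exact hrep
    rw [List.length_append, List.length_singleton] at hle hT
    by_cases hsz : l.sz i ≤ r
    · refine ⟨5 + (d * 5 + 6 + 1), _, ?_, run1 (Runs.ite (d * 5 + 6) le_rfl
        (fun _ => (outputPoint_runs hl ht w1 g17 hi.1 hi.2 rfl
          (Finset.mem_inter.1 hrep1).1).mono le_rfl fun s2 w2 =>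
            ⟨st', _, le_rfl, w2, hc'.output hsz hrep1, ?_⟩) fun h => absurd ?_ h)⟩
      · have := Finset.sum_le_sum_of_subset (f := fun e =>
          refineTime d l.L l.Λ (Inside l Q e) + 2 * outputTime d)
          (pending_pop (l := l) (nd := nd) (Q := Q) (r := r) (st := st') (i := i))
        have h2 : (st'.length + 1) * outputTime d = st'.length * outputTime d + (d * 5 + 15) := by
          rw [Nat.succ_mul]; rfl
        rw [h2] at hT
        omega
      · have := Finset.card_le_card
          (pending_pop (l := l) (nd := nd) (Q := Q) (r := r) (st := st') (i := i))
        rw [List.length_append, List.length_singleton]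
        omega
      · rw [State.holds_rle, gz, w1.radius]; exact hsz
    -- Leaves have size at most `0 ≤ r`, so they are output and never refined.
    · have hin : i < l.n := by
        by_contra h
        exact hsz (((hz i hi.1 hi.2).2 (not_lt.1 h)).trans hr)
      set R := refineTime d l.L l.Λ (Inside l Q i) with hR
      set F : ℕ → ℕ := fun e => refineTime d l.L l.Λ (Inside l Q e) + 2 * outputTime d with hF
      refine ⟨5 + (R + 1), (∑ e ∈ pending l nd Q r (st' ++ [i]), F e) - R + st'.length * outputTime d + 1,
        ?_, run1 (Runs.ite R le_rfl (fun h => absurd ?_ hsz) fun _ =>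
          (refineNode_runs hd hl ht w1.toReady w1.stack g17 hi.1 hin).mono le_rfl ?_)⟩
      · have hmem : i ∈ pending l nd Q r (st' ++ [i]) := by
          simp only [pending, Finset.mem_filter, Finset.mem_Ico]
          exact ⟨⟨hi.1, hin⟩, not_le.1 hsz, ⟨_, hrep1⟩, i, by simp, subset_rfl⟩
        have := Finset.single_le_sum (f := F) (fun _ _ => Nat.zero_le _) hmem
        have h2 : (st'.length + 1) * outputTime d = st'.length * outputTime d + (d * 5 + 15) := by
          rw [Nat.succ_mul]; rfl
        rw [h2] at hT
        have : R ≤ F i := Nat.le_add_right _ _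
        change ∑ e ∈ pending l nd Q r (st' ++ [i]), F e + _ + 1 ≤ _ at hT
        omega
      · rw [State.holds_rle, gz, w1.radius] at h; exact h
      · rintro s2 ⟨k2, m₁, r₁, m₂, r₂, F1, F2, st2, rep2⟩
        obtain ⟨q1, q2⟩ := pending_refine ht hc' hin (not_le.1 hsz) ⟨_, hrep1⟩ F1 F2
        have hsum := Finset.sum_le_sum_of_subset (f := F) q2
        have hcd := Finset.card_le_card q2
        rw [Finset.card_erase_of_mem q1] at hcd
        have hcp := Finset.card_pos.2 ⟨i, q1⟩
        have hadd := Finset.add_sum_erase _ F q1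
        have len : ∀ m, (foundList m).length ≤ 1 := by
          intro m; rw [foundList]; split_ifs <;> simp
        have l1 := len m₁
        have l2 := len m₂
        have w2 : Fine l nd Q k σ r (st' ++ foundList m₁ ++ foundList m₂) out s2 := by
          refine { k2.ready w1.toReady with
            clusters := (k2.low 4 (by omega) (by omega)).trans w1.clusters
            last := (k2.rreg _ (by omega)).trans w1.last
            radius := (k2.rreg _ (by omega)).trans w1.radius
            outAddr := (k2.low 12 (by omega) (by omega)).trans w1.outAddr
            outCount := (k2.low 13 (by omega) (by omega)).trans w1.outCount
            stack := st2
            points := by rw [k2.rmem]; exact w1.points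
            stack_rep := fun j hj => ?_ }
          rw [List.append_assoc, List.mem_append] at hj
          rcases hj with hj | hj
          · exact k2.hasRep j (hc'.valid j (by simp [hj])).2 (w1.stack_rep j hj)
          · exact rep2 j hj
        have hc2 := hc'.refine ht hin F1 F2
        refine ⟨_, out, ?_, w2, hc2, ?_⟩
        -- The share of `i` beyond its refinement time is the credit of the at most two pushed
        -- nodes.
        · have hFi : F i = R + 2 * outputTime d := rfl
          have hlen : (st' ++ foundList m₁ ++ foundList m₂).length * outputTime d ≤
              st'.length * outputTime d + 2 * outputTime d := by
            rw [← add_mul]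
            exact Nat.mul_le_mul_right _ (by simp only [List.length_append]; omega)
          change ∑ e ∈ pending l nd Q r (st' ++ foundList m₁ ++ foundList m₂), F e + _ + 1 ≤ _
          omega
        · simp only [List.length_append]
          omega
  · rintro T s' ⟨st', out, hT, hw, hc', hle⟩ hb
    rw [State.holds_nlt, hw.base, hw.stack.1] at hb
    obtain rfl : st' = [] := List.eq_nil_of_length_eq_zero (by omega)
    exact ⟨by omega, out, hw, hc', by simp at hle; omega⟩

end Fine

/-! ## The query program -/

section Query

variable {d : ℕ} {A : Procedures d} {l : Layout d} {nd : ℕ → Finset ℕ} {Q : Box}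

/-- Initialise the registers. -/
def initRegs (d : ℕ) : Cmd :=
  .seq (code [.nconst 8 0, .nconst 7 1, .nadd 4 0 8, .nload 5 8, .nconst 30 0])
  (.seq (unroll (fun j => code [.nadd (30 + (j + 1)) (30 + j) 5]) (5 * d + 8))
  (.seq (code [.nload 6 31, .nadd 16 6 5, .nadd 16 16 5, .nadd 11 16 5, .nadd 10 11 8, .nadd 12 6 8,
      .nconst 13 0, .nconst 14 0, .rconst (2 * d + 3) 0, .rconst (2 * d + 1) 0, .nadd 9 4 8])
  (.seq (unroll (fun _ => code [.nadd 9 9 9]) d) (code [.nadd 9 9 7]))))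

/-- A state at the start of a query. -/
structure Start (l : Layout d) (Q : Box) (k : ℕ) (s : State) : Prop where
  clusters : s.nreg 0 = k
  lo : ∀ a < d, s.rreg a = Q.lo a
  hi : ∀ a < d, s.rreg (d + a) = Q.hi a
  eps : s.rreg (2 * d) = Q.ε
  nmem : ∀ a < l.E, s.nmem a = l.nm a
  rmem : ∀ a < l.E, s.rmem a = l.rm a
  clear : ∀ a, l.E ≤ a → s.nmem a = 0

/-- Time of `initRegs`. -/
def initTime (d : ℕ) : ℕ := 12 * d + 60

/-- Naturals cannot be multiplied in one step, so the field addresses arise by repeated addition of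
the width, and the limit `2 ^ d * k + 1` by doubling `k` exactly `d` times. Memory beyond the data
structure is zero, so the counters describe the empty queue without initialisation. -/
theorem initRegs_runs {k : ℕ} {s : State} (hl : l.Valid) (hs : Start l Q k s) :
    Runs A (initRegs d) s (initTime d) (Work l nd Q k (2 ^ d * k + 1) 0 ∅ []) := by
  have hst := hl.stored _ _ hs.nmem hs.rmem
  refine Runs.seq 6 (12 * d + 40) (by simp only [initTime]; omega) (Runs.code _ (by simp) ?_)
  refine Runs.seq ((5 * d + 8) * 2 + 1) (2 * d + 20) (by omega) ?_
  refine (Runs.unroll (T := 2) (fun m s' => s'.nreg 8 = 0 ∧ s'.nreg 7 = 1 ∧ s'.nreg 4 = k ∧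
    s'.nreg 5 = 2 ^ l.L ∧ (∀ j ≤ m, s'.nreg (30 + j) = j * 2 ^ l.L) ∧
    s'.nmem = s.nmem ∧ s'.rmem = s.rmem ∧ s'.rreg = s.rreg) ?_ ?_).mono le_rfl ?_
  · rintro m hm s' ⟨h8, h7, h4, h5, hf, hnm, hrm, hrr⟩
    refine Runs.code _ (by simp) ⟨?_, ?_, ?_, ?_, ?_, ?_, ?_, ?_⟩
    · simp (disch := omega) [h8]
    · simp (disch := omega) [h7]
    · simp (disch := omega) [h4]
    · simp (disch := omega) [h5]
    · intro j hj
      rcases Nat.lt_or_ge j (m + 1) with h | h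
      · rw [← hf j (by omega)]; simp (disch := omega)
      · obtain rfl : j = m + 1 := by omega
        simp (disch := omega) [hf m le_rfl, h5]; ring
    · simp [hnm]
    · simp [hrm]
    · simp [hrr]
  · have h0 := hs.clusters
    have hw := hst.width
    refine ⟨?_, ?_, ?_, ?_, ?_, ?_, ?_, ?_⟩
    · simp (disch := omega)
    · simp (disch := omega)
    · simp (disch := omega) [h0]
    · simp (disch := omega) [hw]
    · intro j hj
      obtain rfl : j = 0 := by omega
      simp (disch := omega)
    all_goals simp
  · rintro s1 ⟨h8, h7, h4, h5, hf, hnm, hrm, hrr⟩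
    have h31 := hf 1 (by omega)
    have hE := hst.free
    rw [← hnm] at hE
    refine Runs.seq 12 (2 * d + 8) (by omega) (Runs.code _ (by simp) ?_)
    set s2 := List.foldl State.step s1 [.nload 6 31, .nadd 16 6 5, .nadd 16 16 5, .nadd 11 16 5,
      .nadd 10 11 8, .nadd 12 6 8, .nconst 13 0, .nconst 14 0, .rconst (2 * d + 3) 0,
      .rconst (2 * d + 1) 0, .nadd 9 4 8] with hs2
    have p1 : 2 ^ (l.L + 1) = 2 * 2 ^ l.L := by ring
    have w2 : Work l nd Q k k 0 ∅ [] s2 := by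
      refine { width := ?_, free := ?_, one := ?_, zero := ?_, field := ?_, nmem := ?_, rmem := ?_,
               lo := ?_, hi := ?_, eps := ?_, rzero := ?_, reps := ?_, base := ?_, clusters := ?_,
               limit := ?_, last := ?_, outAddr := ?_, outCount := ?_, counts := ?_, total := ?_,
               stack := ⟨?_, ?_⟩, queue_lt := by simp, stack_lt := by simp, queue_rep := by simp,
               stack_rep := by simp }
      · simp (disch := omega) [hs2, h5]
      · simpa (disch := omega) [hs2, h31] using hE
      · simp (disch := omega) [hs2, h7]
      · simp (disch := omega) [hs2, h8]
      · intro j hj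
        rw [← hf j (by simp only [numFields] at hj; omega)]
        simp (disch := omega) [hs2]
      · intro a ha; rw [← hs.nmem a ha, ← hnm]; simp [hs2]
      · intro a ha; rw [← hs.rmem a ha, ← hrm]; simp [hs2]
      · intro a ha; rw [← hs.lo a ha, ← hrr]; simp (disch := omega) [hs2]
      · intro a ha; rw [← hs.hi a ha, ← hrr]; simp (disch := omega) [hs2]
      · rw [← hs.eps, ← hrr]; simp (disch := omega) [hs2]
      · simp (disch := omega) [hs2]
      · rw [p1]; simp at hE; simp (disch := omega) [hs2, h31, h5, hE]; omega
      · rw [p1]; simp at hE; simp (disch := omega) [hs2, h31, h5, hE]; omega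
      · simp (disch := omega) [hs2, h4]
      · simp (disch := omega) [hs2, h4, h8]
      · simp (disch := omega) [hs2]
      · simp at hE; simp (disch := omega) [hs2, h31, hE, h8]
      · simp (disch := omega) [hs2]
      · intro v hv hv'
        have : s2.nmem = s.nmem := by rw [← hnm]; simp [hs2]
        rw [this, hs.clear _ (by omega)]; simp
      · simp (disch := omega) [hs2]
      · rw [p1]; simp at hE; simp (disch := omega) [hs2, h31, h5, hE, h8]; omega
      · simp
    clear_value s2
    have upd : ∀ {lim lim' : ℕ} {s s' : State}, Work l nd Q k lim 0 ∅ [] s →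
        (∀ j, j ≠ 9 → s'.nreg j = s.nreg j) → s'.nreg 9 = lim' → s'.nmem = s.nmem →
        s'.rmem = s.rmem → s'.rreg = s.rreg → Work l nd Q k lim' 0 ∅ [] s' := by
      intro lim lim' s s' w hn h9 hm hp hr
      exact { w.toReady.congr (fun j hj => hn j (by omega)) (by simp [hr]) (by simp [hm])
          (by simp [hp]) with
        clusters := (hn 4 (by omega)).trans w.clusters
        limit := h9
        last := by rw [hr]; exact w.last
        outAddr := (hn 12 (by omega)).trans w.outAddr
        outCount := (hn 13 (by omega)).trans w.outCount
        counts := by rw [hm]; exact w.counts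
        total := (hn 14 (by omega)).trans w.total
        stack := ⟨(hn 10 (by omega)).trans w.stack.1, by simp⟩
        queue_lt := by simp
        stack_lt := by simp
        queue_rep := by simp
        stack_rep := by simp }
    refine Runs.seq (d * 2 + 1) 2 (by omega) ?_
    refine (Runs.unroll (T := 2) (fun m => Work l nd Q k (2 ^ m * k) 0 ∅ []) ?_
      (by simpa using w2)).mono le_rfl ?_
    · intro m hm s3 w3
      have h9 := w3.limit
      refine Runs.code _ (by simp) (upd w3 (fun j hj => ?_) ?_ ?_ ?_ ?_)
      · simp (disch := omega)
      · simp [h9]; ring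
      all_goals simp
    · intro s3 w3
      have h9 := w3.limit
      have h7 := w3.one
      refine Runs.code _ (by simp) (upd w3 (fun j hj => ?_) ?_ ?_ ?_ ?_)
      · simp (disch := omega)
      · simp [h9, h7]
      all_goals simp

/-- Put the tight node below the root into the queue. -/
def rootStep (d : ℕ) : Cmd :=
  .seq (code [.nconst 23 1])
  (.seq (examine d)
  (.ite (.nlt 8 24)
    (.seq (code [.nadd 20 16 24, .nstore 20 25, .nadd 18 24 8]) (.seq enqueue (code [.nconst 14 1])))
    (code [.nconst 9 0])))

/-- Time of `rootStep`. -/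
def rootTime (d L Λ : ℕ) : ℕ := insideTime d + crossTime d L Λ + (L + 1) * 7 + 20

-- If the query is empty, the limit is set to `0` and the coarse loop is skipped. Otherwise the
-- front consists of the tight node found below the root.
open Classical in
theorem rootStep_runs {k lim : ℕ} {s : State} (hd : 2 ≤ d) (hl : l.Valid) (ht : Tree l nd)
    (hs : Work l nd Q k lim 0 ∅ [] s) :
    Runs A (rootStep d) s (rootTime d l.L l.Λ) fun s' =>
      ∃ B, Front l nd Q B 0 ∧ ((B = ∅ ∧ Work l nd Q k 0 0 B [] s') ∨
        (B.card = 1 ∧ Work l nd Q k lim 0 B [] s')) := by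
  have hlw := hl.lt_width
  have h2n := hl.two_le
  refine Runs.seq 2 (insideTime d + crossTime d l.L l.Λ + (l.L + 1) * 7 + 18)
    (by simp only [rootTime]; omega) (Runs.code _ (by simp) ?_)
  set s1 := List.foldl State.step s [.nconst 23 1] with hs1
  have g23 : s1.nreg 23 = 1 := by simp [hs1]
  have k1 : ∀ j, j ≠ 23 → s1.nreg j = s.nreg j := by intro j hj; simp (disch := omega) [hs1]
  have m1 : s1.nmem = s.nmem := by simp [hs1]
  have p1 : s1.rmem = s.rmem := by simp [hs1]
  have q1 : s1.rreg = s.rreg := by simp [hs1]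
  clear_value s1
  have r1 : Ready l Q s1 := hs.toReady.congr (fun j hj => k1 j (by omega)) (by simp [q1])
    (by simp [m1]) (by simp [p1])
  refine Runs.seq (insideTime d + crossTime d l.L l.Λ) ((l.L + 1) * 7 + 18) (by omega) ?_
  refine (examine_found hd hl ht r1.toOk g23 le_rfl (by omega)).mono ?_ ?_
  · split_ifs <;> omega
  rintro s2 ⟨k2, F⟩
  have r2 := (k2.refine (l := l) (nd := nd) (Q := Q)).ready r1
  have low : ∀ j < 23, s2.nreg j = s.nreg j := fun j hj =>
    (k2.low j (by omega)).trans (k1 j (by omega))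
  have hfr := Front.root ht F
  have e8 := r2.zero
  have e7 := r2.one
  have e16 := r2.reps
  have mm : s2.nmem = s.nmem := k2.nmem.trans m1
  have rr : s2.rreg (2 * d + 1) = 0 := by rw [k2.rreg _ (by omega), q1, hs.last]
  refine Runs.ite ((l.L + 1) * 7 + 17) (by omega) (fun h => ?_) (fun h => Runs.code _ (by simp) ?_)
  all_goals rw [State.holds_nlt, e8] at h
  · rcases F with F | F
    · omega
    set m := s2.nreg 24 with hm
    set x := s2.nreg 25 with hx
    have hfl : foundList m = [m] := if_neg (by omega)
    rw [hfl] at hfr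
    have hB : [m].toFinset = {m} := by simp
    rw [hB] at hfr
    refine Runs.seq 4 ((l.L + 1) * 7 + 10) (by omega) (Runs.code _ (by simp) ?_)
    set s3 := List.foldl State.step s2 [.nadd 20 16 24, .nstore 20 25, .nadd 18 24 8] with hs3
    have g18 : s3.nreg 18 = m := by simp (disch := omega) [hs3, e8, ← hm]
    have k3 : ∀ j, j ≠ 20 → j ≠ 18 → s3.nreg j = s2.nreg j := by
      intro j h1 h2; simp (disch := omega) [hs3]
    have m3 : s3.nmem = Function.update s2.nmem (l.E + 2 ^ (l.L + 1) + m) x := by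
      simp (disch := omega) [hs3, e16, ← hm, ← hx, State.putN]
    have p3 : s3.rmem = s2.rmem := by simp [hs3]
    have q3 : s3.rreg = s2.rreg := by simp [hs3]
    clear_value s3
    have r3 : Ready l Q s3 := r2.congr (fun j hj => k3 j (by omega) (by omega)) (by simp [q3])
      (fun a ha => by
        rw [m3, Function.update_of_ne]
        have := Nat.le_add_right l.E (2 ^ (l.L + 1) + m)
        omega) (by simp [p3])
    have c3 : Counts l.L l.E s3.nmem ∅ := by
      rw [m3, mm]
      exact hs.counts.update_above (by omega)
    have hrep : HasRep l nd Q s3 m := by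
      rw [HasRep, m3]; simpa using F.2.2.2.2.1
    refine Runs.seq ((l.L + 1) * 7 + 3) 2 (by omega) ?_
    refine (enqueue_runs r3.toOk c3 g18 (by omega) (by simp)).mono le_rfl ?_
    rintro s4 ⟨k4, c4, -, -⟩
    have r4 := k4.ready r3
    refine Runs.code _ (by simp) ⟨{m}, hfr, Or.inr ⟨by simp, ?_⟩⟩
    set s5 := List.foldl State.step s4 [.nconst 14 1] with hs5
    have k5 : ∀ j, j ≠ 14 → s5.nreg j = s4.nreg j := by intro j hj; simp (disch := omega) [hs5]
    have g14 : s5.nreg 14 = 1 := by simp [hs5]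
    have m5 : s5.nmem = s4.nmem := by simp [hs5]
    have p5 : s5.rmem = s4.rmem := by simp [hs5]
    have q5 : s5.rreg = s4.rreg := by simp [hs5]
    clear_value s5
    have all : ∀ j < 17, j ≠ 14 → s5.nreg j = s.nreg j := fun j h1 h2 =>
      ((k5 j h2).trans (k4.low j h1)).trans ((k3 j (by omega) (by omega)).trans (low j (by omega)))
    exact { r4.congr (fun j hj => k5 j (by omega)) (by simp [q5]) (by simp [m5]) (by simp [p5]) with
      clusters := (all 4 (by omega) (by omega)).trans hs.clusters
      limit := (all 9 (by omega) (by omega)).trans hs.limit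
      last := by rw [q5, k4.rreg, q3, rr]
      outAddr := (all 12 (by omega) (by omega)).trans hs.outAddr
      outCount := (all 13 (by omega) (by omega)).trans hs.outCount
      counts := by rw [m5]; simpa using c4
      total := by simpa using g14
      stack := ⟨(all 10 (by omega) (by omega)).trans hs.stack.1, by simp⟩
      queue_lt := by simpa using F.2.1
      stack_lt := by simp
      queue_rep := by
        intro i hi
        rw [Finset.mem_singleton] at hi
        subst hi
        rw [HasRep, m5]
        exact k4.hasRep hrep
      stack_rep := by simp }
  · have h0 : s2.nreg 24 = 0 := by omega
    rw [h0, foundList, if_pos rfl] at hfr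
    refine ⟨∅, hfr, Or.inl ⟨rfl, ?_⟩⟩
    set s5 := List.foldl State.step s2 [.nconst 9 0] with hs5
    have k5 : ∀ j, j ≠ 9 → s5.nreg j = s2.nreg j := by intro j hj; simp (disch := omega) [hs5]
    have g9 : s5.nreg 9 = 0 := by simp [hs5]
    have m5 : s5.nmem = s2.nmem := by simp [hs5]
    have p5 : s5.rmem = s2.rmem := by simp [hs5]
    have q5 : s5.rreg = s2.rreg := by simp [hs5]
    clear_value s5
    have all : ∀ j < 17, j ≠ 9 → s5.nreg j = s.nreg j := fun j h1 h2 =>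
      (k5 j h2).trans (low j (by omega))
    exact { r2.congr (fun j hj => k5 j (by omega)) (by simp [q5]) (by simp [m5]) (by simp [p5]) with
      clusters := (all 4 (by omega) (by omega)).trans hs.clusters
      limit := g9
      last := by rw [q5, rr]
      outAddr := (all 12 (by omega) (by omega)).trans hs.outAddr
      outCount := (all 13 (by omega) (by omega)).trans hs.outCount
      counts := by rw [m5, mm]; exact hs.counts
      total := (all 14 (by omega) (by omega)).trans hs.total
      stack := ⟨(all 10 (by omega) (by omega)).trans hs.stack.1, by simp⟩
      queue_lt := by simp
      stack_lt := by simp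
      queue_rep := by simp
      stack_rep := by simp }

/-- The coarse phase. -/
def coarsePhase (d : ℕ) : Cmd :=
  .seq (initRegs d) (.seq (rootStep d) (.seq (coarseLoop d) drainQueue))

/-- Time of the coarse phase. -/
def coarsePhaseTime (d L Λ lim : ℕ) : ℕ :=
  initTime d + rootTime d L Λ + lim * (coarseTime d L Λ + 1) + lim * (L * 12 + 15) + 2

-- At the end all nodes of the front are moved onto the stack, from which the fine phase works; the
-- order of their numbers no longer matters.
open Classical in
theorem coarsePhase_runs {k : ℕ} {s : State} (hd : 2 ≤ d) (hl : l.Valid) (ht : Tree l nd)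
    (hz : ∀ i, 1 ≤ i → i < 2 * l.n → (l.sz i ≤ 0 ↔ l.n ≤ i)) (hk : 1 ≤ k) (hs : Start l Q k s) :
    Runs A (coarsePhase d) s (coarsePhaseTime d l.L l.Λ (2 ^ d * k + 1)) fun s' =>
      ∃ lim' σ st, Work l nd Q k lim' σ ∅ st s' ∧ st.Nodup ∧
        CoarseResult l nd Q (2 ^ d * k + 1) σ st.toFinset := by
  have hlim : 2 ≤ 2 ^ d * k + 1 := by
    have : 0 < 2 ^ d * k := by positivity
    omega
  set lim := 2 ^ d * k + 1 with hlimdef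
  refine Runs.seq (initTime d) (rootTime d l.L l.Λ + lim * (coarseTime d l.L l.Λ + 1) +
    lim * (l.L * 12 + 15) + 2) (by simp only [coarsePhaseTime]; omega) ?_
  refine (initRegs_runs (nd := nd) hl hs).mono le_rfl fun s1 w1 => ?_
  refine Runs.seq (rootTime d l.L l.Λ) (lim * (coarseTime d l.L l.Λ + 1) +
    lim * (l.L * 12 + 15) + 2) (by omega) ?_
  refine (rootStep_runs hd hl ht w1).mono le_rfl fun s2 h2 => ?_
  refine Runs.seq (lim * (coarseTime d l.L l.Λ + 1) + 1) (lim * (l.L * 12 + 15) + 1) (by omega) ?_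
  have key : Runs A (coarseLoop d) s2 (lim * (coarseTime d l.L l.Λ + 1) + 1) fun s' =>
      ∃ lim' σ' B' st, Work l nd Q k lim' σ' B' st s' ∧ st.Nodup ∧ (∀ i ∈ st, i ∉ B') ∧
        CoarseResult l nd Q lim σ' (B' ∪ st.toFinset) := by
    obtain ⟨B, hf, ⟨rfl, w2⟩ | ⟨hB, w2⟩⟩ := h2
    -- With the limit `0` the loop test fails at once; the empty front counts as one of leaves only.
    · refine Runs.while (fun T s' => 1 ≤ T ∧ Work l nd Q k 0 0 ∅ [] s') ?_ ?_ _ _ ⟨by omega, w2⟩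
      · rintro T s' ⟨-, w⟩ hb
        rw [State.holds_nlt, w.limit] at hb
        omega
      · rintro T s' ⟨hT, w⟩ -
        exact ⟨hT, 0, 0, ∅, [], w, by simp, by simp, 0, by simpa using hf, by simp,
          Or.inl ⟨rfl, by simp⟩⟩
    · exact coarseLoop_runs hd hl ht hz w2 hf hB hlim
  refine key.mono le_rfl ?_
  rintro s3 ⟨lim', σ', B', st, w3, hnd, hB, hres⟩
  have hcard : B'.card ≤ lim := by
    obtain ⟨e, -, h, -⟩ := hres
    exact (Finset.card_le_card Finset.subset_union_left).trans h
  refine (drainQueue_runs hl w3 hnd hB).mono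
    (Nat.add_le_add_right (Nat.mul_le_mul_right _ hcard) 1) ?_
  rintro s4 ⟨st', w4, hnd', hst⟩
  exact ⟨lim', σ', st', w4, hnd', by rw [hst]; exact hres⟩

/-- Compute the radius of the packing. -/
def computeRadius (d : ℕ) : Cmd :=
  .seq (code [.rload (2 * d + 4) 8, .rmul (2 * d + 4) (2 * d + 4) (2 * d),
    .nadd 20 (30 + (3 * d + 1)) 4, .rload (2 * d + 5) 20, .rdiv (2 * d + 5) (2 * d + 5) (2 * d + 4),
    .rconst (2 * d + 4) 1])
  (.seq (.ite (.rlt (2 * d + 5) (2 * d + 4)) (code [.rconst (2 * d + 5) 1]) nop)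
  (code [.rconst (2 * d + 4) (2 * d), .rmul (2 * d + 5) (2 * d + 4) (2 * d + 5),
    .rdiv (2 * d + 2) (2 * d + 1) (2 * d + 5)]))

/-- The table of `f` has entries only for `k ≤ n`. For larger `k` the cell read may contain
anything; then `x` is still at least one, which suffices because `σ = 0` in this case. -/
theorem computeRadius_runs {k lim : ℕ} {σ : ℝ} {st : List ℕ} {s : State} (hl : l.Valid)
    (hs : Work l nd Q k lim σ ∅ st s) :
    Runs A (computeRadius d) s 20 fun s' => ∃ x : ℝ, 1 ≤ x ∧
      (k ≤ l.n → x = max 1 (l.fk k / (l.cc * Q.ε))) ∧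
      Fine l nd Q k σ (σ / (2 * d * x)) st [] s' := by
  have e8 := hs.zero
  have e4 := hs.clusters
  have ee := hs.eps
  have ef := hs.field (3 * d + 1) (by simp only [numFields]; omega)
  have hst := hs.toOk.stored hl
  have ec := hst.const
  refine Runs.seq 7 12 (by omega) (Runs.code _ (by simp) ?_)
  set s1 := List.foldl State.step s [.rload (2 * d + 4) 8, .rmul (2 * d + 4) (2 * d + 4) (2 * d),
    .nadd 20 (30 + (3 * d + 1)) 4, .rload (2 * d + 5) 20, .rdiv (2 * d + 5) (2 * d + 5) (2 * d + 4),
    .rconst (2 * d + 4) 1] with hs1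
  set y : ℝ := s.rmem ((3 * d + 1) * 2 ^ l.L + k) / (l.cc * Q.ε) with hy
  have k1 : ∀ j, j ≠ 20 → s1.nreg j = s.nreg j := by intro j hj; simp (disch := omega) [hs1]
  have q1 : ∀ j, j ≠ 2 * d + 4 → j ≠ 2 * d + 5 → s1.rreg j = s.rreg j := by
    intro j h1 h2; simp (disch := omega) [hs1]
  have g4 : s1.rreg (2 * d + 4) = 1 := by simp [hs1]
  have g5 : s1.rreg (2 * d + 5) = y := by
    simp (disch := omega) [hs1, e8, ec, ee, ef, e4, hy]
  have m1 : s1.nmem = s.nmem := by simp [hs1]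
  have p1 : s1.rmem = s.rmem := by simp [hs1]
  clear_value s1
  refine Runs.seq 3 4 (by omega) ?_
  have key : Runs A (.ite (.rlt (2 * d + 5) (2 * d + 4)) (code [.rconst (2 * d + 5) 1]) nop) s1 3
      fun s' => s'.nreg = s1.nreg ∧ (∀ j, j ≠ 2 * d + 5 → s'.rreg j = s1.rreg j) ∧
        s'.rreg (2 * d + 5) = max 1 y ∧ s'.nmem = s1.nmem ∧ s'.rmem = s1.rmem := by
    refine Runs.ite 2 le_rfl (fun h => Runs.code _ (by simp) ⟨?_, fun j hj => ?_, ?_, ?_, ?_⟩)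
      (fun h => Runs.nop (by omega) ⟨rfl, fun _ _ => rfl, ?_, rfl, rfl⟩)
    all_goals rw [State.holds_rlt, g5, g4] at h
    · simp
    · simp (disch := omega)
    · simp [h.le]
    · simp
    · simp
    · rw [g5, max_eq_right (not_lt.1 h)]
  refine key.mono le_rfl ?_
  rintro s2 ⟨k2, q2, g2, m2, p2⟩
  refine Runs.code _ (by simp) ⟨max 1 y, le_max_left _ _, fun hk => ?_, ?_⟩
  · rw [hy, hst.factor k hk]
  set s3 := List.foldl State.step s2 [.rconst (2 * d + 4) (2 * d),
    .rmul (2 * d + 5) (2 * d + 4) (2 * d + 5), .rdiv (2 * d + 2) (2 * d + 1) (2 * d + 5)] with hs3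
  have gl : s2.rreg (2 * d + 1) = σ := by
    rw [q2 _ (by omega), q1 _ (by omega) (by omega), hs.last]
  have k3 : ∀ j, j ≠ 20 → s3.nreg j = s.nreg j := by
    intro j hj
    rw [← k1 j hj, ← k2]; simp [hs3]
  have q3 : ∀ j, j ≠ 2 * d + 4 → j ≠ 2 * d + 5 → j ≠ 2 * d + 2 → s3.rreg j = s.rreg j := by
    intro j h1 h2 h3
    rw [← q1 j h1 h2, ← q2 j h2]; simp (disch := omega) [hs3]
  have m3 : s3.nmem = s.nmem := by rw [← m1, ← m2]; simp [hs3]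
  have p3 : s3.rmem = s.rmem := by rw [← p1, ← p2]; simp [hs3]
  have g3 : s3.rreg (2 * d + 2) = σ / (2 * d * max 1 y) := by
    simp (disch := omega) [hs3, gl, g2]
  clear_value s3
  exact { hs.toReady.congr (fun j hj => k3 j (by omega))
      (fun j hj => q3 j (by omega) (by omega) (by omega)) (by simp [m3]) (by simp [p3]) with
    clusters := (k3 4 (by omega)).trans hs.clusters
    last := (q3 _ (by omega) (by omega) (by omega)).trans hs.last
    radius := g3
    outAddr := by simpa using (k3 12 (by omega)).trans hs.outAddr
    outCount := (k3 13 (by omega)).trans hs.outCount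
    stack := ⟨(k3 10 (by omega)).trans hs.stack.1, by rw [m3]; exact hs.stack.2⟩
    points := by simp
    stack_rep := fun i hi => by rw [HasRep, m3]; exact hs.stack_rep i hi }

/-- The point with the coordinates stored for `p`. -/
def Layout.pt (l : Layout d) (p : ℕ) : Pt d := WithLp.toLp 2 fun i => l.co i p

/-- The lower corner of the query box. -/
def Box.lower (Q : Box) (d : ℕ) : Pt d := WithLp.toLp 2 fun i => Q.lo i

/-- The upper corner of the query box. -/
def Box.upper (Q : Box) (d : ℕ) : Pt d := WithLp.toLp 2 fun i => Q.hi i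

/-- Cluster the packing and expand the clustering. -/
def finish (d : ℕ) : Cmd :=
  .seq (code [.nconst 0 0, .nadd 2 12 8])
  (.seq (.solve 6 13 4 answerRef)
  (.ite (.rlt (2 * d + 3) (2 * d + 1)) (.expand 0 6 13 answerRef (2 * d + 2) 4 answerRef) nop))

theorem block_write {α : Type} (h : ℕ → α) (a : ℕ) (L : List α) :
    State.block (State.write h a L) a L.length = L := by
  refine List.ext_getElem (by simp [State.block]) fun j h1 h2 => ?_
  simp [State.block, State.write, h2]

theorem readDesc_writeDesc (s : State) (D : Desc) :
    (s.writeDesc answerRef D).readDesc answerRef = D := by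
  simp [State.readDesc, State.writeDesc, answerRef, block_write]

theorem points_eq {h : ℕ → ℝ} {E : ℕ} {out : List ℕ}
    (hp : ∀ j (hj : j < out.length), ∀ a < d, h (E + j * d + a) = l.co a out[j]) :
    State.points d h E out.length = out.map l.pt := by
  refine List.ext_getElem (by simp [State.points]) fun j h1 h2 => ?_
  simp only [State.points, List.getElem_map, List.getElem_range, State.point, Layout.pt]
  congr 1
  funext i
  exact hp j (by simpa using h2) i i.2

/-- The description and the time of the final calls. -/
def finalCalls (A : Procedures d) (l : Layout d) (Q : Box) (k : ℕ) (σ r : ℝ) (out : List ℕ) :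
    Desc × ℕ :=
  open Classical in
  if 0 < σ then
    ((A.expand (Q.lower d) (Q.upper d) (out.map l.pt) (A.solve (out.map l.pt) k).1 r k).1,
      (A.solve (out.map l.pt) k).2 +
        (A.expand (Q.lower d) (Q.upper d) (out.map l.pt) (A.solve (out.map l.pt) k).1 r k).2)
  else A.solve (out.map l.pt) k

/-- The description of the first clustering may overwrite the memory for naturals from address `0`,
as nothing there is needed any more. In the memory for reals it is written behind the selected
points, which the expansion still reads. If `σ = 0`, the points selected are all points of the query
and expansion is omitted. -/
theorem finish_runs {k : ℕ} {σ r : ℝ} {out : List ℕ} {s : State}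
    (hs : Fine l nd Q k σ r [] out s) :
    Runs A (finish d) s ((finalCalls A l Q k σ r out).2 + 10) fun s' =>
      s'.readDesc answerRef = (finalCalls A l Q k σ r out).1 := by
  have e8 := hs.zero
  have e12 := hs.outAddr
  set T := (finalCalls A l Q k σ r out).2 with hT
  refine Runs.seq 3 (T + 7) (by omega) (Runs.code _ (by simp) ?_)
  set s1 := List.foldl State.step s [.nconst 0 0, .nadd 2 12 8] with hs1
  have g0 : s1.nreg 0 = 0 := by simp (disch := omega) [hs1]
  have g2 : s1.nreg 2 = l.E + out.length * d := by simp (disch := omega) [hs1, e12, e8]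
  have k1 : ∀ j, j ≠ 0 → j ≠ 2 → s1.nreg j = s.nreg j := by
    intro j h1 h2; simp (disch := omega) [hs1]
  have m1 : s1.rmem = s.rmem := by simp [hs1]
  have q1 : s1.rreg = s.rreg := by simp [hs1]
  clear_value s1
  have g6 := (k1 6 (by omega) (by omega)).trans hs.free
  have g13 := (k1 13 (by omega) (by omega)).trans hs.outCount
  have g4 := (k1 4 (by omega) (by omega)).trans hs.clusters
  set P := out.map l.pt with hP
  have hcall : s1.callSolve A 6 13 4 = A.solve P k := by
    rw [State.callSolve, g6, g13, g4, m1, points_eq hs.points]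
  set D := A.solve P k with hD
  set s2 := s1.writeDesc answerRef D.1 with hs2
  have c2 : ∀ j, j ≠ 1 → j ≠ 3 → s2.nreg j = s1.nreg j := by
    intro j h1 h2; simp [hs2, State.writeDesc, answerRef, h1, h2]
  have r2 : s2.rreg = s.rreg := q1
  -- Writing the description starts at the end of the list of points and leaves the list intact.
  have hpts : State.points d s2.rmem (s2.nreg 6) (s2.nreg 13) = P := by
    rw [c2 6 (by omega) (by omega), c2 13 (by omega) (by omega), g6, g13]
    refine points_eq fun j hj a ha => ?_
    rw [← hs.points j hj a ha, ← m1]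
    have : j * d + d ≤ out.length * d := by
      rw [← Nat.succ_mul]; exact Nat.mul_le_mul_right _ hj
    simp only [hs2, State.writeDesc, State.write, answerRef, g2]
    rw [if_pos (by omega)]
  have hlo : State.point d s2.rreg 0 = Q.lower d := by
    rw [State.point, Box.lower]
    congr 1
    funext i
    rw [r2, zero_add, hs.lo i i.2]
  have hhi : State.point d s2.rreg (0 + d) = Q.upper d := by
    rw [State.point, Box.upper]
    congr 1
    funext i
    rw [r2, zero_add, hs.hi i i.2]
  have hcall2 : s2.callExpand A 0 6 13 answerRef (2 * d + 2) 4 =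
      A.expand (Q.lower d) (Q.upper d) P D.1 r k := by
    rw [State.callExpand, hpts, hlo, hhi, c2 4 (by omega) (by omega), g4, r2, hs.radius,
      hs2, readDesc_writeDesc]
  have ex1 : Exec A (.solve 6 13 4 answerRef) s1 (D.2 + 1) s2 := by
    have := Exec.solve (A := A) 6 13 4 answerRef s1
    rwa [hcall] at this
  have hDT : D.2 ≤ T := by
    rw [hT, finalCalls]
    split_ifs
    · exact Nat.le_add_right _ _
    · exact le_rfl
  refine Runs.seq (D.2 + 1) (T - D.2 + 6) (by omega) ⟨_, s2, le_rfl, ex1, ?_⟩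
  refine Runs.ite (T - D.2 + 5) (by omega) (fun h => ?_) (fun h => Runs.nop (by omega) ?_)
  all_goals rw [State.holds_rlt, r2, hs.rzero, hs.last] at h
  · have ex2 := Exec.expand (A := A) 0 6 13 answerRef (2 * d + 2) 4 answerRef s2
    rw [hcall2] at ex2
    refine ⟨_, _, ?_, ex2, ?_⟩
    · rw [hT, finalCalls, if_pos h]
      simp only [← hP, ← hD]
      omega
    · beta_reduce
      rw [readDesc_writeDesc, finalCalls, if_pos h]
  · rw [hs2, readDesc_writeDesc, finalCalls, if_neg h]

/-- The query program. -/
def queryProgram (d : ℕ) : Cmd :=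
  .seq (coarsePhase d) (.seq (computeRadius d) (.seq (fineLoop d) (finish d)))

open Classical in
/-- Time of the fine phase. -/
def fineTime (l : Layout d) (nd : ℕ → Finset ℕ) (Q : Box) (r : ℝ) (st : List ℕ) : ℕ :=
  ∑ e ∈ pending l nd Q r st, (refineTime d l.L l.Λ (Inside l Q e) + 2 * outputTime d) +
    st.length * outputTime d + 1

/-- This is the interface between program and mathematics: what remains afterwards is to bound the
number of pending nodes and the cost of the final clustering. -/
theorem queryProgram_runs {k : ℕ} {s : State} (hd : 2 ≤ d) (hl : l.Valid) (ht : Tree l nd)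
    (hz : ∀ i, 1 ≤ i → i < 2 * l.n → (l.sz i ≤ 0 ↔ l.n ≤ i)) (hk : 1 ≤ k) (hs : Start l Q k s) :
    ∃ (σ x r : ℝ) (st out : List ℕ) (t : ℕ) (s' : State), 1 ≤ x ∧
      (k ≤ l.n → x = max 1 (l.fk k / (l.cc * Q.ε))) ∧ r = σ / (2 * d * x) ∧ st.Nodup ∧
      CoarseResult l nd Q (2 ^ d * k + 1) σ st.toFinset ∧ Cover l nd Q r [] out ∧
      out.length ≤ (pending l nd Q r st).card + st.length ∧
      Exec A (queryProgram d) s t s' ∧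
      t ≤ coarsePhaseTime d l.L l.Λ (2 ^ d * k + 1) + fineTime l nd Q r st +
        (finalCalls A l Q k σ r out).2 + 30 ∧
      s'.readDesc answerRef = (finalCalls A l Q k σ r out).1 := by
  obtain ⟨t1, s1, ht1, ex1, lim', σ, st, w1, hnd, hres⟩ :=
    coarsePhase_runs (A := A) hd hl ht hz hk hs
  obtain ⟨t2, s2, ht2, ex2, x, hx1, hx2, w2⟩ := computeRadius_runs (A := A) hl w1
  obtain ⟨e, hf, hcard, hcase⟩ := hres
  have hσ : 0 ≤ σ := by
    rcases hcase with ⟨h, -⟩ | ⟨-, h1, h2, h3⟩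
    · exact h.ge
    · rw [h3]
      by_contra h
      have := (hz e h1 (by omega)).1 (not_le.1 h).le
      omega
  have hr : 0 ≤ σ / (2 * d * x) := by positivity
  obtain ⟨t3, s3, ht3, ex3, out, w3, hcov, hlen⟩ :=
    fineLoop_runs (A := A) hd hl ht hz hr w2 (hf.cover_list rfl hnd)
  obtain ⟨t4, s4, ht4, ex4, hdesc⟩ := finish_runs (A := A) w3
  refine ⟨σ, x, _, st, out, _, s4, hx1, hx2, rfl, hnd, ⟨e, hf, hcard, hcase⟩, hcov, hlen,
    .seq ex1 (.seq ex2 (.seq ex3 ex4)), ?_, hdesc⟩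
  have : t3 ≤ fineTime l nd Q (σ / (2 * d * x)) st := ht3
  omega

end Query

/-! ## Bit-interleaved keys -/

section Keys

variable {α : Type} {d : ℕ} {Y : ℕ → α → ℝ}

/-- The index of the dyadic interval of a coordinate; `μ` determines the axis and the level. -/
def zfloor (d : ℕ) (Y : ℕ → α → ℝ) (μ : ℕ) (p : α) : ℕ := ⌊2 ^ (μ / d + 1) * Y (μ % d) p⌋₊

/-- The first bits of the key of a point. -/
def zkey (d : ℕ) (Y : ℕ → α → ℝ) : ℕ → α → ℕ
  | 0, _ => 0
  | m + 1, p => 2 * zkey d Y m p + zfloor d Y m p % 2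

/-- The coordinates are in the unit cube. -/
def InCube (d : ℕ) (Y : ℕ → α → ℝ) (p : α) : Prop := ∀ a < d, 0 ≤ Y a p ∧ Y a p < 1

theorem floor_two_pow_half (m : ℕ) (y : ℝ) : ⌊2 ^ (m + 1) * y⌋₊ / 2 = ⌊2 ^ m * y⌋₊ := by
  have := Nat.floor_div_natCast (2 ^ (m + 1) * y) 2
  rw [← this]
  congr 1
  push_cast
  ring

theorem floor_eq_of_le {m m' : ℕ} (h : m ≤ m') {y y' : ℝ}
    (he : ⌊2 ^ m' * y⌋₊ = ⌊2 ^ m' * y'⌋₊) : ⌊2 ^ m * y⌋₊ = ⌊2 ^ m * y'⌋₊ := by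
  induction m', h using Nat.le_induction with
  | base => exact he
  | succ m' _ ih => exact ih (by rw [← floor_two_pow_half, he, floor_two_pow_half])

theorem zfloor_half_of_lt (hd : 0 < d) {p : α} (hp : InCube d Y p) {μ : ℕ} (hμ : μ < d) :
    zfloor d Y μ p / 2 = 0 := by
  rw [zfloor, floor_two_pow_half, Nat.div_eq_of_lt hμ, Nat.floor_eq_zero]
  have := (hp (μ % d) (Nat.mod_lt _ hd)).2
  simpa using this

theorem zfloor_half_of_ge (hd : 0 < d) {p : α} {μ : ℕ} (hμ : d ≤ μ) :
    zfloor d Y μ p / 2 = zfloor d Y (μ - d) p := by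
  obtain ⟨ν, rfl⟩ := Nat.exists_eq_add_of_le' hμ
  rw [zfloor, floor_two_pow_half, zfloor, Nat.add_sub_cancel, Nat.add_div_right _ hd,
    Nat.add_mod_right]

theorem zkey_half (m : ℕ) (p : α) : zkey d Y (m + 1) p / 2 = zkey d Y m p := by
  rw [zkey]
  omega

theorem zkey_eq_of_le {p q : α} {m m' : ℕ} (h : m ≤ m') (he : zkey d Y m' p = zkey d Y m' q) :
    zkey d Y m p = zkey d Y m q := by
  induction m', h using Nat.le_induction with
  | base => exact he
  | succ m' _ ih => exact ih (by rw [← zkey_half, he, zkey_half])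

theorem zkey_le_of_le {p q : α} {m m' : ℕ} (h : m ≤ m') (he : zkey d Y m' p ≤ zkey d Y m' q) :
    zkey d Y m p ≤ zkey d Y m q := by
  induction m', h using Nat.le_induction with
  | base => exact he
  | succ m' _ ih => exact ih (by rw [← zkey_half m', ← zkey_half m' q]; exact Nat.div_le_div_right he)

/-- The key records only the last binary digit of each dyadic index. The remaining digits of the
index at position `μ` form the index of the same axis one level up, at position `μ - d`, or vanish
in the first `d` positions because the coordinates are less than one. -/
theorem zkey_eq_iff (hd : 0 < d) {p q : α} (hp : InCube d Y p) (hq : InCube d Y q) (m : ℕ) :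
    zkey d Y m p = zkey d Y m q ↔ ∀ μ < m, zfloor d Y μ p = zfloor d Y μ q := by
  induction m with
  | zero => simp [zkey]
  | succ m ih =>
    constructor
    · intro h
      have h1 : zkey d Y m p = zkey d Y m q := zkey_eq_of_le (Nat.le_succ m) h
      have h2 := ih.1 h1
      intro μ hμ
      rcases Nat.lt_or_ge μ m with h3 | h3
      · exact h2 μ h3
      obtain rfl : μ = m := by omega
      have h4 : zfloor d Y μ p / 2 = zfloor d Y μ q / 2 := by
        rcases Nat.lt_or_ge μ d with h5 | h5
        · rw [zfloor_half_of_lt hd hp h5, zfloor_half_of_lt hd hq h5]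
        · rw [zfloor_half_of_ge hd h5, zfloor_half_of_ge hd h5]
          exact h2 _ (by omega)
      rw [zkey, zkey] at h
      omega
    · intro h
      rw [zkey, zkey, ih.2 fun μ hμ => h μ (by omega), h m (by omega)]

theorem zfloor_eq_floor (hd : 0 < d) {a m : ℕ} (ha : a < d) (p : α) :
    zfloor d Y (m * d + a) p = ⌊2 ^ (m + 1) * Y a p⌋₊ := by
  rw [zfloor, mul_comm m d, Nat.mul_add_mod, Nat.mod_eq_of_lt ha, Nat.mul_add_div hd,
    Nat.div_eq_of_lt ha, add_zero]

/-- After `m * d` bits each axis has contributed exactly `m` digits, so equal keys mean the same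
cube of side `2 ^ (-m)`. -/
theorem zkey_octree_iff (hd : 0 < d) {p q : α} (hp : InCube d Y p) (hq : InCube d Y q) (m : ℕ) :
    zkey d Y (m * d) p = zkey d Y (m * d) q ↔ ∀ a < d, ⌊2 ^ m * Y a p⌋₊ = ⌊2 ^ m * Y a q⌋₊ := by
  rw [zkey_eq_iff hd hp hq]
  constructor
  · intro h a ha
    rcases m with _ | m
    · have h1 := (hp a ha).2
      have h2 := (hq a ha).2
      rw [pow_zero, one_mul, one_mul, Nat.floor_eq_zero.2 h1, Nat.floor_eq_zero.2 h2]
    · rw [← zfloor_eq_floor hd ha, ← zfloor_eq_floor hd ha]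
      exact h _ (by rw [Nat.succ_mul]; omega)
  · intro h μ hμ
    have ha := Nat.mod_lt μ hd
    have hdm : μ / d < m := (Nat.div_lt_iff_lt_mul hd).2 hμ
    exact floor_eq_of_le hdm (h (μ % d) ha)

theorem abs_sub_lt_of_zkey_eq (hd : 0 < d) {p q : α} (hp : InCube d Y p) (hq : InCube d Y q) {m : ℕ}
    (h : zkey d Y (m * d) p = zkey d Y (m * d) q) {a : ℕ} (ha : a < d) :
    |Y a p - Y a q| < (2 ^ m)⁻¹ := by
  have hf := (zkey_octree_iff hd hp hq m).1 h a ha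
  have h2 : (0 : ℝ) < 2 ^ m := by positivity
  have hp0 := (hp a ha).1
  have hq0 := (hq a ha).1
  have a1 := Nat.floor_le (show 0 ≤ 2 ^ m * Y a p by positivity)
  have a2 := Nat.lt_floor_add_one (2 ^ m * Y a p)
  have b1 := Nat.floor_le (show 0 ≤ 2 ^ m * Y a q by positivity)
  have b2 := Nat.lt_floor_add_one (2 ^ m * Y a q)
  rw [hf] at a1 a2
  have key : |2 ^ m * (Y a p - Y a q)| < 1 := abs_lt.2 ⟨by linarith, by linarith⟩
  rw [abs_mul, abs_of_pos h2] at key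
  rwa [← one_div, lt_div_iff₀' h2]

/-- Two different points differ in some coordinate and are separated by a sufficiently fine grid. A
maximum over the finitely many pairs gives one length for all. -/
theorem exists_zkey_injOn (hd : 0 < d) (X : Finset α) (hX : ∀ p ∈ X, InCube d Y p)
    (hsep : ∀ p ∈ X, ∀ q ∈ X, (∀ a < d, Y a p = Y a q) → p = q) :
    ∃ M, ∀ p ∈ X, ∀ q ∈ X, zkey d Y M p = zkey d Y M q → p = q := by
  have : ∀ pq : α × α, ∃ m : ℕ, pq.1 ∈ X → pq.2 ∈ X →
      zkey d Y (m * d) pq.1 = zkey d Y (m * d) pq.2 → pq.1 = pq.2 := by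
    rintro ⟨p, q⟩
    by_cases h : ∃ a < d, Y a p ≠ Y a q
    · obtain ⟨a, ha, hne⟩ := h
      obtain ⟨m, hm⟩ := exists_pow_lt_of_lt_one (abs_pos.2 (sub_ne_zero.2 hne))
        (show (2 : ℝ)⁻¹ < 1 by norm_num)
      refine ⟨m, fun hp hq he => ?_⟩
      have := abs_sub_lt_of_zkey_eq hd (hX p hp) (hX q hq) he ha
      rw [← inv_pow] at this
      exact absurd this hm.le.not_gt
    · push Not at h
      exact ⟨0, fun hp hq _ => hsep p hp q hq h⟩
  choose m hm using this
  refine ⟨(X ×ˢ X).sup m * d, fun p hp q hq he => hm (p, q) hp hq (zkey_eq_of_le ?_ he)⟩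
  exact Nat.mul_le_mul_right d (Finset.le_sup (f := m) (Finset.mk_mem_product hp hq))

end Keys

/-! ## The tree of the cells of a key -/

section KeyTree

/-- The length of the longest common beginning of the keys of `g` and `g + 1`. -/
def lam (key : ℕ → ℕ → ℕ) (M g : ℕ) : ℕ := Nat.findGreatest (fun m => key m g = key m (g + 1)) M

/-- The points `1, …, n` are sorted by their keys; `gap` enumerates the gaps between consecutive
points in the order of the common beginning of the keys. -/
structure KeyTree (n M : ℕ) (key : ℕ → ℕ → ℕ) (gap gid : ℕ → ℕ) : Prop where
  two_le : 2 ≤ n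
  zero : ∀ p, key 0 p = 0
  half : ∀ m p, key (m + 1) p / 2 = key m p
  mono : ∀ m ≤ M, ∀ p q, 1 ≤ p → p ≤ q → q ≤ n → key m p ≤ key m q
  inj : ∀ p q, 1 ≤ p → p ≤ n → 1 ≤ q → q ≤ n → key M p = key M q → p = q
  gap_mem : ∀ i, 1 ≤ i → i < n → 1 ≤ gap i ∧ gap i < n
  gid_mem : ∀ g, 1 ≤ g → g < n → 1 ≤ gid g ∧ gid g < n
  gap_gid : ∀ g, 1 ≤ g → g < n → gap (gid g) = g
  gid_gap : ∀ i, 1 ≤ i → i < n → gid (gap i) = i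
  gap_mono : ∀ i j, 1 ≤ i → i ≤ j → j < n → lam key M (gap i) ≤ lam key M (gap j)

/-- The length of the common beginning of the keys of the points of a node. -/
def level (n M : ℕ) (key : ℕ → ℕ → ℕ) (gap : ℕ → ℕ) (i : ℕ) : ℕ :=
  if i < n then lam key M (gap i) else M

/-- A point of a node. -/
def anchor (n : ℕ) (gap : ℕ → ℕ) (i : ℕ) : ℕ := if i < n then gap i else i + 1 - n

/-- The points of a node. -/
def cell (n M : ℕ) (key : ℕ → ℕ → ℕ) (gap : ℕ → ℕ) (i : ℕ) : Finset ℕ :=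
  (Finset.Icc 1 n).filter fun p =>
    key (level n M key gap i) p = key (level n M key gap i) (anchor n gap i)

/-- The in-order sequence of the nodes. -/
def nodeSeq (n H : ℕ) (gid : ℕ → ℕ) (x : ℕ) : ℕ :=
  if x < 2 ∨ 2 * n < x then H else if x % 2 = 0 then x / 2 + n - 1 else gid (x / 2)

/-- The minimum of the sequence of the nodes between two leaves. -/
def lcaSeq (n H : ℕ) (gid : ℕ → ℕ) (u v : ℕ) : ℕ :=
  (Finset.Ico (2 * u) (2 * v + 1)).fold min H (nodeSeq n H gid)

variable {n M H : ℕ} {key : ℕ → ℕ → ℕ} {gap gid : ℕ → ℕ}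

theorem mem_cell {i p : ℕ} : p ∈ cell n M key gap i ↔ (1 ≤ p ∧ p ≤ n) ∧
    key (level n M key gap i) p = key (level n M key gap i) (anchor n gap i) := by
  rw [cell, Finset.mem_filter, Finset.mem_Icc]

namespace KeyTree

theorem eq_of_le (h : KeyTree n M key gap gid) {m m' p q : ℕ} (hm : m ≤ m')
    (he : key m' p = key m' q) : key m p = key m q := by
  induction m', hm using Nat.le_induction with
  | base => exact he
  | succ m' _ ih => exact ih (by rw [← h.half, he, h.half])

theorem key_lam (h : KeyTree n M key gap gid) (g : ℕ) :
    key (lam key M g) g = key (lam key M g) (g + 1) :=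
  Nat.findGreatest_spec (P := fun m => key m g = key m (g + 1)) (Nat.zero_le M)
    (by rw [h.zero, h.zero])

theorem le_lam {m g : ℕ} (hm : m ≤ M) (he : key m g = key m (g + 1)) : m ≤ lam key M g :=
  Nat.le_findGreatest hm he

theorem lam_lt (h : KeyTree n M key gap gid) {g : ℕ} (h1 : 1 ≤ g) (h2 : g < n) :
    lam key M g < M := by
  refine lt_of_le_of_ne (Nat.findGreatest_le M) fun he => ?_
  have := h.key_lam g
  rw [he] at this
  have := h.inj g (g + 1) h1 (by omega) (by omega) (by omega) this
  omega

/-- Directly after the longest common prefix of two consecutive points, the bit is zero for the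
first and one for the second, by sortedness. -/
theorem succ_lt (h : KeyTree n M key gap gid) {g : ℕ} (h1 : 1 ≤ g) (h2 : g < n) :
    key (lam key M g + 1) g < key (lam key M g + 1) (g + 1) := by
  have hlt := h.lam_lt h1 h2
  refine lt_of_le_of_ne (h.mono (lam key M g + 1) hlt g (g + 1) h1 (by omega) (by omega)) fun he => ?_
  have := le_lam hlt he
  omega

/-- Since keys are sorted, a prefix shared by `u` and `v` is shared by all points between them,
hence across each gap. -/
theorem key_eq_iff (h : KeyTree n M key gap gid) {m u v : ℕ} (hm : m ≤ M) (h1 : 1 ≤ u)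
    (huv : u ≤ v) (h2 : v ≤ n) : key m u = key m v ↔ ∀ g, u ≤ g → g < v → m ≤ lam key M g := by
  constructor
  · intro he g hg1 hg2
    have a1 := h.mono m hm u g h1 hg1 (by omega)
    have a2 := h.mono m hm g (g + 1) (by omega) (by omega) (by omega)
    have a3 := h.mono m hm (g + 1) v (by omega) (by omega) h2
    exact le_lam hm (by omega)
  · intro hg
    induction v, huv using Nat.le_induction with
    | base => rfl
    | succ v huv ih =>
      rw [ih (by omega) fun g h1 h2 => hg g h1 (by omega)]
      exact h.eq_of_le (hg v huv (by omega)) (h.key_lam v)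

/-- Within one cell the bit after the common prefix changes from zero to one at a gap of this prefix
length. By sortedness it cannot return to zero, so a second such gap is impossible. -/
theorem lam_unique (h : KeyTree n M key gap gid) {g g' : ℕ} (h1 : 1 ≤ g) (hgg : g < g')
    (h2 : g' < n) (hl : lam key M g = lam key M g')
    (he : key (lam key M g) g = key (lam key M g) g') : False := by
  have a1 := h.succ_lt h1 (by omega)
  have a2 := h.succ_lt (g := g') (by omega) h2
  have a3 := h.mono (lam key M g + 1) (h.lam_lt h1 (by omega)) (g + 1) g' (by omega) hgg (by omega)
  have a4 := h.key_lam g'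
  rw [← hl] at a2 a4
  have b1 := h.half (lam key M g) g
  have b2 := h.half (lam key M g) g'
  have b3 := h.half (lam key M g) (g' + 1)
  omega

theorem level_le (h : KeyTree n M key gap gid) {i : ℕ} (hi : 1 ≤ i) : level n M key gap i ≤ M := by
  rw [level]
  split_ifs with hin
  · obtain ⟨g1, g2⟩ := h.gap_mem i hi hin
    exact (h.lam_lt g1 g2).le
  · exact le_rfl

theorem level_mono (h : KeyTree n M key gap gid) {i j : ℕ} (hi : 1 ≤ i) (hij : i ≤ j) :
    level n M key gap i ≤ level n M key gap j := by
  by_cases hj : j < n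
  · rw [level, level, if_pos hj, if_pos (by omega)]
    exact h.gap_mono i j hi hij hj
  · conv_rhs => rw [level, if_neg hj]
    exact h.level_le hi

/-- An inner node is determined by its prefix length and its cell. -/
theorem id_unique (h : KeyTree n M key gap gid) {i j : ℕ} (hi : 1 ≤ i) (hin : i < n) (hj : 1 ≤ j)
    (hjn : j < n) (hl : lam key M (gap i) = lam key M (gap j))
    (he : key (lam key M (gap i)) (gap i) = key (lam key M (gap i)) (gap j)) : i = j := by
  obtain ⟨gi1, gi2⟩ := h.gap_mem i hi hin
  obtain ⟨gj1, gj2⟩ := h.gap_mem j hj hjn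
  rcases lt_trichotomy (gap i) (gap j) with c | c | c
  · exact (h.lam_unique gi1 c gj2 hl he).elim
  · rw [← h.gid_gap i hi hin, c, h.gid_gap j hj hjn]
  · exact (h.lam_unique gj1 c gi2 hl.symm (by rw [← hl]; exact he.symm)).elim

theorem anchor_mem (h : KeyTree n M key gap gid) {i : ℕ} (hi : 1 ≤ i) (hi2 : i < 2 * n) :
    anchor n gap i ∈ cell n M key gap i := by
  rw [mem_cell]
  refine ⟨?_, rfl⟩
  rw [anchor]
  split_ifs with hin
  · have := h.gap_mem i hi hin
    omega
  · omega

theorem leaf_cell (h : KeyTree n M key gap gid) {i : ℕ} (hi : n ≤ i) (hi2 : i < 2 * n) :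
    cell n M key gap i = {i + 1 - n} := by
  have h2 := h.two_le
  ext p
  rw [mem_cell, level, if_neg (by omega), anchor, if_neg (by omega), Finset.mem_singleton]
  constructor
  · rintro ⟨hp, he⟩
    exact h.inj p _ hp.1 hp.2 (by omega) (by omega) he
  · rintro rfl
    exact ⟨by omega, rfl⟩

theorem lca_self {u : ℕ} (hH : 2 * n < H) (h1 : 1 ≤ u) (h2 : u ≤ n) :
    lcaSeq n H gid u u = u + n - 1 := by
  have : Finset.Ico (2 * u) (2 * u + 1) = {2 * u} := by ext x; simp
  rw [lcaSeq, this, Finset.fold_singleton, nodeSeq, if_neg (by omega), if_pos (by omega)]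
  rw [Nat.mul_div_cancel_left u two_pos, min_eq_left (by omega)]

/-- Leaves have larger numbers than gaps, so between two different leaves the minimum is taken at a
gap. -/
theorem lca_eq_gid (h : KeyTree n M key gap gid) {u v : ℕ} (hH : 2 * n < H) (h1 : 1 ≤ u)
    (huv : u < v) (h2 : v ≤ n) : ∃ g, u ≤ g ∧ g < v ∧ lcaSeq n H gid u v = gid g ∧
      ∀ g', u ≤ g' → g' < v → gid g ≤ gid g' := by
  obtain ⟨g, hg, hmin⟩ := (Finset.Ico u v).exists_min_image gid ⟨u, by simp [huv]⟩
  rw [Finset.mem_Ico] at hg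
  have hg2 := h.gid_mem g (by omega) (by omega)
  refine ⟨g, hg.1, hg.2, le_antisymm ?_ ?_, fun g' a b => hmin g' (by simp [a, b])⟩
  · rw [lcaSeq, Finset.fold_min_le]
    refine Or.inr ⟨2 * g + 1, by rw [Finset.mem_Ico]; omega, ?_⟩
    rw [nodeSeq, if_neg (by omega), if_neg (by omega), show (2 * g + 1) / 2 = g by omega]
  · rw [lcaSeq, Finset.le_fold_min]
    refine ⟨by omega, fun x hx => ?_⟩
    rw [Finset.mem_Ico] at hx
    rw [nodeSeq]
    split_ifs with c1 c2
    · omega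
    · omega
    · exact hmin (x / 2) (by rw [Finset.mem_Ico]; omega)

/-- The lowest common ancestor of two points. -/
theorem lca_spec (h : KeyTree n M key gap gid) {u v : ℕ} (hH : 2 * n < H) (h1 : 1 ≤ u)
    (huv : u ≤ v) (h2 : v ≤ n) : 1 ≤ lcaSeq n H gid u v ∧ lcaSeq n H gid u v < 2 * n ∧
      (∀ p, u ≤ p → p ≤ v → p ∈ cell n M key gap (lcaSeq n H gid u v)) ∧
      (∀ m ≤ M, key m u = key m v → m ≤ level n M key gap (lcaSeq n H gid u v)) ∧
      (lcaSeq n H gid u v < n → u ≤ gap (lcaSeq n H gid u v) ∧ gap (lcaSeq n H gid u v) < v) := by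
  rcases huv.eq_or_lt with rfl | huv
  · have h3 := lca_self (gid := gid) hH h1 h2
    have h4 := h.leaf_cell (i := u + n - 1) (by omega) (by omega)
    rw [h3]
    refine ⟨by omega, by omega, fun p a b => ?_, fun m hm _ => ?_, fun hh => by omega⟩
    · rw [h4, Finset.mem_singleton]; omega
    · rw [level, if_neg (by omega)]; exact hm
  · obtain ⟨g, g1, g2, g3, g4⟩ := h.lca_eq_gid hH h1 huv h2
    have g5 := h.gid_mem g (by omega) (by omega)
    have g6 := h.gap_gid g (by omega) (by omega)
    have hlam := h.lam_lt (g := g) (by omega) (by omega)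
    -- Gap numbers follow the prefix lengths, so the gap with the least number is also one with the
    -- shortest common prefix between `u` and `v`.
    have hmin : ∀ g', u ≤ g' → g' < v → lam key M g ≤ lam key M g' := by
      intro g' a b
      have := h.gap_mono _ _ g5.1 (g4 g' a b) (h.gid_mem g' (by omega) (by omega)).2
      rwa [g6, h.gap_gid g' (by omega) (by omega)] at this
    rw [g3]
    refine ⟨g5.1, by omega, fun p a b => ?_, fun m hm he => ?_, fun _ => by rw [g6]; exact ⟨g1, g2⟩⟩
    · rw [mem_cell, level, if_pos g5.2, anchor, if_pos g5.2, g6]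
      refine ⟨by omega, ?_⟩
      rcases le_total p g with c | c
      · exact (h.key_eq_iff hlam.le (by omega) c (by omega)).2 fun g' x y =>
          hmin g' (by omega) (by omega)
      · exact ((h.key_eq_iff hlam.le (by omega) c (by omega)).2 fun g' x y =>
          hmin g' (by omega) (by omega)).symm
    · rw [level, if_pos g5.2, g6]
      exact ((h.key_eq_iff hm h1 huv.le h2).1 he) g g1 g2

/-- The first point of a node. -/
def first (n M : ℕ) (key : ℕ → ℕ → ℕ) (gap : ℕ → ℕ) (i : ℕ) : ℕ :=
  sInf (cell n M key gap i : Set ℕ)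

/-- The last point of a node. -/
def last (n M : ℕ) (key : ℕ → ℕ → ℕ) (gap : ℕ → ℕ) (i : ℕ) : ℕ := (cell n M key gap i).sup id

theorem first_mem (h : KeyTree n M key gap gid) {i : ℕ} (hi : 1 ≤ i) (hi2 : i < 2 * n) :
    first n M key gap i ∈ cell n M key gap i :=
  Nat.sInf_mem (s := (cell n M key gap i : Set ℕ)) ⟨_, h.anchor_mem hi hi2⟩

theorem last_mem (h : KeyTree n M key gap gid) {i : ℕ} (hi : 1 ≤ i) (hi2 : i < 2 * n) :
    last n M key gap i ∈ cell n M key gap i := by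
  obtain ⟨x, hx, he⟩ := Finset.exists_mem_eq_sup _ ⟨_, h.anchor_mem hi hi2⟩ id
  rw [last, he]
  exact hx

theorem first_le {i p : ℕ} (hp : p ∈ cell n M key gap i) : first n M key gap i ≤ p :=
  Nat.sInf_le (s := (cell n M key gap i : Set ℕ)) hp

theorem le_last {i p : ℕ} (hp : p ∈ cell n M key gap i) : p ≤ last n M key gap i :=
  Finset.le_sup (f := id) hp

/-- The points of an inner node on the left and on the right of its gap. -/
theorem split (h : KeyTree n M key gap gid) {i p : ℕ} (hi : 1 ≤ i) (hin : i < n)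
    (hp : p ∈ cell n M key gap i) :
    (p ≤ gap i → key (lam key M (gap i) + 1) p = key (lam key M (gap i) + 1) (gap i)) ∧
    (gap i < p → key (lam key M (gap i) + 1) p = key (lam key M (gap i) + 1) (gap i + 1)) := by
  obtain ⟨g1, g2⟩ := h.gap_mem i hi hin
  rw [mem_cell, level, if_pos hin, anchor, if_pos hin] at hp
  have hlt := h.lam_lt g1 g2
  have a1 := h.succ_lt g1 g2
  have a2 := h.half (lam key M (gap i)) p
  have a3 := h.half (lam key M (gap i)) (gap i)
  have a4 := h.half (lam key M (gap i)) (gap i + 1)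
  have a5 := h.key_lam (gap i)
  constructor
  · intro hle
    have := h.mono (lam key M (gap i) + 1) hlt p (gap i) (by omega) hle (by omega)
    omega
  · intro hle
    have := h.mono (lam key M (gap i) + 1) hlt (gap i + 1) p (by omega) hle (by omega)
    omega

/-- The first point of cell `i` and the point before its gap share one bit more than the cell. So
their common ancestor `j` has a longer prefix than `i`, hence a larger number. Conversely, a point
sharing this bit with the point before the gap belongs to the cell and cannot be behind the gap. -/
theorem left_cell (h : KeyTree n M key gap gid) {i : ℕ} (hH : 2 * n < H) (hi : 1 ≤ i)
    (hin : i < n) :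
    i < lcaSeq n H gid (first n M key gap i) (gap i) ∧
      ∀ p, p ∈ cell n M key gap (lcaSeq n H gid (first n M key gap i) (gap i)) ↔
        p ∈ cell n M key gap i ∧ p ≤ gap i := by
  obtain ⟨g1, g2⟩ := h.gap_mem i hi hin
  have hga : gap i ∈ cell n M key gap i := by
    have := h.anchor_mem hi (show i < 2 * n by omega)
    rwa [anchor, if_pos hin] at this
  have hf := h.first_mem hi (show i < 2 * n by omega)
  have hfl := first_le hga
  have hf' := mem_cell.1 hf
  have hlt := h.lam_lt g1 g2
  obtain ⟨s1, s2, s3, s4, s5⟩ := h.lca_spec hH hf'.1.1 hfl g2.le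
  have hkey := (h.split hi hin hf).1 hfl
  have hlev := s4 _ hlt hkey
  set j := lcaSeq n H gid (first n M key gap i) (gap i) with hj
  have hij : i < j := by
    by_contra hc
    have := h.level_mono s1 (not_lt.1 hc)
    conv_rhs at this => rw [level, if_pos hin]
    omega
  refine ⟨hij, fun p => ⟨fun hp => ?_, fun hp => s3 p (first_le hp.1) hp.2⟩⟩
  have hg := s3 (gap i) hfl le_rfl
  have hp' := mem_cell.1 hp
  have hpg : key (level n M key gap j) p = key (level n M key gap j) (gap i) :=
    hp'.2.trans (mem_cell.1 hg).2.symm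
  have hpl : key (lam key M (gap i) + 1) p = key (lam key M (gap i) + 1) (gap i) :=
    h.eq_of_le hlev hpg
  refine ⟨?_, ?_⟩
  · rw [mem_cell, level, if_pos hin, anchor, if_pos hin]
    exact ⟨hp'.1, h.eq_of_le (Nat.le_succ _) hpl⟩
  · by_contra hc
    have := h.mono (lam key M (gap i) + 1) hlt (gap i + 1) p (by omega) (by omega) hp'.1.2
    have := h.succ_lt g1 g2
    omega

/-- The mirror image of `left_cell`, starting from the point `gap i + 1` behind the gap. -/
theorem right_cell (h : KeyTree n M key gap gid) {i : ℕ} (hH : 2 * n < H) (hi : 1 ≤ i)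
    (hin : i < n) :
    i < lcaSeq n H gid (gap i + 1) (last n M key gap i) ∧
      lcaSeq n H gid (gap i + 1) (last n M key gap i) < 2 * n ∧
      ∀ p, p ∈ cell n M key gap (lcaSeq n H gid (gap i + 1) (last n M key gap i)) ↔
        p ∈ cell n M key gap i ∧ gap i < p := by
  obtain ⟨g1, g2⟩ := h.gap_mem i hi hin
  have hga : gap i + 1 ∈ cell n M key gap i := by
    rw [mem_cell, level, if_pos hin, anchor, if_pos hin]
    exact ⟨by omega, (h.key_lam _).symm⟩
  have hf := h.last_mem hi (show i < 2 * n by omega)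
  have hfl := le_last hga
  have hf' := mem_cell.1 hf
  have hlt := h.lam_lt g1 g2
  obtain ⟨s1, s2, s3, s4, s5⟩ := h.lca_spec hH (show 1 ≤ gap i + 1 by omega) hfl hf'.1.2
  have hkey := (h.split hi hin hf).2 (by omega)
  have hlev := s4 _ hlt hkey.symm
  set j := lcaSeq n H gid (gap i + 1) (last n M key gap i) with hj
  have hij : i < j := by
    by_contra hc
    have := h.level_mono s1 (not_lt.1 hc)
    conv_rhs at this => rw [level, if_pos hin]
    omega
  refine ⟨hij, s2, fun p => ⟨fun hp => ?_, fun hp => s3 p hp.2 (le_last hp.1)⟩⟩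
  have hg := s3 (gap i + 1) le_rfl hfl
  have hp' := mem_cell.1 hp
  have hpg : key (level n M key gap j) p = key (level n M key gap j) (gap i + 1) :=
    hp'.2.trans (mem_cell.1 hg).2.symm
  have hpl : key (lam key M (gap i) + 1) p = key (lam key M (gap i) + 1) (gap i + 1) :=
    h.eq_of_le hlev hpg
  refine ⟨?_, ?_⟩
  · rw [mem_cell, level, if_pos hin, anchor, if_pos hin]
    exact ⟨hp'.1, (h.eq_of_le (Nat.le_succ _) hpl).trans (h.key_lam _).symm⟩
  · by_contra hc
    have := h.mono (lam key M (gap i) + 1) hlt p (gap i) (by omega) (by omega) g2.le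
    have := h.succ_lt g1 g2
    omega

end KeyTree

/-- The layout stores the tree of a key; `convex` says that cells are cut out by boxes. -/
structure Layout.OfKey {d : ℕ} (l : Layout d) (M : ℕ) (key : ℕ → ℕ → ℕ) (gap gid : ℕ → ℕ) :
    Prop where
  tree : KeyTree l.n M key gap gid
  lt_width : 2 * l.n < 2 ^ l.L
  sq : l.sq = nodeSeq l.n (2 ^ l.L) gid
  lc : ∀ i, l.lc i = lcaSeq l.n (2 ^ l.L) gid (KeyTree.first l.n M key gap i) (gap i)
  rc : ∀ i, l.rc i = lcaSeq l.n (2 ^ l.L) gid (gap i + 1) (KeyTree.last l.n M key gap i)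
  rp : ∀ i, l.rp i = anchor l.n gap i
  bl : ∀ a i, l.bl a i = sInf ((cell l.n M key gap i).image (l.co a) : Set ℝ)
  bh : ∀ a i, l.bh a i = sSup ((cell l.n M key gap i).image (l.co a) : Set ℝ)
  convex : ∀ m c p, 1 ≤ p → p ≤ l.n → (∀ a < d, ∃ q q', (1 ≤ q ∧ q ≤ l.n) ∧ (1 ≤ q' ∧ q' ≤ l.n) ∧
    key m q = c ∧ key m q' = c ∧ l.co a q ≤ l.co a p ∧ l.co a p ≤ l.co a q') → key m p = c

/-- Boxes cut out cells by `convex`, because each side of a bounding box is attained. Children are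
obtained by splitting a cell at its gap, which gives the disjoint union and the growth of numbers.
The statements on lowest common ancestors follow from the prefix lengths, except that equal lengths
need an extra argument. -/
theorem Layout.OfKey.toTree {d : ℕ} {l : Layout d} (h : l.OfKey M key gap gid) :
    Tree l (cell l.n M key gap) := by
  have hH := h.lt_width
  have hlca : ∀ u v, l.lcaId u v = lcaSeq l.n (2 ^ l.L) gid u v := fun u v => by
    rw [Layout.lcaId, lcaSeq, h.sq]
  have im : ∀ a i, 1 ≤ i → i < 2 * l.n → ((cell l.n M key gap i).image (l.co a)).Nonempty :=
    fun a i h1 h2 => Finset.Nonempty.image ⟨_, h.tree.anchor_mem h1 h2⟩ _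
  have lo : ∀ i, 1 ≤ i → i < 2 * l.n → ∀ a < d, ∃ p ∈ cell l.n M key gap i,
      l.co a p = l.bl a i := by
    intro i h1 h2 a _
    have := (im a i h1 h2).csInf_mem
    rw [← h.bl, Finset.mem_image] at this
    exact this
  have hi : ∀ i, 1 ≤ i → i < 2 * l.n → ∀ a < d, ∃ p ∈ cell l.n M key gap i,
      l.co a p = l.bh a i := by
    intro i h1 h2 a _
    have := (im a i h1 h2).csSup_mem
    rw [← h.bh, Finset.mem_image] at this
    exact this
  have lcs : ∀ i, 1 ≤ i → i < l.n → l.lc i < 2 * l.n := by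
    intro i h1 h2
    obtain ⟨g1, g2⟩ := h.tree.gap_mem i h1 h2
    have hga : gap i ∈ cell l.n M key gap i := by
      have := h.tree.anchor_mem h1 (show i < 2 * l.n by omega)
      rwa [anchor, if_pos h2] at this
    have hf := mem_cell.1 (h.tree.first_mem h1 (show i < 2 * l.n by omega))
    rw [h.lc]
    exact (h.tree.lca_spec hH hf.1.1 (KeyTree.first_le hga) g2.le).2.1
  constructor
  · exact fun i _ _ => Finset.filter_subset _ _
  · intro i h1 h2 p hp
    rw [Finset.mem_Icc] at hp
    constructor
    · intro hpi a ha
      have hm : l.co a p ∈ ((cell l.n M key gap i).image (l.co a) : Set ℝ) := by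
        rw [Finset.mem_coe]; exact Finset.mem_image_of_mem _ hpi
      rw [h.bl, h.bh]
      exact ⟨csInf_le (Finset.bddBelow _) hm, le_csSup (Finset.bddAbove _) hm⟩
    · intro hb
      rw [mem_cell]
      refine ⟨hp, h.convex _ _ p hp.1 hp.2 fun a ha => ?_⟩
      obtain ⟨q, hq, hqe⟩ := lo i h1 h2 a ha
      obtain ⟨q', hq', hqe'⟩ := hi i h1 h2 a ha
      rw [mem_cell] at hq hq'
      exact ⟨q, q', hq.1, hq'.1, hq.2, hq'.2, by rw [hqe]; exact (hb a ha).1,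
        by rw [hqe']; exact (hb a ha).2⟩
  · exact lo
  · exact hi
  · intro i h1 h2
    rw [h.rp]
    exact h.tree.anchor_mem h1 h2
  · have h2 := h.tree.two_le
    obtain ⟨g1, g2⟩ := h.tree.gap_mem 1 le_rfl (by omega)
    ext p
    rw [mem_cell, Finset.mem_Icc, and_iff_left_iff_imp, level, if_pos (by omega), anchor,
      if_pos (by omega)]
    intro hp
    have hlt := h.tree.lam_lt g1 g2
    -- Node `1` belongs to a gap with the shortest common prefix of all, so its prefix is common to
    -- all points.
    have hmin : ∀ g, 1 ≤ g → g < l.n → lam key M (gap 1) ≤ lam key M g := by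
      intro g a b
      have h3 := h.tree.gid_mem g a b
      have := h.tree.gap_mono 1 _ le_rfl h3.1 h3.2
      rwa [h.tree.gap_gid g a b] at this
    rcases le_total p (gap 1) with c | c
    · exact (h.tree.key_eq_iff hlt.le hp.1 c g2.le).2 fun g a b => hmin g (by omega) (by omega)
    · exact ((h.tree.key_eq_iff hlt.le g1 c hp.2).2 fun g a b =>
        hmin g (by omega) (by omega)).symm
  · intro i h1 h2
    exact ⟨by rw [h.lc]; exact (h.tree.left_cell hH h1 h2).1, lcs i h1 h2⟩
  · intro i h1 h2
    rw [h.rc]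
    exact ⟨(h.tree.right_cell hH h1 h2).1, (h.tree.right_cell hH h1 h2).2.1⟩
  · intro i h1 h2
    ext p
    rw [Finset.mem_union, h.lc, h.rc, (h.tree.left_cell hH h1 h2).2,
      (h.tree.right_cell hH h1 h2).2.2, ← and_or_left, and_iff_left]
    exact le_or_gt p (gap i)
  · intro i h1 h2
    rw [Finset.disjoint_left]
    intro p
    rw [h.lc, h.rc, (h.tree.left_cell hH h1 h2).2, (h.tree.right_cell hH h1 h2).2.2]
    rintro ⟨-, a⟩ ⟨-, b⟩
    omega
  · intro u v h1 h2 h3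
    rw [hlca]
    obtain ⟨a, b, -⟩ := h.tree.lca_spec hH h1 h2 h3
    exact ⟨a, b⟩
  · intro u v h1 h2 h3
    rw [hlca]
    exact (h.tree.lca_spec hH h1 h2 h3).2.2.1
  · intro u v h1 h2 h3 i hi1 hi2 hu hv
    rw [hlca]
    obtain ⟨s1, s2, s3, s4, s5⟩ := h.tree.lca_spec hH h1 h2 h3
    rw [mem_cell] at hu hv
    have hlev := s4 _ (h.tree.level_le hi1) (hu.2.trans hv.2.symm)
    set j := lcaSeq l.n (2 ^ l.L) gid u v with hj
    have hu' := mem_cell.1 (s3 u le_rfl h2)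
    refine ⟨?_, fun p hp => ?_⟩
    -- If `j < i`, the two prefix lengths coincide. Two inner nodes are then equal by `id_unique`,
    -- an inner node and a leaf cannot have the same prefix length, and two leaves that contain `u`
    -- are equal.
    · by_contra hc
      rw [not_le] at hc
      have hle := h.tree.level_mono s1 hc.le
      have heq : level l.n M key gap j = level l.n M key gap i := le_antisymm hle hlev
      by_cases hjn : j < l.n
      · by_cases hin : i < l.n
        · have hji : key (level l.n M key gap j) (gap j) = key (level l.n M key gap j) (gap i) := by
            have e1 := hu'.2
            have e2 := hu.2
            rw [anchor, if_pos hjn] at e1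
            rw [anchor, if_pos hin, ← heq] at e2
            rw [← e1, e2]
          rw [level, level, if_pos hjn, if_pos hin] at heq
          rw [level, if_pos hjn] at hji
          have := h.tree.id_unique s1 hjn hi1 hin heq hji
          omega
        · rw [level, level, if_pos hjn, if_neg hin] at heq
          obtain ⟨gj1, gj2⟩ := h.tree.gap_mem j s1 hjn
          have := h.tree.lam_lt gj1 gj2
          omega
      · have e1 : u ∈ cell l.n M key gap i := mem_cell.2 hu
        have e2 : u ∈ cell l.n M key gap j := mem_cell.2 hu'
        rw [h.tree.leaf_cell (by omega) hi2, Finset.mem_singleton] at e1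
        rw [h.tree.leaf_cell (by omega) s2, Finset.mem_singleton] at e2
        omega
    · rw [mem_cell] at hp ⊢
      exact ⟨hp.1, (h.tree.eq_of_le hlev (hp.2.trans hu'.2.symm)).trans hu.2⟩
  · intro u v h1 h2 h3
    rw [hlca]
    obtain ⟨s1, s2, s3, s4, s5⟩ := h.tree.lca_spec hH h1 h2 h3
    intro hlt
    have := s5 hlt
    rw [h.lc, h.rc, (h.tree.left_cell hH s1 hlt).2, (h.tree.right_cell hH s1 hlt).2.2]
    exact ⟨⟨s3 u le_rfl h2, this.1⟩, s3 v h2 le_rfl, this.2⟩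
  · intro i h1 h2 u hu v hv
    rw [h.lc, (h.tree.left_cell hH h1 h2).2] at hu
    rw [h.rc, (h.tree.right_cell hH h1 h2).2.2] at hv
    have hun := (mem_cell.1 hu.1).1
    have hvn := (mem_cell.1 hv.1).1
    obtain ⟨g, g1, g2, g3, g4⟩ := h.tree.lca_eq_gid hH hun.1 (show u < v by omega) hvn.2
    refine ⟨by omega, ?_⟩
    rw [hlca, g3]
    have := g4 (gap i) hu.2 hv.2
    rwa [h.tree.gid_gap i h1 h2] at this

end KeyTree

/-! ## Counting cells -/

section Counting

variable {α : Type} {d : ℕ} {Y : ℕ → α → ℝ}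

/-- The bits of the key from position `b` on without those of axis `a`, after a leading one. -/
def rkey (d a b : ℕ) (Y : ℕ → α → ℝ) : ℕ → α → ℕ
  | 0, _ => 1
  | t + 1, p => if t % d = a then rkey d a b Y t p
      else 2 * rkey d a b Y t p + zfloor d Y (b + t) p % 2

/-- The leading one makes the number of retained bits readable from the value. The value `a = d` is
no residue modulo `d`, so it drops no axis; this unifies the two counts needed later. -/
theorem rkey_bounds (a b t : ℕ) (p : α) :
    2 ^ Nat.count (fun x => x % d ≠ a) t ≤ rkey d a b Y t p ∧
      rkey d a b Y t p < 2 ^ (Nat.count (fun x => x % d ≠ a) t + 1) := by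
  induction t with
  | zero => simp [rkey]
  | succ t ih =>
    rw [rkey, Nat.count_succ]
    by_cases h : t % d = a
    · rw [if_pos h, if_neg (not_not.2 h), add_zero]
      exact ih
    · rw [if_neg h, if_pos h]
      have h1 := ih.1
      have h2 := ih.2
      rw [pow_succ] at h2 ⊢
      rw [pow_succ]
      omega

/-- The key is reassembled bit by bit: the retained bits from `rkey`, those of axis `a` from `hf`.
-/
theorem zkey_eq_of_rkey {a b t : ℕ} {p q : α} (hb : zkey d Y b p = zkey d Y b q)
    (hr : rkey d a b Y t p = rkey d a b Y t q)
    (hf : ∀ u < t, u % d = a → zfloor d Y (b + u) p % 2 = zfloor d Y (b + u) q % 2) :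
    zkey d Y (b + t) p = zkey d Y (b + t) q := by
  induction t with
  | zero => exact hb
  | succ t ih =>
    rw [rkey, rkey] at hr
    have hf' : ∀ u < t, u % d = a → _ := fun u hu => hf u (by omega)
    rw [← add_assoc, zkey, zkey]
    split_ifs at hr with h
    · rw [ih hr hf', hf t (by omega) h]
    · rw [ih (by omega) hf']
      omega

/-- The number of axes other than `a`. -/
def axesLeft (d a : ℕ) : ℕ := if a < d then d - 1 else d

/-- Every block of `d` consecutive positions retains `axesLeft d a` bits; the last incomplete block
is rounded up. -/
theorem count_le (hd : 2 ≤ d) (a t : ℕ) :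
    Nat.count (fun x => x % d ≠ a) t ≤ axesLeft d a * (t / d + 1) := by
  have h0 : Nat.count (fun x => x % d ≠ a) d = axesLeft d a := by
    rw [Nat.count_eq_card_filter_range]
    have : (Finset.range d).filter (fun x => x % d ≠ a) = (Finset.range d).erase a := by
      ext x
      rw [Finset.mem_filter, Finset.mem_erase, Finset.mem_range]
      constructor
      · rintro ⟨h1, h2⟩
        rw [Nat.mod_eq_of_lt h1] at h2
        exact ⟨h2, h1⟩
      · rintro ⟨h1, h2⟩
        rw [Nat.mod_eq_of_lt h2]
        exact ⟨h2, h1⟩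
    rw [this, axesLeft]
    split_ifs with h
    · rw [Finset.card_erase_of_mem (by simpa using h), Finset.card_range]
    · rw [Finset.erase_eq_of_notMem (by simpa using h), Finset.card_range]
  have h1 : ∀ q, Nat.count (fun x => x % d ≠ a) (d * q) = axesLeft d a * q := by
    intro q
    induction q with
    | zero => simp
    | succ q ih =>
      rw [Nat.mul_succ, Nat.count_add, ih]
      simp only [Nat.mul_add_mod]
      rw [h0, Nat.mul_succ]
  rw [← h1]
  exact Nat.count_monotone _ (Nat.lt_mul_div_succ t (by omega)).le

/-- Lengths with the same residue differ by at least two, and of two consecutive positions at most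
one belongs to axis `a` since `d ≥ 2`. -/
theorem count_lt (hd : 2 ≤ d) (a : ℕ) {t t' : ℕ} (h : t < t') (hm : t % d = t' % d) :
    Nat.count (fun x => x % d ≠ a) t < Nat.count (fun x => x % d ≠ a) t' := by
  have h2 : t + 2 ≤ t' := by
    by_contra hc
    obtain rfl : t' = t + 1 := by omega
    have := Nat.ModEq.symm hm
    rw [← Nat.add_zero t, add_assoc] at this
    have := Nat.ModEq.add_left_cancel' t this
    rw [Nat.ModEq, Nat.zero_mod, Nat.mod_eq_of_lt (by omega)] at this
    omega
  refine lt_of_lt_of_le ?_ (Nat.count_monotone _ h2)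
  rw [Nat.count_succ, Nat.count_succ]
  have : t % d ≠ a ∨ (t + 1) % d ≠ a := by
    by_contra hc
    push Not at hc
    have : t ≡ t + 1 [MOD d] := by rw [Nat.ModEq, hc.1, hc.2]
    rw [← Nat.add_zero t, add_assoc] at this
    have := Nat.ModEq.add_left_cancel' t this
    rw [Nat.ModEq, Nat.zero_mod, zero_add, Nat.mod_eq_of_lt (by omega)] at this
    omega
  rcases this with h | h
  · rw [if_pos h]; omega
  · rw [if_pos h]; omega

/-- A family of cells below a common cell of level `b`, given by points `pt e` and their relative
levels `t e`, that agree in the bits of axis `a`. -/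
theorem card_cells_le (hd : 2 ≤ d) {P : Finset ℕ} {a b : ℕ} {t : ℕ → ℕ} {pt : ℕ → α} {y : ℝ}
    (hy0 : 0 ≤ y) (hy : ∀ e ∈ P, 2 ^ (t e / d) ≤ y)
    (hb : ∀ e ∈ P, ∀ e' ∈ P, zkey d Y b (pt e) = zkey d Y b (pt e'))
    (hf : ∀ e ∈ P, ∀ e' ∈ P, ∀ u < t e, u < t e' → u % d = a →
      zfloor d Y (b + u) (pt e) = zfloor d Y (b + u) (pt e'))
    (hinj : ∀ e ∈ P, ∀ e' ∈ P, t e = t e' →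
      zkey d Y (b + t e) (pt e) = zkey d Y (b + t e) (pt e') → e = e') :
    (P.card : ℝ) ≤ d * (2 * (2 * y) ^ axesLeft d a) := by
  set X : ℝ := 2 * (2 * y) ^ axesLeft d a with hX
  have hX0 : 0 ≤ X := by positivity
  have hcard : P.card ≤ (Finset.range d ×ˢ Finset.Ico 1 (⌊X⌋₊ + 1)).card := by
    -- A cell is coded by its relative level modulo `d` and its reduced key. The reduced key has at
    -- most `axesLeft d a * (t e / d + 1)` bits after the leading one, hence is at most `2 * (2 * y)
    -- ^ axesLeft d a`.
    refine Finset.card_le_card_of_injOn (fun e => (t e % d, rkey d a b Y (t e) (pt e))) ?_ ?_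
    · intro e he
      rw [Finset.mem_coe] at he
      have h1 := rkey_bounds (d := d) (Y := Y) a b (t e) (pt e)
      have h2 : 1 ≤ 2 ^ Nat.count (fun x => x % d ≠ a) (t e) := Nat.one_le_two_pow
      rw [Finset.mem_coe, Finset.mem_product, Finset.mem_range, Finset.mem_Ico]
      refine ⟨Nat.mod_lt _ (by omega), h2.trans h1.1, Nat.lt_succ_of_le (Nat.le_floor ?_)⟩
      have h3 : (rkey d a b Y (t e) (pt e) : ℝ) ≤
          2 ^ (axesLeft d a * (t e / d + 1) + 1) := by
        have : rkey d a b Y (t e) (pt e) ≤ 2 ^ (axesLeft d a * (t e / d + 1) + 1) :=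
          h1.2.le.trans (Nat.pow_le_pow_right (by omega) (by have := count_le hd a (t e); omega))
        exact_mod_cast this
      refine h3.trans ?_
      rw [hX, pow_succ, mul_comm, mul_comm (axesLeft d a), pow_mul]
      gcongr
      rw [pow_succ, mul_comm]
      gcongr
      exact hy e he
    · intro e he e' he' hee
      rw [Finset.mem_coe] at he he'
      simp only [Prod.mk.injEq] at hee
      have h1 := rkey_bounds (d := d) (Y := Y) a b (t e) (pt e)
      have h2 := rkey_bounds (d := d) (Y := Y) a b (t e') (pt e')
      -- Equal reduced keys have equally many bits. Together with the residue this determines the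
      -- level by `count_lt`.
      have ht : t e = t e' := by
        rcases lt_trichotomy (t e) (t e') with c | c | c
        · have := count_lt hd a c hee.1
          have := Nat.pow_le_pow_right (show 0 < 2 by omega) (Nat.succ_le_of_lt this)
          rw [Nat.succ_eq_add_one] at this
          omega
        · exact c
        · have := count_lt hd a c hee.1.symm
          have := Nat.pow_le_pow_right (show 0 < 2 by omega) (Nat.succ_le_of_lt this)
          rw [Nat.succ_eq_add_one] at this
          omega
      refine hinj e he e' he' ht (zkey_eq_of_rkey (a := a) (hb e he e' he') ?_ fun u hu hua => ?_)
      · rw [hee.2, ht]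
      · rw [hf e he e' he' u hu (by omega) hua]
  have h2 : (P.card : ℝ) ≤ d * ⌊X⌋₊ := by
    rw [Finset.card_product, Finset.card_range, Nat.card_Ico, Nat.add_sub_cancel] at hcard
    exact_mod_cast hcard
  exact h2.trans (mul_le_mul_of_nonneg_left (Nat.floor_le hX0) (Nat.cast_nonneg d))

end Counting

/-! ## The number of refined nodes -/

section Geometric

variable {d : ℕ}

/-- The tree of a layout is the tree of the interleaved keys of the coordinates `Y`, which are
normalised by translation by `o` and scaling by `W`. -/
structure Layout.Geometric (l : Layout d) (W : ℝ) (o : ℕ → ℝ) (M : ℕ) (Y : ℕ → ℕ → ℝ)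
    (gap gid : ℕ → ℕ) : Prop extends l.OfKey M (zkey d Y) gap gid where
  pos : 0 < W
  cube : ∀ p, 1 ≤ p → p ≤ l.n → InCube d Y p
  coord : ∀ a < d, ∀ p, 1 ≤ p → p ≤ l.n → Y a p = (l.co a p - o a) / W
  inner_size : ∀ i, 1 ≤ i → i < l.n → l.sz i = d * W / 2 ^ (level l.n M (zkey d Y) gap i / d)
  leaf_size : ∀ i, l.n ≤ i → i < 2 * l.n → l.sz i = 0

variable {l : Layout d} {W : ℝ} {o : ℕ → ℝ} {M : ℕ} {Y : ℕ → ℕ → ℝ} {gap gid : ℕ → ℕ}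

namespace Layout.Geometric

theorem size_nonpos_iff (h : l.Geometric W o M Y gap gid) (hd : 0 < d) {i : ℕ} (h1 : 1 ≤ i)
    (h2 : i < 2 * l.n) : l.sz i ≤ 0 ↔ l.n ≤ i := by
  rcases Nat.lt_or_ge i l.n with hi | hi
  · rw [h.inner_size i h1 hi]
    have := h.pos
    have hd' : (0 : ℝ) < d := by exact_mod_cast hd
    have : 0 < d * W / 2 ^ (level l.n M (zkey d Y) gap i / d) := by positivity
    constructor
    · intro hh; linarith
    · intro hh; omega
  · rw [h.leaf_size i hi h2]
    simpa using hi

theorem zfloor_eq (h : l.Geometric W o M Y gap gid) (hd : 0 < d) {i p q μ : ℕ}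
    (hp : p ∈ cell l.n M (zkey d Y) gap i) (hq : q ∈ cell l.n M (zkey d Y) gap i)
    (hμ : μ < level l.n M (zkey d Y) gap i) : zfloor d Y μ p = zfloor d Y μ q := by
  rw [mem_cell] at hp hq
  exact (zkey_eq_iff hd (h.cube p hp.1.1 hp.1.2) (h.cube q hq.1.1 hq.1.2) _).1
    (hp.2.trans hq.2.symm) μ hμ

/-- The dyadic index of a hyperplane is defined by the same formula as for points. The hyperplane
may lie outside the unit cube; only monotonicity of the floor is used. -/
theorem zfloor_mono (h : l.Geometric W o M Y gap gid) (hd : 0 < d) {p μ : ℕ} {z : ℝ} (h1 : 1 ≤ p)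
    (h2 : p ≤ l.n) :
    (l.co (μ % d) p ≤ z → zfloor d Y μ p ≤ ⌊2 ^ (μ / d + 1) * ((z - o (μ % d)) / W)⌋₊) ∧
    (z ≤ l.co (μ % d) p → ⌊2 ^ (μ / d + 1) * ((z - o (μ % d)) / W)⌋₊ ≤ zfloor d Y μ p) := by
  have hW := h.pos
  rw [zfloor, h.coord _ (Nat.mod_lt _ hd) p h1 h2]
  constructor <;> intro hz <;> refine Nat.floor_le_floor ?_ <;> gcongr

/-- An inner node contains both points next to its gap. A cell containing both has a prefix common
to them, which is no longer than that of the gap. -/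
theorem inner_sub (h : l.Geometric W o M Y gap gid) {e D : ℕ} (he : 1 ≤ e) (hen : e < l.n)
    (hD : 1 ≤ D) (hs : cell l.n M (zkey d Y) gap e ⊆ cell l.n M (zkey d Y) gap D) :
    level l.n M (zkey d Y) gap D ≤ level l.n M (zkey d Y) gap e := by
  have h1 := h.tree.anchor_mem he (show e < 2 * l.n by omega)
  rw [anchor, if_pos hen] at h1
  have h2 : gap e + 1 ∈ cell l.n M (zkey d Y) gap e := by
    obtain ⟨g1, g2⟩ := h.tree.gap_mem e he hen
    rw [mem_cell, level, if_pos hen, anchor, if_pos hen]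
    exact ⟨by omega, (h.tree.key_lam _).symm⟩
  have a1 := mem_cell.1 (hs h1)
  have a2 := mem_cell.1 (hs h2)
  conv_rhs => rw [level, if_pos hen]
  exact KeyTree.le_lam (h.tree.level_le hD) (a1.2.trans a2.2.symm)

/-- The inner nodes below `D` of relative level at most `log y`, possibly only those that meet a
hyperplane orthogonal to axis `a`. -/
theorem card_below_le (h : l.Geometric W o M Y gap gid) (hd : 2 ≤ d) {P : Finset ℕ} {D b a : ℕ}
    {y : ℝ} (hy0 : 0 ≤ y) (hD : 1 ≤ D) (hb : b * d ≤ level l.n M (zkey d Y) gap D)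
    (hP : ∀ e ∈ P, 1 ≤ e ∧ e < l.n ∧
      cell l.n M (zkey d Y) gap e ⊆ cell l.n M (zkey d Y) gap D ∧
      2 ^ (level l.n M (zkey d Y) gap e / d) ≤ 2 ^ b * y)
    (ha : a < d → ∃ z, ∀ e ∈ P, ∃ p ∈ cell l.n M (zkey d Y) gap e,
      ∃ q ∈ cell l.n M (zkey d Y) gap e, l.co a p ≤ z ∧ z ≤ l.co a q) :
    (P.card : ℝ) ≤ d * (2 * (2 * y) ^ axesLeft d a) := by
  have hd0 : 0 < d := by omega
  have hlev : ∀ e ∈ P, b * d ≤ level l.n M (zkey d Y) gap e := fun e he =>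
    hb.trans (h.inner_sub (hP e he).1 (hP e he).2.1 hD (hP e he).2.2.1)
  have hmem : ∀ e ∈ P, gap e ∈ cell l.n M (zkey d Y) gap e := fun e he => by
    have := h.tree.anchor_mem (hP e he).1 (show e < 2 * l.n by have := (hP e he).2.1; omega)
    rwa [anchor, if_pos (hP e he).2.1] at this
  refine card_cells_le (Y := Y) (b := b * d) (t := fun e => level l.n M (zkey d Y) gap e - b * d)
    (pt := gap) hd hy0 (fun e he => ?_) (fun e he e' he' => ?_) (fun e he e' he' u hu hu' hua => ?_)
    (fun e he e' he' ht hk => ?_)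
  · have h1 := hlev e he
    obtain ⟨t, ht⟩ := Nat.exists_eq_add_of_le h1
    have h2 := (hP e he).2.2.2
    rw [ht, Nat.add_sub_cancel_left]
    rw [ht, mul_comm b d, Nat.mul_add_div hd0, pow_add] at h2
    exact le_of_mul_le_mul_left h2 (by positivity)
  · have h1 := mem_cell.1 ((hP e he).2.2.1 (hmem e he))
    have h2 := mem_cell.1 ((hP e' he').2.2.1 (hmem e' he'))
    exact h.tree.eq_of_le hb (h1.2.trans h2.2.symm)
  · have had : a < d := by rw [← hua]; exact Nat.mod_lt _ hd0
    obtain ⟨z, hz⟩ := ha had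
    -- All points of the cell have the same dyadic index at this position. The points `p` and `q` on
    -- the two sides of the hyperplane force this index to be that of `z`.
    have key : ∀ e ∈ P, u < level l.n M (zkey d Y) gap e - b * d → zfloor d Y (b * d + u) (gap e) =
        ⌊2 ^ ((b * d + u) / d + 1) * ((z - o ((b * d + u) % d)) / W)⌋₊ := by
      intro e he hu
      obtain ⟨p, hp, q, hq, h1, h2⟩ := hz e he
      have hm : (b * d + u) % d = a := by rw [mul_comm, Nat.mul_add_mod, hua]
      have e1 := h.zfloor_eq hd0 (hmem e he) hp (μ := b * d + u) (by omega)
      have e2 := h.zfloor_eq hd0 (hmem e he) hq (μ := b * d + u) (by omega)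
      have hp' := (mem_cell.1 hp).1
      have hq' := (mem_cell.1 hq).1
      have f1 := (h.zfloor_mono hd0 (μ := b * d + u) (z := z) hp'.1 hp'.2).1 (by rwa [hm])
      have f2 := (h.zfloor_mono hd0 (μ := b * d + u) (z := z) hq'.1 hq'.2).2 (by rwa [hm])
      omega
    rw [key e he hu, key e' he' hu']
  · have h1 := hlev e he
    have h2 := hlev e' he'
    beta_reduce at ht hk
    rw [Nat.add_sub_cancel' h1] at hk
    have h3 : level l.n M (zkey d Y) gap e = level l.n M (zkey d Y) gap e' := by omega
    rw [level, level, if_pos (hP e he).2.1, if_pos (hP e' he').2.1] at h3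
    rw [level, if_pos (hP e he).2.1] at hk
    exact h.tree.id_unique (hP e he).1 (hP e he).2.1 (hP e' he').1 (hP e' he').2.1 h3 hk

open Classical in
/-- Bounds for the number of the nodes that the fine phase refines. -/
theorem card_pending_le (h : l.Geometric W o M Y gap gid) (hd : 2 ≤ d) {Q : Box} {r y : ℝ}
    {st : List ℕ} {b : ℕ} (hy0 : 0 ≤ y) (hst : ∀ D ∈ st, 1 ≤ D)
    (hb : ∀ D ∈ st, b * d ≤ level l.n M (zkey d Y) gap D)
    (hr : ∀ e, 1 ≤ e → e < l.n → r < l.sz e →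
      2 ^ (level l.n M (zkey d Y) gap e / d) ≤ 2 ^ b * y) :
    ((pending l (cell l.n M (zkey d Y) gap) Q r st).card : ℝ) ≤
        st.length * (d * (2 * (2 * y) ^ d)) ∧
      (((pending l (cell l.n M (zkey d Y) gap) Q r st).filter fun e => ¬ Inside l Q e).card : ℝ) ≤
        st.length * (2 * d * (d * (2 * (2 * y) ^ (d - 1)))) := by
  set nd := cell l.n M (zkey d Y) gap with hnd
  set P := pending l nd Q r st with hP
  have htree := h.toTree
  set PD : ℕ → Finset ℕ := fun D => P.filter fun e => nd e ⊆ nd D with hPD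
  -- Every pending node is below some node on the stack, so a bound below each of these suffices.
  have hsum : ∀ (q : ℕ → Prop) [DecidablePred q] (C : ℝ), (∀ D ∈ st, (((PD D).filter q).card : ℝ) ≤ C) →
      ((P.filter q).card : ℝ) ≤ st.length * C := by
    intro q _ C hC
    have h1 : P.filter q ⊆ st.toFinset.biUnion fun D => (PD D).filter q := by
      intro e he
      rw [Finset.mem_filter] at he
      have := he.1
      simp only [hP, pending, Finset.mem_filter] at this
      obtain ⟨-, -, -, D, hD, hDe⟩ := this
      rw [Finset.mem_biUnion]
      exact ⟨D, by simpa using hD, Finset.mem_filter.2 ⟨Finset.mem_filter.2 ⟨he.1, hDe⟩, he.2⟩⟩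
    have h2 : ((P.filter q).card : ℝ) ≤ ∑ D ∈ st.toFinset, (((PD D).filter q).card : ℝ) := by
      exact_mod_cast (Finset.card_le_card h1).trans Finset.card_biUnion_le
    refine h2.trans ((Finset.sum_le_card_nsmul _ _ C fun D hD => hC D (by simpa using hD)).trans ?_)
    rw [nsmul_eq_mul]
    rcases st with _ | ⟨D, st⟩
    · simp
    · have hC0 : 0 ≤ C := (Nat.cast_nonneg _).trans (hC D (by simp))
      gcongr
      exact_mod_cast List.toFinset_card_le _
  have hmem : ∀ D, ∀ e ∈ PD D, (1 ≤ e ∧ e < l.n) ∧ r < l.sz e ∧ (nd e ∩ inQuery l Q).Nonempty ∧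
      nd e ⊆ nd D := by
    intro D e he
    simp only [hPD, hP, pending, Finset.mem_filter, Finset.mem_Ico] at he
    exact ⟨he.1.1, he.1.2.1, he.1.2.2.1, he.2⟩
  constructor
  · have hone : ∀ D ∈ st, ((PD D).card : ℝ) ≤ d * (2 * (2 * y) ^ d) := by
      intro D hD
      have := h.card_below_le (P := PD D) (a := d) hd hy0 (hst D hD) (hb D hD) (fun e he => ?_)
        fun hh => absurd hh (lt_irrefl d)
      · rwa [axesLeft, if_neg (lt_irrefl d)] at this
      · obtain ⟨h1, h2, h3, h4⟩ := hmem D e he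
        exact ⟨h1.1, h1.2, h4, hr e h1.1 h1.2 h2⟩
    refine le_trans ?_ (hsum (fun _ => True) (d * (2 * (2 * y) ^ d)) fun D hD =>
      le_trans ?_ (hone D hD))
    · exact_mod_cast Finset.card_le_card fun e he => Finset.mem_filter.2 ⟨he, trivial⟩
    · exact_mod_cast Finset.card_le_card (Finset.filter_subset _ _)
  · refine hsum _ _ fun D hD => ?_
    set X : ℝ := d * (2 * (2 * y) ^ (d - 1)) with hX
    set cross : ℕ → ℝ → Finset ℕ := fun a z => (PD D).filter fun e =>
      ∃ p ∈ nd e, ∃ q ∈ nd e, l.co a p ≤ z ∧ z ≤ l.co a q with hcross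
    have hc : ∀ a < d, ∀ z, ((cross a z).card : ℝ) ≤ X := by
      intro a ha z
      have := h.card_below_le (P := cross a z) (a := a) hd hy0 (hst D hD) (hb D hD)
        (fun e he => ?_) fun _ => ⟨z, fun e he => (Finset.mem_filter.1 he).2⟩
      · rwa [axesLeft, if_pos ha] at this
      · obtain ⟨h1, h2, h3, h4⟩ := hmem D e (Finset.mem_filter.1 he).1
        exact ⟨h1.1, h1.2, h4, hr e h1.1 h1.2 h2⟩
    -- A pending node that is not inside has a point in the query box and one that violates a bound
    -- on some axis. It therefore meets one of the `2 * d` hyperplanes that carry the sides of the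
    -- query box.
    have hsub : (PD D).filter (fun e => ¬ Inside l Q e) ⊆
        (Finset.range d).biUnion fun a => cross a (Q.lo a) ∪ cross a (Q.hi a) := by
      intro e he
      rw [Finset.mem_filter] at he
      obtain ⟨h1, h2, ⟨p, hp⟩, h4⟩ := hmem D e he.1
      have hin := he.2
      rw [htree.inside_iff h1.1 (by omega), Finset.not_subset] at hin
      obtain ⟨q, hq, hqQ⟩ := hin
      have hqn := htree.subset e h1.1 (by omega) hq
      rw [inQuery, mem_boxSel] at hqQ
      rw [Finset.mem_inter, inQuery, mem_boxSel] at hp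
      have : ∃ a < d, l.co a q < Q.lo a ∨ Q.hi a < l.co a q := by
        by_contra hc
        push Not at hc
        exact hqQ ⟨hqn, fun a ha => hc a ha⟩
      obtain ⟨a, ha, hqa⟩ := this
      have hpa := hp.2.2 a ha
      rw [Finset.mem_biUnion]
      refine ⟨a, by simpa using ha, ?_⟩
      rw [Finset.mem_union]
      rcases hqa with hqa | hqa
      · exact Or.inl (Finset.mem_filter.2 ⟨he.1, q, hq, p, hp.1, hqa.le, hpa.1⟩)
      · exact Or.inr (Finset.mem_filter.2 ⟨he.1, p, hp.1, q, hq, hpa.2, hqa.le⟩)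
    have h2 : (((PD D).filter fun e => ¬ Inside l Q e).card : ℝ) ≤
        ∑ a ∈ Finset.range d, ((cross a (Q.lo a) ∪ cross a (Q.hi a)).card : ℝ) := by
      exact_mod_cast (Finset.card_le_card hsub).trans Finset.card_biUnion_le
    refine h2.trans ((Finset.sum_le_card_nsmul _ _ (2 * X) fun a ha => ?_).trans ?_)
    · rw [Finset.mem_range] at ha
      have h3 : ((cross a (Q.lo a) ∪ cross a (Q.hi a)).card : ℝ) ≤
          (cross a (Q.lo a)).card + (cross a (Q.hi a)).card := by
        exact_mod_cast Finset.card_union_le _ _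
      have h4 := hc a ha (Q.lo a)
      have h5 := hc a ha (Q.hi a)
      linarith
    · rw [Finset.card_range, nsmul_eq_mul]
      exact le_of_eq (by ring)

end Layout.Geometric

end Geometric

/-! ## Distances and the cost of a clustering -/

section Distances

variable {d : ℕ} {l : Layout d} {W : ℝ} {o : ℕ → ℝ} {M : ℕ} {Y : ℕ → ℕ → ℝ} {gap gid : ℕ → ℕ}

/-- The crude factor `d` in place of its square root keeps node sizes free of roots. -/
theorem euclidean_dist_le {p q : Pt d} {w : ℝ} (hd : 0 < d) (h : ∀ i, |p i - q i| ≤ w) :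
    dist p q ≤ d * w := by
  have hw : 0 ≤ w := (abs_nonneg _).trans (h ⟨0, hd⟩)
  have hd1 : (1 : ℝ) ≤ d := by exact_mod_cast hd
  rw [EuclideanSpace.dist_eq]
  refine Real.sqrt_le_iff.2 ⟨by positivity, ?_⟩
  have : ∑ i, dist (p i) (q i) ^ 2 ≤ ∑ _i : Fin d, w ^ 2 :=
    Finset.sum_le_sum fun i _ => by
      rw [Real.dist_eq]
      exact pow_le_pow_left₀ (abs_nonneg _) (h i) 2
  refine this.trans ?_
  rw [Finset.sum_const, Finset.card_univ, Fintype.card_fin, nsmul_eq_mul]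
  nlinarith [sq_nonneg w, mul_nonneg (sub_nonneg.2 hd1) (sq_nonneg w)]

theorem abs_sub_le_dist (p q : Pt d) (i : Fin d) : |p i - q i| ≤ dist p q := by
  rw [dist_eq_norm]
  have := PiLp.norm_apply_le (p - q) i
  simpa using this

namespace Layout.Geometric

/-- The points of a node are close to each other. -/
theorem dist_le_size (h : l.Geometric W o M Y gap gid) (hd : 0 < d) {i p q : ℕ} (h1 : 1 ≤ i)
    (h2 : i < 2 * l.n) (hp : p ∈ cell l.n M (zkey d Y) gap i)
    (hq : q ∈ cell l.n M (zkey d Y) gap i) : dist (l.pt p) (l.pt q) ≤ l.sz i := by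
  rcases Nat.lt_or_ge i l.n with hi | hi
  · rw [h.inner_size i h1 hi, mul_div_assoc]
    refine euclidean_dist_le hd fun a => ?_
    have hp' := mem_cell.1 hp
    have hq' := mem_cell.1 hq
    have hW := h.pos
    -- Shortening the common prefix to a multiple of `d` bits places the cell in a grid cube.
    have hlt := abs_sub_lt_of_zkey_eq hd (h.cube p hp'.1.1 hp'.1.2) (h.cube q hq'.1.1 hq'.1.2)
      (zkey_eq_of_le (Nat.div_mul_le_self _ d) (hp'.2.trans hq'.2.symm)) a.2
    rw [h.coord a a.2 p hp'.1.1 hp'.1.2, h.coord a a.2 q hq'.1.1 hq'.1.2, ← sub_div,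
      sub_sub_sub_cancel_right, abs_div, abs_of_pos hW, div_lt_iff₀ hW, ← div_eq_inv_mul] at hlt
    exact hlt.le
  · rw [h.tree.leaf_cell hi h2, Finset.mem_singleton] at hp hq
    rw [hp, hq, dist_self, h.leaf_size i hi h2]

theorem pt_injOn (h : l.Geometric W o M Y gap gid) (hd : 0 < d) :
    Set.InjOn l.pt (Finset.Icc 1 l.n : Set ℕ) := by
  intro p hp q hq he
  rw [Finset.mem_coe, Finset.mem_Icc] at hp hq
  have hco : ∀ a < d, l.co a p = l.co a q := fun a ha => congrArg (fun x : Pt d => x ⟨a, ha⟩) he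
  refine h.tree.inj p q hp.1 hp.2 hq.1 hq.2 ?_
  rw [zkey_eq_iff hd (h.cube p hp.1 hp.2) (h.cube q hq.1 hq.2)]
  intro μ _
  have ha := Nat.mod_lt μ hd
  rw [zfloor, zfloor, h.coord _ ha p hp.1 hp.2, h.coord _ ha q hq.1 hq.2, hco _ ha]

/-- Among more than `2 ^ d` points of distinct cells of a grid, two are far apart. -/
theorem exists_far_pair (h : l.Geometric W o M Y gap gid) (hd : 0 < d) {X : Finset ℕ} {m : ℕ}
    (hX : ∀ p ∈ X, 1 ≤ p ∧ p ≤ l.n) (hcard : 2 ^ d < X.card)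
    (hinj : ∀ p ∈ X, ∀ q ∈ X, p ≠ q → zkey d Y (m * d) p ≠ zkey d Y (m * d) q) :
    ∃ p ∈ X, ∃ q ∈ X, W / 2 ^ m ≤ dist (l.pt p) (l.pt q) := by
  set F : ℕ → Fin d → ℕ := fun p a => ⌊2 ^ m * Y a p⌋₊ with hF
  have hto : ∀ p ∈ X, (fun a => (⟨F p a % 2, Nat.mod_lt _ two_pos⟩ : Fin 2)) ∈
      (Finset.univ : Finset (Fin d → Fin 2)) := fun _ _ => Finset.mem_univ _
  -- Pigeonhole on the `2 ^ d` parity patterns of the grid indices.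
  obtain ⟨p, hp, q, hq, hpq, he⟩ := Finset.exists_ne_map_eq_of_card_lt_of_maps_to
    (by simpa using hcard) hto
  have hne := hinj p hp q hq hpq
  have hpn := hX p hp
  have hqn := hX q hq
  rw [Ne, zkey_octree_iff hd (h.cube p hpn.1 hpn.2) (h.cube q hqn.1 hqn.2)] at hne
  push Not at hne
  obtain ⟨a, ha, hfl⟩ := hne
  have hpar : F p ⟨a, ha⟩ % 2 = F q ⟨a, ha⟩ % 2 := by
    have := congrFun he ⟨a, ha⟩
    simpa using this
  have hW := h.pos
  -- Distinct indices of equal parity differ by at least two, so a full grid step lies between the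
  -- points.
  have far : ∀ u v : ℕ, (1 ≤ u ∧ u ≤ l.n) → (1 ≤ v ∧ v ≤ l.n) →
      ⌊2 ^ m * Y a u⌋₊ + 2 ≤ ⌊2 ^ m * Y a v⌋₊ → W / 2 ^ m ≤ dist (l.pt v) (l.pt u) := by
    intro u v hu hv huv
    have hu0 := (h.cube u hu.1 hu.2 a ha).1
    have hv0 := (h.cube v hv.1 hv.2 a ha).1
    have b1 := Nat.lt_floor_add_one (2 ^ m * Y a u)
    have b2 := Nat.floor_le (show 0 ≤ 2 ^ m * Y a v by positivity)
    have b3 : (⌊2 ^ m * Y a u⌋₊ : ℝ) + 2 ≤ ⌊2 ^ m * Y a v⌋₊ := by exact_mod_cast huv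
    have b4 : 1 ≤ 2 ^ m * (Y a v - Y a u) := by linarith
    rw [h.coord a ha u hu.1 hu.2, h.coord a ha v hv.1 hv.2, ← sub_div, sub_sub_sub_cancel_right,
      mul_div_assoc', le_div_iff₀ hW, one_mul] at b4
    have b5 : W / 2 ^ m ≤ l.co a v - l.co a u := by
      rw [div_le_iff₀ (by positivity)]
      linarith
    exact b5.trans ((le_abs_self _).trans (abs_sub_le_dist (l.pt v) (l.pt u) ⟨a, ha⟩))
  rcases Nat.lt_or_ge ⌊2 ^ m * Y a p⌋₊ ⌊2 ^ m * Y a q⌋₊ with hlt | hge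
  · exact ⟨q, hq, p, hp, far p q hpn hqn (by simp only [hF] at hpar; omega)⟩
  · exact ⟨p, hp, q, hq, far q p hqn hpn (by simp only [hF] at hpar; omega)⟩

/-- Representatives of the nodes of a front are in distinct cells of a grid. -/
theorem exists_reps (h : l.Geometric W o M Y gap gid) (hd : 0 < d) {Q : Box} {B : Finset ℕ} {e : ℕ}
    (hF : Front l (cell l.n M (zkey d Y) gap) Q B e) :
    ∃ X ⊆ inQuery l Q, X.card = B.card ∧ ∀ p ∈ X, ∀ q ∈ X, p ≠ q →
      zkey d Y ((level l.n M (zkey d Y) gap e / d + 1) * d) p ≠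
        zkey d Y ((level l.n M (zkey d Y) gap e / d + 1) * d) q := by
  set nd := cell l.n M (zkey d Y) gap with hnd
  choose! g hg using hF.meets
  have hg1 : ∀ i ∈ B, g i ∈ nd i := fun i hi => (Finset.mem_inter.1 (hg i hi)).1
  have hginj : ∀ i ∈ B, ∀ j ∈ B, g i = g j → i = j := by
    intro i hi j hj hij
    by_contra hne
    exact Finset.disjoint_left.1 (hF.disj i hi j hj hne) (hg1 i hi) (hij ▸ hg1 j hj)
  have main : ∀ i ∈ B, ∀ j ∈ B, g i < g j →
      zkey d Y ((level l.n M (zkey d Y) gap e / d + 1) * d) (g i) ≠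
        zkey d Y ((level l.n M (zkey d Y) gap e / d + 1) * d) (g j) := by
    intro i hi j hj hlt heq
    have h1 := (mem_cell.1 (hg1 i hi)).1
    have h2 := (mem_cell.1 (hg1 j hj)).1
    set m := level l.n M (zkey d Y) gap e / d + 1 with hm
    -- If the prefix exceeds `M` bits, it separates all points. Otherwise a common prefix of `m * d`
    -- bits would give the common ancestor a level above that of `e`, whereas by `sep` its number is
    -- at most `e`.
    rcases Nat.lt_or_ge M (m * d) with hM | hM
    · exact hlt.ne (h.tree.inj _ _ h1.1 h1.2 h2.1 h2.2 (zkey_eq_of_le hM.le heq))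
    · have hsep := hF.sep i hi j hj (fun hij => by rw [hij] at hlt; omega) _ (hg1 i hi) _
        (hg1 j hj) hlt.le
      rw [Layout.lcaId, h.sq] at hsep
      obtain ⟨c1, c2, -, c4, -⟩ := h.tree.lca_spec h.lt_width h1.1 hlt.le h2.2
      have c5 := c4 _ hM heq
      have c6 := h.tree.level_mono c1 hsep
      have c7 := Nat.lt_div_mul_add (a := level l.n M (zkey d Y) gap e) hd
      have c8 : m * d = level l.n M (zkey d Y) gap e / d * d + d := by rw [hm]; ring
      have c9 := c5.trans c6
      omega
  refine ⟨B.image g, fun p hp => ?_, Finset.card_image_of_injOn fun i hi j hj => hginj i hi j hj,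
    fun p hp q hq hpq => ?_⟩
  · obtain ⟨i, hi, rfl⟩ := Finset.mem_image.1 hp
    exact (Finset.mem_inter.1 (hg i hi)).2
  · obtain ⟨i, hi, rfl⟩ := Finset.mem_image.1 hp
    obtain ⟨j, hj, rfl⟩ := Finset.mem_image.1 hq
    rcases lt_or_gt_of_ne hpq with hlt | hgt
    · exact main i hi j hj hlt
    · exact (main j hj i hi hgt).symm

end Layout.Geometric

/-- The infimum needs a non-empty family of clusterings to be bounded below: the empty partition, or
a single cluster, which is allowed as `k ≥ 1`. -/
theorem le_opt {cost : Cost d} {k : ℕ} (hk : 1 ≤ k) {P : Finset (Pt d)} {v : ℝ}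
    (h : ∀ C : Finpartition P, C.parts.card ≤ k → v ≤ cost C.parts) : v ≤ opt cost k P := by
  have : Nonempty {C : Finpartition P // C.parts.card ≤ k} := by
    rcases P.eq_empty_or_nonempty with rfl | hP
    · exact ⟨⟨Finpartition.empty _, by simp⟩⟩
    · exact ⟨⟨Finpartition.indiscrete hP.ne_empty, by simpa using hk⟩⟩
  exact le_ciInf fun C => h C.1 C.2

theorem inBox_eq_image {S : Finset (Pt d)} (hS : (Finset.Icc 1 l.n).image l.pt = S) (Q : Box) :
    inBox S (Q.lower d) (Q.upper d) = (inQuery l Q).image l.pt := by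
  ext x
  rw [inBox, Finset.mem_filter, ← hS, Finset.mem_image, Finset.mem_image]
  constructor
  · rintro ⟨⟨p, hp, rfl⟩, hx⟩
    exact ⟨p, mem_boxSel.2 ⟨hp, fun a ha => hx ⟨a, ha⟩⟩, rfl⟩
  · rintro ⟨p, hp, rfl⟩
    obtain ⟨h1, h2⟩ := mem_boxSel.1 hp
    exact ⟨⟨p, h1, rfl⟩, fun i => h2 i i.2⟩

/-- If the coarse phase ends with an inner node, then every clustering is expensive. -/
theorem Layout.Geometric.size_le_opt (h : l.Geometric W o M Y gap gid) (hd : 0 < d)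
    {S : Finset (Pt d)} {cost : Cost d} {c : ℝ} {f : ℕ → ℝ} (hc : RegularCost S cost c f)
    (hS : (Finset.Icc 1 l.n).image l.pt = S) {Q : Box} {B : Finset ℕ} {e k : ℕ} (he : 1 ≤ e)
    (hen : e < l.n) (hk : 1 ≤ k) (hF : Front l (cell l.n M (zkey d Y) gap) Q B e)
    (hB : B.card = 2 ^ d * k + 1) :
    c * (l.sz e / (2 * d)) ≤ opt cost k (inBox S (Q.lower d) (Q.upper d)) := by
  obtain ⟨X, hXQ, hX, hinj⟩ := h.exists_reps hd hF
  have hXn : ∀ p ∈ X, 1 ≤ p ∧ p ≤ l.n := fun p hp =>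
    Finset.mem_Icc.1 (mem_boxSel.1 (hXQ hp)).1
  refine le_opt hk fun C hC => ?_
  have hmem : ∀ p ∈ X, l.pt p ∈ inBox S (Q.lower d) (Q.upper d) := fun p hp => by
    rw [inBox_eq_image hS]
    exact Finset.mem_image_of_mem _ (hXQ hp)
  -- As `k * 2 ^ d < 2 ^ d * k + 1`, some cluster receives more than `2 ^ d` representatives.
  obtain ⟨D, hD, hcard⟩ := Finset.exists_lt_card_fiber_of_mul_lt_card_of_maps_to
    (s := X) (t := C.parts) (f := fun p => C.part (l.pt p)) (n := 2 ^ d)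
    (fun p hp => C.part_mem.2 (hmem p hp)) (by
      rw [hX, hB]
      calc C.parts.card * 2 ^ d ≤ k * 2 ^ d := Nat.mul_le_mul_right _ hC
        _ < 2 ^ d * k + 1 := by rw [mul_comm]; omega)
  obtain ⟨p, hp, q, hq, hpq⟩ := h.exists_far_pair hd
    (fun p hp => hXn p (Finset.mem_filter.1 hp).1) hcard
    (fun p hp q hq => hinj p (Finset.mem_filter.1 hp).1 q (Finset.mem_filter.1 hq).1)
  rw [Finset.mem_filter] at hp hq
  have hpD : l.pt p ∈ D := by rw [← hp.2]; exact C.mem_part (hmem p hp.1)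
  have hqD : l.pt q ∈ D := by rw [← hq.2]; exact C.mem_part (hmem q hq.1)
  have hdiam := Metric.dist_le_diam_of_mem (D.finite_toSet.isBounded) hpD hqD
  refine le_trans (mul_le_mul_of_nonneg_left ?_ hc.c_pos.le)
    (hc.diameter_sensitive _ (Finset.filter_subset _ _) C D hD)
  refine le_trans (le_of_eq ?_) (hpq.trans hdiam)
  rw [h.inner_size e he hen, pow_succ]
  have : (d : ℝ) ≠ 0 := by exact_mod_cast hd.ne'
  field_simp

end Distances

/-! ## Correctness and running time of the query program -/

section Query

variable {d : ℕ} {l : Layout d} {W : ℝ} {o : ℕ → ℝ} {M : ℕ} {Y : ℕ → ℕ → ℝ} {gap gid : ℕ → ℕ}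

/-- An inner node has at least the two points next to its gap and so does not fit into a leaf. -/
theorem pending_eq_empty (h : l.Geometric W o M Y gap gid) {Q : Box} {r : ℝ} {st : List ℕ}
    (hst : ∀ i ∈ st, l.n ≤ i ∧ i < 2 * l.n) :
    pending l (cell l.n M (zkey d Y) gap) Q r st = ∅ := by
  refine Finset.eq_empty_of_forall_notMem fun e he => ?_
  simp only [pending, Finset.mem_filter, Finset.mem_Ico] at he
  obtain ⟨⟨h1, h2⟩, -, -, D, hD, hs⟩ := he
  obtain ⟨g1, g2⟩ := h.tree.gap_mem e h1 h2
  have m1 : gap e ∈ cell l.n M (zkey d Y) gap e := by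
    rw [mem_cell, anchor, if_pos h2]
    exact ⟨by omega, rfl⟩
  have m2 : gap e + 1 ∈ cell l.n M (zkey d Y) gap e := by
    rw [mem_cell, level, if_pos h2, anchor, if_pos h2]
    exact ⟨by omega, (h.tree.key_lam _).symm⟩
  have m3 := hs m1
  have m4 := hs m2
  rw [h.tree.leaf_cell (hst D hD).1 (hst D hD).2, Finset.mem_singleton] at m3 m4
  omega

/-- A bound for the number of nodes that the fine phase refines. -/
def refinedBound (d k : ℕ) (x : ℝ) : ℝ := (2 ^ d * k + 1 : ℕ) * (d * (2 * (2 * (2 * d * x)) ^ d))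

/-- A bound for the number of nodes whose bounding box is not inside the query box among them. -/
def crossingBound (d k : ℕ) (x : ℝ) : ℝ :=
  (2 ^ d * k + 1 : ℕ) * (2 * d * (d * (2 * (2 * (2 * d * x)) ^ (d - 1))))

/-- This excludes that the limit is reached when `k > n`, the case in which no value of `f` is
stored. -/
theorem Front.card_le {nd : ℕ → Finset ℕ} {Q : Box} {B : Finset ℕ} {e : ℕ} (h : Front l nd Q B e) :
    B.card ≤ 2 * l.n := by
  have : B ⊆ Finset.range (2 * l.n) := fun i hi => Finset.mem_range.2 (h.valid i hi).2
  simpa using Finset.card_le_card this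

-- Every pending node costs a constant, and only those that are not inside add the range searches.
-- This is where `x ^ d` gets separated from `log ^ (d - 1)`.
open Classical in
theorem fineTime_le {nd : ℕ → Finset ℕ} {Q : Box} {r : ℝ} {st : List ℕ} {u v : ℝ}
    (hu : ((pending l nd Q r st).card : ℝ) ≤ u)
    (hv : (((pending l nd Q r st).filter fun e => ¬ Inside l Q e).card : ℝ) ≤ v) :
    (fineTime l nd Q r st : ℝ) ≤ u * (2 * insideTime d + 18 + 2 * outputTime d : ℕ) +
      v * (2 * crossTime d l.L l.Λ : ℕ) + st.length * outputTime d + 1 := by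
  have key : ∑ e ∈ pending l nd Q r st, (refineTime d l.L l.Λ (Inside l Q e) + 2 * outputTime d) =
      (pending l nd Q r st).card * (2 * insideTime d + 18 + 2 * outputTime d) +
        ((pending l nd Q r st).filter fun e => ¬ Inside l Q e).card *
          (2 * crossTime d l.L l.Λ) := by
    have hconst : (pending l nd Q r st).card * (2 * insideTime d + 18 + 2 * outputTime d) =
        ∑ _e ∈ pending l nd Q r st, (2 * insideTime d + 18 + 2 * outputTime d) := by
      rw [Finset.sum_const, smul_eq_mul]
    rw [Finset.card_filter, Finset.sum_mul, hconst, ← Finset.sum_add_distrib]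
    refine Finset.sum_congr rfl fun e _ => ?_
    by_cases hi : Inside l Q e
    · simp [refineTime, hi]
    · simp [refineTime, hi]
      ring
  rw [fineTime, key]
  push_cast
  gcongr

/-- The result of the coarse phase bounds the work of the fine phase. -/
theorem Layout.Geometric.pending_bounds (h : l.Geometric W o M Y gap gid) (hd : 2 ≤ d) {Q : Box}
    {σ x r x' : ℝ} {k : ℕ} {st : List ℕ} (hx : 1 ≤ x) (hx' : 1 ≤ x') (hxx : k ≤ l.n → x = x')
    (hr : r = σ / (2 * d * x))
    (hnd : st.Nodup)
    (hco : CoarseResult l (cell l.n M (zkey d Y) gap) Q (2 ^ d * k + 1) σ st.toFinset) :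
    open Classical in
    ((pending l (cell l.n M (zkey d Y) gap) Q r st).card : ℝ) ≤ refinedBound d k x' ∧
    (((pending l (cell l.n M (zkey d Y) gap) Q r st).filter fun e => ¬ Inside l Q e).card : ℝ) ≤
      crossingBound d k x' := by
  obtain ⟨e, hF, hcard, ⟨h0, hleaf⟩ | ⟨hlim, he1, hen, hσ⟩⟩ := hco
  · rw [pending_eq_empty h fun i hi =>
      ⟨hleaf i (List.mem_toFinset.2 hi), (hF.valid i (List.mem_toFinset.2 hi)).2⟩]
    have : 0 ≤ x' := by linarith
    constructor
    · simp only [Finset.card_empty, Nat.cast_zero, refinedBound]; positivity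
    · simp only [Finset.filter_empty, Finset.card_empty, Nat.cast_zero, crossingBound]; positivity
  -- A front has at most `2 * n` nodes, whereas the limit exceeds `4 * k`.
  · have hkn : k ≤ l.n := by
      have h1 := hF.card_le
      have h2 : 2 ^ 2 ≤ 2 ^ d := Nat.pow_le_pow_right two_pos hd
      have h3 : 2 ^ 2 * k ≤ 2 ^ d * k := Nat.mul_le_mul_right k h2
      omega
    rw [← hxx hkn]
    have hlen : st.length = 2 ^ d * k + 1 := by rw [← hlim, List.toFinset_card_of_nodup hnd]
    have hd0 : (0 : ℝ) < d := by exact_mod_cast (show 0 < d by omega)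
    have hW := h.pos
    have hv := fun D (hD : D ∈ st) => hF.valid D (List.mem_toFinset.2 hD)
    -- A node of size above `r = σ / (2 * d * x)` has fewer than `log (2 * d * x)` octree levels
    -- more than `e`, whence `y = 2 * d * x`. All front nodes have numbers above `e`, so the cube
    -- level `b` of `e` is a common start.
    have := h.card_pending_le (Q := Q) (r := r) (y := 2 * d * x) (st := st)
      (b := level l.n M (zkey d Y) gap e / d) hd (by positivity)
      (fun D hD => by have := hv D hD; omega)
      (fun D hD => (Nat.div_mul_le_self _ _).trans (h.tree.level_mono he1 (hv D hD).1.le))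
      (fun i hi1 hin hri => ?_)
    · rw [hlen] at this
      exact this
    · rw [hr, hσ, h.inner_size i hi1 hin, h.inner_size e he1 hen, div_div,
        div_lt_div_iff_of_pos_left (by positivity) (by positivity) (by positivity)] at hri
      exact hri.le

/-- A query. -/
theorem query_correct {S : Finset (Pt d)} {cost : Cost d} {c : ℝ} {f : ℕ → ℝ}
    {rep : Desc → Finset (Finset (Pt d)) → Prop} {A : Procedures d} {Tss Texpand : ℕ → ℕ → ℕ}
    (hd : 2 ≤ d) (hl : l.Valid) (h : l.Geometric W o M Y gap gid)
    (hS : (Finset.Icc 1 l.n).image l.pt = S) (hf : ∀ k ≤ l.n, l.fk k = f k) (hcc : l.cc = c)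
    (hreg : RegularCost S cost c f) (hsolve : Solves A rep S cost Tss)
    (hexp : Expands A rep S cost f Texpand) {Q : Box} (hε : 0 < Q.ε) {k : ℕ} (hk : 2 ≤ k)
    {s : State} (hs : Start l Q k s) {m : ℕ}
    (hm : refinedBound d k (max 1 (f k / (c * Q.ε))) + (2 ^ d * k + 1 : ℕ) ≤ m) :
    ∃ (t : ℕ) (s' : State), Exec A (queryProgram d) s t s' ∧
      (∃ C : Finpartition (inBox S (Q.lower d) (Q.upper d)), C.parts.card ≤ k ∧
        rep (s'.readDesc answerRef) C.parts ∧
        cost C.parts ≤ (1 + Q.ε) * opt cost k (inBox S (Q.lower d) (Q.upper d))) ∧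
      (t : ℝ) ≤ coarsePhaseTime d l.L l.Λ (2 ^ d * k + 1) +
        (refinedBound d k (max 1 (f k / (c * Q.ε))) *
            (2 * insideTime d + 18 + 2 * outputTime d : ℕ) +
          crossingBound d k (max 1 (f k / (c * Q.ε))) * (2 * crossTime d l.L l.Λ : ℕ) +
          (2 ^ d * k + 1 : ℕ) * outputTime d + 1) + Tss m k + Texpand S.card k + 30 := by
  classical
  have hd0 : 0 < d := by omega
  set nd := cell l.n M (zkey d Y) gap with hnd
  set P := inBox S (Q.lower d) (Q.upper d) with hP
  obtain ⟨σ, x, r, st, out, t, s', hx1, hx, hr, hst, hco, hcov, hlen, hex, ht, hread⟩ :=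
    queryProgram_runs (A := A) hd hl h.toTree (fun i h1 h2 => h.size_nonpos_iff hd0 h1 h2)
      (by omega : 1 ≤ k) hs
  have hxx : k ≤ l.n → x = max 1 (f k / (c * Q.ε)) := fun hkn => by rw [hx hkn, hf k hkn, hcc]
  obtain ⟨b1, b2⟩ := h.pending_bounds hd hx1 (le_max_left 1 _) hxx hr hst hco
  have hstl : st.length ≤ 2 ^ d * k + 1 := by
    obtain ⟨e, -, hcard, -⟩ := hco
    rwa [List.toFinset_card_of_nodup hst] at hcard
  have hfine := fineTime_le (l := l) b1 b2
  set R := out.map l.pt with hR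
  have hQn : ∀ p ∈ inQuery l Q, p ∈ (Finset.Icc 1 l.n : Set ℕ) := fun p hp => (mem_boxSel.1 hp).1
  have hRnd : R.Nodup := by
    refine List.Nodup.map_on (fun p hp q hq he => ?_) hcov.nodup
    exact h.pt_injOn hd0 (hQn p (hcov.mem p hp)) (hQn q (hcov.mem q hq)) he
  have hPim : P = (inQuery l Q).image l.pt := inBox_eq_image hS Q
  have hPS : P ⊆ S := Finset.filter_subset _ _
  have hRP : R.toFinset ⊆ P := by
    intro y hy
    rw [List.mem_toFinset, hR, List.mem_map] at hy
    obtain ⟨p, hp, rfl⟩ := hy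
    rw [hPim]
    exact Finset.mem_image_of_mem _ (hcov.mem p hp)
  obtain ⟨⟨C, hC1, hC2, hC3⟩, hsT⟩ := hsolve R hRnd (hRP.trans hPS) k hk
  have hRm : R.length ≤ m := by
    have h1 : ((R.length : ℕ) : ℝ) ≤ ((pending l nd Q r st).card + st.length : ℕ) := by
      rw [hR, List.length_map]
      exact_mod_cast hlen
    have h2 : ((st.length : ℕ) : ℝ) ≤ (2 ^ d * k + 1 : ℕ) := by exact_mod_cast hstl
    push_cast at h1 h2 hm
    have : (R.length : ℝ) ≤ m := by linarith
    exact_mod_cast this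
  have hsT' := hsT m hRm
  -- The stack is empty, so each query point shares a node of size at most `r` with a selected
  -- point.
  have hclose : ∀ y ∈ P, ∃ z ∈ R.toFinset, dist y z ≤ r := by
    intro y hy
    rw [hPim, Finset.mem_image] at hy
    obtain ⟨p, hp, rfl⟩ := hy
    rcases hcov.cover p hp with ⟨i, hi, -⟩ | ⟨i, h1, h2, hsz, hpi, q, hq, hqi⟩
    · simp at hi
    · exact ⟨l.pt q, by rw [List.mem_toFinset]; exact List.mem_map_of_mem hq,
        (h.dist_le_size hd0 h1 h2 hpi hqi).trans hsz⟩
  have hopt0 : 0 ≤ opt cost k P := le_opt (by omega) fun C _ => hreg.cost_nonneg P hPS C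
  have htime : (finalCalls A l Q k σ r out).2 ≤ Tss m k + Texpand S.card k → (t : ℝ) ≤
      coarsePhaseTime d l.L l.Λ (2 ^ d * k + 1) +
        (refinedBound d k (max 1 (f k / (c * Q.ε))) *
            (2 * insideTime d + 18 + 2 * outputTime d : ℕ) +
          crossingBound d k (max 1 (f k / (c * Q.ε))) * (2 * crossTime d l.L l.Λ : ℕ) +
          (2 ^ d * k + 1 : ℕ) * outputTime d + 1) + Tss m k + Texpand S.card k + 30 := by
    intro hcalls
    have h1 : (t : ℝ) ≤ (coarsePhaseTime d l.L l.Λ (2 ^ d * k + 1) + fineTime l nd Q r st +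
        (finalCalls A l Q k σ r out).2 + 30 : ℕ) := by exact_mod_cast ht
    have h2 : ((finalCalls A l Q k σ r out).2 : ℝ) ≤ (Tss m k + Texpand S.card k : ℕ) := by
      exact_mod_cast hcalls
    have h3 : (st.length : ℝ) * outputTime d ≤ (2 ^ d * k + 1 : ℕ) * outputTime d := by
      exact_mod_cast Nat.mul_le_mul_right _ hstl
    push_cast at h1 h2 h3 hfine ⊢
    linarith
  refine ⟨t, s', hex, ?_⟩
  rw [hread]
  obtain ⟨e, hF, hcard, ⟨h0, hleaf⟩ | ⟨hlim, he1, hen, hσ⟩⟩ := hco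
  -- With `σ = 0` the radius is zero, so all query points are selected and the clustering is
  -- optimal.
  · have hRe : R.toFinset = P := by
      refine Finset.Subset.antisymm hRP fun y hy => ?_
      obtain ⟨z, hz, hyz⟩ := hclose y hy
      rw [hr, h0, zero_div] at hyz
      rwa [dist_le_zero.1 hyz]
    have hfc : finalCalls A l Q k σ r out = A.solve R k := by
      rw [finalCalls, if_neg (by rw [h0]; exact lt_irrefl 0)]
    refine ⟨?_, htime (by rw [hfc]; omega)⟩
    rw [hfc, ← hRe]
    refine ⟨C, hC1, hC2, ?_⟩
    rw [← hRe] at hopt0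
    rw [hC3]
    nlinarith
  · have hkn : k ≤ l.n := by
      have h1 := hF.card_le
      have h2 : 2 ^ 2 ≤ 2 ^ d := Nat.pow_le_pow_right two_pos hd
      have h3 : 2 ^ 2 * k ≤ 2 ^ d * k := Nat.mul_le_mul_right k h2
      omega
    have hσ0 : 0 < σ := by
      rw [hσ]
      by_contra hle
      have := (h.size_nonpos_iff hd0 he1 (by omega)).1 (not_lt.1 hle)
      omega
    have hdR : (0 : ℝ) < d := by exact_mod_cast hd0
    have hr0 : 0 < r := by rw [hr]; positivity
    have hpack : IsWeakPacking r R.toFinset P := ⟨hr0, hRP, hclose⟩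
    have hlow := h.size_le_opt hd0 hreg hS he1 hen (by omega) hF hlim
    rw [← hσ, ← hP] at hlow
    have hc0 := hreg.c_pos
    -- This is the choice of the radius: `x ≥ f k / (c * ε)` cancels `f k`, and the lower bound on
    -- the optimum does the rest.
    have hrf : r * f k ≤ Q.ε * opt cost k P := by
      have hfx : f k ≤ x * (c * Q.ε) := by
        rw [hxx hkn, ← div_le_iff₀ (by positivity)]
        exact le_max_right _ _
      calc r * f k ≤ r * (x * (c * Q.ε)) := mul_le_mul_of_nonneg_left hfx hr0.le
        _ = Q.ε * (c * (σ / (2 * d))) := by rw [hr]; field_simp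
        _ ≤ _ := mul_le_mul_of_nonneg_left hlow hε.le
    obtain ⟨⟨C', hC'1, hC'2, hC'3⟩, heT⟩ := hexp (Q.lower d) (Q.upper d) R r hRnd hpack k hk C
      (A.solve R k).1 hC1 hC2
    have hle := hreg.opt_packing_le P hPS r _ hpack k hk
    rw [finalCalls, if_pos hσ0] at htime ⊢
    refine ⟨⟨C', hC'1, hC'2, ?_⟩, htime (Nat.add_le_add hsT' heT)⟩
    rw [hC3] at hC'3
    linarith

end Query

/-! ## Construction of the data structure -/

section Build

/-- Every finite set can be enumerated in the order of a key. -/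
theorem exists_sorted {α β : Type*} [DecidableEq α] [Inhabited α] [LinearOrder β] (X : Finset α)
    (key : α → β) : ∃ (e : ℕ → α) (rk : α → ℕ), (∀ i < X.card, e i ∈ X ∧ rk (e i) = i) ∧
      (∀ p ∈ X, rk p < X.card ∧ e (rk p) = p) ∧
      ∀ i j, i ≤ j → j < X.card → key (e i) ≤ key (e j) := by
  induction X using Finset.induction_on_max_value key with
  | empty => exact ⟨fun _ => default, fun _ => 0, by simp, by simp, by simp⟩
  | insert a s ha hmax ih =>
    obtain ⟨e, rk, h1, h2, h3⟩ := ih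
    rw [Finset.card_insert_of_notMem ha]
    refine ⟨fun i => if i = s.card then a else e i, fun p => if p = a then s.card else rk p,
      fun i hi => ?_, fun p hp => ?_, fun i j hij hj => ?_⟩
    · by_cases hc : i = s.card
      · simp [hc]
      · obtain ⟨h4, h5⟩ := h1 i (by omega)
        have : e i ≠ a := fun h => ha (h ▸ h4)
        simp [hc, h4, h5, this]
    · by_cases hc : p = a
      · simp [hc]
      · obtain ⟨h4, h5⟩ := h2 p ((Finset.mem_insert.1 hp).resolve_left hc)
        have : rk p ≠ s.card := h4.ne
        simp only [hc, if_false, this, h5, and_true]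
        omega
    · by_cases hc : j = s.card
      · by_cases hc' : i = s.card
        · simp [hc, hc']
        · simp only [hc, hc', if_false, if_true]
          exact hmax _ (h1 i (by omega)).1
      · have hc' : i ≠ s.card := by omega
        simp only [hc, hc', if_false]
        exact h3 i j hij (by omega)

/-- `P nm rm a` says that something is stored at the address `a`; it can be stored in `size` cells
at every address. -/
def Buildable (V : ℕ) (P : (ℕ → ℕ) → (ℕ → ℝ) → ℕ → Prop) (size : ℕ) : Prop :=
  ∀ base, ∃ (gn : ℕ → ℕ) (gr : ℕ → ℝ), (∀ i, gn i ≤ V + (base + size)) ∧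
    ∀ nm rm, (∀ i, base ≤ i → i < base + size → nm i = gn i ∧ rm i = gr i) → P nm rm base

theorem Buildable.mono {V s s' : ℕ} {P : (ℕ → ℕ) → (ℕ → ℝ) → ℕ → Prop} (h : Buildable V P s)
    (hs : s ≤ s') : Buildable V P s' := fun base => by
  obtain ⟨gn, gr, h1, h2⟩ := h base
  exact ⟨gn, gr, fun i => (h1 i).trans (by omega), fun nm rm ha => h2 nm rm fun i hi hi' =>
    ha i hi (by omega)⟩

/-- Store several things one after the other. -/
theorem Buildable.pi {V N : ℕ} {P : ℕ → (ℕ → ℕ) → (ℕ → ℝ) → ℕ → Prop} {s : ℕ → ℕ}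
    (h : ∀ v < N, Buildable V (P v) (s v)) :
    Buildable V (fun nm rm a => ∀ v < N, P v nm rm (a + ∑ u ∈ Finset.range v, s u))
      (∑ u ∈ Finset.range N, s u) := by
  intro base
  induction N with
  | zero => exact ⟨fun _ => 0, fun _ => 0, by simp, by simp⟩
  | succ N ih =>
    obtain ⟨gn, gr, h1, h2⟩ := ih fun v hv => h v (by omega)
    set T := base + ∑ u ∈ Finset.range N, s u with hT
    obtain ⟨gn', gr', h1', h2'⟩ := h N (by omega) T
    have hT' : base + ∑ u ∈ Finset.range (N + 1), s u = T + s N := by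
      rw [Finset.sum_range_succ, ← add_assoc]
    rw [hT']
    refine ⟨fun i => if i < T then gn i else gn' i, fun i => if i < T then gr i else gr' i,
      fun i => ?_, fun nm rm ha v hv => ?_⟩
    · beta_reduce
      split_ifs
      · exact (h1 i).trans (by omega)
      · exact h1' i
    · rcases Nat.lt_or_ge v N with hvN | hvN
      · refine h2 nm rm (fun i hi hi' => ?_) v hvN
        have := ha i hi (by omega)
        simpa only [hi', if_true] using this
      · obtain rfl : v = N := by omega
        refine h2' nm rm fun i hi hi' => ?_
        have := ha i (by omega) hi'
        simpa only [show ¬ i < T by omega, if_false] using this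

/-- Store a block that may contain the addresses of other things. -/
theorem Buildable.block {V s₀ N : ℕ} {P : ℕ → (ℕ → ℕ) → (ℕ → ℝ) → ℕ → Prop} {s : ℕ → ℕ}
    {R : (ℕ → ℕ) → (ℕ → ℝ) → ℕ → Prop} (h : ∀ v < N, Buildable V (P v) (s v))
    (hn : (ℕ → ℕ) → ℕ → ℕ) (hr : ℕ → ℝ)
    (hb : ∀ adr T, (∀ v < N, adr v + s v ≤ T) → s₀ + ∑ u ∈ Finset.range N, s u ≤ T →
      ∀ j < s₀, hn adr j ≤ V + T)
    (hR : ∀ nm rm base adr, (∀ j < s₀, nm (base + j) = hn adr j ∧ rm (base + j) = hr j) →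
      (∀ v < N, P v nm rm (adr v)) → R nm rm base) :
    Buildable V R (s₀ + ∑ u ∈ Finset.range N, s u) := by
  intro base
  obtain ⟨gn, gr, h1, h2⟩ := Buildable.pi h (base + s₀)
  -- The parts lie one after the other behind the block, so their addresses are known before the
  -- words of the block are chosen.
  set adr : ℕ → ℕ := fun v => base + s₀ + ∑ u ∈ Finset.range v, s u with hadr
  set T := base + (s₀ + ∑ u ∈ Finset.range N, s u) with hT
  have hadrT : ∀ v < N, adr v + s v ≤ T := by
    intro v hv
    have := Finset.sum_le_sum_of_subset (f := s) (Finset.range_mono (show v + 1 ≤ N by omega))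
    rw [Finset.sum_range_succ] at this
    simp only [hadr, hT]
    omega
  refine ⟨fun i => if i < base + s₀ then (if base ≤ i then hn adr (i - base) else 0) else gn i,
    fun i => if i < base + s₀ then hr (i - base) else gr i, fun i => ?_, fun nm rm ha => ?_⟩
  · beta_reduce
    split_ifs with c1 c2
    · exact hb adr T hadrT (by omega) _ (by omega)
    · exact Nat.zero_le _
    · exact (h1 i).trans (by omega)
  · refine hR nm rm base adr (fun j hj => ?_) (h2 nm rm fun i hi hi' => ?_)
    · have := ha (base + j) (by omega) (by omega)
      simpa [hj] using this
    · have := ha i (by omega) (by omega)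
      simpa only [show ¬ i < base + s₀ by omega, if_false] using this

theorem sum_range_card_inter_blk_le (l : ℕ) (X : Finset ℕ) :
    ∑ v ∈ Finset.range (2 ^ (l + 1)), (blk l v ∩ X).card ≤ X.card * (l + 1) := by
  have h0 : blk l 0 = ∅ := by
    refine Finset.filter_eq_empty_iff.2 fun x _ => ?_
    simp
  rw [Finset.range_eq_Ico, Finset.sum_eq_sum_Ico_succ_bot (by positivity), h0]
  simpa using sum_card_inter_blk_le l X

theorem part_subset {X : Finset ℕ} {e : ℕ → ℕ} {l v : ℕ} (he : ∀ i < X.card, e i ∈ X) :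
    part X e l v ⊆ X := by
  intro p hp
  obtain ⟨i, hi, rfl⟩ := Finset.mem_image.1 hp
  exact he i (Finset.mem_range.1 (Finset.mem_inter.1 hi).2)

/-- The number of cells of a range tree. -/
def rangeSize (Λ m t : ℕ) : ℕ := 10 ^ (m + 1) * ((t + 1) * Λ ^ m)

/-- Each index occurs below at most `l + 1` nodes of the outermost tree, so the subtrees contain at
most `X.card * (l + 1)` points in total. This contributes one factor `Λ` for every further
coordinate. -/
theorem rangeTree_buildable {co : ℕ → ℕ → ℝ} {wt : ℕ → ℕ} {Λ V : ℕ} (hΛ : 1 ≤ Λ)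
    (hV : 2 ^ Λ ≤ V) (m : ℕ) :
    ∀ X : Finset ℕ, Nat.log 2 X.card + 1 ≤ Λ → (∀ p ∈ X, p ≤ V ∧ wt p ≤ V) →
      Buildable V (fun nm rm a => RangeTree co wt Λ nm rm m X a) (rangeSize Λ m X.card) := by
  have main : ∀ (m : ℕ) (X : Finset ℕ), Nat.log 2 X.card + 1 ≤ Λ → ∃ l ≤ Λ, 1 ≤ l ∧
      X.card < 2 ^ l ∧ 2 ^ l ≤ 2 * (X.card + 1) ∧ ∃ e : ℕ → ℕ, (∀ i < X.card, e i ∈ X) ∧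
      (Finset.range X.card).image e = X ∧
      ∀ i j, i ≤ j → j < X.card → co (m + 1) (e i) ≤ co (m + 1) (e j) := by
    intro m X hX
    obtain ⟨e, rk, h1, h2, h3⟩ := exists_sorted X (co (m + 1))
    refine ⟨Nat.log 2 X.card + 1, hX, by omega, Nat.lt_pow_succ_log_self (by omega) _, ?_, e,
      fun i hi => (h1 i hi).1, ?_, h3⟩
    · rcases Nat.eq_zero_or_pos X.card with h0 | h0
      · simp [h0]
      · have := Nat.pow_log_le_self 2 h0.ne'
        rw [pow_succ]
        omega
    · ext p
      rw [Finset.mem_image]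
      constructor
      · rintro ⟨i, hi, rfl⟩
        exact (h1 i (Finset.mem_range.1 hi)).1
      · intro hp
        exact ⟨rk p, Finset.mem_range.2 (h2 p hp).1, (h2 p hp).2⟩
  induction m with
  | zero =>
    intro X hX hwt
    obtain ⟨l, hl, hl1, hc, hc2, e, he, him, hmono⟩ := main 0 X hX
    have hlV : 2 ^ l ≤ V := (Nat.pow_le_pow_right two_pos hl).trans hV
    have h2 : 2 ≤ 2 ^ l := by simpa using Nat.pow_le_pow_right two_pos hl1
    refine Buildable.mono (Buildable.block (s₀ := 2 ^ l + 2 ^ l + X.card) (N := 0)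
      (P := fun _ _ _ _ => True) (s := fun _ => 0) (by simp)
      (fun _ j => if j = 0 then X.card else if j = 1 then 2 ^ l else
        if j < 2 ^ l + 2 ^ l then (part X e l j).sup wt else e (j - (2 ^ l + 2 ^ l)))
      (fun j => co 1 (e j)) (fun _ T _ _ j hj => ?_) fun nm rm a _ hm _ => ?_) ?_
    · split_ifs
      · omega
      · omega
      · refine (Finset.sup_le fun p hp => ?_).trans (Nat.le_add_right V T)
        exact (hwt p (part_subset he hp)).2
      · have := (hwt _ (he (j - (2 ^ l + 2 ^ l)) (by omega))).1
        omega
    · refine ⟨l, hl, e, ⟨hc, ?_, ?_, him, fun i hi => (hm i (by omega)).2, hmono⟩,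
        fun v hv1 hv2 => ?_, fun i hi => ?_⟩
      · have := (hm 0 (by omega)).1
        simpa using this
      · have := (hm 1 (by omega)).1
        simpa using this
      · rw [pow_succ] at hv2
        have := (hm v (by omega)).1
        rwa [if_neg (by omega), if_neg (by omega), if_pos (by omega)] at this
      · have := (hm (2 ^ l + 2 ^ l + i) (by omega)).1
        rw [if_neg (by omega), if_neg (by omega), if_neg (by omega), Nat.add_sub_cancel_left,
          ← add_assoc, ← add_assoc] at this
        exact this
    · simp only [Finset.range_zero, Finset.sum_empty, rangeSize, pow_zero]
      omega
  | succ m ih =>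
    intro X hX hwt
    obtain ⟨l, hl, hl1, hc, hc2, e, he, him, hmono⟩ := main (m + 1) X hX
    have hlV : 2 ^ l ≤ V := (Nat.pow_le_pow_right two_pos hl).trans hV
    have h2 : 2 ≤ 2 ^ l := by simpa using Nat.pow_le_pow_right two_pos hl1
    have hcp : ∀ v, (part X e l v).card ≤ (blk l v ∩ Finset.range X.card).card := fun v =>
      Finset.card_image_le
    have hchild : ∀ v < 2 ^ (l + 1), Buildable V
        (fun nm rm a => RangeTree co wt Λ nm rm m (part X e l v) a)
        (rangeSize Λ m (blk l v ∩ Finset.range X.card).card) := by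
      intro v _
      refine Buildable.mono (ih _ ?_ fun p hp => hwt p (part_subset he hp)) ?_
      · have := Nat.log_mono_right (b := 2) (Finset.card_le_card (part_subset (l := l) (v := v) he))
        omega
      · unfold rangeSize
        have := hcp v
        gcongr
    refine Buildable.mono (Buildable.block (s₀ := 2 ^ (l + 1)) hchild
      (fun adr j => if j = 0 then X.card else if j = 1 then 2 ^ l else adr j)
      (fun j => co (m + 2) (e j)) (fun adr T hadr _ j hj => ?_) fun nm rm a adr hm hch => ?_) ?_
    · have := hadr j hj
      split_ifs <;> omega
    · rw [pow_succ] at hm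
      refine ⟨l, hl, e, ⟨hc, ?_, ?_, him, fun i hi => (hm i (by omega)).2, hmono⟩,
        fun v hv1 hv2 => ?_⟩
      · have := (hm 0 (by omega)).1
        simpa using this
      · have := (hm 1 (by omega)).1
        simpa using this
      · have := (hm v (by rw [pow_succ] at hv2; omega)).1
        rw [if_neg (by omega), if_neg (by omega)] at this
        rw [this]
        exact hch v hv2
    · simp only [rangeSize]
      rw [← Finset.mul_sum, ← Finset.sum_mul, Finset.sum_add_distrib, Finset.sum_const,
        Finset.card_range, smul_eq_mul, mul_one]
      have hs := sum_range_card_inter_blk_le l (Finset.range X.card)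
      rw [Finset.card_range] at hs
      set σ := ∑ v ∈ Finset.range (2 ^ (l + 1)), (blk l v ∩ Finset.range X.card).card
      -- Six units for the subtrees, counting the `+ 1` of each, and four for the own block of the
      -- node give the base `10` of `rangeSize`.
      have h1 : σ + 2 ^ (l + 1) ≤ 6 * ((X.card + 1) * Λ) := by
        have : X.card * (l + 1) ≤ X.card * (Λ + 1) := Nat.mul_le_mul_left _ (by omega)
        rw [pow_succ]
        nlinarith
      have h3 : 2 ^ (l + 1) ≤ 4 * (10 ^ (m + 1) * ((X.card + 1) * Λ ^ (m + 1))) := by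
        have h4 : 1 * ((X.card + 1) * 1) ≤ 10 ^ (m + 1) * ((X.card + 1) * Λ ^ (m + 1)) := by
          gcongr
          · exact Nat.one_le_pow _ _ (by omega)
          · exact Nat.one_le_pow _ _ (by omega)
        rw [pow_succ]
        omega
      calc 2 ^ (l + 1) + 10 ^ (m + 1) * ((σ + 2 ^ (l + 1)) * Λ ^ m)
          ≤ 4 * (10 ^ (m + 1) * ((X.card + 1) * Λ ^ (m + 1))) +
            10 ^ (m + 1) * (6 * ((X.card + 1) * Λ) * Λ ^ m) := by gcongr
        _ = 10 ^ (m + 1 + 1) * ((X.card + 1) * Λ ^ (m + 1)) := by ring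

end Build

/-! ## The tree of a point set -/

section PointSet

variable {d : ℕ}

theorem zkey_comp {α β : Type} {Y : ℕ → α → ℝ} {g : β → α} (m : ℕ) (p : β) :
    zkey d (fun a p => Y a (g p)) m p = zkey d Y m (g p) := by
  induction m with
  | zero => rfl
  | succ m ih => rw [zkey, zkey, ih]; rfl

/-- The points of a block of the grid between points of a cell are in the cell. -/
theorem zkey_convex {α : Type} {Y : ℕ → α → ℝ} (hd : 0 < d) {m c : ℕ} {p : α}
    (hp : InCube d Y p) (h : ∀ a < d, ∃ q q', InCube d Y q ∧ InCube d Y q' ∧ zkey d Y m q = c ∧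
      zkey d Y m q' = c ∧ Y a q ≤ Y a p ∧ Y a p ≤ Y a q') : zkey d Y m p = c := by
  obtain ⟨q₀, -, hq₀, -, hc₀, -⟩ := h 0 hd
  rw [← hc₀, zkey_eq_iff hd hp hq₀]
  intro μ hμ
  obtain ⟨q, q', hq, hq', hc, hc', h1, h2⟩ := h (μ % d) (Nat.mod_lt _ hd)
  have e1 := (zkey_eq_iff hd hq hq₀ m).1 (hc.trans hc₀.symm) μ hμ
  have e2 := (zkey_eq_iff hd hq' hq₀ m).1 (hc'.trans hc₀.symm) μ hμ
  have f1 : zfloor d Y μ q ≤ zfloor d Y μ p := by unfold zfloor; gcongr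
  have f2 : zfloor d Y μ p ≤ zfloor d Y μ q' := by unfold zfloor; gcongr
  omega

/-- The gaps between consecutive points can be numbered such that one gets the tree of the keys. -/
theorem exists_keyTree {n M : ℕ} {key : ℕ → ℕ → ℕ} (two_le : 2 ≤ n) (zero : ∀ p, key 0 p = 0)
    (half : ∀ m p, key (m + 1) p / 2 = key m p)
    (mono : ∀ m ≤ M, ∀ p q, 1 ≤ p → p ≤ q → q ≤ n → key m p ≤ key m q)
    (inj : ∀ p q, 1 ≤ p → p ≤ n → 1 ≤ q → q ≤ n → key M p = key M q → p = q) :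
    ∃ gap gid, KeyTree n M key gap gid ∧ ∀ i < n, gap i ≤ n := by
  -- The gaps sorted by common prefix length; ranks start at `0` and node numbers at `1`.
  obtain ⟨e, rk, h1, h2, h3⟩ := exists_sorted (Finset.Ico 1 n) (lam key M)
  rw [Nat.card_Ico] at h1 h2 h3
  have hgap : ∀ i < n, e (i - 1) ∈ Finset.Ico 1 n ∧ rk (e (i - 1)) = i - 1 := fun i hi =>
    h1 (i - 1) (by omega)
  refine ⟨fun i => e (i - 1), fun g => rk g + 1, ⟨two_le, zero, half, mono, inj, fun i h hn => ?_,
    fun g h hn => ?_, fun g h hn => ?_, fun i h hn => ?_, fun i j h hij hn => ?_⟩, fun i hi => ?_⟩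
  · exact Finset.mem_Ico.1 (hgap i hn).1
  · have := (h2 g (Finset.mem_Ico.2 ⟨h, hn⟩)).1
    omega
  · exact (h2 g (Finset.mem_Ico.2 ⟨h, hn⟩)).2
  · have := (hgap i hn).2
    omega
  · exact h3 (i - 1) (j - 1) (by omega) (by omega)
  · exact (Finset.mem_Ico.1 (hgap i hi).1).2.le

/-- What the construction of the static part needs to know about a layout. -/
structure Layout.Bounded (l : Layout d) : Prop where
  two_le : 2 ≤ l.n
  width : l.L = Nat.log 2 l.n + 2
  left : ∀ i, l.lc i ≤ 2 ^ l.L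
  right : ∀ i, l.rc i ≤ 2 ^ l.L
  rep : ∀ i < 2 ^ l.L, l.rp i ≤ 2 ^ l.L

/-- The width must exceed all node numbers, which are below `2 * n`, and still be linear in `n`. -/
theorem lt_two_pow_log {n : ℕ} (hn : 1 ≤ n) :
    2 * n < 2 ^ (Nat.log 2 n + 2) ∧ 2 ^ (Nat.log 2 n + 2) ≤ 4 * n := by
  have h1 := Nat.lt_pow_succ_log_self (b := 2) (by omega) n
  have h2 := Nat.pow_log_le_self 2 (show n ≠ 0 by omega)
  rw [pow_succ] at h1
  rw [pow_add]
  omega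

/-- Coordinates for all axis numbers. -/
def axisCoord (p : Pt d) (a : ℕ) : ℝ := if h : a < d then p ⟨a, h⟩ else 0

/-- Every point set has a layout. The contents of the memory are still missing. -/
theorem exists_geometric (hd : 2 ≤ d) {S : Finset (Pt d)} (hS : 2 ≤ S.card) (c : ℝ) (f : ℕ → ℝ) :
    ∃ (l : Layout d) (W : ℝ) (o : ℕ → ℝ) (M : ℕ) (Y : ℕ → ℕ → ℝ) (gap gid : ℕ → ℕ),
      l.Geometric W o M Y gap gid ∧ l.Bounded ∧ l.n = S.card ∧
        (Finset.Icc 1 l.n).image l.pt = S ∧ l.fk = f ∧ l.cc = c := by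
  have hd0 : 0 < d := by omega
  -- All coordinates are strictly between `-B` and `B`, so translation by `B` and division by `2 *
  -- B` lead into the half-open unit cube.
  set B : ℝ := 1 + ∑ p ∈ S, ‖p‖ with hB
  have hB0 : 0 < B := by
    have : 0 ≤ ∑ p ∈ S, ‖p‖ := Finset.sum_nonneg fun p _ => norm_nonneg p
    linarith
  set yp : ℕ → Pt d → ℝ := fun a p => (axisCoord p a - -B) / (2 * B) with hyp
  have hcube : ∀ p ∈ S, InCube d yp p := by
    intro p hp a ha
    have h1 : ‖p‖ ≤ ∑ p ∈ S, ‖p‖ := Finset.single_le_sum (fun p _ => norm_nonneg p) hp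
    have h2 := PiLp.norm_apply_le p ⟨a, ha⟩
    rw [Real.norm_eq_abs, abs_le] at h2
    have h3 : axisCoord p a = p ⟨a, ha⟩ := dif_pos ha
    constructor
    · refine div_nonneg ?_ (by positivity)
      rw [h3]
      linarith
    · rw [div_lt_one (by positivity), h3]
      linarith
  have hsep : ∀ p ∈ S, ∀ q ∈ S, (∀ a < d, yp a p = yp a q) → p = q := by
    intro p _ q _ h
    ext i
    have := h i i.2
    simp only [hyp] at this
    rw [div_left_inj' (by positivity), sub_left_inj, axisCoord, axisCoord, dif_pos i.2,
      dif_pos i.2] at this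
    exact this
  -- The first `M` bits tell all points apart. The points are numbered from `1` in the order of
  -- these keys, hence `e (p - 1)`.
  obtain ⟨M, hM⟩ := exists_zkey_injOn hd0 S hcube hsep
  obtain ⟨e, rk, h1, h2, h3⟩ := exists_sorted S (zkey d yp M)
  set n := S.card with hn
  set Y : ℕ → ℕ → ℝ := fun a p => yp a (e (p - 1)) with hY
  have hkey : ∀ m p, zkey d Y m p = zkey d yp m (e (p - 1)) := fun m p =>
    zkey_comp (Y := yp) (g := fun p => e (p - 1)) m p
  have hmem : ∀ p, 1 ≤ p → p ≤ n → e (p - 1) ∈ S ∧ rk (e (p - 1)) = p - 1 := fun p _ _ =>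
    h1 (p - 1) (by omega)
  have hYc : ∀ p, 1 ≤ p → p ≤ n → InCube d Y p := fun p hp hp' => hcube _ (hmem p hp hp').1
  obtain ⟨gap, gid, htree, hgap⟩ := exists_keyTree (n := n) (M := M) (key := zkey d Y) hS
    (fun _ => rfl) zkey_half
    (fun m hm p q hp hpq hq => by
      rw [hkey, hkey]
      exact zkey_le_of_le hm (h3 (p - 1) (q - 1) (by omega) (by omega)))
    (fun p q hp hp' hq hq' h => by
      rw [hkey, hkey] at h
      have h4 := hM _ (hmem p hp hp').1 _ (hmem q hq hq').1 h
      have h5 := (hmem p hp hp').2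
      have h6 := (hmem q hq hq').2
      rw [h4] at h5
      omega)
  set L := Nat.log 2 n + 2 with hL
  obtain ⟨hw1, hw2⟩ := lt_two_pow_log (show 1 ≤ n by omega)
  rw [← hL] at hw1 hw2
  set co : ℕ → ℕ → ℝ := fun a p => axisCoord (e (p - 1)) a with hco
  set nd := cell n M (zkey d Y) gap with hnd
  set l : Layout d :=
    { n := n, L := L, E := 0, Λ := L
      lc := fun i => lcaSeq n (2 ^ L) gid (KeyTree.first n M (zkey d Y) gap i) (gap i)
      rc := fun i => lcaSeq n (2 ^ L) gid (gap i + 1) (KeyTree.last n M (zkey d Y) gap i)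
      rp := anchor n gap
      sq := nodeSeq n (2 ^ L) gid
      bl := fun a i => sInf ((nd i).image (co a) : Set ℝ)
      bh := fun a i => sSup ((nd i).image (co a) : Set ℝ)
      sz := fun i => if i < n then d * (2 * B) / 2 ^ (level n M (zkey d Y) gap i / d) else 0
      co := co, fk := f, cc := c, nm := fun _ => 0, rm := fun _ => 0 } with hl
  have hfold : ∀ u v, lcaSeq n (2 ^ L) gid u v ≤ 2 ^ L := fun u v => by
    rw [lcaSeq, Finset.fold_min_le]
    exact Or.inl le_rfl
  refine ⟨l, 2 * B, fun _ => -B, M, Y, gap, gid,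
    { tree := htree, lt_width := hw1, sq := rfl, lc := fun _ => rfl, rc := fun _ => rfl
      rp := fun _ => rfl, bl := fun _ _ => rfl, bh := fun _ _ => rfl
      convex := fun m c p hp hp' hc => ?_
      pos := by positivity
      cube := hYc
      coord := fun _ _ _ _ _ => rfl
      inner_size := fun i _ hi => if_pos hi
      leaf_size := fun i hi _ => if_neg (not_lt.2 hi) },
    ⟨hS, rfl, fun i => hfold _ _, fun i => hfold _ _, fun i hi => ?_⟩, rfl, ?_, rfl,
    rfl⟩
  · refine zkey_convex hd0 (hYc p hp hp') fun a ha => ?_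
    obtain ⟨q, q', hq, hq', hk, hk', hle, hle'⟩ := hc a ha
    refine ⟨q, q', hYc q hq.1 hq.2, hYc q' hq'.1 hq'.2, hk, hk', ?_, ?_⟩
    · simp only [hY, hyp]
      gcongr
    · simp only [hY, hyp]
      gcongr
  · show anchor n gap i ≤ 2 ^ L
    rw [anchor]
    split_ifs with hin
    · have := hgap i hin
      omega
    · have : i < 2 ^ L := hi
      omega
  · have hpt : ∀ p, l.pt p = e (p - 1) := fun p => by
      ext i
      exact dif_pos i.2
    ext x
    rw [Finset.mem_image]
    constructor
    · rintro ⟨p, hp, rfl⟩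
      rw [Finset.mem_Icc] at hp
      rw [hpt]
      exact (hmem p hp.1 hp.2).1
    · intro hx
      obtain ⟨a1, a2⟩ := h2 x hx
      refine ⟨rk x + 1, Finset.mem_Icc.2 ⟨by omega, a1⟩, ?_⟩
      rw [hpt]
      exact a2

end PointSet

/-! ## The contents of the memory -/

section Memory

variable {d : ℕ}

/-- The number of points in the `v`-th subtree of a box structure. -/
def subtreeCard (n L v : ℕ) : ℕ := (blk L v ∩ Finset.Icc 1 n).card

/-- The offset of the `v`-th subtree of a box structure. -/
def subtreeOffset (d n L v : ℕ) : ℕ :=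
  ∑ u ∈ Finset.range v, rangeSize L (d - 2) (subtreeCard n L u)

/-- The number of memory cells of the data structure. -/
def layoutSize (d n L : ℕ) : ℕ := numFields d * 2 ^ L + 2 * d * subtreeOffset d n L (2 ^ (L + 1))

/-- The index `i` is at leaf `i + 1`, so shifting by one maps the points of subtree `v` injectively
into the leaves counted by `subtreeCard`. -/
theorem boxTrees_buildable {co : ℕ → ℕ → ℝ} {e rk : ℕ → ℕ} {n L : ℕ} (hn : 1 ≤ n)
    (hL : L = Nat.log 2 n + 2) (h1 : ∀ i < n, e i ∈ Finset.Icc 1 n ∧ rk (e i) = i) :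
    Buildable (2 ^ L) (fun nm rm a => ∀ v < 2 ^ (L + 1),
      RangeTree co (fun p => if v % 2 = 0 then rk p + 1 else 2 ^ L - (rk p + 1)) L nm rm (d - 2)
        (((Finset.range n).filter fun i => i + 1 ∈ blk L v).image e) (a + subtreeOffset d n L v))
      (subtreeOffset d n L (2 ^ (L + 1))) := by
  have hw := (lt_two_pow_log hn).1
  rw [← hL] at hw
  refine Buildable.pi fun v _ => ?_
  have hc : (((Finset.range n).filter fun i => i + 1 ∈ blk L v).image e).card ≤
      subtreeCard n L v := by
    refine Finset.card_image_le.trans (Finset.card_le_card_of_injOn (fun i => i + 1) ?_ ?_)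
    · intro i hi
      simp only [Finset.coe_filter, Finset.mem_range, Set.mem_ofPred_eq] at hi
      simp only [Finset.coe_inter, Set.mem_inter_iff, Finset.mem_coe, Finset.mem_Icc]
      exact ⟨hi.2, by omega, by omega⟩
    · intro i _ j _ h
      simpa using h
  have hn' : subtreeCard n L v ≤ n := by
    refine (Finset.card_le_card Finset.inter_subset_right).trans ?_
    simp
  refine Buildable.mono (rangeTree_buildable (by omega) le_rfl (d - 2) _ ?_ fun p hp => ?_) ?_
  · have := Nat.log_mono_right (b := 2) (hc.trans hn')
    omega
  · obtain ⟨i, hi, rfl⟩ := Finset.mem_image.1 hp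
    have hin := Finset.mem_range.1 (Finset.mem_filter.1 hi).1
    obtain ⟨a1, a2⟩ := h1 i hin
    rw [Finset.mem_Icc] at a1
    rw [a2]
    split_ifs <;> omega
  · unfold rangeSize
    gcongr

/-- The words of the static part: here `adr` are the addresses of the box structures. -/
def natField (l : Layout d) (E : ℕ) (adr : ℕ → ℕ) (x : ℕ) : ℕ :=
  if x = 0 then 2 ^ l.L else if x < 2 ^ l.L then l.lc x
  else if x = 2 ^ l.L then E else if x < 2 * 2 ^ l.L then l.rc (x - 2 ^ l.L)
  else if x = 2 * 2 ^ l.L then l.n else if x < 3 * 2 ^ l.L then l.rp (x - 2 * 2 ^ l.L)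
  else if x < 7 * 2 ^ l.L then (blk (l.L + 1) (x - 3 * 2 ^ l.L)).fold min (2 ^ l.L) l.sq
  else if (x - 7 * 2 ^ l.L) / 2 ^ (l.L + 1) < 2 * d then
    adr ((x - 7 * 2 ^ l.L) / 2 ^ (l.L + 1)) +
      subtreeOffset d l.n l.L ((x - 7 * 2 ^ l.L) % 2 ^ (l.L + 1))
  else 0

/-- Entry `i` of field number `φ` of the real numbers of the static part. -/
def realField (l : Layout d) (e : ℕ → ℕ → ℕ) (φ i : ℕ) : ℝ :=
  if φ < d then (if φ = 0 ∧ i = 0 then l.cc else l.bl φ i)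
  else if φ < 2 * d then l.bh (φ - d) i
  else if φ = 2 * d then l.sz i
  else if φ < 3 * d + 1 then l.co (φ - (2 * d + 1)) i
  else if φ = 3 * d + 1 then l.fk i
  else copyCo l.co (φ - (3 * d + 2)) 0 (e (φ - (3 * d + 2)) i)

theorem subtreeOffset_mono {n L u v : ℕ} (h : u ≤ v) :
    subtreeOffset d n L u ≤ subtreeOffset d n L v :=
  Finset.sum_le_sum_of_subset (Finset.range_mono h)

/-- Node numbers and representatives are at most the width, and addresses of subtrees stay below the
end of the memory. This yields words of `O(log n)` bits. -/
theorem natField_le {l : Layout d} (hb : l.Bounded) {E T : ℕ} {adr : ℕ → ℕ} (hE : E ≤ T)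
    (hadr : ∀ j < 2 * d, adr j + subtreeOffset d l.n l.L (2 ^ (l.L + 1)) ≤ T) (x : ℕ) :
    natField l E adr x ≤ 2 ^ l.L + T := by
  have hw := (lt_two_pow_log (show 1 ≤ l.n by have := hb.two_le; omega)).1
  rw [← hb.width] at hw
  unfold natField
  split_ifs
  · omega
  · have := hb.left x
    omega
  · omega
  · have := hb.right (x - 2 ^ l.L)
    omega
  · omega
  · have := hb.rep (x - 2 * 2 ^ l.L) (by omega)
    omega
  · exact ((Finset.fold_min_le _).2 (Or.inl le_rfl)).trans (Nat.le_add_right _ _)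
  · rename_i hj
    have h1 := hadr _ hj
    have h2 := subtreeOffset_mono (d := d) (n := l.n) (L := l.L)
      (Nat.mod_lt (x - 7 * 2 ^ l.L) (Nat.two_pow_pos (l.L + 1))).le
    omega
  · omega

/-- The layout with the given contents of the memory below the address `E`. -/
def Layout.withMemory (l : Layout d) (E : ℕ) (gn : ℕ → ℕ) (gr : ℕ → ℝ) : Layout d :=
  { l with E := E, Λ := l.L, nm := gn, rm := gr }

/-- The memory of a layout can be filled. -/
theorem exists_memory (hd : 2 ≤ d) {l : Layout d} (hb : l.Bounded) :
    ∃ (gn : ℕ → ℕ) (gr : ℕ → ℝ), (∀ i, gn i ≤ 2 ^ l.L + layoutSize d l.n l.L) ∧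
      (l.withMemory (layoutSize d l.n l.L) gn gr).Valid := by
  have hn1 : 1 ≤ l.n := by have := hb.two_le; omega
  obtain ⟨hw1, hw2⟩ := lt_two_pow_log hn1
  rw [← hb.width] at hw1 hw2
  have hsort := fun j => exists_sorted (Finset.Icc 1 l.n) (copyCo l.co j 0)
  choose e rk h1 h2 h3 using hsort
  simp only [Nat.card_Icc, Nat.add_sub_cancel] at h1 h2 h3
  set E := layoutSize d l.n l.L with hE
  have hsum : ∑ _j ∈ Finset.range (2 * d), subtreeOffset d l.n l.L (2 ^ (l.L + 1)) =
      2 * d * subtreeOffset d l.n l.L (2 ^ (l.L + 1)) := by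
    rw [Finset.sum_const, Finset.card_range, smul_eq_mul]
  -- The static part uses absolute addresses and is placed at address `0` only, whereas
  -- `Buildable.block` speaks of all base addresses; this explains the premise `a = 0`.
  have hbuild := Buildable.block (V := 2 ^ l.L) (s₀ := numFields d * 2 ^ l.L) (N := 2 * d)
    (R := fun nm rm a => a = 0 → (l.withMemory E nm rm).Stored nm rm)
    (fun j _ => boxTrees_buildable (d := d) (co := copyCo l.co j) hn1 hb.width (h1 j))
    (natField l E) (fun x => realField l e (x / 2 ^ l.L) (x % 2 ^ l.L))
    (fun adr T hadr hT x _ => natField_le hb (by rw [hsum] at hT; exact hT) hadr x) ?_ 0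
  · rw [hsum] at hbuild
    obtain ⟨gn, gr, hg, hst⟩ := hbuild
    refine ⟨gn, gr, fun i => (hg i).trans (by rw [zero_add]; exact le_rfl), hb.two_le, hw1,
      fun nm rm hnm hrm => ?_⟩
    have hs := hst nm rm (fun i _ hi => by
      rw [zero_add] at hi
      exact ⟨hnm i hi, hrm i hi⟩) rfl
    exact ⟨hs.width, hs.free, hs.size, hs.left, hs.right, hs.rep, hs.seq, hs.boxLo, hs.boxHi,
      hs.nodeSize, hs.coord, hs.factor, hs.const, hs.copies⟩
  · rintro nm rm base adr hm htr rfl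
    simp only [zero_add] at hm
    set H := 2 ^ l.L with hH
    clear_value H
    have hH2 : 2 ^ (l.L + 1) = 2 * H := by rw [pow_succ, mul_comm, hH]
    have hH4 : 2 ^ (l.L + 1 + 1) = 4 * H := by rw [pow_succ, hH2]; ring
    have hreal : ∀ φ < numFields d, ∀ i < H, rm (φ * H + i) = realField l e φ i := by
      intro φ hφ i hi
      have hx : φ * H + i < numFields d * H := by nlinarith
      rw [(hm _ hx).2, mul_comm, Nat.mul_add_div (by omega), Nat.div_eq_of_lt hi, Nat.mul_add_mod,
        Nat.mod_eq_of_lt hi, add_zero]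
    have hnat : ∀ x < (4 * d + 7) * H, nm x = natField l E adr x := by
      intro x hx
      refine (hm x (hx.trans_le (Nat.mul_le_mul_right _ ?_))).1
      simp only [numFields]
      omega
    have h7 : ∀ x < 7 * H, nm x = natField l E adr x := fun x hx =>
      hnat x (hx.trans_le (Nat.mul_le_mul_right _ (by omega)))
    refine ⟨?_, ?_, ?_, fun i hi1 hi2 => ?_, fun i hi1 hi2 => ?_, fun i hi1 hi2 => ?_,
      fun v hv1 hv2 => ?_, fun a ha i hi1 hi2 => ?_, fun a ha i hi1 hi2 => ?_, fun i hi1 hi2 => ?_,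
      fun a ha p hp1 hp2 => ?_, fun k hk => ?_, ?_, fun j hj => ?_⟩
    all_goals dsimp only [Layout.withMemory]
    · rw [h7 0 (by omega), natField, if_pos rfl]
    · rw [← hH, h7 _ (by omega), natField]
      simp only [← hH]
      rw [if_neg (by omega), if_neg (by omega), if_pos (by omega)]
    · rw [← hH, h7 _ (by omega), natField]
      simp only [← hH]
      rw [if_neg (by omega), if_neg (by omega), if_neg (by omega), if_neg (by omega),
        if_pos trivial]
    · dsimp only [Layout.withMemory] at hi2
      rw [← hH, h7 _ (by omega), natField]
      simp only [← hH]
      rw [if_neg (by omega), if_pos (by omega), zero_mul, zero_add]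
    · dsimp only [Layout.withMemory] at hi2
      rw [← hH, h7 _ (by omega), natField]
      simp only [← hH]
      rw [if_neg (by omega), if_neg (by omega), if_neg (by omega), if_pos (by omega), one_mul,
        Nat.add_sub_cancel_left]
    · dsimp only [Layout.withMemory] at hi2
      rw [← hH, h7 _ (by omega), natField]
      simp only [← hH]
      rw [if_neg (by omega), if_neg (by omega), if_neg (by omega), if_neg (by omega),
        if_neg (by omega), if_pos (by omega), Nat.add_sub_cancel_left]
    · dsimp only [Layout.withMemory] at hv2
      rw [hH4] at hv2
      rw [← hH, h7 _ (by omega), natField]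
      simp only [← hH]
      rw [if_neg (by omega), if_neg (by omega), if_neg (by omega), if_neg (by omega),
        if_neg (by omega), if_neg (by omega), if_pos (by omega), Nat.add_sub_cancel_left]
    · dsimp only [Layout.withMemory] at hi2
      rw [← hH, hreal _ (by simp only [numFields]; omega) _ (by omega), realField, if_pos ha,
        if_neg (by omega)]
    · dsimp only [Layout.withMemory] at hi2
      rw [← hH, hreal _ (by simp only [numFields]; omega) _ (by omega), realField,
        if_neg (by omega), if_pos (by omega), Nat.add_sub_cancel_left]
    · dsimp only [Layout.withMemory] at hi2
      rw [← hH, hreal _ (by simp only [numFields]; omega) _ (by omega), realField,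
        if_neg (by omega), if_neg (by omega), if_pos rfl]
    · dsimp only [Layout.withMemory] at hp2
      rw [← hH, hreal _ (by simp only [numFields]; omega) _ (by omega), realField,
        if_neg (by omega), if_neg (by omega), if_neg (by omega), if_pos (by omega),
        Nat.add_sub_cancel_left]
    · dsimp only [Layout.withMemory] at hk
      rw [← hH, hreal _ (by simp only [numFields]; omega) _ (by omega), realField,
        if_neg (by omega), if_neg (by omega), if_neg (by omega), if_neg (by omega), if_pos rfl]
    · have := hreal 0 (by simp only [numFields]; omega) 0 (by omega)
      rw [zero_mul, zero_add, realField, if_pos (by omega), if_pos ⟨rfl, rfl⟩] at this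
      exact this
    · refine ⟨e j, fun p => rk j p + 1, ?_, fun i hi => ?_, fun i hi => ?_, h3 j,
        fun v hv1 hv2 => ?_⟩
      · ext p
        rw [Finset.mem_image]
        constructor
        · rintro ⟨i, hi, rfl⟩
          exact (h1 j i (Finset.mem_range.1 hi)).1
        · intro hp
          exact ⟨rk j p, Finset.mem_range.2 (h2 j p hp).1, (h2 j p hp).2⟩
      · rw [(h1 j i hi).2]
      · rw [← hH, hreal _ (by simp only [numFields]; omega) _ (by omega), realField,
          if_neg (by omega), if_neg (by omega), if_neg (by omega), if_neg (by omega),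
          if_neg (by omega), Nat.add_sub_cancel_left]
      · have hv3 := hv2
        rw [hH2] at hv3
        -- The `j`-th pointer array occupies two widths from field `7 + 2 * j` on, so division by `2
        -- ^ (L + 1)` with remainder recovers `j` and `v`.
        have e1 : (7 + 2 * j) * H + v - 7 * H = 2 * H * j + v := by
          have : (7 + 2 * j) * H + v = 7 * H + (2 * H * j + v) := by ring
          omega
        have hx : (7 + 2 * j) * H + v < (4 * d + 7) * H := by
          have : (7 + 2 * j + 2) * H ≤ (4 * d + 7) * H := Nat.mul_le_mul_right _ (by omega)
          have : (7 + 2 * j + 2) * H = (7 + 2 * j) * H + 2 * H := by ring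
          omega
        have h7x : 7 * H ≤ (7 + 2 * j) * H := Nat.mul_le_mul_right _ (by omega)
        have := htr j hj v hv2
        rw [← hH, hnat _ hx, natField]
        simp only [← hH, hH2]
        rw [if_neg (by omega), if_neg (by omega), if_neg (by omega), if_neg (by omega),
          if_neg (by omega), if_neg (by omega), if_neg (by omega), e1,
          Nat.mul_add_div (by omega), Nat.div_eq_of_lt hv3, add_zero, if_pos hj, Nat.mul_add_mod,
          Nat.mod_eq_of_lt hv3]
        exact this

end Memory

/-! ## Asymptotic bounds -/

section Bounds

variable {d : ℕ}

/-- Each further coordinate multiplies the time by twice the height of its tree; the binary searches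
are of lower order. The base `100` absorbs all constants. -/
theorem rangeTime_le {L : ℕ} (hL : 1 ≤ L) (m : ℕ) : rangeTime L m ≤ 100 ^ (m + 1) * L ^ (m + 1) := by
  induction m with
  | zero =>
    simp only [rangeTime, zero_add, pow_one]
    omega
  | succ m ih =>
    simp only [rangeTime, canonicalTime, bsearchTime]
    set c := 100 ^ (m + 1) * L ^ (m + 1) with hc
    have hc1 : 1 ≤ c := Nat.mul_pos (by positivity) (by positivity)
    have h1 : L * (2 * (rangeTime L m + 3) + 20) ≤ L * (2 * (c + 3) + 20) := by gcongr
    have h2 : 100 ^ (m + 1 + 1) * L ^ (m + 1 + 1) = 100 * (L * c) := by rw [hc]; ring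
    rw [h2]
    nlinarith

/-- Range searching on `d - 1` coordinates dominates; since `L ≤ L ^ (d - 1)` for `d ≥ 2`, the
linear terms are absorbed. -/
theorem crossTime_le (hd : 2 ≤ d) : ∃ C, ∀ L, 1 ≤ L → crossTime d L L ≤ C * L ^ (d - 1) := by
  refine ⟨2 * d * (2 * 100 ^ (d - 1) + 72 + d * 3 + 10) + 103, fun L hL => ?_⟩
  have h1 := rangeTime_le hL (d - 2)
  rw [show d - 2 + 1 = d - 1 by omega] at h1
  have h2 : L ≤ L ^ (d - 1) := Nat.le_self_pow (by omega) L
  simp only [crossTime, boxTime, bsearchTime, lcaTime, canonicalTime]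
  set P := L ^ (d - 1)
  set c := 100 ^ (d - 1)
  have h3 : 2 * (9 * L + 4) + 6 * L + 2 * rangeTime L (d - 2) + 40 + d * 3 + 10 ≤
      (2 * c + 72 + d * 3 + 10) * P := by
    have h4 : d * 3 ≤ d * 3 * P := Nat.le_mul_of_pos_right _ (by omega)
    have h5 : (2 * c + 72 + d * 3 + 10) * P = 2 * (c * P) + 72 * P + d * 3 * P + 10 * P := by ring
    omega
  have h6 := Nat.mul_le_mul_left (2 * d) h3
  have h7 : (2 * d * (2 * c + 72 + d * 3 + 10) + 103) * P =
      2 * d * ((2 * c + 72 + d * 3 + 10) * P) + 103 * P := by ring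
  rw [h7]
  omega

/-- Each of the `lim` rounds examines two nodes, possibly both with range searches, besides queue
operations of time linear in `L`. -/
theorem coarsePhaseTime_le (hd : 2 ≤ d) : ∃ C, ∀ L lim, 1 ≤ L → 1 ≤ lim →
    coarsePhaseTime d L L lim ≤ C * (lim * L ^ (d - 1)) := by
  obtain ⟨C, hC⟩ := crossTime_le hd
  refine ⟨initTime d + insideTime d + C + 34 + (2 * insideTime d + 18 + 2 * C + 112 + 1) + 27 + 2,
    fun L lim hL hlim => ?_⟩
  have h1 := hC L hL
  have h2 : L ≤ L ^ (d - 1) := Nat.le_self_pow (by omega) L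
  simp only [coarsePhaseTime, rootTime, coarseTime, refineTime, Bool.false_eq_true, if_false]
  set P := L ^ (d - 1)
  have hP : 1 ≤ P := by omega
  have hQ : P ≤ lim * P := Nat.le_mul_of_pos_left _ hlim
  have h3 : 2 * insideTime d + 18 + 2 * crossTime d L L + (L + 1) * 26 + 60 + 1 ≤
      (2 * insideTime d + 18 + 2 * C + 112 + 1) * P := by
    have h4 : insideTime d ≤ insideTime d * P := Nat.le_mul_of_pos_right _ hP
    have h5 : (2 * insideTime d + 18 + 2 * C + 112 + 1) * P =
      2 * (insideTime d * P) + 18 * P + 2 * (C * P) + 113 * P := by ring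
    omega
  have h6 := Nat.mul_le_mul_left lim h3
  have h7 : lim * (L * 12 + 15) ≤ 27 * (lim * P) := by
    calc lim * (L * 12 + 15) ≤ lim * (27 * P) := Nat.mul_le_mul_left _ (by omega)
      _ = _ := by ring
  have h8 : initTime d + (insideTime d + crossTime d L L + (L + 1) * 7 + 20) + 2 ≤
      (initTime d + insideTime d + C + 34 + 2) * P := by
    have h4 : insideTime d ≤ insideTime d * P := Nat.le_mul_of_pos_right _ hP
    have h4' : initTime d ≤ initTime d * P := Nat.le_mul_of_pos_right _ hP
    have h5 : (initTime d + insideTime d + C + 34 + 2) * P =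
      initTime d * P + insideTime d * P + C * P + 36 * P := by ring
    omega
  have h9 := Nat.mul_le_mul_left (initTime d + insideTime d + C + 34 + 2) hQ
  calc _ ≤ (initTime d + insideTime d + C + 34 + 2) * (lim * P) +
        lim * ((2 * insideTime d + 18 + 2 * C + 112 + 1) * P) + 27 * (lim * P) := by omega
    _ = _ := by ring

/-- Each of the `2 * d` box structures repeats every point in at most `L + 1` range trees, each with
a factor `L ^ (d - 2)`. -/
theorem layoutSize_le (hd : 2 ≤ d) : ∃ C, ∀ n L, 1 ≤ n → L = Nat.log 2 n + 2 →
    2 ^ L + layoutSize d n L ≤ C * (n * L ^ (d - 1)) := by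
  refine ⟨4 + numFields d * 4 + 2 * d * (10 ^ (d - 1) * 13), fun n L hn hL => ?_⟩
  have hw := (lt_two_pow_log hn).2
  rw [← hL] at hw
  have hP : 1 ≤ L ^ (d - 1) := Nat.one_le_pow _ _ (by omega)
  have hsum : subtreeOffset d n L (2 ^ (L + 1)) ≤ 10 ^ (d - 1) * (13 * (n * L ^ (d - 1))) := by
    simp only [subtreeOffset, rangeSize]
    rw [← Finset.mul_sum, ← Finset.sum_mul, Finset.sum_add_distrib, Finset.sum_const,
      Finset.card_range, smul_eq_mul, mul_one, show d - 2 + 1 = d - 1 by omega]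
    have h1 : ∑ v ∈ Finset.range (2 ^ (L + 1)), subtreeCard n L v ≤ n * (L + 1) := by
      have := sum_range_card_inter_blk_le L (Finset.Icc 1 n)
      rwa [Nat.card_Icc, Nat.add_sub_cancel] at this
    have h2 : ∑ v ∈ Finset.range (2 ^ (L + 1)), subtreeCard n L v + 2 ^ (L + 1) ≤
        13 * (n * L) := by
      have h5 : 2 ^ (L + 1) = 2 * 2 ^ L := by ring
      have h6 : n ≤ n * L := Nat.le_mul_of_pos_right _ (by omega)
      have h7 : n * (L + 1) = n * L + n := by ring
      omega
    have h3 : 13 * (n * L ^ (d - 1)) = 13 * (n * L) * L ^ (d - 2) := by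
      rw [show d - 1 = d - 2 + 1 by omega, pow_succ]
      ring
    rw [h3]
    gcongr
  have h4 : 2 ^ L ≤ 4 * (n * L ^ (d - 1)) := by nlinarith
  rw [layoutSize]
  calc 2 ^ L + (numFields d * 2 ^ L + 2 * d * subtreeOffset d n L (2 ^ (L + 1)))
      ≤ 4 * (n * L ^ (d - 1)) + (numFields d * (4 * (n * L ^ (d - 1))) +
        2 * d * (10 ^ (d - 1) * (13 * (n * L ^ (d - 1))))) := by gcongr
    _ = _ := by ring

/-- For `n ≥ 2` the additive constant is absorbed by `Real.log n ≥ Real.log 2`. -/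
theorem width_le_log {n : ℕ} (hn : 2 ≤ n) : ((Nat.log 2 n + 2 : ℕ) : ℝ) ≤ 5 * Real.log n := by
  have h2 := Real.log_two_gt_d9
  have hn0 : (0 : ℝ) < n := by positivity
  have h3 : Real.log 2 ≤ Real.log n := Real.log_le_log two_pos (by exact_mod_cast hn)
  have h4 : (Nat.log 2 n : ℝ) * Real.log 2 ≤ Real.log n := by
    rw [← Real.log_pow]
    refine Real.log_le_log (by positivity) ?_
    exact_mod_cast Nat.pow_log_le_self 2 (show n ≠ 0 by omega)
  push_cast
  nlinarith [Nat.cast_nonneg (α := ℝ) (Nat.log 2 n)]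

/-- The additive one of the limit is absorbed by doubling `2 ^ d * k`. -/
theorem refinedBound_le {k : ℕ} (hk : 1 ≤ k) {x : ℝ} (hx : 0 ≤ x) :
    refinedBound d k x ≤ (2 ^ (d + 1) * (d * (2 * (4 * d) ^ d)) : ℕ) * (k * x ^ d) := by
  have h1 : ((2 ^ d * k + 1 : ℕ) : ℝ) ≤ (2 ^ (d + 1) * k : ℕ) := by
    have := Nat.mul_pos (Nat.two_pow_pos d) hk
    exact_mod_cast (show 2 ^ d * k + 1 ≤ 2 ^ (d + 1) * k by rw [pow_succ]; nlinarith)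
  calc refinedBound d k x ≤ (2 ^ (d + 1) * k : ℕ) * (d * (2 * (2 * (2 * d * x)) ^ d)) := by
        unfold refinedBound; gcongr
    _ = _ := by
        rw [show 2 * (2 * (d : ℝ) * x) = 4 * d * x by ring, mul_pow]
        push_cast
        ring

theorem crossingBound_le {k : ℕ} (hk : 1 ≤ k) {x : ℝ} (hx : 0 ≤ x) :
    crossingBound d k x ≤
      (2 ^ (d + 1) * (2 * d * (d * (2 * (4 * d) ^ (d - 1)))) : ℕ) * (k * x ^ (d - 1)) := by
  have h1 : ((2 ^ d * k + 1 : ℕ) : ℝ) ≤ (2 ^ (d + 1) * k : ℕ) := by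
    have := Nat.mul_pos (Nat.two_pow_pos d) hk
    exact_mod_cast (show 2 ^ d * k + 1 ≤ 2 ^ (d + 1) * k by rw [pow_succ]; nlinarith)
  calc crossingBound d k x ≤
        (2 ^ (d + 1) * k : ℕ) * (2 * d * (d * (2 * (2 * (2 * d * x)) ^ (d - 1)))) := by
        unfold crossingBound; gcongr
    _ = _ := by
        rw [show 2 * (2 * (d : ℝ) * x) = 4 * d * x by ring, mul_pow]
        push_cast
        ring

/-- All words of the data structure have `O(log n)` bits. -/
theorem word_le_pow {C n : ℕ} (hn : 2 ≤ n) :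
    C * (n * (Nat.log 2 n + 2) ^ (d - 1)) ≤ n ^ (C + 2 * d + 1) := by
  have h1 : Nat.log 2 n + 2 ≤ n ^ 2 := by
    have := Nat.log_lt_self 2 (show n ≠ 0 by omega)
    nlinarith
  have h2 : C ≤ n ^ C := (Nat.lt_pow_self (by omega)).le
  calc C * (n * (Nat.log 2 n + 2) ^ (d - 1)) ≤ n ^ C * (n * (n ^ 2) ^ (d - 1)) := by gcongr
    _ = n ^ (C + 2 * (d - 1) + 1) := by rw [← pow_mul]; ring
    _ ≤ _ := Nat.pow_le_pow_right (by omega) (by omega)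

end Bounds

/-! ## The data structure -/

section Final

variable {d : ℕ}

/-- The geometry does not mention the memory, so filling the memory afterwards does no harm. -/
theorem Layout.Geometric.withMemory {l : Layout d} {W : ℝ} {o : ℕ → ℝ} {M : ℕ} {Y : ℕ → ℕ → ℝ}
    {gap gid : ℕ → ℕ} (h : l.Geometric W o M Y gap gid) (E : ℕ) (gn : ℕ → ℕ) (gr : ℕ → ℝ) :
    (l.withMemory E gn gr).Geometric W o M Y gap gid where
  tree := h.tree
  lt_width := h.lt_width
  sq := h.sq
  lc := h.lc
  rc := h.rc
  rp := h.rp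
  bl := h.bl
  bh := h.bh
  convex := h.convex
  pos := h.pos
  cube := h.cube
  coord := h.coord
  inner_size := h.inner_size
  leaf_size := h.leaf_size

/-- The data structure of a layout. -/
def Layout.dataStructure (l : Layout d) : DataStructure where
  nats := (List.range l.E).map l.nm
  reals := (List.range l.E).map l.rm

theorem Layout.storage_dataStructure (l : Layout d) : l.dataStructure.storage = 2 * l.E := by
  simp only [DataStructure.storage, Layout.dataStructure, List.length_map, List.length_range]
  ring

/-- The query of a box with given corners. -/
def Box.ofCorners (lo hi : Pt d) (ε : ℝ) : Box := ⟨axisCoord lo, axisCoord hi, ε⟩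

theorem Box.lower_ofCorners (lo hi : Pt d) (ε : ℝ) : (Box.ofCorners lo hi ε).lower d = lo := by
  ext i
  exact dif_pos i.2

theorem Box.upper_ofCorners (lo hi : Pt d) (ε : ℝ) : (Box.ofCorners lo hi ε).upper d = hi := by
  ext i
  exact dif_pos i.2

theorem Layout.start (l : Layout d) (lo hi : Pt d) (k : ℕ) (ε : ℝ) :
    Start l (Box.ofCorners lo hi ε) k (l.dataStructure.queryState lo hi k ε) where
  clusters := by simp [DataStructure.queryState]
  lo a ha := by simp [DataStructure.queryState, Box.ofCorners, axisCoord, ha]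
  hi a ha := by simp [DataStructure.queryState, Box.ofCorners, axisCoord, ha]
  eps := by
    simp only [DataStructure.queryState, Box.ofCorners]
    rw [dif_neg (by omega), dif_neg (by omega), if_pos trivial]
  nmem a ha := by simp [DataStructure.queryState, Layout.dataStructure, ha]
  rmem a ha := by simp [DataStructure.queryState, Layout.dataStructure, ha]
  clear a ha := by
    simp only [DataStructure.queryState, Layout.dataStructure]
    exact List.getD_eq_default _ _ (by simpa using ha)

/-- The running time of a query in closed form. -/
theorem queryTime_le (hd : 2 ≤ d) : ∃ C : ℕ, ∀ (n L k m K : ℕ) (x : ℝ), 2 ≤ n →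
    L = Nat.log 2 n + 2 → 1 ≤ k → 1 ≤ x → (k : ℝ) * x ^ d ≤ m → C ≤ K →
    coarsePhaseTime d L L (2 ^ d * k + 1) + (refinedBound d k x *
        (2 * insideTime d + 18 + 2 * outputTime d : ℕ) +
      crossingBound d k x * (2 * crossTime d L L : ℕ) + (2 ^ d * k + 1 : ℕ) * outputTime d + 1) +
      (m : ℝ) + 30 ≤ K * (k * (x * Real.log n) ^ (d - 1) + m) := by
  obtain ⟨C₁, hC₁⟩ := coarsePhaseTime_le hd
  obtain ⟨C₂, hC₂⟩ := crossTime_le hd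
  set R : ℕ := 2 ^ (d + 1) * (d * (2 * (4 * d) ^ d)) with hR
  set X : ℕ := 2 ^ (d + 1) * (2 * d * (d * (2 * (4 * d) ^ (d - 1)))) with hX
  set I : ℕ := 2 * insideTime d + 18 + 2 * outputTime d with hI
  refine ⟨(C₁ * 2 ^ (d + 1) + X * (2 * C₂)) * 5 ^ (d - 1) +
    (R * I + 2 ^ (d + 1) * outputTime d + 32), fun n L k m K x hn hL hk hx hm hK => ?_⟩
  have hL1 : 1 ≤ L := by omega
  have hx0 : 0 ≤ x := by linarith
  have hlog : (L : ℝ) ≤ 5 * Real.log n := by rw [hL]; exact width_le_log hn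
  have hlog0 : 0 ≤ Real.log n := by
    have : (1 : ℝ) ≤ L := by exact_mod_cast hL1
    linarith
  clear_value R X I
  have hlim : 2 ^ d * k + 1 ≤ 2 ^ (d + 1) * k := by
    have := Nat.mul_pos (Nat.two_pow_pos d) hk
    rw [pow_succ]
    nlinarith
  have hk1 : (1 : ℝ) ≤ k := by exact_mod_cast hk
  -- Terms linear in `k` without a logarithm are absorbed by `m`, as `x ≥ 1`.
  have hkm : (k : ℝ) ≤ m := by
    have : (1 : ℝ) ≤ x ^ d := one_le_pow₀ hx
    nlinarith
  set ℓ : ℝ := Real.log n ^ (d - 1) with hℓ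
  have hℓ0 : 0 ≤ ℓ := by positivity
  have hP : ((L ^ (d - 1) : ℕ) : ℝ) ≤ 5 ^ (d - 1) * ℓ := by
    rw [hℓ, ← mul_pow]
    push_cast
    gcongr
  have hxp : (1 : ℝ) ≤ x ^ (d - 1) := one_le_pow₀ hx
  set G : ℝ := k * (x * Real.log n) ^ (d - 1) with hG
  have hG' : G = k * x ^ (d - 1) * ℓ := by rw [hG, mul_pow, mul_assoc]
  have hkG : k * ℓ ≤ G := by
    rw [hG']
    have : (k : ℝ) * 1 ≤ k * x ^ (d - 1) := by gcongr
    rw [mul_one] at this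
    gcongr
  have hG0 : 0 ≤ G := by positivity
  have t1 : (coarsePhaseTime d L L (2 ^ d * k + 1) : ℝ) ≤
      C₁ * 2 ^ (d + 1) * 5 ^ (d - 1) * G := by
    have h1 : coarsePhaseTime d L L (2 ^ d * k + 1) ≤ C₁ * (2 ^ (d + 1) * k * L ^ (d - 1)) :=
      (hC₁ L _ hL1 (by omega)).trans (by gcongr)
    calc (coarsePhaseTime d L L (2 ^ d * k + 1) : ℝ)
        ≤ (C₁ * (2 ^ (d + 1) * k * L ^ (d - 1)) : ℕ) := by exact_mod_cast h1
      _ = C₁ * 2 ^ (d + 1) * (k * (L ^ (d - 1) : ℕ)) := by push_cast; ring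
      _ ≤ C₁ * 2 ^ (d + 1) * (k * (5 ^ (d - 1) * ℓ)) := by gcongr
      _ = C₁ * 2 ^ (d + 1) * 5 ^ (d - 1) * (k * ℓ) := by ring
      _ ≤ _ := by gcongr
  have t2 : refinedBound d k x * (I : ℝ) ≤ R * I * m := by
    calc refinedBound d k x * (I : ℝ) ≤ R * (k * x ^ d) * I := by
          gcongr
          rw [hR]
          exact refinedBound_le hk hx0
      _ ≤ R * m * I := by
          gcongr
      _ = _ := by ring
  have t3 : crossingBound d k x * (2 * crossTime d L L : ℕ) ≤ X * (2 * C₂) * 5 ^ (d - 1) * G := by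
    have h1 : 2 * crossTime d L L ≤ 2 * C₂ * L ^ (d - 1) := by
      have := hC₂ L hL1
      rw [mul_assoc]
      omega
    calc crossingBound d k x * (2 * crossTime d L L : ℕ)
        ≤ X * (k * x ^ (d - 1)) * (2 * C₂ * L ^ (d - 1) : ℕ) := by
          gcongr
          rw [hX]
          exact crossingBound_le hk hx0
      _ = X * (k * x ^ (d - 1)) * (2 * C₂ * (L ^ (d - 1) : ℕ)) := by push_cast; ring
      _ ≤ X * (k * x ^ (d - 1)) * (2 * C₂ * (5 ^ (d - 1) * ℓ)) := by gcongr
      _ = _ := by rw [hG']; ring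
  have t4 : ((2 ^ d * k + 1 : ℕ) : ℝ) * outputTime d ≤ 2 ^ (d + 1) * outputTime d * m := by
    calc ((2 ^ d * k + 1 : ℕ) : ℝ) * outputTime d ≤ (2 ^ (d + 1) * k : ℕ) * outputTime d := by
          gcongr
      _ = 2 ^ (d + 1) * outputTime d * k := by push_cast; ring
      _ ≤ _ := by gcongr
  set a : ℝ := (C₁ * 2 ^ (d + 1) + X * (2 * C₂)) * 5 ^ (d - 1) with ha
  set b : ℝ := R * I + 2 ^ (d + 1) * outputTime d + 32 with hb
  have hab : a + b ≤ K := by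
    rw [ha, hb]
    exact_mod_cast hK
  have ha0 : 0 ≤ a := by positivity
  have hb0 : 0 ≤ b := by positivity
  have hm0 : (0 : ℝ) ≤ m := by positivity
  have hm1 : (1 : ℝ) ≤ m := hk1.trans hkm
  -- One constant multiplies both terms; the mixed products `a * m` and `b * G` are non-negative and
  -- dropped.
  have hfin : (K : ℝ) * (G + m) ≥ a * G + b * m := by
    have h1 := mul_le_mul_of_nonneg_right hab (add_nonneg hG0 hm0)
    have h2 : (a + b) * (G + m) = a * G + b * m + (a * m + b * G) := by ring
    have h3 : 0 ≤ a * m + b * G := by positivity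
    linarith
  refine le_trans ?_ hfin
  clear_value a b G
  have e1 : a * G = C₁ * 2 ^ (d + 1) * 5 ^ (d - 1) * G + X * (2 * C₂) * 5 ^ (d - 1) * G := by
    rw [ha]; ring
  have e2 : b * m = R * I * m + 2 ^ (d + 1) * outputTime d * m + 32 * m := by rw [hb]; ring
  rw [e1, e2]
  linarith

end Final

end RangeClustering

end

/-! ### Choice of the constant and assembly. -/

theorem mainTheorem1 (d : ℕ) (hd : 2 ≤ d) :
    ∃ (query : Cmd) (K : ℕ),
      ∀ (S : Finset (Pt d)) (cost : Cost d) (c : ℝ) (f : ℕ → ℝ)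
        (rep : Desc → Finset (Finset (Pt d)) → Prop) (A : Procedures d)
        (Tss Texpand : ℕ → ℕ → ℕ),
        2 ≤ S.card →
        RegularCost S cost c f →
        Solves A rep S cost Tss →
        (∀ m k, 2 ≤ k → m ≤ Tss m k) →
        Expands A rep S cost f Texpand →
        ∃ D : DataStructure,
          (D.storage : ℝ) ≤ K * (S.card * Real.log S.card ^ (d - 1)) ∧
          (∀ w ∈ D.nats, w ≤ S.card ^ K) ∧
          ∀ (lo hi : Pt d), (∀ i, lo i ≤ hi i) → ∀ k : ℕ, 2 ≤ k → ∀ ε : ℝ, 0 < ε →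
            ∃ (t : ℕ) (s : State),
              Exec A query (D.queryState lo hi k ε) t s ∧
              (∃ C : Finpartition (inBox S lo hi), C.parts.card ≤ k ∧
                rep (s.readDesc answerRef) C.parts ∧
                cost C.parts ≤ (1 + ε) * opt cost k (inBox S lo hi)) ∧
              (t : ℝ) ≤ K * (k * (max 1 (f k / (c * ε)) * Real.log S.card) ^ (d - 1)
                + Tss ⌈K * (k * max 1 (f k / (c * ε)) ^ d)⌉₊ k
                + Texpand S.card k) := by
  obtain ⟨Cs, hCs⟩ := layoutSize_le hd
  obtain ⟨Ct, hCt⟩ := queryTime_le hd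
  set R : ℕ := 2 ^ (d + 1) * (d * (2 * (4 * d) ^ d)) with hR
  -- The requirements on `K` come, in this order, from the storage, the word length, the size of the
  -- packing, the query time, and the factor in front of `Texpand`.
  obtain ⟨K, hK₁, hK₂, hK₃, hK₄, hK₅⟩ : ∃ K, 2 * Cs * 5 ^ (d - 1) ≤ K ∧ Cs + 2 * d + 1 ≤ K ∧
      R + 2 ^ (d + 1) ≤ K ∧ Ct ≤ K ∧ 1 ≤ K :=
    ⟨_, le_max_left _ _, (le_max_left _ _).trans (le_max_right _ _),
      (le_max_left _ _).trans ((le_max_right _ _).trans (le_max_right _ _)),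
      (le_max_left _ _).trans ((le_max_right _ _).trans ((le_max_right _ _).trans
        (le_max_right _ _))),
      (le_max_right Ct 1).trans ((le_max_right _ _).trans ((le_max_right _ _).trans
        (le_max_right _ _)))⟩
  refine ⟨queryProgram d, K, fun S cost c f rep A Tss Texpand hS hreg hsolve hTss hexp => ?_⟩
  obtain ⟨l₀, W, o, M, Y, gap, gid, hgeo, hbd, hn, him, hf, hc⟩ := exists_geometric hd hS c f
  obtain ⟨gn, gr, hgn, hvalid⟩ := exists_memory hd hbd
  set l := l₀.withMemory (layoutSize d l₀.n l₀.L) gn gr with hl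
  have hsize := hCs l₀.n l₀.L (by omega) hbd.width
  refine ⟨l.dataStructure, ?_, fun w hw => ?_, fun lo hi _ k hk ε hε => ?_⟩
  · rw [l.storage_dataStructure]
    have h1 : ((2 * l.E : ℕ) : ℝ) ≤ (2 * (Cs * (S.card * l₀.L ^ (d - 1))) : ℕ) := by
      rw [← hn]
      exact_mod_cast Nat.mul_le_mul_left 2 ((Nat.le_add_left _ _).trans hsize)
    have h2 : (l₀.L : ℝ) ≤ 5 * Real.log S.card := by
      rw [hbd.width, hn]
      exact width_le_log hS
    have h3 : ((2 * Cs * 5 ^ (d - 1) : ℕ) : ℝ) ≤ K := by exact_mod_cast hK₁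
    have h4 : 0 ≤ Real.log S.card := Real.log_nonneg (by exact_mod_cast (show 1 ≤ S.card by omega))
    calc ((2 * l.E : ℕ) : ℝ) ≤ 2 * Cs * (S.card * (l₀.L : ℝ) ^ (d - 1)) := by
          refine h1.trans (le_of_eq ?_)
          push_cast
          ring
      _ ≤ 2 * Cs * (S.card * (5 * Real.log S.card) ^ (d - 1)) :=
          mul_le_mul_of_nonneg_left (mul_le_mul_of_nonneg_left
            (pow_le_pow_left₀ (Nat.cast_nonneg _) h2 _) (Nat.cast_nonneg _))
            (mul_nonneg two_pos.le (Nat.cast_nonneg _))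
      _ = (2 * Cs * 5 ^ (d - 1) : ℕ) * (S.card * Real.log S.card ^ (d - 1)) := by
          rw [mul_pow]
          push_cast
          ring
      _ ≤ _ := mul_le_mul_of_nonneg_right h3 (mul_nonneg (Nat.cast_nonneg _) (pow_nonneg h4 _))
  · obtain ⟨i, -, rfl⟩ := List.mem_map.1 hw
    rw [hbd.width, hn] at hsize
    refine (hgn i).trans ?_
    rw [hbd.width, hn]
    exact hsize.trans ((word_le_pow (d := d) hS).trans (Nat.pow_le_pow_right (by omega) hK₂))
  · set x := max 1 (f k / (c * ε)) with hx
    have hx1 : 1 ≤ x := le_max_left _ _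
    set m := ⌈K * (k * x ^ d)⌉₊ with hm
    have hk1 : (1 : ℝ) ≤ k := by exact_mod_cast (show 1 ≤ k by omega)
    have hxd : (1 : ℝ) ≤ x ^ d := one_le_pow₀ hx1
    have hkx : (k : ℝ) ≤ k * x ^ d := le_mul_of_one_le_right (by linarith) hxd
    have hKm : K * (k * x ^ d) ≤ m := Nat.le_ceil _
    have hgeo' := hgeo.withMemory (layoutSize d l₀.n l₀.L) gn gr
    -- The packing has at most as many points as there are refined nodes and front nodes together,
    -- which `m` was chosen to exceed.
    have hRm : refinedBound d k x + (2 ^ d * k + 1 : ℕ) ≤ m := by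
      have h1 : ((2 ^ d * k + 1 : ℕ) : ℝ) ≤ 2 ^ (d + 1) * (k * x ^ d) := by
        have h2 : (1 : ℝ) ≤ 2 ^ d * k := by
          have : (1 : ℝ) ≤ 2 ^ d := one_le_pow₀ (by norm_num)
          nlinarith
        have h3 : (2 : ℝ) ^ (d + 1) * k ≤ 2 ^ (d + 1) * (k * x ^ d) := by gcongr
        push_cast
        rw [pow_succ] at h3 ⊢
        linarith
      have h4 := refinedBound_le (d := d) (k := k) (by omega) (show 0 ≤ x by linarith)
      have h5 : ((R + 2 ^ (d + 1) : ℕ) : ℝ) ≤ K := by exact_mod_cast hK₃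
      calc refinedBound d k x + (2 ^ d * k + 1 : ℕ) ≤
            R * (k * x ^ d) + 2 ^ (d + 1) * (k * x ^ d) := add_le_add h4 h1
        _ = (R + 2 ^ (d + 1) : ℕ) * (k * x ^ d) := by push_cast; ring
        _ ≤ K * (k * x ^ d) := by gcongr
        _ ≤ m := hKm
    obtain ⟨t, s, hex, hC, ht⟩ := query_correct (l := l) hd hvalid hgeo' him
      (fun k _ => congrFun hf k) hc hreg hsolve hexp (Q := Box.ofCorners lo hi ε) hε hk
      (l.start lo hi k ε) (m := m) hRm
    rw [Box.lower_ofCorners, Box.upper_ofCorners] at hC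
    refine ⟨t, s, hex, hC, ht.trans ?_⟩
    -- The fine phase costs `O(k * x ^ d)`. As `Tss m k ≥ m`, this is covered by the time of the
    -- single-shot algorithm.
    have hTm : (k : ℝ) * x ^ d ≤ Tss m k := by
      have h1 : (1 : ℝ) ≤ K := by exact_mod_cast hK₅
      have h2 : (m : ℝ) ≤ Tss m k := by exact_mod_cast hTss m k hk
      have h3 : (k : ℝ) * x ^ d ≤ K * (k * x ^ d) := le_mul_of_one_le_left (by positivity) h1
      linarith
    have htime := hCt S.card l₀.L k (Tss m k) K x hS (by rw [hbd.width, hn]) (by omega) hx1 hTm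
      hK₄
    have hexpand : (Texpand S.card k : ℝ) ≤ K * Texpand S.card k :=
      le_mul_of_one_le_left (by positivity) (by exact_mod_cast hK₅)
    rw [mul_add (K : ℝ) _ (Texpand S.card k : ℝ)]
    have hpush : ∀ u v w z : ℝ, u + v + 30 ≤ w → z ≤ K * z → u + v + z + 30 ≤ w + K * z :=
      fun u v w z h h' => by linarith
    exact hpush _ _ _ _ htime hexpand
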